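/- Fix an integer $M\ge 0$ and let $\mathcal P$ be the set of probability vectors $(v(j):-M\le j\le M)$. An environment is $\omega=(u_\tau(x):(x,\tau)\in\mathbb Z^2)\in\Omega=\mathcal P^{\mathbb Z^2}$, with $u_\tau(x)=(u_\tau(x,j))_{|j|\le M}$ and $u_\tau(x,j)=0$ for $|j|>M$. Let $\mathbb P$ be a probability measure on $\Omega$ (with the product of the Borel $\sigma$-fields) under which the vectors $u_\tau(x)$ are i.i.d., and let $\mathbb E$ be its expectation. Put $p(0,j)=\mathbb E\,u_0(0,j)$. Assume * (ellipticity) $\mathbb P\{\max_j u_0(0,j)<1\}>0$; * (span 1) there are no integers $h>1$ and $x$ with $\sum_{k\in\mathbb Z}p(0,x+kh)=1$. Given $\omega$, let $X^{i,\tau}=(X^{i,\tau}_s)_{s\ge 0}$ under $P^\omega$ be the Markov chain on $\mathbb Z$ with $X^{i,\tau}_0=i$ and $P^\omega(X^{i,\tau}_{s+1}=y\mid X^{i,\tau}_s=x)=u_{\tau-s}(x,y-x)$, and let $E^\omega$ be the expectation under $P^\omega$. Define $$D(\omega)=\sum_x x\,u_0(0,x),\quad V=\mathbb E D,\quad b=-V,\quad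 \sigma_D^2=\mathbb E[(D-V)^2],\quad \sigma_a^2=\sum_x (x-V)^2p(0,x),$$ $$\lambda(t)=\mathbb E\Bigl|\sum_x u_0(0,x)e^{itx}\Bigr|^2,\quad \bar\lambda(t)=\Bigl|\sum_x p(0,x)e^{itx}\Bigr|^2,\quad \beta=\frac1{2\pi}\int_{-\pi}^{\pi}\frac{1-\lambda(t)}{1-\bar\lambda(t)}\,dt,\quad \kappa=\frac{\sigma_D^2}{\beta\sigma_a^2},$$ and, for $(s,q),(t,r)\in\mathbb R_+\times\mathbb R$, $$\Gamma_q((s,q),(t,r))=\frac{\kappa}{2}\int_{\sigma_a^2|t-s|}^{\sigma_a^2(t+s)}\frac1{\sqrt{2\pi v}}\exp\Bigl\{-\frac{(q-r)^2}{2v}\Bigr\}\,dv .$$ For $n\ge 1$, $t\ge0$ and $r\in\mathbb R$ let $$y_n(t,r)=n^{-1/4}\Bigl\{E^\omega\bigl(X^{\lfloor ntb\rfloor+\lfloor r\sqrt n\rfloor,\,\lfloor nt\rfloor}_{\lfloor nt\rfloor}\bigr)-\lfloor r\sqrt n\rfloor\Bigr\}.$$ **Theorem.** Let $\{y(t,r):(t,r)\in\mathbb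 R_+\times\mathbb R\}$ be the mean zero Gaussian process with covariance $E\,y(s,q)y(t,r)=\Gamma_q((s,q),(t,r))$. 1. For any $k$ and any points $(t_1,r_1),\dots,(t_k,r_k)\in\mathbb R_+\times\mathbb R$, the random vector $(y_n(t_j,r_j))_{1\le j\le k}$ (under $\mathbb P$) converges weakly in $\mathbb R^k$ to $(y(t_j,r_j))_{1\le j\le k}$ as $n\to\infty$. 2. The process $y$ exists and is, in law, a weak solution of the stochastic heat equation $$y_t=\tfrac12\sigma_a^2\,y_{rr}+\sigma_a\sqrt\kappa\,\dot W,\qquad y(0,\cdot)\equiv0,$$ where $\sigma_a=\sqrt{\sigma_a^2}$. That is, on some probability space there are a space-time white noise $W$ on $\mathbb R_+\times\mathbb R$ (a mean zero Gaussian family $(W(f))_{f\in L^2(\mathbb R_+\times\mathbb R)}$ with $E[W(f)W(g)]=\iint fg$) and a jointly measurable process $y$ with the above Gaussian law and almost surely locally integrable paths, such that $y(0,r)=0$ a.s. for every $r$, and for every $\varphi\in C_c^\infty(\mathbb R\times\mathbb R)$, almost surely, $$-\int_0^\infty\!\!\int_{\mathbb R} y\,\varphi_t\,dr\,dt=\tfrac12\sigma_a^2\int_0^\infty\!\!\int_{\mathbb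 R} y\,\varphi_{rr}\,dr\,dt+\sigma_a\sqrt\kappa\;W\bigl(\varphi|_{\mathbb R_+\times\mathbb R}\bigr).$$ -/

import Mathlib

open MeasureTheory ProbabilityTheory Filter Set
open scoped ENNReal NNReal

noncomputable section

namespace SpaceTimeRWRE

/-! ### Environments -/

/-- Probability vectors `(v j : -M ≤ j ≤ M)` of length `2M+1`. -/
abbrev JumpVector (M : ℕ) : Type := stdSimplex ℝ (Finset.Icc (-(M : ℤ)) (M : ℤ))

/-- An environment: `ω (x, τ)` is the probability vector `u_τ(x)` attached to the site `x` at
time level `τ`. The σ-algebra is the product of the Borel σ-algebras. -/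
abbrev Env (M : ℕ) : Type := ℤ × ℤ → JumpVector M

/-- The weight `u_τ(x, j)`, extended by `0` to all integers `j`. -/
def weight {M : ℕ} (ω : Env M) (x τ j : ℤ) : ℝ :=
  if h : j ∈ Finset.Icc (-(M : ℤ)) (M : ℤ) then ω (x, τ) ⟨j, h⟩ else 0

/-- The vectors `u_τ(x)`, `(x, τ) ∈ ℤ²`, are independent and identically distributed. -/
structure IsIID {M : ℕ} (P : Measure (Env M)) : Prop where
  indep : iIndepFun (fun (z : ℤ × ℤ) (ω : Env M) => ω z) P
  ident : ∀ z : ℤ × ℤ, IdentDistrib (fun ω : Env M => ω z) (fun ω : Env M => ω (0, 0)) P P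

/-- Averaged jump probabilities `p(0, j) = 𝔼 u_0(0, j)`. -/
def avgProb {M : ℕ} (P : Measure (Env M)) (j : ℤ) : ℝ := ∫ ω, weight ω 0 0 j ∂P

/-- Ellipticity: `ℙ{max_j u_0(0, j) < 1} > 0`. -/
def Elliptic {M : ℕ} (P : Measure (Env M)) : Prop :=
  0 < P {ω | ∀ j : ℤ, weight ω 0 0 j < 1}

/-- The averaged walk has span 1: there is no integer `h > 1` such that
`∑_k p(0, x + k h) = 1` for some `x`. -/
def SpanOne {M : ℕ} (P : Measure (Env M)) : Prop :=
  ¬ ∃ h : ℤ, 1 < h ∧ ∃ x : ℤ, ∑' k : ℤ, avgProb P (x + k * h) = 1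

/-! ### Constants -/

/-- The quenched drift at the origin, `D(ω) = ∑_x x u_0(0, x)`. -/
def drift {M : ℕ} (ω : Env M) : ℝ :=
  ∑ x ∈ Finset.Icc (-(M : ℤ)) (M : ℤ), (x : ℝ) * weight ω 0 0 x

/-- The mean drift `V = 𝔼 D`. -/
def meanDrift {M : ℕ} (P : Measure (Env M)) : ℝ := ∫ ω, drift ω ∂P

/-- `σ_D² = 𝔼[(D - V)²]`. -/
def sigmaDSq {M : ℕ} (P : Measure (Env M)) : ℝ := ∫ ω, (drift ω - meanDrift P) ^ 2 ∂P

/-- `σ_a² = ∑_x (x - V)² p(0, x)`. -/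
def sigmaASq {M : ℕ} (P : Measure (Env M)) : ℝ :=
  ∑ x ∈ Finset.Icc (-(M : ℤ)) (M : ℤ), ((x : ℝ) - meanDrift P) ^ 2 * avgProb P x

/-- The random characteristic function `φ^ω(t) = ∑_x u_0(0, x) e^{itx}`. -/
def quenchedCharFun {M : ℕ} (ω : Env M) (t : ℝ) : ℂ :=
  ∑ x ∈ Finset.Icc (-(M : ℤ)) (M : ℤ), (weight ω 0 0 x : ℂ) * Complex.exp (Complex.I * t * x)

/-- The averaged characteristic function `φ_a(t) = ∑_x p(0, x) e^{itx}`. -/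
def avgCharFun {M : ℕ} (P : Measure (Env M)) (t : ℝ) : ℂ :=
  ∑ x ∈ Finset.Icc (-(M : ℤ)) (M : ℤ), (avgProb P x : ℂ) * Complex.exp (Complex.I * t * x)

/-- `β = (2π)⁻¹ ∫_{-π}^{π} (1 - λ(t)) / (1 - λ̄(t)) dt`, with `λ(t) = 𝔼 |φ^ω(t)|²` and
`λ̄(t) = |φ_a(t)|²`. -/
def beta {M : ℕ} (P : Measure (Env M)) : ℝ :=
  1 / (2 * Real.pi) * ∫ t in (-Real.pi)..Real.pi,
    (1 - ∫ ω, ‖quenchedCharFun ω t‖ ^ 2 ∂P) / (1 - ‖avgCharFun P t‖ ^ 2)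

/-- `κ = σ_D² / (β σ_a²)`. -/
def kappa {M : ℕ} (P : Measure (Env M)) : ℝ := sigmaDSq P / (beta P * sigmaASq P)

/-- The covariance `Γ_q((s, q), (t, r))`. -/
def GammaQ {M : ℕ} (P : Measure (Env M)) (a b : ℝ≥0 × ℝ) : ℝ :=
  kappa P / 2 * ∫ v in (sigmaASq P * |(b.1 : ℝ) - a.1|)..(sigmaASq P * ((b.1 : ℝ) + a.1)),
    1 / Real.sqrt (2 * Real.pi * v) * Real.exp (-(1 / (2 * v)) * (a.2 - b.2) ^ 2)

/-! ### The backward quenched walk -/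

/-- The law of the next position of a walk standing at `x` at time level `τ`: it is `x + j` with
probability `u_τ(x, j)`. -/
def stepLaw {M : ℕ} (ω : Env M) (x τ : ℤ) : Measure ℤ :=
  ∑ j ∈ Finset.Icc (-(M : ℤ)) (M : ℤ),
    ENNReal.ofReal (weight ω x τ j) • Measure.dirac (x + j)

/-- The transition kernel of the spatial backward walk started from time level `τ`, from the
path up to time `s` to the position at time `s + 1`; it only uses the position at time `s`, and
the level occupied at time `s` is `τ - s`. -/
def backwardKernel {M : ℕ} (ω : Env M) (τ : ℤ) (s : ℕ) :
    Kernel ((_ : Finset.Iic s) → ℤ) ℤ where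
  toFun path := stepLaw ω (path ⟨s, Finset.mem_Iic.mpr le_rfl⟩) (τ - s)
  measurable' :=
    (measurable_of_countable fun x : ℤ => stepLaw ω x (τ - s)).comp (measurable_pi_apply _)

lemma isProbabilityMeasure_stepLaw {M : ℕ} (ω : Env M) (x τ : ℤ) :
    IsProbabilityMeasure (stepLaw ω x τ) := by
  have hmem := (ω (x, τ)).2
  have hnn : ∀ j ∈ Finset.Icc (-(M : ℤ)) (M : ℤ), 0 ≤ weight ω x τ j := by
    intro j hj
    simp only [weight, hj, dif_pos]
    exact hmem.1 _
  have hsum : ∑ j ∈ Finset.Icc (-(M : ℤ)) (M : ℤ), weight ω x τ j = 1 := by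
    rw [← Finset.sum_coe_sort, ← hmem.2]
    refine Finset.sum_congr rfl fun j _ => ?_
    simp only [weight, j.2, dif_pos]
    rfl
  constructor
  simp only [stepLaw, Measure.finsetSum_apply, Measure.smul_apply, measure_univ, smul_eq_mul,
    mul_one]
  rw [← ENNReal.ofReal_sum_of_nonneg hnn, hsum, ENNReal.ofReal_one]

instance {M : ℕ} (ω : Env M) (τ : ℤ) (s : ℕ) : IsMarkovKernel (backwardKernel ω τ s) :=
  ⟨fun _ => isProbabilityMeasure_stepLaw ω _ _⟩

/-- The path measure `P^ω` of the spatial backward walk `X^{i,τ}`, a probability measure on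
`ℕ → ℤ`: the canonical Markov chain started at `i` with the transitions above. -/
def quenchedLaw {M : ℕ} (ω : Env M) (i τ : ℤ) : Measure (ℕ → ℤ) :=
  Kernel.trajMeasure (X := fun _ => ℤ) (Measure.dirac i) (backwardKernel ω τ)

/-- The quenched mean `E^ω(X^{i,τ}_m)`. -/
def quenchedMean {M : ℕ} (ω : Env M) (i τ : ℤ) (m : ℕ) : ℝ :=
  ∫ X : ℕ → ℤ, (X m : ℝ) ∂(quenchedLaw ω i τ)

/-- `y_n(t, r) = n^{-1/4} { E^ω(X^{⌊ntb⌋ + ⌊r√n⌋, ⌊nt⌋}_{⌊nt⌋}) - ⌊r√n⌋ }` with `b = -V`. -/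
def yProc {M : ℕ} (P : Measure (Env M)) (n : ℕ) (a : ℝ≥0 × ℝ) (ω : Env M) : ℝ :=
  (n : ℝ) ^ (-(1 / 4) : ℝ) *
    (quenchedMean ω (⌊(n : ℝ) * a.1 * (-meanDrift P)⌋ + ⌊a.2 * Real.sqrt n⌋)
        (⌊(n : ℝ) * a.1⌋₊ : ℤ) ⌊(n : ℝ) * a.1⌋₊
      - (⌊a.2 * Real.sqrt n⌋ : ℝ))

/-! ### Gaussian processes, white noise and the stochastic heat equation -/

/-- `X` is a mean zero Gaussian process with covariance function `Γ`. -/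
structure IsCenteredGaussian {T Ω : Type*} [MeasurableSpace Ω] (X : T → Ω → ℝ)
    (Γ : T → T → ℝ) (Q : Measure Ω) : Prop where
  gaussian : IsGaussianProcess X Q
  mean_zero : ∀ a, ∫ ω, X a ω ∂Q = 0
  covariance : ∀ a b, ∫ ω, X a ω * X b ω ∂Q = Γ a b

/-- Lebesgue measure on the space-time half plane `[0, ∞) × ℝ`. -/
def halfPlane : Measure (ℝ × ℝ) := volume.restrict (Ici (0 : ℝ) ×ˢ univ)

/-- Space-time white noise on `[0, ∞) × ℝ`, as the isonormal process `W f = ∬ f dW` indexed by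
`L²([0, ∞) × ℝ)`: mean zero Gaussian with `E[W f W g] = ∬ f g`. -/
def IsWhiteNoise {Ω : Type*} [MeasurableSpace Ω] (W : Lp ℝ 2 halfPlane → Ω → ℝ)
    (Q : Measure Ω) : Prop :=
  IsCenteredGaussian W (fun f g => ∫ z, f z * g z ∂halfPlane) Q

lemma memLp_test {φ : ℝ × ℝ → ℝ} (hφ : ContDiff ℝ ((⊤ : ℕ∞) : WithTop ℕ∞) φ) (hc : HasCompactSupport φ) :
    MemLp φ 2 halfPlane :=
  (hφ.continuous.memLp_of_hasCompactSupport (μ := volume) hc).restrict _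

/-- `y` is a weak solution of `y_t = A y_rr + B Ẇ` on `[0, ∞) × ℝ` with `y(0, ·) = 0`: it is a
jointly measurable random field, vanishing at time `0`, with locally integrable paths, and for
every smooth compactly supported space-time test function `φ`, almost surely,
`-∬ y φ_t = A ∬ y φ_rr + B ∬ φ dW`. The test functions need not vanish at `t = 0`; there is
no boundary term because the initial value is zero. -/
structure IsWeakSolutionSHE {Ω : Type*} [MeasurableSpace Ω] (A B : ℝ) (y : ℝ≥0 × ℝ → Ω → ℝ)
    (W : Lp ℝ 2 halfPlane → Ω → ℝ) (Q : Measure Ω) : Prop where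
  measurable : Measurable (Function.uncurry y)
  initial : ∀ r : ℝ, ∀ᵐ ω ∂Q, y (0, r) ω = 0
  locallyIntegrable : ∀ᵐ ω ∂Q,
    LocallyIntegrable (fun z : ℝ × ℝ => y (z.1.toNNReal, z.2) ω) halfPlane
  equation : ∀ (φ : ℝ × ℝ → ℝ) (hφ : ContDiff ℝ ((⊤ : ℕ∞) : WithTop ℕ∞) φ) (hc : HasCompactSupport φ), ∀ᵐ ω ∂Q,
    -∫ z, y (z.1.toNNReal, z.2) ω * deriv (fun s => φ (s, z.2)) z.1 ∂halfPlane
      = A * ∫ z, y (z.1.toNNReal, z.2) ω * iteratedDeriv 2 (fun x => φ (z.1, x)) z.2 ∂halfPlane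
        + B * W ((memLp_test hφ hc).toLp φ) ω

end SpaceTimeRWRE

end

open MeasureTheory ProbabilityTheory Filter Set
open scoped ENNReal NNReal Topology

noncomputable section

namespace SpaceTimeRWRE


variable {M : ℕ}

/-! ### The quenched transition probabilities -/

/-! Fluctuations. The quenched mean telescopes: `E^ω X_m - i - mV` is the sum over `s < m` of the
centred drift averaged over the position of the walk after `s` steps (`quenchedMean_eq_sum_drift`).
Up to an error of order `n^{-1/4}` from the integer parts, a linear combination of values of `y_n`
is therefore a sum over time levels. The position law at a level is a function of the strictly
higher levels, while the drifts on that level are fresh and centred, so reading the levels downwards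
gives a bounded martingale array. By a quantitative martingale central limit theorem
(`norm_integral_cexp_sum_sub_le`) it remains to find the limit of the conditional covariances. These
are `σ_D² n^{-1/2}` times the summed probabilities that two walks, independent given the
environment, stand on the same site: the overlap.

Overlap. The potential kernel `a` of the symmetrized averaged walk, `a(x) = (2π)⁻¹ ∫ (1 - cos xt) /
(1 - λ̄(t)) dt`, is harmonic off `0` for that walk. For two walks in a common environment the
difference moves like the symmetrized walk when they are apart, and from a common site the mean
increment of `a` is exactly `β` (`beta_eq`). Hence the quenched mean of `a` of the difference grows
by `β` times the overlap plus a martingale increment (`pairExp_succ_eq`). Taking expectations, the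
summed overlap over `n` steps has mean `O(√n)`; this bound in turn makes the martingale part
`O(n^{1/4})` in `L²`, negligible on the scale `√n`. So the overlap is the difference of two values
of the quenched mean of `a`, divided by `β`. That mean is a Fourier integral of quenched
characteristic functions, which concentrate around the averaged ones, again by the overlap bound;
dominated convergence gives the limit (`tendsto_pairExp_potKer`), and the difference of two such
limits is an integral of Gaussian densities, that is, `Γ_q` (`potLimit_sub_potLimit`,
`tendsto_sum_overlap`).

Stochastic heat equation. White noise is realized as a random series of independent normal variables
along a sequence satisfying Parseval's identity in `L²` of the half plane, and `y` is the stochastic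
convolution of the heat kernel with it. The Chapman–Kolmogorov identity gives the covariance
(`integral_heatKer_mul_heatKer`). The equation follows from a stochastic Fubini theorem
(`IsIsonormal.integral_ae_eq`) and the fact that the heat kernel is a fundamental solution
(`integral_adjointHeat_mul_heatKer`). -/

lemma weight_nonneg (ω : Env M) (x τ j : ℤ) : 0 ≤ weight ω x τ j := by
  unfold weight
  split_ifs with h
  · exact (ω (x, τ)).2.1 _
  · exact le_rfl

lemma weight_sum (ω : Env M) (x τ : ℤ) :
    ∑ j ∈ Finset.Icc (-(M : ℤ)) M, weight ω x τ j = 1 := by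
  rw [← Finset.sum_coe_sort, ← (ω (x, τ)).2.2]
  refine Finset.sum_congr rfl fun j _ => ?_
  simp only [weight, j.2, dif_pos]
  rfl

lemma weight_eq_zero (ω : Env M) (x τ : ℤ) {j : ℤ} (hj : j ∉ Finset.Icc (-(M : ℤ)) M) :
    weight ω x τ j = 0 := by
  simp only [weight, hj, dif_neg, not_false_eq_true]

lemma weight_le_one (ω : Env M) (x τ j : ℤ) : weight ω x τ j ≤ 1 := by
  by_cases hj : j ∈ Finset.Icc (-(M : ℤ)) M
  · rw [← weight_sum ω x τ]
    exact Finset.single_le_sum (fun i _ => weight_nonneg ω x τ i) hj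
  · rw [weight_eq_zero ω x τ hj]; exact zero_le_one

/-- The σ-algebra generated by the environment at the space-time points in `S`. -/
@[reducible] def sig (M : ℕ) (S : Set (ℤ × ℤ)) : MeasurableSpace (Env M) :=
  ⨆ z ∈ S, MeasurableSpace.comap (fun ω : Env M => ω z) inferInstance

lemma sig_mono {S T : Set (ℤ × ℤ)} (h : S ⊆ T) : sig M S ≤ sig M T :=
  biSup_mono h

lemma sig_le (S : Set (ℤ × ℤ)) : sig M S ≤ MeasurableSpace.pi :=
  iSup₂_le fun z _ => (measurable_pi_apply z).comap_le

lemma measurable_apply_sig {S : Set (ℤ × ℤ)} {z : ℤ × ℤ} (hz : z ∈ S) :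
    Measurable[sig M S] (fun ω : Env M => ω z) := by
  have h : MeasurableSpace.comap (fun ω : Env M => ω z) inferInstance ≤ sig M S :=
    le_iSup₂ (f := fun (z : ℤ × ℤ) (_ : z ∈ S) =>
      MeasurableSpace.comap (fun ω : Env M => ω z) inferInstance) z hz
  exact (comap_measurable _).mono h le_rfl

lemma measurable_weight_sig {S : Set (ℤ × ℤ)} {x τ : ℤ} (hz : (x, τ) ∈ S) (j : ℤ) :
    Measurable[sig M S] (fun ω : Env M => weight ω x τ j) := by
  unfold weight
  split_ifs with h
  · exact ((measurable_pi_apply _).comp measurable_subtype_coe).comp (measurable_apply_sig hz)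
  · exact measurable_const

/-- The quenched transition probability `P^ω(X^{i,τ}_s = x)`. -/
def mass (ω : Env M) (i τ : ℤ) : ℕ → ℤ → ℝ
  | 0, x => if x = i then 1 else 0
  | s + 1, x => ∑ j ∈ Finset.Icc (-(M : ℤ)) M, mass ω i τ s (x - j) * weight ω (x - j) (τ - s) j

/-- The positions that the walk started at `i` may occupy after `s` steps. -/
def window (M : ℕ) (i : ℤ) (s : ℕ) : Finset ℤ := Finset.Icc (i - s * M) (i + s * M)

lemma mass_nonneg (ω : Env M) (i τ : ℤ) (s : ℕ) (x : ℤ) : 0 ≤ mass ω i τ s x := by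
  induction s generalizing x with
  | zero => simp only [mass]; split_ifs <;> norm_num
  | succ s ih =>
    exact Finset.sum_nonneg fun j _ => mul_nonneg (ih _) (weight_nonneg _ _ _ _)

lemma mass_eq_zero (ω : Env M) (i τ : ℤ) (s : ℕ) {x : ℤ} (hx : x ∉ window M i s) :
    mass ω i τ s x = 0 := by
  induction s generalizing x with
  | zero =>
    simp only [mass]
    rw [if_neg]
    rintro rfl
    simp [window] at hx
  | succ s ih =>
    refine Finset.sum_eq_zero fun j hj => ?_
    rw [ih, zero_mul]
    intro h
    apply hx
    simp only [window, Finset.mem_Icc] at h hj ⊢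
    push_cast
    constructor <;> nlinarith [h.1, h.2, hj.1, hj.2]

/-- After `s` steps only the levels `τ, …, τ - s + 1` have been read. The inequality is strict:
level `τ - s`, which governs the next step, stays independent of the present position law. All
martingale arguments rest on this. -/
lemma measurable_mass_sig (i τ : ℤ) (s : ℕ) (x : ℤ) :
    Measurable[sig M {z | τ - s < z.2}] (fun ω : Env M => mass ω i τ s x) := by
  induction s generalizing x with
  | zero => exact measurable_const
  | succ s ih =>
    simp only [mass]
    refine Finset.measurable_sum _ fun j _ => ?_
    refine Measurable.mul ((ih _).mono (sig_mono ?_) le_rfl) (measurable_weight_sig ?_ j)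
    · intro z hz
      simp only [mem_ofPred_eq] at hz ⊢
      push_cast; omega
    · simp only [mem_ofPred_eq]; push_cast; omega

lemma measurable_mass (i τ : ℤ) (s : ℕ) (x : ℤ) :
    Measurable (fun ω : Env M => mass ω i τ s x) :=
  (measurable_mass_sig i τ s x).mono (sig_le _) le_rfl

/-- The quenched expectation `E^ω f(X^{i,τ}_s)`. -/
def walkExp {E : Type*} [AddCommGroup E] [Module ℝ E] (ω : Env M) (i τ : ℤ) (s : ℕ)
    (f : ℤ → E) : E :=
  ∑ x ∈ window M i s, mass ω i τ s x • f x

section walkExp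

variable {E : Type*} [AddCommGroup E] [Module ℝ E]

lemma walkExp_eq_sum_of_subset (ω : Env M) (i τ : ℤ) (s : ℕ) (f : ℤ → E) {W : Finset ℤ}
    (hW : window M i s ⊆ W) : walkExp ω i τ s f = ∑ x ∈ W, mass ω i τ s x • f x :=
  Finset.sum_subset hW fun x _ hx => by rw [mass_eq_zero ω i τ s hx, zero_smul]

lemma walkExp_zero (ω : Env M) (i τ : ℤ) (f : ℤ → E) : walkExp ω i τ 0 f = f i := by
  simp [walkExp, window, mass]

/-- The expectation is conditioned on the position before the last step. -/
lemma walkExp_succ (ω : Env M) (i τ : ℤ) (s : ℕ) (f : ℤ → E) :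
    walkExp ω i τ (s + 1) f =
      walkExp ω i τ s fun x =>
        ∑ j ∈ Finset.Icc (-(M : ℤ)) M, weight ω x (τ - s) j • f (x + j) := by
  unfold walkExp
  simp only [mass, Finset.sum_smul, Finset.smul_sum, smul_smul]
  rw [Finset.sum_comm]
  rw [Finset.sum_comm (s := window M i s)]
  refine Finset.sum_congr rfl fun j hj => ?_
  symm
  -- A shifted window need not fill the larger window, so the shift is onto only after terms of zero
  -- mass are discarded.
  refine Finset.sum_bij_ne_zero (fun x _ _ => x + j) ?_ ?_ ?_ ?_
  · intro x hx _
    simp only [window, Finset.mem_Icc] at hx hj ⊢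
    push_cast
    constructor <;> nlinarith [hx.1, hx.2, hj.1, hj.2]
  · intro a _ _ b _ _ h
    simpa using h
  · intro b hb hne
    have hmem : b - j ∈ window M i s := by
      by_contra h
      rw [mass_eq_zero ω i τ s h] at hne
      simp at hne
    refine ⟨b - j, hmem, ?_, by ring⟩
    simpa using hne
  · intro x _ _
    simp

lemma walkExp_add (ω : Env M) (i τ : ℤ) (s : ℕ) (f g : ℤ → E) :
    walkExp ω i τ s (fun x => f x + g x) = walkExp ω i τ s f + walkExp ω i τ s g := by
  simp [walkExp, smul_add, Finset.sum_add_distrib]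

lemma walkExp_const (ω : Env M) (i τ : ℤ) (s : ℕ) (e : E) :
    walkExp ω i τ s (fun _ => e) = e := by
  induction s with
  | zero => rw [walkExp_zero]
  | succ s ih =>
    rw [walkExp_succ]
    simp only [← Finset.sum_smul, weight_sum, one_smul, ih]

end walkExp

lemma mass_sum (ω : Env M) (i τ : ℤ) (s : ℕ) : ∑ x ∈ window M i s, mass ω i τ s x = 1 := by
  simpa [walkExp] using walkExp_const ω i τ s (1 : ℝ)

lemma mass_le_one (ω : Env M) (i τ : ℤ) (s : ℕ) (x : ℤ) : mass ω i τ s x ≤ 1 := by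
  by_cases hx : x ∈ window M i s
  · rw [← mass_sum ω i τ s]
    exact Finset.single_le_sum (fun y _ => mass_nonneg ω i τ s y) hx
  · rw [mass_eq_zero ω i τ s hx]; exact zero_le_one

lemma stepLaw_singleton (ω : Env M) (x τ y : ℤ) :
    stepLaw ω x τ {y} = ENNReal.ofReal (weight ω x τ (y - x)) := by
  simp only [stepLaw, Measure.finsetSum_apply, Measure.smul_apply, smul_eq_mul,
    Measure.dirac_apply, Set.indicator_apply, mem_singleton_iff, Pi.one_apply, mul_ite, mul_one,
    mul_zero]
  have : ∀ j : ℤ, (x + j = y) = (j = y - x) := fun j => by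
    rw [eq_iff_iff]; constructor <;> intro h <;> omega
  simp only [this, Finset.sum_ite_eq']
  split_ifs with h
  · rfl
  · rw [weight_eq_zero ω x τ h, ENNReal.ofReal_zero]

instance (ω : Env M) (i τ : ℤ) : IsProbabilityMeasure (quenchedLaw ω i τ) := by
  unfold quenchedLaw; infer_instance

lemma map_quenchedLaw_succ (ω : Env M) (i τ : ℤ) (s : ℕ) (y : ℤ) :
    (quenchedLaw ω i τ).map (fun X => X (s + 1)) {y} =
      ∫⁻ x, stepLaw ω x (τ - s) {y} ∂((quenchedLaw ω i τ).map (fun X => X s)) := by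
  have h := Kernel.map_frestrictLe_trajMeasure_compProd_eq_map_trajMeasure
    (X := fun _ => ℤ) (μ₀ := Measure.dirac i) (κ := backwardKernel ω τ) (a := s)
  have h2 : (quenchedLaw ω i τ).map (fun X => X (s + 1)) =
      ((quenchedLaw ω i τ).map (Preorder.frestrictLe s) ⊗ₘ backwardKernel ω τ s).map Prod.snd := by
    unfold quenchedLaw
    rw [h, Measure.map_map (by fun_prop) (by fun_prop)]
    rfl
  rw [h2, Measure.map_apply measurable_snd (measurableSet_singleton y),
    Measure.compProd_apply (measurable_snd (measurableSet_singleton y)),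
    lintegral_map (Kernel.measurable_kernel_prodMk_left
      (measurable_snd (measurableSet_singleton y))) (by fun_prop),
    lintegral_map (measurable_of_countable _) (by fun_prop)]
  rfl

lemma map_quenchedLaw_zero (ω : Env M) (i τ : ℤ) :
    (quenchedLaw ω i τ).map (fun X => X 0) = Measure.dirac i := by
  unfold quenchedLaw Kernel.trajMeasure
  rw [Measure.map_comp _ _ (measurable_pi_apply _)]
  have h1 : (fun X : ℕ → ℤ => X 0) =
      (fun x : ((_ : Finset.Iic 0) → ℤ) => x ⟨0, Finset.mem_Iic.2 le_rfl⟩) ∘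
        Preorder.frestrictLe (π := fun _ => ℤ) 0 := rfl
  rw [h1, Kernel.map_comp_right _ (by fun_prop) (by fun_prop), Kernel.traj_map_frestrictLe,
    Kernel.partialTraj_self, ← Measure.map_comp _ _ (by fun_prop), Measure.id_comp,
    Measure.map_map (by fun_prop) (by fun_prop)]
  exact Measure.map_id

/-- The bridge from the canonical path measure to the explicit recursion; afterwards only finite
sums are handled. -/
lemma map_quenchedLaw_singleton (ω : Env M) (i τ : ℤ) (s : ℕ) (y : ℤ) :
    (quenchedLaw ω i τ).map (fun X => X s) {y} = ENNReal.ofReal (mass ω i τ s y) := by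
  induction s generalizing y with
  | zero =>
    rw [map_quenchedLaw_zero]
    simp only [Measure.dirac_apply, Set.indicator_apply, mem_singleton_iff, Pi.one_apply, mass]
    by_cases h : i = y
    · simp [h]
    · simp [h, Ne.symm h]
  | succ s ih =>
    rw [map_quenchedLaw_succ, lintegral_countable']
    simp only [ih, stepLaw_singleton]
    rw [← (Equiv.subLeft y).tsum_eq]
    simp only [Equiv.subLeft_apply, sub_sub_cancel]
    rw [tsum_eq_sum (s := Finset.Icc (-(M : ℤ)) M)]
    · simp only [mass]
      rw [ENNReal.ofReal_sum_of_nonneg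
        fun j _ => mul_nonneg (mass_nonneg _ _ _ _ _) (weight_nonneg _ _ _ _)]
      exact Finset.sum_congr rfl fun j _ => by
        rw [mul_comm, ENNReal.ofReal_mul (mass_nonneg _ _ _ _ _)]
    · intro j hj
      rw [weight_eq_zero _ _ _ hj, ENNReal.ofReal_zero, zero_mul]

lemma quenchedMean_eq_walkExp (ω : Env M) (i τ : ℤ) (s : ℕ) :
    quenchedMean ω i τ s = walkExp ω i τ s (fun x => (x : ℝ)) := by
  have hμ : (quenchedLaw ω i τ).map (fun X => X s) =
      ∑ x ∈ window M i s, ENNReal.ofReal (mass ω i τ s x) • Measure.dirac x := by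
    refine Measure.ext_of_singleton fun y => ?_
    rw [map_quenchedLaw_singleton]
    simp only [Measure.finsetSum_apply, Measure.smul_apply, smul_eq_mul,
      Measure.dirac_apply, Set.indicator_apply, mem_singleton_iff, Pi.one_apply, mul_ite, mul_one,
      mul_zero, Finset.sum_ite_eq']
    split_ifs with h
    · rfl
    · rw [mass_eq_zero ω i τ s h, ENNReal.ofReal_zero]
  have h1 : quenchedMean ω i τ s =
      ∫ x : ℤ, (x : ℝ) ∂((quenchedLaw ω i τ).map (fun X => X s)) := by
    rw [integral_map (measurable_pi_apply s).aemeasurable (by fun_prop)]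
    rfl
  rw [h1, hμ, integral_finsetSum_measure]
  · simp only [integral_smul_measure, integral_dirac, walkExp,
      ENNReal.toReal_ofReal (mass_nonneg _ _ _ _ _)]
  · intro x _
    exact (integrable_dirac (by simp)).smul_measure ENNReal.ofReal_ne_top

/-- The quenched drift at the space-time point `(x, τ)`. -/
def driftAt (ω : Env M) (x τ : ℤ) : ℝ :=
  ∑ j ∈ Finset.Icc (-(M : ℤ)) M, (j : ℝ) * weight ω x τ j

/-- Each step adds the quenched mean of the local drift. With `V` the mean drift, the summands are
centred given the environment at the higher levels, which is the martingale structure behind the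
central limit theorem. -/
lemma quenchedMean_eq_sum_drift (ω : Env M) (i τ : ℤ) (m : ℕ) (V : ℝ) :
    quenchedMean ω i τ m = i + m * V +
      ∑ s ∈ Finset.range m, walkExp ω i τ s (fun x => driftAt ω x (τ - s) - V) := by
  rw [quenchedMean_eq_walkExp]
  induction m with
  | zero => simp [walkExp_zero]
  | succ m ih =>
    rw [walkExp_succ, Finset.sum_range_succ]
    have : (fun x : ℤ => ∑ j ∈ Finset.Icc (-(M : ℤ)) M, weight ω x (τ - m) j • ((x + j : ℤ) : ℝ)) =
        fun x : ℤ => (x : ℝ) + ((driftAt ω x (τ - m) - V) + V) := by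
      funext x
      simp only [smul_eq_mul, Int.cast_add, mul_add, Finset.sum_add_distrib, ← Finset.sum_mul,
        weight_sum, one_mul, driftAt, sub_add_cancel]
      congr 1
      exact Finset.sum_congr rfl fun j _ => mul_comm _ _
    rw [this, walkExp_add, walkExp_add, walkExp_const, ih]
    push_cast
    ring


/-! ### The Fejér kernel and the potential kernel -/

/-- The Fejér kernel `|∑_{m < |k|} e^{imt}|²`. -/
def fejer (k : ℤ) (t : ℝ) : ℝ :=
  ∑ m ∈ Finset.range k.natAbs, ∑ l ∈ Finset.range k.natAbs, Real.cos ((m - l : ℤ) * t)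

lemma fejer_zero_left (t : ℝ) : fejer 0 t = 0 := by
  simp [fejer]

@[fun_prop]
lemma continuous_fejer (k : ℤ) : Continuous (fejer k) := by
  unfold fejer
  fun_prop

lemma fejer_eq_norm_sq (k : ℤ) (t : ℝ) :
    fejer k t = ‖∑ m ∈ Finset.range k.natAbs, Complex.exp (t * Complex.I) ^ m‖ ^ 2 := by
  have h : ∑ m ∈ Finset.range k.natAbs, Complex.exp (t * Complex.I) ^ m =
      ((∑ m ∈ Finset.range k.natAbs, Real.cos (m * t) : ℝ) : ℂ) +
        ((∑ m ∈ Finset.range k.natAbs, Real.sin (m * t) : ℝ) : ℂ) * Complex.I := by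
    push_cast
    rw [Finset.sum_mul, ← Finset.sum_add_distrib]
    refine Finset.sum_congr rfl fun m _ => ?_
    rw [← Complex.exp_nat_mul, ← mul_assoc, Complex.exp_mul_I]
  rw [h, ← Complex.normSq_eq_norm_sq, Complex.normSq_add_mul_I, sq, sq, Finset.sum_mul_sum,
    Finset.sum_mul_sum, ← Finset.sum_add_distrib]
  refine Finset.sum_congr rfl fun m _ => ?_
  rw [← Finset.sum_add_distrib]
  refine Finset.sum_congr rfl fun l _ => ?_
  push_cast
  rw [sub_mul, Real.cos_sub]

lemma fejer_nonneg (k : ℤ) (t : ℝ) : 0 ≤ fejer k t := by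
  rw [fejer_eq_norm_sq]; positivity

/-- Squared modulus of the geometric sum identity. The product form holds at `t = 0` too, so the
quotient `(1 - cos kt) / (1 - cos t)` can be replaced by a continuous function. -/
lemma one_sub_cos_mul_fejer (k : ℤ) (t : ℝ) :
    (1 - Real.cos t) * fejer k t = 1 - Real.cos (k * t) := by
  have key : ∀ x : ℝ, ‖Complex.exp (x * Complex.I) - 1‖ ^ 2 = 2 * (1 - Real.cos x) := by
    intro x
    have : Complex.exp (x * Complex.I) - 1 =
        ((Real.cos x - 1 : ℝ) : ℂ) + ((Real.sin x : ℝ) : ℂ) * Complex.I := by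
      rw [Complex.exp_mul_I]; push_cast; ring
    rw [this, ← Complex.normSq_eq_norm_sq, Complex.normSq_add_mul_I]
    nlinarith [Real.sin_sq_add_cos_sq x]
  have h := geom_sum_mul (Complex.exp (t * Complex.I)) k.natAbs
  have h2 := congrArg (fun z => ‖z‖ ^ 2) h
  simp only [norm_mul, mul_pow] at h2
  rw [← fejer_eq_norm_sq, key, ← Complex.exp_nat_mul] at h2
  have h3 : ((k.natAbs : ℕ) : ℂ) * (t * Complex.I) = (((k.natAbs : ℝ) * t : ℝ) : ℂ) * Complex.I := by
    push_cast; ring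
  rw [h3, key] at h2
  have h4 : Real.cos ((k.natAbs : ℝ) * t) = Real.cos (k * t) := by
    rcases Int.natAbs_eq k with h | h
    · conv_rhs => rw [h]
      simp
    · conv_rhs => rw [h]
      simp
  rw [h4] at h2
  linarith

lemma fejer_le (k : ℤ) (t : ℝ) : fejer k t ≤ (k : ℝ) ^ 2 := by
  have h : fejer k t ≤
      ∑ m ∈ Finset.range k.natAbs, ∑ l ∈ Finset.range k.natAbs, (1 : ℝ) :=
    Finset.sum_le_sum fun m _ => Finset.sum_le_sum fun l _ => Real.cos_le_one _
  refine h.trans (le_of_eq ?_)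
  simp only [Finset.sum_const, Finset.card_range, nsmul_eq_mul, mul_one]
  rw [← sq, ← Int.cast_natCast, ← Int.cast_pow, Int.natAbs_sq, Int.cast_pow]

lemma fejer_zero_right (k : ℤ) : fejer k 0 = (k : ℝ) ^ 2 := by
  simp only [fejer, mul_zero, Real.cos_zero, Finset.sum_const, Finset.card_range, nsmul_eq_mul,
    mul_one]
  rw [← sq, ← Int.cast_natCast, ← Int.cast_pow, Int.natAbs_sq, Int.cast_pow]

/-- The difference is the sum of `1 - cos ((m - l) t)`, and each term is `1 - cos t` times another
Fejér kernel. The factor `1 - cos t` is later absorbed by `fejer x t` to give a bound uniform in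
`x`. -/
lemma exists_fejer_zero_sub_le (k : ℤ) :
    ∃ C : ℝ, ∀ t, |fejer k 0 - fejer k t| ≤ C * (1 - Real.cos t) := by
  refine ⟨∑ m ∈ Finset.range k.natAbs, ∑ l ∈ Finset.range k.natAbs, ((m - l : ℤ) : ℝ) ^ 2,
    fun t => ?_⟩
  have h : fejer k 0 - fejer k t = ∑ m ∈ Finset.range k.natAbs, ∑ l ∈ Finset.range k.natAbs,
      (1 - Real.cos t) * fejer (m - l) t := by
    simp only [one_sub_cos_mul_fejer]
    simp only [fejer, mul_zero, Real.cos_zero, Finset.sum_sub_distrib]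
  have h1 : 0 ≤ 1 - Real.cos t := by linarith [Real.cos_le_one t]
  rw [h, abs_of_nonneg (Finset.sum_nonneg fun m _ => Finset.sum_nonneg fun l _ =>
    mul_nonneg h1 (fejer_nonneg _ _)), Finset.sum_mul]
  refine Finset.sum_le_sum fun m _ => ?_
  rw [Finset.sum_mul]
  refine Finset.sum_le_sum fun l _ => ?_
  rw [mul_comm]
  exact mul_le_mul_of_nonneg_right (fejer_le _ _) h1

lemma integral_cos_int_mul (n : ℤ) :
    ∫ t in (-Real.pi)..Real.pi, Real.cos (n * t) = if n = 0 then 2 * Real.pi else 0 := by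
  split_ifs with h
  · subst h; simp; ring
  · have hn : (n : ℝ) ≠ 0 := by exact_mod_cast h
    rw [intervalIntegral.integral_comp_mul_left _ hn]
    simp

/-- Only the `|k|` diagonal cosines have nonzero integral. -/
lemma integral_fejer (k : ℤ) :
    ∫ t in (-Real.pi)..Real.pi, fejer k t = 2 * Real.pi * |(k : ℝ)| := by
  unfold fejer
  rw [intervalIntegral.integral_finsetSum
    fun m _ => (Continuous.intervalIntegrable (by fun_prop) _ _)]
  have : ∀ m ∈ Finset.range k.natAbs, ∫ t in (-Real.pi)..Real.pi,
      ∑ l ∈ Finset.range k.natAbs, Real.cos ((m - l : ℤ) * t) = 2 * Real.pi := by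
    intro m hm
    rw [intervalIntegral.integral_finsetSum
      fun m _ => (Continuous.intervalIntegrable (by fun_prop) _ _)]
    simp only [integral_cos_int_mul, sub_eq_zero, Nat.cast_inj, Finset.sum_ite_eq, hm, if_true]
  rw [Finset.sum_congr rfl this]
  simp only [Finset.sum_const, Finset.card_range, nsmul_eq_mul, Nat.cast_natAbs, Int.cast_abs]
  ring

/-- A probability law on `ℤ` supported in `[-M, M]` and of span one. -/
structure IsSpanOneLaw (M : ℕ) (p : ℤ → ℝ) : Prop where
  nonneg : ∀ j, 0 ≤ p j
  eq_zero : ∀ j, j ∉ Finset.Icc (-(M : ℤ)) M → p j = 0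
  sum_eq : ∑ j ∈ Finset.Icc (-(M : ℤ)) M, p j = 1
  span : ¬ ∃ h : ℤ, 1 < h ∧ ∃ x : ℤ, ∑' k : ℤ, p (x + k * h) = 1

/-- The ratio `(1 - |φ(t)|²) / (1 - cos t)`, as a trigonometric polynomial. -/
def ratioFun (M : ℕ) (p : ℤ → ℝ) (t : ℝ) : ℝ :=
  ∑ i ∈ Finset.Icc (-(M : ℤ)) M, ∑ j ∈ Finset.Icc (-(M : ℤ)) M, p i * p j * fejer (i - j) t

@[fun_prop]
lemma continuous_ratioFun (M : ℕ) (p : ℤ → ℝ) : Continuous (ratioFun M p) := by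
  unfold ratioFun; fun_prop

/-- The potential kernel of the symmetrized walk. -/
def potKer (M : ℕ) (p : ℤ → ℝ) (x : ℤ) : ℝ :=
  1 / (2 * Real.pi) * ∫ t in (-Real.pi)..Real.pi, fejer x t / ratioFun M p t

/-- For independent variables with laws `c` and `d`, both sides are the mean of `1 - cos` of `t`
times their difference. It serves the one-step laws and the quenched position laws alike. -/
lemma one_sub_re_mul_conj {W W' : Finset ℤ} {c d : ℤ → ℝ} (hc : ∑ x ∈ W, c x = 1)
    (hd : ∑ x ∈ W', d x = 1) (t : ℝ) :
    1 - ((∑ x ∈ W, (c x : ℂ) * Complex.exp (Complex.I * t * x)) *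
      (starRingEnd ℂ) (∑ y ∈ W', (d y : ℂ) * Complex.exp (Complex.I * t * y))).re =
    ∑ x ∈ W, ∑ y ∈ W', c x * d y * (1 - Real.cos ((x - y : ℤ) * t)) := by
  have h1 : (1 : ℝ) = ∑ x ∈ W, ∑ y ∈ W', c x * d y := by
    rw [← Finset.sum_mul_sum, hc, hd, one_mul]
  rw [map_sum, Finset.sum_mul_sum, Complex.re_sum]
  simp only [Complex.re_sum]
  conv_lhs => rw [h1]
  rw [← Finset.sum_sub_distrib]
  refine Finset.sum_congr rfl fun x _ => ?_
  rw [← Finset.sum_sub_distrib]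
  refine Finset.sum_congr rfl fun y _ => ?_
  have h2 : (c x : ℂ) * Complex.exp (Complex.I * t * x) *
      (starRingEnd ℂ) ((d y : ℂ) * Complex.exp (Complex.I * t * y)) =
      ((c x * d y : ℝ) : ℂ) * Complex.exp ((((x - y : ℤ) * t : ℝ) : ℂ) * Complex.I) := by
    rw [map_mul, Complex.conj_ofReal, ← Complex.exp_conj]
    simp only [map_mul, Complex.conj_I, Complex.conj_ofReal, map_intCast]
    push_cast
    rw [sub_mul, sub_mul, sub_eq_add_neg, Complex.exp_add]
    have e1 : Complex.I * t * x = (x : ℂ) * t * Complex.I := by ring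
    have e2 : -Complex.I * t * y = -((y : ℂ) * t * Complex.I) := by ring
    rw [e1, e2]
    ring
  rw [h2, Complex.re_ofReal_mul, Complex.exp_ofReal_mul_I_re]
  ring

section potKer

variable {M : ℕ} {p : ℤ → ℝ}

lemma IsSpanOneLaw.false_of_subset (hp : IsSpanOneLaw M p) {h : ℤ} (hh : 1 < h) {x : ℤ}
    (hs : ∀ j, p j ≠ 0 → ∃ k : ℤ, j = x + k * h) : False := by
  refine hp.span ⟨h, hh, x, ?_⟩
  have hinj : Function.Injective (fun k : ℤ => x + k * h) := by
    intro a b hab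
    simp only [add_right_inj] at hab
    exact mul_right_cancel₀ (by omega) hab
  rw [show (fun k : ℤ => p (x + k * h)) = fun k => p ((fun k : ℤ => x + k * h) k) from rfl,
    hinj.tsum_eq, tsum_eq_sum (s := Finset.Icc (-(M : ℤ)) M), hp.sum_eq]
  · exact fun j hj => hp.eq_zero j hj
  · intro j hj
    obtain ⟨k, hk⟩ := hs j hj
    exact ⟨k, hk.symm⟩

lemma IsSpanOneLaw.exists_ne_zero (hp : IsSpanOneLaw M p) : ∃ x, p x ≠ 0 := by
  by_contra! h
  have := hp.sum_eq
  simp [h] at this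

/-- The subgroup is cyclic, and the support lies in one coset of it. A generator other than `±1`
would place the support in a progression of step larger than one. -/
lemma IsSpanOneLaw.eq_top_of_sub_mem (hp : IsSpanOneLaw M p) (G : AddSubgroup ℤ)
    (hG : ∀ i j, p i ≠ 0 → p j ≠ 0 → i - j ∈ G) : G = ⊤ := by
  obtain ⟨a, ha⟩ := Int.subgroup_cyclic G
  obtain ⟨x, hx⟩ := hp.exists_ne_zero
  have hmem : ∀ j, p j ≠ 0 → ∃ k : ℤ, j = x + k * a := by
    intro j hj
    have := hG j x hj hx
    rw [ha, AddSubgroup.mem_closure_singleton] at this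
    obtain ⟨k, hk⟩ := this
    refine ⟨k, ?_⟩
    simp only [smul_eq_mul] at hk
    omega
  rcases lt_trichotomy (a.natAbs) 1 with h | h | h
  · exfalso
    have h0 : a = 0 := by omega
    -- The generator is `0`, so the support is one point, which lies in a progression of any step;
    -- `2` is an arbitrary choice.
    refine hp.false_of_subset (h := 2) (by norm_num) (x := x) fun j hj => ⟨0, ?_⟩
    obtain ⟨k, hk⟩ := hmem j hj
    rw [hk, h0]; ring
  · rw [ha, AddSubgroup.eq_top_iff']
    intro y
    rw [AddSubgroup.mem_closure_singleton]
    rcases Int.natAbs_eq a with h' | h'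
    · exact ⟨y, by rw [h', h]; simp⟩
    · exact ⟨-y, by rw [h', h]; simp⟩
  · exfalso
    refine hp.false_of_subset (h := |a|) (by rw [Int.abs_eq_natAbs]; exact_mod_cast h)
      (x := x) fun j hj => ?_
    obtain ⟨k, hk⟩ := hmem j hj
    rcases abs_choice a with h' | h'
    · exact ⟨k, by rw [h', hk]⟩
    · exact ⟨-k, by rw [h', hk]; ring⟩

lemma ratioFun_nonneg (hp : IsSpanOneLaw M p) (t : ℝ) : 0 ≤ ratioFun M p t :=
  Finset.sum_nonneg fun i _ => Finset.sum_nonneg fun j _ =>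
    mul_nonneg (mul_nonneg (hp.nonneg i) (hp.nonneg j)) (fejer_nonneg _ _)

/-- A zero would annihilate `fejer (i - j) t` for all `i, j` in the support. At `t = 0` this forces
`i = j`. Otherwise `(i - j) t ∈ 2πℤ`; the integers `k` with `k t ∈ 2πℤ` form a subgroup, so span one
gives `t ∈ 2πℤ`, impossible for `0 < |t| ≤ π`. -/
lemma ratioFun_pos (hp : IsSpanOneLaw M p) {t : ℝ} (ht : t ∈ Icc (-Real.pi) Real.pi) :
    0 < ratioFun M p t := by
  refine lt_of_le_of_ne (ratioFun_nonneg hp t) fun h0 => ?_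
  have hz : ∀ i j, p i ≠ 0 → p j ≠ 0 → fejer (i - j) t = 0 := by
    intro i j hi hj
    have hi' : i ∈ Finset.Icc (-(M : ℤ)) M := by
      by_contra h; exact hi (hp.eq_zero i h)
    have hj' : j ∈ Finset.Icc (-(M : ℤ)) M := by
      by_contra h; exact hj (hp.eq_zero j h)
    have hnn : ∀ i j, 0 ≤ p i * p j * fejer (i - j) t := fun i j =>
      mul_nonneg (mul_nonneg (hp.nonneg i) (hp.nonneg j)) (fejer_nonneg _ _)
    have h1 := (Finset.sum_eq_zero_iff_of_nonneg
      (fun i _ => Finset.sum_nonneg fun j _ => hnn i j)).1 h0.symm i hi'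
    have h2 := (Finset.sum_eq_zero_iff_of_nonneg (fun j _ => hnn i j)).1 h1 j hj'
    simpa [hi, hj] using h2
  by_cases ht0 : t = 0
  · subst ht0
    have := hp.eq_top_of_sub_mem ⊥ fun i j hi hj => by
      have := hz i j hi hj
      rw [fejer_zero_right] at this
      rw [AddSubgroup.mem_bot]
      exact_mod_cast pow_eq_zero_iff (two_ne_zero) |>.1 this
    exact bot_ne_top this
  · have hG := hp.eq_top_of_sub_mem
      { carrier := {k : ℤ | ∃ n : ℤ, (n : ℝ) * (2 * Real.pi) = k * t}
        zero_mem' := ⟨0, by simp⟩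
        add_mem' := by
          rintro a b ⟨n, hn⟩ ⟨m, hm⟩
          exact ⟨n + m, by push_cast; rw [add_mul, add_mul, hn, hm]⟩
        neg_mem' := by
          rintro a ⟨n, hn⟩
          exact ⟨-n, by push_cast; rw [neg_mul, neg_mul, hn]⟩ } (fun i j hi hj => by
        have h1 := one_sub_cos_mul_fejer (i - j) t
        rw [hz i j hi hj, mul_zero] at h1
        exact (Real.cos_eq_one_iff _).1 (by linarith))
    have h1 : (1 : ℤ) ∈ (⊤ : AddSubgroup ℤ) := AddSubgroup.mem_top _
    rw [← hG] at h1
    obtain ⟨n, hn⟩ := h1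
    have hπ := Real.pi_pos
    rw [Int.cast_one, one_mul] at hn
    have hn1 : n < 1 := by
      by_contra! h
      have : (1 : ℝ) ≤ n := by exact_mod_cast h
      nlinarith [ht.2]
    have hn2 : -1 < n := by
      by_contra! h
      have : (n : ℝ) ≤ -1 := by exact_mod_cast h
      nlinarith [ht.1]
    have : n = 0 := by omega
    subst this
    simp at hn
    exact ht0 hn.symm

lemma exists_ratioFun_bounds (hp : IsSpanOneLaw M p) :
    ∃ c C : ℝ, 0 < c ∧ 0 < C ∧
      ∀ t ∈ Icc (-Real.pi) Real.pi, c ≤ ratioFun M p t ∧ ratioFun M p t ≤ C := by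
  have hne : (Icc (-Real.pi) Real.pi).Nonempty := ⟨0, by constructor <;> linarith [Real.pi_pos]⟩
  obtain ⟨a, ha, hamin⟩ := isCompact_Icc.exists_isMinOn hne
    (continuous_ratioFun M p).continuousOn
  obtain ⟨b, hb, hbmax⟩ := isCompact_Icc.exists_isMaxOn hne
    (continuous_ratioFun M p).continuousOn
  exact ⟨_, _, ratioFun_pos hp ha, ratioFun_pos hp hb, fun t ht => ⟨hamin ht, hbmax ht⟩⟩

lemma continuousOn_div_ratioFun (hp : IsSpanOneLaw M p) {f : ℝ → ℝ} (hf : Continuous f) :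
    ContinuousOn (fun t => f t / ratioFun M p t) (uIcc (-Real.pi) Real.pi) := by
  refine hf.continuousOn.div (continuous_ratioFun M p).continuousOn fun t ht => ?_
  rw [uIcc_of_le (by linarith [Real.pi_pos])] at ht
  exact (ratioFun_pos hp ht).ne'

lemma potKer_zero : potKer M p 0 = 0 := by
  simp [potKer, fejer_zero_left]

lemma potKer_nonneg (hp : IsSpanOneLaw M p) (x : ℤ) : 0 ≤ potKer M p x := by
  refine mul_nonneg (by positivity) (intervalIntegral.integral_nonneg
    (by linarith [Real.pi_pos]) fun t ht => div_nonneg (fejer_nonneg _ _) (ratioFun_nonneg hp t))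

/-- The denominator is bounded above, so the integral is at least a positive multiple of the Fejér
integral `2π|x|`. -/
lemma potKer_pos (hp : IsSpanOneLaw M p) {x : ℤ} (hx : x ≠ 0) : 0 < potKer M p x := by
  obtain ⟨c, C, hc, hC, hb⟩ := exists_ratioFun_bounds hp
  have hx' : 0 < |(x : ℝ)| := abs_pos.2 (by exact_mod_cast hx)
  have hπ := Real.pi_pos
  have h : ∫ t in (-Real.pi)..Real.pi, fejer x t / C ≤
      ∫ t in (-Real.pi)..Real.pi, fejer x t / ratioFun M p t := by
    refine intervalIntegral.integral_mono_on (by linarith)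
      (Continuous.intervalIntegrable (by fun_prop) _ _)
      (continuousOn_div_ratioFun hp (continuous_fejer x)).intervalIntegrable fun t ht => ?_
    exact div_le_div_of_nonneg_left (fejer_nonneg _ _) (ratioFun_pos hp ht) (hb t ht).2
  rw [intervalIntegral.integral_div, integral_fejer] at h
  unfold potKer
  have : 0 < 2 * Real.pi * |(x : ℝ)| / C := by positivity
  exact mul_pos (by positivity) (this.trans_le h)

lemma exists_potKer_le (hp : IsSpanOneLaw M p) :
    ∃ C : ℝ, 0 ≤ C ∧ ∀ x, potKer M p x ≤ C * |(x : ℝ)| := by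
  obtain ⟨c, C, hc, hC, hb⟩ := exists_ratioFun_bounds hp
  have hπ := Real.pi_pos
  refine ⟨1 / c, by positivity, fun x => ?_⟩
  have h : ∫ t in (-Real.pi)..Real.pi, fejer x t / ratioFun M p t ≤
      ∫ t in (-Real.pi)..Real.pi, fejer x t / c := by
    refine intervalIntegral.integral_mono_on (by linarith)
      (continuousOn_div_ratioFun hp (continuous_fejer x)).intervalIntegrable
      (Continuous.intervalIntegrable (by fun_prop) _ _) fun t ht => ?_
    exact div_le_div_of_nonneg_left (fejer_nonneg _ _) hc (hb t ht).1
  rw [intervalIntegral.integral_div, integral_fejer] at h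
  calc potKer M p x ≤ 1 / (2 * Real.pi) * (2 * Real.pi * |(x : ℝ)| / c) :=
        mul_le_mul_of_nonneg_left h (by positivity)
    _ = 1 / c * |(x : ℝ)| := by field_simp

lemma exists_ratioFun_zero_sub_le (hp : IsSpanOneLaw M p) :
    ∃ C : ℝ, ∀ t, |ratioFun M p 0 - ratioFun M p t| ≤ C * (1 - Real.cos t) := by
  choose C hC using exists_fejer_zero_sub_le
  refine ⟨∑ i ∈ Finset.Icc (-(M : ℤ)) M, ∑ j ∈ Finset.Icc (-(M : ℤ)) M,
    p i * p j * C (i - j), fun t => ?_⟩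
  unfold ratioFun
  rw [← Finset.sum_sub_distrib, Finset.sum_mul]
  refine (Finset.abs_sum_le_sum_abs _ _).trans (Finset.sum_le_sum fun i _ => ?_)
  rw [← Finset.sum_sub_distrib, Finset.sum_mul]
  refine (Finset.abs_sum_le_sum_abs _ _).trans (Finset.sum_le_sum fun j _ => ?_)
  have hnn : 0 ≤ p i * p j := mul_nonneg (hp.nonneg i) (hp.nonneg j)
  rw [← mul_sub, abs_mul, abs_of_nonneg hnn, mul_assoc (p i * p j)]
  exact mul_le_mul_of_nonneg_left (hC _ t) hnn

/-- Linear growth with bounded error. The two integrands differ by `fejer x t * (R(0) - R(t)) /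
(R(t) R(0))` with `R` the `ratioFun`; since `|R(0) - R(t)| ≤ K (1 - cos t)`, the numerator is at
most `K (1 - cos xt) ≤ 2K`, whatever `x` is. -/
lemma exists_abs_potKer_sub_le (hp : IsSpanOneLaw M p) :
    ∃ C : ℝ, 0 ≤ C ∧ ∀ x, |potKer M p x - |(x : ℝ)| / ratioFun M p 0| ≤ C := by
  obtain ⟨c, C, hc, hC, hb⟩ := exists_ratioFun_bounds hp
  obtain ⟨K, hK⟩ := exists_ratioFun_zero_sub_le hp
  have hπ := Real.pi_pos
  have h0 : (0 : ℝ) ∈ Icc (-Real.pi) Real.pi := by constructor <;> linarith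
  have hR0 := ratioFun_pos hp h0
  have hK0 : 0 ≤ K := by
    have := (abs_nonneg _).trans (hK Real.pi)
    rw [Real.cos_pi] at this
    linarith
  refine ⟨2 * K / (c * ratioFun M p 0), by positivity, fun x => ?_⟩
  have e1 : potKer M p x - |(x : ℝ)| / ratioFun M p 0 = 1 / (2 * Real.pi) *
      ∫ t in (-Real.pi)..Real.pi, (fejer x t / ratioFun M p t - fejer x t / ratioFun M p 0) := by
    rw [intervalIntegral.integral_sub
      (continuousOn_div_ratioFun hp (continuous_fejer x)).intervalIntegrable
      (Continuous.intervalIntegrable (by fun_prop) _ _), intervalIntegral.integral_div,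
      integral_fejer]
    unfold potKer
    field_simp
  rw [e1, abs_mul, abs_of_pos (by positivity)]
  have h2 : ‖∫ t in (-Real.pi)..Real.pi,
      (fejer x t / ratioFun M p t - fejer x t / ratioFun M p 0)‖ ≤
      2 * K / (c * ratioFun M p 0) * |Real.pi - -Real.pi| := by
    refine intervalIntegral.norm_integral_le_of_norm_le_const fun t ht => ?_
    rw [uIoc_of_le (by linarith)] at ht
    have ht' := Ioc_subset_Icc_self ht
    have hRt := ratioFun_pos hp ht'
    have e2 : fejer x t / ratioFun M p t - fejer x t / ratioFun M p 0 =
        fejer x t * (ratioFun M p 0 - ratioFun M p t) / (ratioFun M p t * ratioFun M p 0) := by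
      field_simp
    rw [e2, Real.norm_eq_abs, abs_div, abs_mul, abs_of_nonneg (fejer_nonneg x t),
      abs_of_pos (mul_pos hRt hR0)]
    refine div_le_div₀ (by positivity) ?_ (by positivity)
      (mul_le_mul_of_nonneg_right (hb t ht').1 hR0.le)
    calc fejer x t * |ratioFun M p 0 - ratioFun M p t|
        ≤ fejer x t * (K * (1 - Real.cos t)) :=
          mul_le_mul_of_nonneg_left (hK t) (fejer_nonneg x t)
      _ = K * (1 - Real.cos (x * t)) := by rw [← one_sub_cos_mul_fejer]; ring
      _ ≤ 2 * K := by nlinarith [Real.neg_one_le_cos (x * t)]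
  rw [Real.norm_eq_abs, abs_of_pos (by linarith : 0 < Real.pi - -Real.pi)] at h2
  calc _ ≤ 1 / (2 * Real.pi) *
        (2 * K / (c * ratioFun M p 0) * (Real.pi - -Real.pi)) :=
        mul_le_mul_of_nonneg_left h2 (by positivity)
    _ = 2 * K / (c * ratioFun M p 0) := by field_simp; ring

/-- The potential kernel is Lipschitz up to a constant, so its increments over bounded jumps are
bounded. -/
lemma exists_abs_potKer_sub_potKer_le (hp : IsSpanOneLaw M p) :
    ∃ C : ℝ, 0 ≤ C ∧ ∀ x y, |potKer M p x - potKer M p y| ≤ C * (1 + |((x - y : ℤ) : ℝ)|) := by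
  obtain ⟨C, hC, h⟩ := exists_abs_potKer_sub_le hp
  have hR0 := ratioFun_pos hp (t := 0) (by constructor <;> linarith [Real.pi_pos])
  refine ⟨2 * C + 1 / ratioFun M p 0, by positivity, fun x y => ?_⟩
  have h1 := abs_le.1 (h x)
  have h2 := abs_le.1 (h y)
  have h3 : abs (|(x : ℝ)| / ratioFun M p 0 - |(y : ℝ)| / ratioFun M p 0) ≤
      1 / ratioFun M p 0 * |((x - y : ℤ) : ℝ)| := by
    rw [← sub_div, abs_div, abs_of_pos hR0, div_eq_mul_one_div, mul_comm]
    push_cast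
    exact mul_le_mul_of_nonneg_left (abs_abs_sub_abs_le _ _) (by positivity)
  have h3' := abs_le.1 h3
  have h4 : 0 ≤ |((x - y : ℤ) : ℝ)| := abs_nonneg _
  have h5 : 0 < 1 / ratioFun M p 0 := by positivity
  rw [abs_le]
  constructor <;> nlinarith [mul_nonneg hC h4]

/-- Integrands are compared after multiplication by `1 - cos t`; the only point lost is `t = 0`. -/
lemma ae_cos_ne_one :
    ∀ᵐ t ∂(volume : Measure ℝ), t ∈ uIoc (-Real.pi) Real.pi → 1 - Real.cos t ≠ 0 := by
  have h : ∀ᵐ t ∂(volume : Measure ℝ), t ≠ 0 := by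
    rw [ae_iff]; simp
  filter_upwards [h] with t ht0 ht hc
  have hπ := Real.pi_pos
  rw [uIoc_of_le (by linarith)] at ht
  exact ht0 ((Real.cos_eq_one_iff_of_lt_of_lt (by linarith [ht.1]) (by linarith [ht.2])).1
    (by linarith))

lemma one_sub_cos_mul_ratioFun (t : ℝ) :
    (1 - Real.cos t) * ratioFun M p t = ∑ i ∈ Finset.Icc (-(M : ℤ)) M,
      ∑ j ∈ Finset.Icc (-(M : ℤ)) M, p i * p j * (1 - Real.cos ((i - j : ℤ) * t)) := by
  simp only [ratioFun, Finset.mul_sum, ← one_sub_cos_mul_fejer]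
  refine Finset.sum_congr rfl fun i _ => Finset.sum_congr rfl fun j _ => by ring

lemma sum_sum_mul_potKer (hp : IsSpanOneLaw M p) {W W' : Finset ℤ} (m : ℤ → ℤ → ℝ)
    (g : ℤ → ℤ → ℤ) :
    ∑ x ∈ W, ∑ y ∈ W', m x y * potKer M p (g x y) = 1 / (2 * Real.pi) *
      ∫ t in (-Real.pi)..Real.pi,
        (∑ x ∈ W, ∑ y ∈ W', m x y * fejer (g x y) t) / ratioFun M p t := by
  have hi : ∀ x y, IntervalIntegrable (fun t => m x y * fejer (g x y) t / ratioFun M p t) volume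
      (-Real.pi) Real.pi := fun x y =>
    (continuousOn_div_ratioFun hp (by fun_prop)).intervalIntegrable
  simp only [Finset.sum_div]
  rw [intervalIntegral.integral_finsetSum
    fun x _ => by
      simpa only [← Finset.sum_fn] using IntervalIntegrable.sum W' fun y _ => hi x y]
  rw [Finset.mul_sum]
  refine Finset.sum_congr rfl fun x _ => ?_
  rw [intervalIntegral.integral_finsetSum fun y _ => hi x y, Finset.mul_sum]
  refine Finset.sum_congr rfl fun y _ => ?_
  simp only [potKer, mul_div_assoc, intervalIntegral.integral_const_mul]
  ring

/-- The Poisson equation of the symmetrized walk: harmonic away from `0`, with a unit source at `0`.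
Averaging `1 - cos ((z + i - j) t)` gives `(1 - cos zt) + cos zt · (1 - |φ(t)|²)`, since the sine
part is antisymmetric in `i` and `j`; after division the extra term is `cos zt`, whose mean over the
circle is the indicator of `z = 0`. -/
lemma sum_sum_potKer_shift (hp : IsSpanOneLaw M p) (z : ℤ) :
    ∑ i ∈ Finset.Icc (-(M : ℤ)) M, ∑ j ∈ Finset.Icc (-(M : ℤ)) M,
      p i * p j * potKer M p (z + i - j) = potKer M p z + if z = 0 then 1 else 0 := by
  rw [sum_sum_mul_potKer hp (fun i j => p i * p j) (fun i j => z + i - j)]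
  have hπ := Real.pi_pos
  have h1 : (if z = 0 then (1 : ℝ) else 0) =
      1 / (2 * Real.pi) * ∫ t in (-Real.pi)..Real.pi, Real.cos (z * t) := by
    rw [integral_cos_int_mul]
    split_ifs
    · field_simp
    · simp
  rw [h1, potKer, ← mul_add, ← intervalIntegral.integral_add
    (continuousOn_div_ratioFun hp (continuous_fejer z)).intervalIntegrable
    (Continuous.intervalIntegrable (by fun_prop) _ _)]
  congr 1
  refine intervalIntegral.integral_congr_ae ?_
  filter_upwards [ae_cos_ne_one] with t hc ht
  have hR : ratioFun M p t ≠ 0 := by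
    rw [uIoc_of_le (by linarith)] at ht
    exact (ratioFun_pos hp (Ioc_subset_Icc_self ht)).ne'
  rw [div_add' _ _ _ hR]
  congr 1
  apply mul_left_cancel₀ (hc ht)
  rw [mul_add, one_sub_cos_mul_fejer, mul_left_comm, one_sub_cos_mul_ratioFun]
  have h2 : ∑ i ∈ Finset.Icc (-(M : ℤ)) M, ∑ j ∈ Finset.Icc (-(M : ℤ)) M, p i * p j = 1 := by
    rw [← Finset.sum_mul_sum, hp.sum_eq, one_mul]
  have h3 : ∑ i ∈ Finset.Icc (-(M : ℤ)) M, ∑ j ∈ Finset.Icc (-(M : ℤ)) M,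
      p i * p j * Real.sin ((i - j : ℤ) * t) = 0 := by
    have : ∑ i ∈ Finset.Icc (-(M : ℤ)) M, ∑ j ∈ Finset.Icc (-(M : ℤ)) M,
        p i * p j * Real.sin ((i - j : ℤ) * t) = -∑ i ∈ Finset.Icc (-(M : ℤ)) M,
        ∑ j ∈ Finset.Icc (-(M : ℤ)) M, p i * p j * Real.sin ((i - j : ℤ) * t) := by
      conv_lhs => rw [Finset.sum_comm]
      rw [← Finset.sum_neg_distrib]
      refine Finset.sum_congr rfl fun i _ => ?_
      rw [← Finset.sum_neg_distrib]
      refine Finset.sum_congr rfl fun j _ => ?_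
      rw [← neg_sub j i, ← neg_neg (((j - i : ℤ) : ℝ))]
      push_cast
      rw [neg_mul, Real.sin_neg]
      ring_nf
    linarith
  have h4 : ∀ i j : ℤ, p i * p j * (1 - Real.cos ((z + i - j : ℤ) * t)) =
      p i * p j * (1 - Real.cos (z * t)) + Real.cos (z * t) *
        (p i * p j * (1 - Real.cos ((i - j : ℤ) * t))) + Real.sin (z * t) *
        (p i * p j * Real.sin ((i - j : ℤ) * t)) := by
    intro i j
    have : ((z + i - j : ℤ) : ℝ) * t = z * t + (i - j : ℤ) * t := by push_cast; ring
    rw [this, Real.cos_add]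
    ring
  simp only [Finset.mul_sum]
  have h5 : ∀ i j : ℤ, (1 - Real.cos t) * (p i * p j * fejer (z + i - j) t) =
      p i * p j * (1 - Real.cos (z * t)) + Real.cos (z * t) *
        (p i * p j * (1 - Real.cos ((i - j : ℤ) * t))) + Real.sin (z * t) *
        (p i * p j * Real.sin ((i - j : ℤ) * t)) := by
    intro i j
    rw [← h4, ← one_sub_cos_mul_fejer]; ring
  simp only [h5, Finset.sum_add_distrib, ← Finset.mul_sum, h3, mul_zero, add_zero,
    ← Finset.sum_mul]
  rw [hp.sum_eq]
  ring

end potKer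


/-! ### Independence of the environment -/

section independence

variable {M : ℕ} {𝕜 : Type*} [RCLike 𝕜]

/-- A bounded function of the environment at the space-time points in `S`. -/
structure BddMeasurable (S : Set (ℤ × ℤ)) (f : Env M → 𝕜) : Prop where
  measurable_sig : Measurable[sig M S] f
  bounded : ∃ C : ℝ, ∀ ω, ‖f ω‖ ≤ C

namespace BddMeasurable

variable {S T : Set (ℤ × ℤ)} {f g : Env M → 𝕜}

lemma mono (h : BddMeasurable S f) (hST : S ⊆ T) : BddMeasurable T f :=
  ⟨h.1.mono (sig_mono hST) le_rfl, h.2⟩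

lemma measurable (h : BddMeasurable S f) : Measurable f := h.1.mono (sig_le _) le_rfl

lemma integrable (h : BddMeasurable S f) (P : Measure (Env M)) [IsFiniteMeasure P] :
    Integrable f P := by
  obtain ⟨C, hC⟩ := h.2
  exact Integrable.of_bound h.measurable.aestronglyMeasurable C (ae_of_all _ hC)

lemma const (c : 𝕜) : BddMeasurable (M := M) S (fun _ => c) :=
  ⟨measurable_const, ‖c‖, fun _ => le_rfl⟩

lemma add (hf : BddMeasurable S f) (hg : BddMeasurable S g) :
    BddMeasurable S (fun ω => f ω + g ω) := by
  obtain ⟨C, hC⟩ := hf.2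
  obtain ⟨D, hD⟩ := hg.2
  exact ⟨hf.1.add hg.1, C + D, fun ω => (norm_add_le _ _).trans (add_le_add (hC ω) (hD ω))⟩

lemma sub (hf : BddMeasurable S f) (hg : BddMeasurable S g) :
    BddMeasurable S (fun ω => f ω - g ω) := by
  obtain ⟨C, hC⟩ := hf.2
  obtain ⟨D, hD⟩ := hg.2
  exact ⟨hf.1.sub hg.1, C + D, fun ω => (norm_sub_le _ _).trans (add_le_add (hC ω) (hD ω))⟩

lemma mul (hf : BddMeasurable S f) (hg : BddMeasurable S g) :
    BddMeasurable S (fun ω => f ω * g ω) := by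
  obtain ⟨C, hC⟩ := hf.2
  obtain ⟨D, hD⟩ := hg.2
  refine ⟨hf.1.mul hg.1, C * D, fun ω => ?_⟩
  rw [norm_mul]
  exact mul_le_mul (hC ω) (hD ω) (norm_nonneg _) ((norm_nonneg _).trans (hC ω))

lemma pow (hf : BddMeasurable S f) (n : ℕ) : BddMeasurable S (fun ω => f ω ^ n) := by
  induction n with
  | zero => simpa using const 1
  | succ n ih => simpa only [pow_succ] using ih.mul hf

lemma sum {ι : Type*} (W : Finset ι) {f : ι → Env M → 𝕜} (hf : ∀ i ∈ W, BddMeasurable S (f i)) :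
    BddMeasurable S (fun ω => ∑ i ∈ W, f i ω) := by
  classical
  induction W using Finset.induction_on with
  | empty => simpa using const 0
  | insert a W ha ih =>
    simp only [Finset.sum_insert ha]
    exact (hf a (Finset.mem_insert_self _ _)).add
      (ih fun i hi => hf i (Finset.mem_insert_of_mem hi))

lemma ofReal {f : Env M → ℝ} (hf : BddMeasurable S f) :
    BddMeasurable S (fun ω => (f ω : 𝕜)) := by
  obtain ⟨C, hC⟩ := hf.2
  exact ⟨RCLike.measurable_ofReal.comp hf.1, C, fun ω => by simpa using hC ω⟩

lemma conj (hf : BddMeasurable S f) :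
    BddMeasurable S (fun ω => (starRingEnd 𝕜) (f ω)) := by
  obtain ⟨C, hC⟩ := hf.2
  exact ⟨RCLike.continuous_conj.measurable.comp hf.1, C, fun ω => by simpa using hC ω⟩

lemma norm (hf : BddMeasurable S f) : BddMeasurable S (fun ω => ‖f ω‖) := by
  obtain ⟨C, hC⟩ := hf.2
  exact ⟨measurable_norm.comp hf.1, C, fun ω => by simpa using hC ω⟩

/-- The site vectors are independent, hence so are the σ-algebras of disjoint sets of sites. -/
lemma integral_mul {P : Measure (Env M)} (hiid : IsIID P) (hST : Disjoint S T)
    (hf : BddMeasurable S f) (hg : BddMeasurable T g) :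
    ∫ ω, f ω * g ω ∂P = (∫ ω, f ω ∂P) * ∫ ω, g ω ∂P := by
  have h1 : Indep (sig M S) (sig M T) P :=
    indep_iSup_of_disjoint (fun z => (measurable_pi_apply z).comap_le) hiid.indep hST
  have h2 : IndepFun f g P :=
    indep_of_indep_of_le_right (indep_of_indep_of_le_left h1 hf.1.comap_le) hg.1.comap_le
  exact h2.integral_mul_eq_mul_integral hf.measurable.aestronglyMeasurable
    hg.measurable.aestronglyMeasurable

end BddMeasurable

lemma bddMeasurable_weight {S : Set (ℤ × ℤ)} {x τ : ℤ} (hz : (x, τ) ∈ S) (j : ℤ) :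
    BddMeasurable (𝕜 := ℝ) S (fun ω : Env M => weight ω x τ j) :=
  ⟨measurable_weight_sig hz j, 1, fun ω => by
    rw [Real.norm_eq_abs, abs_of_nonneg (weight_nonneg _ _ _ _)]
    exact weight_le_one _ _ _ _⟩

lemma bddMeasurable_mass {S : Set (ℤ × ℤ)} (i τ : ℤ) (s : ℕ) (x : ℤ)
    (hS : {z : ℤ × ℤ | τ - s < z.2} ⊆ S) :
    BddMeasurable (𝕜 := ℝ) S (fun ω : Env M => mass ω i τ s x) :=
  ⟨(measurable_mass_sig i τ s x).mono (sig_mono hS) le_rfl, 1, fun ω => by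
    rw [Real.norm_eq_abs, abs_of_nonneg (mass_nonneg _ _ _ _ _)]
    exact mass_le_one _ _ _ _ _⟩

lemma IsIID.integral_comp {P : Measure (Env M)} (hiid : IsIID P) {E : Type*}
    [NormedAddCommGroup E] [NormedSpace ℝ E] [MeasurableSpace E] [BorelSpace E]
    {F : JumpVector M → E} (hF : Measurable F) (z : ℤ × ℤ) :
    ∫ ω, F (ω z) ∂P = ∫ ω, F (ω (0, 0)) ∂P :=
  ((hiid.ident z).comp hF).integral_eq

/-- The weights as functions of the jump vector at a single site. -/
def jumpWeight (v : JumpVector M) (j : ℤ) : ℝ :=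
  if h : j ∈ Finset.Icc (-(M : ℤ)) (M : ℤ) then v ⟨j, h⟩ else 0

lemma weight_eq_jumpWeight (ω : Env M) (x τ j : ℤ) :
    weight ω x τ j = jumpWeight (ω (x, τ)) j := rfl

@[fun_prop]
lemma measurable_jumpWeight (j : ℤ) : Measurable (fun v : JumpVector M => jumpWeight v j) := by
  unfold jumpWeight
  split_ifs with h
  · exact (measurable_pi_apply _).comp measurable_subtype_coe
  · exact measurable_const

lemma IsIID.integral_weight {P : Measure (Env M)} (hiid : IsIID P) (x τ j : ℤ) :
    ∫ ω, weight ω x τ j ∂P = avgProb P j := by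
  simp only [weight_eq_jumpWeight, avgProb]
  exact hiid.integral_comp (measurable_jumpWeight j) (x, τ)

lemma isSpanOneLaw_avgProb {P : Measure (Env M)} [IsProbabilityMeasure P] (hspan : SpanOne P) :
    IsSpanOneLaw M (avgProb P) where
  nonneg j := integral_nonneg fun ω => weight_nonneg ω 0 0 j
  eq_zero j hj := by simp only [avgProb, weight_eq_zero _ _ _ hj, integral_zero]
  sum_eq := by
    simp only [avgProb]
    rw [← integral_finsetSum _ fun j _ =>
      (bddMeasurable_weight (S := univ) (mem_univ _) j).integrable P]
    simp [weight_sum]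
  span := hspan

/-- Sums over sites at a common level of past-measurable coefficients times independent centred
site variables: first moment. -/
lemma integral_mul_siteSum {P : Measure (Env M)} [IsProbabilityMeasure P] (hiid : IsIID P)
    {l : ℤ} {S : Set (ℤ × ℤ)} (hS : ∀ x, (x, l) ∉ S)
    {W : Finset ℤ} {c : ℤ → Env M → 𝕜} {Z : JumpVector M → 𝕜}
    (hc : ∀ x, BddMeasurable S (c x)) (hZ : Measurable Z)
    (hZb : ∃ C, ∀ v, ‖Z v‖ ≤ C) (hZ0 : ∫ ω, Z (ω (0, 0)) ∂P = 0) {Ψ : Env M → 𝕜}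
    (hΨ : BddMeasurable S Ψ) :
    ∫ ω, Ψ ω * ∑ x ∈ W, c x ω * Z (ω (x, l)) ∂P = 0 := by
  obtain ⟨C, hC⟩ := hZb
  have hZx : ∀ x, BddMeasurable {(x, l)} (fun ω : Env M => Z (ω (x, l))) := fun x =>
    ⟨hZ.comp (measurable_apply_sig (mem_singleton _)), C, fun ω => hC _⟩
  have hZx' : ∀ x, BddMeasurable univ (fun ω : Env M => Z (ω (x, l))) := fun x =>
    (hZx x).mono (subset_univ _)
  have hcu := fun x => (hc x).mono (subset_univ S)
  have hΨu := hΨ.mono (subset_univ S)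
  simp only [Finset.mul_sum, ← mul_assoc]
  rw [integral_finsetSum _ fun x _ => ((hΨu.mul (hcu x)).mul (hZx' x)).integrable P]
  refine Finset.sum_eq_zero fun x _ => ?_
  rw [(hΨ.mul (hc x)).integral_mul hiid (disjoint_singleton_right.2 (hS x)) (hZx x),
    hiid.integral_comp hZ, hZ0, mul_zero]

/-- Sums over sites at a common level of past-measurable coefficients times independent centred
site variables: second moment. -/
lemma integral_mul_siteSum_sq {P : Measure (Env M)} [IsProbabilityMeasure P] (hiid : IsIID P)
    {l : ℤ} {S : Set (ℤ × ℤ)} (hS : ∀ x, (x, l) ∉ S)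
    {W : Finset ℤ} {c : ℤ → Env M → 𝕜} {Z : JumpVector M → 𝕜}
    (hc : ∀ x, BddMeasurable S (c x)) (hZ : Measurable Z)
    (hZb : ∃ C, ∀ v, ‖Z v‖ ≤ C) (hZ0 : ∫ ω, Z (ω (0, 0)) ∂P = 0) {Ψ : Env M → 𝕜}
    (hΨ : BddMeasurable S Ψ) :
    ∫ ω, Ψ ω * ((‖∑ x ∈ W, c x ω * Z (ω (x, l))‖ ^ 2 : ℝ) : 𝕜) ∂P =
      (∫ ω, Ψ ω * ((∑ x ∈ W, ‖c x ω‖ ^ 2 : ℝ) : 𝕜) ∂P) *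
        ((∫ ω, ‖Z (ω (0, 0))‖ ^ 2 ∂P : ℝ) : 𝕜) := by
  have hZb' := hZb
  obtain ⟨C, hC⟩ := hZb
  have hZx : ∀ x, BddMeasurable {(x, l)} (fun ω : Env M => Z (ω (x, l))) := fun x =>
    ⟨hZ.comp (measurable_apply_sig (mem_singleton _)), C, fun ω => hC _⟩
  have hZx' : ∀ x, BddMeasurable univ (fun ω : Env M => Z (ω (x, l))) := fun x =>
    (hZx x).mono (subset_univ _)
  have hcu := fun x => (hc x).mono (subset_univ S)
  have hΨu := hΨ.mono (subset_univ S)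
  have hexp : ∀ ω : Env M, Ψ ω * ((‖∑ x ∈ W, c x ω * Z (ω (x, l))‖ ^ 2 : ℝ) : 𝕜) =
      ∑ x ∈ W, ∑ y ∈ W, (Ψ ω * (c x ω * (starRingEnd 𝕜) (c y ω))) *
        (Z (ω (x, l)) * (starRingEnd 𝕜) (Z (ω (y, l)))) := by
    intro ω
    push_cast
    rw [← RCLike.mul_conj, map_sum, Finset.sum_mul_sum, Finset.mul_sum]
    refine Finset.sum_congr rfl fun x _ => ?_
    rw [Finset.mul_sum]
    refine Finset.sum_congr rfl fun y _ => ?_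
    rw [map_mul]
    ring
  simp only [hexp]
  have hint : ∀ x y, Integrable (fun ω => (Ψ ω * (c x ω * (starRingEnd 𝕜) (c y ω))) *
        (Z (ω (x, l)) * (starRingEnd 𝕜) (Z (ω (y, l))))) P := fun x y =>
    ((hΨu.mul ((hcu x).mul (hcu y).conj)).mul ((hZx' x).mul (hZx' y).conj)).integrable P
  rw [integral_finsetSum _ fun x _ => integrable_finsetSum _ fun y _ => hint x y]
  push_cast
  simp only [Finset.mul_sum]
  rw [integral_finsetSum _ fun x _ => (hΨu.mul (((hcu x).norm.ofReal).pow 2)).integrable P,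
    Finset.sum_mul]
  refine Finset.sum_congr rfl fun x hx => ?_
  -- Off the diagonal the site variable at `(y, l)` is independent of all the other factors and
  -- centred, so only `y = x` survives.
  rw [integral_finsetSum _ fun y _ => hint x y, Finset.sum_eq_single_of_mem x hx]
  · have hd : Disjoint S {(x, l)} := disjoint_singleton_right.2 (hS x)
    rw [(hΨ.mul ((hc x).mul (hc x).conj)).integral_mul hiid hd ((hZx x).mul (hZx x).conj)]
    simp only [RCLike.mul_conj]
    congr 1
    rw [hiid.integral_comp (F := fun v => (‖Z v‖ : 𝕜) ^ 2)
      ((RCLike.measurable_ofReal.comp hZ.norm).pow_const 2) (x, l), ← integral_ofReal]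
    push_cast
    rfl
  · intro y _ hyx
    have hd : Disjoint (S ∪ {(x, l)}) {(y, l)} := by
      rw [disjoint_singleton_right]
      rintro (h | h)
      · exact hS y h
      · simp only [mem_singleton_iff, Prod.mk.injEq] at h
        exact hyx h.1
    have h1 := ((hΨ.mul ((hc x).mul (hc y).conj)).mono (subset_union_left (t := {(x, l)}))).mul
      ((hZx x).mono subset_union_right)
    have h2 := h1.integral_mul hiid hd (hZx y).conj
    simp only [mul_assoc] at h2 ⊢
    rw [h2, integral_conj, hiid.integral_comp hZ, hZ0, map_zero, mul_zero]

end independence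


/-! ### Two walks in a common environment -/

section pair

variable {M : ℕ}

/-- The potential kernel applied to the difference of two walks after one step from `x` and `y` at
the common level `l`. -/
def pairKer (P : Measure (Env M)) (ω : Env M) (l x y : ℤ) : ℝ :=
  ∑ i ∈ Finset.Icc (-(M : ℤ)) M, ∑ j ∈ Finset.Icc (-(M : ℤ)) M,
    weight ω x l i * weight ω y l j * potKer M (avgProb P) (x + i - (y + j))

/-- The centred version of `pairKer`. -/
def pairNoise (P : Measure (Env M)) (ω : Env M) (l x y : ℤ) : ℝ :=
  pairKer P ω l x y - (potKer M (avgProb P) (x - y) + if x = y then beta P else 0)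

/-- The joint quenched expectation of a function of two independent walks. -/
def pairExp (ω : Env M) (i τ : ℤ) (s : ℕ) (i' τ' : ℤ) (s' : ℕ) (F : ℤ → ℤ → ℝ) : ℝ :=
  walkExp ω i τ s fun x => walkExp ω i' τ' s' fun y => F x y

/-- The quenched probability that two independent walks occupy the same site. -/
def overlap (ω : Env M) (i τ : ℤ) (s : ℕ) (i' τ' : ℤ) (s' : ℕ) : ℝ :=
  pairExp ω i τ s i' τ' s' fun x y => if x = y then 1 else 0

variable {P : Measure (Env M)}

lemma pairExp_eq_sum (ω : Env M) (i τ : ℤ) (s : ℕ) (i' τ' : ℤ) (s' : ℕ) (F : ℤ → ℤ → ℝ)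
    {W W' : Finset ℤ} (h : window M i s ⊆ W) (h' : window M i' s' ⊆ W') :
    pairExp ω i τ s i' τ' s' F =
      ∑ x ∈ W, ∑ y ∈ W', mass ω i τ s x * mass ω i' τ' s' y * F x y := by
  rw [pairExp, walkExp_eq_sum_of_subset _ _ _ _ _ h]
  refine Finset.sum_congr rfl fun x _ => ?_
  rw [walkExp_eq_sum_of_subset _ _ _ _ _ h', Finset.smul_sum]
  exact Finset.sum_congr rfl fun y _ => by simp only [smul_eq_mul, mul_assoc]

lemma pairExp_add (ω : Env M) (i τ : ℤ) (s : ℕ) (i' τ' : ℤ) (s' : ℕ) (F G : ℤ → ℤ → ℝ) :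
    pairExp ω i τ s i' τ' s' (fun x y => F x y + G x y) =
      pairExp ω i τ s i' τ' s' F + pairExp ω i τ s i' τ' s' G := by
  simp only [pairExp, walkExp_add]

lemma pairExp_const_mul (ω : Env M) (i τ : ℤ) (s : ℕ) (i' τ' : ℤ) (s' : ℕ) (F : ℤ → ℤ → ℝ)
    (b : ℝ) : pairExp ω i τ s i' τ' s' (fun x y => b * F x y) =
      b * pairExp ω i τ s i' τ' s' F := by
  rw [pairExp_eq_sum _ _ _ _ _ _ _ _ subset_rfl subset_rfl,
    pairExp_eq_sum _ _ _ _ _ _ _ _ subset_rfl subset_rfl, Finset.mul_sum]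
  refine Finset.sum_congr rfl fun x _ => ?_
  rw [Finset.mul_sum]
  exact Finset.sum_congr rfl fun y _ => by ring

lemma pairExp_mono (ω : Env M) (i τ : ℤ) (s : ℕ) (i' τ' : ℤ) (s' : ℕ) {F G : ℤ → ℤ → ℝ}
    (h : ∀ x y, F x y ≤ G x y) :
    pairExp ω i τ s i' τ' s' F ≤ pairExp ω i τ s i' τ' s' G := by
  rw [pairExp_eq_sum _ _ _ _ _ _ _ _ subset_rfl subset_rfl,
    pairExp_eq_sum _ _ _ _ _ _ _ _ subset_rfl subset_rfl]
  exact Finset.sum_le_sum fun x _ => Finset.sum_le_sum fun y _ =>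
    mul_le_mul_of_nonneg_left (h x y) (mul_nonneg (mass_nonneg _ _ _ _ _) (mass_nonneg _ _ _ _ _))

lemma bddMeasurable_pairExp {S : Set (ℤ × ℤ)} (i τ : ℤ) (s : ℕ) (i' τ' : ℤ) (s' : ℕ)
    {F : Env M → ℤ → ℤ → ℝ} (hS : {z : ℤ × ℤ | τ - s < z.2} ⊆ S)
    (hS' : {z : ℤ × ℤ | τ' - s' < z.2} ⊆ S) (hF : ∀ x y, BddMeasurable S (fun ω => F ω x y)) :
    BddMeasurable S (fun ω : Env M => pairExp ω i τ s i' τ' s' (F ω)) := by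
  simp only [pairExp_eq_sum _ _ _ _ _ _ _ _ subset_rfl subset_rfl]
  exact BddMeasurable.sum _ fun x _ => BddMeasurable.sum _ fun y _ =>
    ((bddMeasurable_mass _ _ _ _ hS).mul (bddMeasurable_mass _ _ _ _ hS')).mul (hF x y)

lemma bddMeasurable_overlap {S : Set (ℤ × ℤ)} (i τ : ℤ) (s : ℕ) (i' τ' : ℤ) (s' : ℕ)
    (hS : {z : ℤ × ℤ | τ - s < z.2} ⊆ S) (hS' : {z : ℤ × ℤ | τ' - s' < z.2} ⊆ S) :
    BddMeasurable S (fun ω : Env M => overlap ω i τ s i' τ' s') :=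
  bddMeasurable_pairExp i τ s i' τ' s' hS hS' fun _ _ => BddMeasurable.const _

lemma overlap_eq_sum (ω : Env M) (i τ : ℤ) (s : ℕ) (i' τ' : ℤ) (s' : ℕ) {W : Finset ℤ}
    (h : window M i s ⊆ W) (h' : window M i' s' ⊆ W) :
    overlap ω i τ s i' τ' s' = ∑ x ∈ W, mass ω i τ s x * mass ω i' τ' s' x := by
  rw [overlap, pairExp_eq_sum _ _ _ _ _ _ _ _ h h']
  refine Finset.sum_congr rfl fun x hx => ?_
  simp [hx]

lemma overlap_nonneg (ω : Env M) (i τ : ℤ) (s : ℕ) (i' τ' : ℤ) (s' : ℕ) :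
    0 ≤ overlap ω i τ s i' τ' s' := by
  rw [overlap_eq_sum ω i τ s i' τ' s' Finset.subset_union_left Finset.subset_union_right]
  exact Finset.sum_nonneg fun x _ => mul_nonneg (mass_nonneg _ _ _ _ _) (mass_nonneg _ _ _ _ _)

lemma pairExp_succ (ω : Env M) (i τ : ℤ) (s : ℕ) (i' τ' : ℤ) (s' : ℕ)
    (h : τ - s = τ' - s') :
    pairExp ω i τ (s + 1) i' τ' (s' + 1) (fun x y => potKer M (avgProb P) (x - y)) =
      pairExp ω i τ s i' τ' s' fun x y => pairKer P ω (τ' - s') x y := by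
  simp only [pairExp]
  rw [walkExp_succ]
  congr 1
  funext x
  simp only [walkExp_succ]
  simp only [walkExp, smul_eq_mul, Finset.mul_sum, pairKer]
  rw [Finset.sum_comm]
  refine Finset.sum_congr rfl fun y _ => Finset.sum_congr rfl fun k _ =>
    Finset.sum_congr rfl fun j _ => ?_
  rw [h]
  ring

/-- The martingale increment of the potential kernel of the difference of two walks. -/
def pairIncr (P : Measure (Env M)) (ω : Env M) (i τ : ℤ) (s : ℕ) (i' τ' : ℤ) (s' : ℕ) : ℝ :=
  pairExp ω i τ s i' τ' s' fun x y => pairNoise P ω (τ' - s') x y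

/-- The Doob decomposition along which the overlap is measured: given the higher levels, the mean
increment of the potential kernel of the difference is `β` when the walks meet and `0` otherwise.
The hypothesis `h` says that the walks are at a common level. -/
lemma pairExp_succ_eq (ω : Env M) (i τ : ℤ) (s : ℕ) (i' τ' : ℤ) (s' : ℕ)
    (h : τ - s = τ' - s') :
    pairExp ω i τ (s + 1) i' τ' (s' + 1) (fun x y => potKer M (avgProb P) (x - y)) =
      pairExp ω i τ s i' τ' s' (fun x y => potKer M (avgProb P) (x - y)) +
        beta P * overlap ω i τ s i' τ' s' + pairIncr P ω i τ s i' τ' s' := by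
  rw [pairExp_succ ω i τ s i' τ' s' h, overlap, ← pairExp_const_mul, ← pairExp_add, pairIncr,
    ← pairExp_add]
  congr 1
  funext x y
  simp only [pairNoise, mul_ite, mul_one, mul_zero]
  ring

lemma bddMeasurable_pairNoise {S : Set (ℤ × ℤ)} {l x y : ℤ} (hx : (x, l) ∈ S) (hy : (y, l) ∈ S) :
    BddMeasurable S (fun ω : Env M => pairNoise P ω l x y) :=
  (BddMeasurable.sum _ fun i _ => BddMeasurable.sum _ fun j _ =>
    ((bddMeasurable_weight hx i).mul (bddMeasurable_weight hy j)).mul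
      (BddMeasurable.const _)).sub (BddMeasurable.const _)

/-- The `- 1` adds the level `τ' - s'`, which the noise reads although the two position laws do not.
-/
lemma bddMeasurable_pairIncr (i τ : ℤ) (s : ℕ) (i' τ' : ℤ) (s' : ℕ) (h : τ - s = τ' - s')
    {S : Set (ℤ × ℤ)} (hS : {z : ℤ × ℤ | τ' - s' - 1 < z.2} ⊆ S) :
    BddMeasurable S (fun ω : Env M => pairIncr P ω i τ s i' τ' s') := by
  refine bddMeasurable_pairExp _ _ _ _ _ _ (subset_trans ?_ hS) (subset_trans ?_ hS)
    fun x y => bddMeasurable_pairNoise (hS ?_) (hS ?_)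
  · intro z hz; simp only [mem_ofPred_eq] at hz ⊢; omega
  · intro z hz; simp only [mem_ofPred_eq] at hz ⊢; omega
  · simp
  · simp

variable [IsProbabilityMeasure P]

/-- `β` is the mean potential kernel of the difference after one step of two walks from one site.
Indeed `1 - λ(t)` is `1 - cos t` times the mean of `∑ u(i) u(j) fejer (i - j) t`, and the same
factor `1 - cos t` cancels from the denominator. -/
lemma beta_eq (hspan : SpanOne P) :
    beta P = ∫ ω, ∑ i ∈ Finset.Icc (-(M : ℤ)) M, ∑ j ∈ Finset.Icc (-(M : ℤ)) M,
      weight ω 0 0 i * weight ω 0 0 j * potKer M (avgProb P) (i - j) ∂P := by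
  have hp := isSpanOneLaw_avgProb hspan
  have hw : ∀ j, BddMeasurable univ (fun ω : Env M => weight ω 0 0 j) := fun j =>
    bddMeasurable_weight (mem_univ _) j
  rw [integral_finsetSum _ fun i _ => integrable_finsetSum _ fun j _ =>
    (((hw i).mul (hw j)).mul (BddMeasurable.const _)).integrable P]
  have h1 : ∀ i ∈ Finset.Icc (-(M : ℤ)) M, ∫ ω, ∑ j ∈ Finset.Icc (-(M : ℤ)) M,
      weight ω 0 0 i * weight ω 0 0 j * potKer M (avgProb P) (i - j) ∂P =
      ∑ j ∈ Finset.Icc (-(M : ℤ)) M,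
        (∫ ω, weight ω 0 0 i * weight ω 0 0 j ∂P) * potKer M (avgProb P) (i - j) := by
    intro i _
    rw [integral_finsetSum _ fun j _ =>
      (((hw i).mul (hw j)).mul (BddMeasurable.const _)).integrable P]
    exact Finset.sum_congr rfl fun j _ => integral_mul_const _ _
  rw [Finset.sum_congr rfl h1, sum_sum_mul_potKer hp
    (fun i j => ∫ ω, weight ω 0 0 i * weight ω 0 0 j ∂P) (fun i j => i - j), beta]
  congr 1
  refine intervalIntegral.integral_congr_ae ?_
  filter_upwards [ae_cos_ne_one] with t hc ht
  have hR : ratioFun M (avgProb P) t ≠ 0 := by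
    rw [uIoc_of_le (by linarith [Real.pi_pos])] at ht
    exact (ratioFun_pos hp (Ioc_subset_Icc_self ht)).ne'
  have h2 : 1 - ‖avgCharFun P t‖ ^ 2 = (1 - Real.cos t) * ratioFun M (avgProb P) t := by
    rw [one_sub_cos_mul_ratioFun, ← one_sub_re_mul_conj hp.sum_eq hp.sum_eq]
    congr 1
    rw [Complex.mul_conj, Complex.ofReal_re, Complex.normSq_eq_norm_sq]
    rfl
  have h3 : ∀ ω : Env M, ‖quenchedCharFun ω t‖ ^ 2 = 1 - ∑ i ∈ Finset.Icc (-(M : ℤ)) M,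
      ∑ j ∈ Finset.Icc (-(M : ℤ)) M,
        weight ω 0 0 i * weight ω 0 0 j * (1 - Real.cos ((i - j : ℤ) * t)) := by
    intro ω
    rw [← one_sub_re_mul_conj (weight_sum ω 0 0) (weight_sum ω 0 0), Complex.mul_conj,
      Complex.ofReal_re, Complex.normSq_eq_norm_sq]
    simp [quenchedCharFun]
  rw [h2]
  have h4 : 1 - ∫ ω, ‖quenchedCharFun ω t‖ ^ 2 ∂P = (1 - Real.cos t) *
      ∑ i ∈ Finset.Icc (-(M : ℤ)) M, ∑ j ∈ Finset.Icc (-(M : ℤ)) M,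
        (∫ ω, weight ω 0 0 i * weight ω 0 0 j ∂P) * fejer (i - j) t := by
    simp only [h3]
    rw [integral_sub (integrable_const _) (integrable_finsetSum _ fun i _ =>
      integrable_finsetSum _ fun j _ =>
        (((hw i).mul (hw j)).mul (BddMeasurable.const _)).integrable P)]
    simp only [integral_const, probReal_univ, one_smul, sub_sub_cancel]
    rw [integral_finsetSum _ fun i _ => integrable_finsetSum _ fun j _ =>
      (((hw i).mul (hw j)).mul (BddMeasurable.const _)).integrable P, Finset.mul_sum]
    refine Finset.sum_congr rfl fun i _ => ?_
    rw [integral_finsetSum _ fun j _ =>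
      (((hw i).mul (hw j)).mul (BddMeasurable.const _)).integrable P, Finset.mul_sum]
    refine Finset.sum_congr rfl fun j _ => ?_
    rw [integral_mul_const, ← one_sub_cos_mul_fejer]
    ring
  rw [h4, mul_div_mul_left _ _ (hc ht)]

/-- The integrand is nonnegative, and since the potential kernel is positive off `0` it vanishes
only if no two distinct jumps have positive weight. Then one weight equals `1`, which is excluded on
the ellipticity event. -/
lemma beta_pos (hell : Elliptic P) (hspan : SpanOne P) : 0 < beta P := by
  have hp := isSpanOneLaw_avgProb hspan
  have hw : ∀ j, BddMeasurable univ (fun ω : Env M => weight ω 0 0 j) := fun j =>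
    bddMeasurable_weight (mem_univ _) j
  rw [beta_eq hspan]
  have hnn : ∀ ω : Env M, ∀ i j, 0 ≤ weight ω 0 0 i * weight ω 0 0 j *
      potKer M (avgProb P) (i - j) := fun ω i j =>
    mul_nonneg (mul_nonneg (weight_nonneg _ _ _ _) (weight_nonneg _ _ _ _)) (potKer_nonneg hp _)
  rw [integral_pos_iff_support_of_nonneg
    (fun ω => Finset.sum_nonneg fun i _ => Finset.sum_nonneg fun j _ => hnn ω i j)
    (integrable_finsetSum _ fun i _ => integrable_finsetSum _ fun j _ =>
      (((hw i).mul (hw j)).mul (BddMeasurable.const _)).integrable P)]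
  refine lt_of_lt_of_le hell (measure_mono fun ω hω => ?_)
  simp only [mem_ofPred_eq] at hω
  simp only [Function.mem_support]
  intro h0
  have hz : ∀ i ∈ Finset.Icc (-(M : ℤ)) M, ∀ j ∈ Finset.Icc (-(M : ℤ)) M, i ≠ j →
      weight ω 0 0 i * weight ω 0 0 j = 0 := by
    intro i hi j hj hij
    have h1 := (Finset.sum_eq_zero_iff_of_nonneg
      (fun i _ => Finset.sum_nonneg fun j _ => hnn ω i j)).1 h0 i hi
    have h2 := (Finset.sum_eq_zero_iff_of_nonneg (fun j _ => hnn ω i j)).1 h1 j hj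
    exact (mul_eq_zero.1 h2).resolve_right (potKer_pos hp (sub_ne_zero.2 hij)).ne'
  have hex : ∃ i ∈ Finset.Icc (-(M : ℤ)) M, weight ω 0 0 i ≠ 0 := by
    by_contra! h
    have := weight_sum ω 0 0
    rw [Finset.sum_eq_zero h] at this
    exact zero_ne_one this
  obtain ⟨i, hi, hi0⟩ := hex
  have h1 := weight_sum ω 0 0
  rw [Finset.sum_eq_single_of_mem i hi fun j hj hji =>
    (mul_eq_zero.1 (hz i hi j hj hji.symm)).resolve_left hi0] at h1
  exact absurd h1 (hω i).ne

/-- On one site this is `beta_eq`. On two different sites the weights are independent and average to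
`p(0,i) p(0,j)`, and the potential kernel is harmonic at `x - y ≠ 0`. -/
lemma integral_pairNoise (hiid : IsIID P) (hspan : SpanOne P) (l x y : ℤ) :
    ∫ ω, pairNoise P ω l x y ∂P = 0 := by
  have hp := isSpanOneLaw_avgProb hspan
  have hw : ∀ x j, BddMeasurable univ (fun ω : Env M => weight ω x l j) := fun x j =>
    bddMeasurable_weight (mem_univ _) j
  have hK : Integrable (fun ω => pairKer P ω l x y) P :=
    (BddMeasurable.sum (S := univ) _ fun i _ => BddMeasurable.sum _ fun j _ =>
    ((hw x i).mul (hw y j)).mul (BddMeasurable.const _)).integrable P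
  simp only [pairNoise]
  rw [integral_sub hK (integrable_const _), integral_const, probReal_univ, one_smul, sub_eq_zero]
  by_cases hxy : x = y
  · subst hxy
    simp only [pairKer, sub_self, potKer_zero, zero_add, if_true, beta_eq hspan]
    have h := hiid.integral_comp (F := fun v : JumpVector M => ∑ i ∈ Finset.Icc (-(M : ℤ)) M,
      ∑ j ∈ Finset.Icc (-(M : ℤ)) M,
        jumpWeight v i * jumpWeight v j * potKer M (avgProb P) (i - j)) (by fun_prop) (x, l)
    simp only [← weight_eq_jumpWeight] at h
    rw [← h]
    simp only [add_sub_add_left_eq_sub]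
  · simp only [hxy, if_false, add_zero]
    have h1 := sum_sum_potKer_shift hp (x - y)
    rw [if_neg (sub_ne_zero.2 hxy), add_zero] at h1
    rw [← h1]
    simp only [pairKer]
    rw [integral_finsetSum _ fun i _ => integrable_finsetSum _ fun j _ =>
      (((hw x i).mul (hw y j)).mul (BddMeasurable.const _)).integrable P]
    refine Finset.sum_congr rfl fun i _ => ?_
    rw [integral_finsetSum _ fun j _ =>
      (((hw x i).mul (hw y j)).mul (BddMeasurable.const _)).integrable P]
    refine Finset.sum_congr rfl fun j _ => ?_
    rw [integral_mul_const, (bddMeasurable_weight (mem_singleton (x, l)) i).integral_mul hiid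
      (by simpa using hxy) (bddMeasurable_weight (mem_singleton (y, l)) j),
      hiid.integral_weight, hiid.integral_weight]
    congr 2
    ring

lemma exists_abs_pairNoise_le (hell : Elliptic P) (hspan : SpanOne P) :
    ∃ C : ℝ, 0 ≤ C ∧ ∀ (ω : Env M) (l x y : ℤ), |pairNoise P ω l x y| ≤ C := by
  have hp := isSpanOneLaw_avgProb hspan
  obtain ⟨C, hC, h⟩ := exists_abs_potKer_sub_potKer_le hp
  have hβ := (beta_pos hell hspan).le
  refine ⟨C * (1 + 2 * M) + beta P, by positivity, fun ω l x y => ?_⟩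
  have h1 : pairKer P ω l x y - potKer M (avgProb P) (x - y) =
      ∑ i ∈ Finset.Icc (-(M : ℤ)) M, ∑ j ∈ Finset.Icc (-(M : ℤ)) M,
        weight ω x l i * weight ω y l j *
          (potKer M (avgProb P) (x + i - (y + j)) - potKer M (avgProb P) (x - y)) := by
    simp only [mul_sub, Finset.sum_sub_distrib, ← Finset.sum_mul, pairKer]
    rw [← Finset.sum_mul_sum, weight_sum, weight_sum, one_mul, one_mul]
  have h2 : |pairKer P ω l x y - potKer M (avgProb P) (x - y)| ≤ C * (1 + 2 * M) := by
    rw [h1]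
    calc _ ≤ ∑ i ∈ Finset.Icc (-(M : ℤ)) M, ∑ j ∈ Finset.Icc (-(M : ℤ)) M,
          weight ω x l i * weight ω y l j * (C * (1 + 2 * M)) := by
          refine (Finset.abs_sum_le_sum_abs _ _).trans (Finset.sum_le_sum fun i hi => ?_)
          refine (Finset.abs_sum_le_sum_abs _ _).trans (Finset.sum_le_sum fun j hj => ?_)
          have hnn := mul_nonneg (weight_nonneg ω x l i) (weight_nonneg ω y l j)
          rw [abs_mul, abs_of_nonneg hnn]
          refine mul_le_mul_of_nonneg_left ((h _ _).trans ?_) hnn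
          refine mul_le_mul_of_nonneg_left ?_ hC
          have : |x + i - (y + j) - (x - y)| ≤ 2 * (M : ℤ) := by
            rw [Finset.mem_Icc] at hi hj
            rw [abs_le]; constructor <;> linarith [hi.1, hi.2, hj.1, hj.2]
          have : |((x + i - (y + j) - (x - y) : ℤ) : ℝ)| ≤ 2 * (M : ℝ) := by exact_mod_cast this
          linarith
      _ = C * (1 + 2 * M) := by
          simp only [← Finset.sum_mul]
          rw [← Finset.sum_mul_sum, weight_sum, weight_sum]; ring
  unfold pairNoise
  rw [abs_le] at h2 ⊢
  split_ifs <;> constructor <;> linarith [h2.1, h2.2]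

/-- The noise lives on level `τ' - s'` alone and is centred; `Ψ` and both position laws read only
the levels above it. -/
lemma integral_mul_pairIncr (hiid : IsIID P) (hspan : SpanOne P) (i τ : ℤ) (s : ℕ)
    (i' τ' : ℤ) (s' : ℕ) (h : τ - s = τ' - s') {Ψ : Env M → ℝ}
    (hΨ : BddMeasurable {z : ℤ × ℤ | τ' - s' < z.2} Ψ) :
    ∫ ω, Ψ ω * pairIncr P ω i τ s i' τ' s' ∂P = 0 := by
  set S : Set (ℤ × ℤ) := {z : ℤ × ℤ | τ' - s' < z.2} with hSdef
  have hm : ∀ x, BddMeasurable S (fun ω : Env M => mass ω i τ s x) := fun x =>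
    bddMeasurable_mass _ _ _ _ (by rw [h])
  have hm' : ∀ x, BddMeasurable S (fun ω : Env M => mass ω i' τ' s' x) := fun x =>
    bddMeasurable_mass _ _ _ _ le_rfl
  have hN : ∀ x y, BddMeasurable {(x, τ' - (s' : ℤ)), (y, τ' - (s' : ℤ))}
      (fun ω : Env M => pairNoise P ω (τ' - s') x y) := fun x y =>
    bddMeasurable_pairNoise (by simp) (by simp)
  have hd : ∀ x y, Disjoint S {(x, τ' - (s' : ℤ)), (y, τ' - (s' : ℤ))} := by
    intro x y
    rw [disjoint_insert_right, disjoint_singleton_right]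
    simp [hSdef]
  simp only [pairIncr, pairExp_eq_sum _ _ _ _ _ _ _ _ subset_rfl subset_rfl, Finset.mul_sum,
    ← mul_assoc]
  have hi : ∀ x y, Integrable (fun ω => Ψ ω * mass ω i τ s x * mass ω i' τ' s' y *
      pairNoise P ω (τ' - s') x y) P := fun x y =>
    ((((hΨ.mul (hm x)).mul (hm' y)).mono (subset_univ _)).mul
      ((hN x y).mono (subset_univ _))).integrable P
  rw [integral_finsetSum _ fun x _ => integrable_finsetSum _ fun y _ => hi x y]
  refine Finset.sum_eq_zero fun x _ => ?_
  rw [integral_finsetSum _ fun y _ => hi x y]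
  refine Finset.sum_eq_zero fun y _ => ?_
  rw [((hΨ.mul (hm x)).mul (hm' y)).integral_mul hiid (hd x y) (hN x y),
    integral_pairNoise hiid hspan, mul_zero]

/-- Noises attached to two pairs of sites are uncorrelated unless the pairs share a site. The second
moment is thus at most `C²` times the expected number of coincidences between two independent copies
of the pair of positions, which overlaps control. This bounds the martingale by the very quantity
under study. -/
lemma exists_integral_pairIncr_sq_le (hiid : IsIID P) (hell : Elliptic P) (hspan : SpanOne P) :
    ∃ C : ℝ, 0 ≤ C ∧ ∀ (i τ : ℤ) (s : ℕ) (i' τ' : ℤ) (s' : ℕ), τ - s = τ' - s' →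
      ∫ ω, pairIncr P ω i τ s i' τ' s' ^ 2 ∂P ≤
        C * ∫ ω, (overlap ω i τ s i τ s + overlap ω i' τ' s' i' τ' s') ∂P := by
  obtain ⟨C, hC, hb⟩ := exists_abs_pairNoise_le hell hspan
  refine ⟨2 * C ^ 2, by positivity, fun i τ s i' τ' s' h => ?_⟩
  set S : Set (ℤ × ℤ) := {z : ℤ × ℤ | τ' - s' < z.2} with hSdef
  set W := window M i s ∪ window M i' s' with hW
  set l := τ' - (s' : ℤ) with hl
  have hm : ∀ x, BddMeasurable S (fun ω : Env M => mass ω i τ s x) := fun x =>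
    bddMeasurable_mass _ _ _ _ (by rw [h])
  have hm' : ∀ x, BddMeasurable S (fun ω : Env M => mass ω i' τ' s' x) := fun x =>
    bddMeasurable_mass _ _ _ _ le_rfl
  have hN : ∀ x y, BddMeasurable {(x, l), (y, l)}
      (fun ω : Env M => pairNoise P ω l x y) := fun x y =>
    bddMeasurable_pairNoise (by simp) (by simp)
  set m : ℤ × ℤ → Env M → ℝ := fun q ω => mass ω i τ s q.1 * mass ω i' τ' s' q.2 with hmdef
  have hmq : ∀ q, BddMeasurable S (m q) := fun q => (hm q.1).mul (hm' q.2)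
  have hm0 : ∀ q ω, 0 ≤ m q ω := fun q ω => mul_nonneg (mass_nonneg _ _ _ _ _)
    (mass_nonneg _ _ _ _ _)
  -- The number of coincidences between the sites of `q` and those of `r`, at least `1` as soon as
  -- they share one.
  set ind : ℤ × ℤ → ℤ × ℤ → ℝ := fun q r =>
    (if r.1 = q.1 then 1 else 0) + (if r.1 = q.2 then 1 else 0) + (if r.2 = q.1 then 1 else 0) +
      (if r.2 = q.2 then 1 else 0) with hind
  have hind0 : ∀ q r, 0 ≤ ind q r := by
    intro q r
    simp only [hind]
    positivity
  -- covariance bound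
  have hcov : ∀ q r : ℤ × ℤ, ∫ ω, pairNoise P ω l q.1 q.2 * pairNoise P ω l r.1 r.2 ∂P ≤
      C ^ 2 * ind q r := by
    intro q r
    by_cases hsh : r.1 = q.1 ∨ r.1 = q.2 ∨ r.2 = q.1 ∨ r.2 = q.2
    · have h1 : (1 : ℝ) ≤ ind q r := by
        simp only [hind]
        rcases hsh with h | h | h | h <;> rw [if_pos h] <;>
          · have : ∀ p : Prop, ∀ [Decidable p], (0 : ℝ) ≤ if p then 1 else 0 := by
              intro p _; positivity
            linarith [this (r.1 = q.1), this (r.1 = q.2), this (r.2 = q.1), this (r.2 = q.2)]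
      have h2 : ∫ ω, pairNoise P ω l q.1 q.2 * pairNoise P ω l r.1 r.2 ∂P ≤ ∫ _, C ^ 2 ∂P := by
        refine integral_mono ((((hN q.1 q.2).mono (subset_univ _)).mul
          ((hN r.1 r.2).mono (subset_univ _))).integrable P) (integrable_const _) fun ω => ?_
        refine (le_abs_self _).trans ?_
        rw [abs_mul, sq]
        exact mul_le_mul (hb _ _ _ _) (hb _ _ _ _) (abs_nonneg _) hC
      simp only [integral_const, probReal_univ, one_smul] at h2
      nlinarith [sq_nonneg C]
    · push Not at hsh
      rw [(hN q.1 q.2).integral_mul hiid ?_ (hN r.1 r.2), integral_pairNoise hiid hspan, zero_mul]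
      · exact mul_nonneg (sq_nonneg _) (hind0 _ _)
      · rw [disjoint_insert_right, disjoint_singleton_right]
        simp only [mem_insert_iff, mem_singleton_iff, Prod.mk.injEq, and_true]
        tauto
  have hd : ∀ q r : ℤ × ℤ, Disjoint S ({(q.1, l), (q.2, l)} ∪ {(r.1, l), (r.2, l)}) := by
    intro q r
    simp [hSdef, disjoint_insert_right]
  have hmN : ∀ q, BddMeasurable univ (fun ω => m q ω * pairNoise P ω l q.1 q.2) := fun q =>
    ((hmq q).mono (subset_univ _)).mul ((hN q.1 q.2).mono (subset_univ _))
  -- expansion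
  have hexp : ∀ ω, pairIncr P ω i τ s i' τ' s' =
      ∑ q ∈ W ×ˢ W, m q ω * pairNoise P ω l q.1 q.2 := by
    intro ω
    rw [pairIncr, pairExp_eq_sum _ _ _ _ _ _ _ _ (W := W) (W' := W) Finset.subset_union_left
      Finset.subset_union_right, Finset.sum_product]
  have hsum : ∫ ω, pairIncr P ω i τ s i' τ' s' ^ 2 ∂P =
      ∑ q ∈ W ×ˢ W, ∑ r ∈ W ×ˢ W, (∫ ω, m q ω * m r ω ∂P) *
        ∫ ω, pairNoise P ω l q.1 q.2 * pairNoise P ω l r.1 r.2 ∂P := by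
    simp only [hexp, sq, Finset.sum_mul_sum]
    rw [integral_finsetSum _ fun q _ => integrable_finsetSum _ fun r _ =>
      ((hmN q).mul (hmN r)).integrable P]
    refine Finset.sum_congr rfl fun q _ => ?_
    rw [integral_finsetSum _ fun r _ => ((hmN q).mul (hmN r)).integrable P]
    refine Finset.sum_congr rfl fun r _ => ?_
    rw [← ((hmq q).mul (hmq r)).integral_mul hiid (hd q r)
      (((hN q.1 q.2).mono subset_union_left).mul ((hN r.1 r.2).mono subset_union_right))]
    congr 1
    funext ω
    ring
  rw [hsum]
  have hle : ∑ q ∈ W ×ˢ W, ∑ r ∈ W ×ˢ W, (∫ ω, m q ω * m r ω ∂P) *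
        ∫ ω, pairNoise P ω l q.1 q.2 * pairNoise P ω l r.1 r.2 ∂P ≤
      C ^ 2 * ∫ ω, ∑ q ∈ W ×ˢ W, ∑ r ∈ W ×ˢ W, m q ω * m r ω * ind q r ∂P := by
    have hi : ∀ q r, Integrable (fun ω => m q ω * m r ω * ind q r) P := fun q r =>
      (((hmq q).mul (hmq r)).mul (BddMeasurable.const _)).integrable P
    rw [integral_finsetSum _ fun q _ => integrable_finsetSum _ fun r _ => hi q r, Finset.mul_sum]
    refine Finset.sum_le_sum fun q _ => ?_
    rw [integral_finsetSum _ fun r _ => hi q r, Finset.mul_sum]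
    refine Finset.sum_le_sum fun r _ => ?_
    rw [integral_mul_const, mul_left_comm]
    exact mul_le_mul_of_nonneg_left (hcov q r)
      (integral_nonneg fun ω => mul_nonneg (hm0 q ω) (hm0 r ω))
  refine hle.trans ?_
  rw [mul_comm 2 (C ^ 2), mul_assoc]
  refine mul_le_mul_of_nonneg_left ?_ (sq_nonneg C)
  rw [← integral_const_mul]
  refine integral_mono (integrable_finsetSum _ fun q _ => integrable_finsetSum _ fun r _ =>
    (((hmq q).mul (hmq r)).mul (BddMeasurable.const _)).integrable P) ?_ fun ω => ?_
  · exact ((BddMeasurable.const 2).mul ((bddMeasurable_overlap (S := univ) _ _ _ _ _ _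
      (subset_univ _) (subset_univ _)).add (bddMeasurable_overlap _ _ _ _ _ _
      (subset_univ _) (subset_univ _)))).integrable P
  set c : ℤ → ℝ := fun x => mass ω i τ s x with hc
  set d : ℤ → ℝ := fun x => mass ω i' τ' s' x with hd'
  have hcW : ∀ x, x ∉ W → c x = 0 := fun x hx => mass_eq_zero _ _ _ _ fun h' =>
    hx (Finset.mem_union_left _ h')
  have hdW : ∀ x, x ∉ W → d x = 0 := fun x hx => mass_eq_zero _ _ _ _ fun h' =>
    hx (Finset.mem_union_right _ h')
  have hcs : ∑ x ∈ W, c x = 1 := by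
    rw [← mass_sum ω i τ s]
    exact (Finset.sum_subset Finset.subset_union_left fun x _ hx => mass_eq_zero _ _ _ _ hx).symm
  have hds : ∑ x ∈ W, d x = 1 := by
    rw [← mass_sum ω i' τ' s']
    exact (Finset.sum_subset Finset.subset_union_right fun x _ hx => mass_eq_zero _ _ _ _ hx).symm
  have hs1 : ∀ x, ∑ r ∈ W ×ˢ W, c r.1 * d r.2 * (if r.1 = x then 1 else 0) = c x := by
    intro x
    rw [Finset.sum_product]
    simp only [mul_ite, mul_one, mul_zero]
    by_cases hx : x ∈ W
    · rw [Finset.sum_eq_single_of_mem x hx fun y _ hy => by simp [hy]]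
      simp [← Finset.mul_sum, hds]
    · rw [hcW x hx]
      refine Finset.sum_eq_zero fun y hy => ?_
      have hyx : y ≠ x := fun h => hx (h ▸ hy)
      simp [hyx]
  have hs2 : ∀ x, ∑ r ∈ W ×ˢ W, c r.1 * d r.2 * (if r.2 = x then 1 else 0) = d x := by
    intro x
    rw [Finset.sum_product]
    simp only [mul_ite, mul_one, mul_zero]
    rw [Finset.sum_comm]
    by_cases hx : x ∈ W
    · rw [Finset.sum_eq_single_of_mem x hx fun y _ hy => by simp [hy]]
      simp [← Finset.sum_mul, hcs]
    · rw [hdW x hx]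
      refine Finset.sum_eq_zero fun y hy => ?_
      have hyx : y ≠ x := fun h => hx (h ▸ hy)
      simp [hyx]
  have hq : ∀ q ∈ W ×ˢ W, ∑ r ∈ W ×ˢ W, m q ω * m r ω * ind q r =
      c q.1 * d q.2 * (c q.1 + c q.2 + d q.1 + d q.2) := by
    intro q _
    simp only [mul_assoc, ← Finset.mul_sum, hmdef]
    congr 2
    simp only [hind, mul_add, Finset.sum_add_distrib, ← mul_assoc]
    rw [← hs1 q.1, ← hs1 q.2, ← hs2 q.1, ← hs2 q.2]
  dsimp only
  rw [Finset.sum_congr rfl hq, overlap_eq_sum ω i τ s i τ s (W := W) Finset.subset_union_left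
    Finset.subset_union_left, overlap_eq_sum ω i' τ' s' i' τ' s' (W := W)
    Finset.subset_union_right Finset.subset_union_right]
  have hfin : ∑ q ∈ W ×ˢ W, c q.1 * d q.2 * (c q.1 + c q.2 + d q.1 + d q.2) =
      ∑ x ∈ W, (c x * c x + 2 * (c x * d x) + d x * d x) := by
    rw [Finset.sum_product]
    have e1 : ∀ x ∈ W, ∑ y ∈ W, c x * d y * (c x + c y + d x + d y) =
        c x * c x + c x * (∑ y ∈ W, c y * d y) + c x * d x + c x * ∑ y ∈ W, d y * d y := by
      intro x _
      have : ∀ y ∈ W, c x * d y * (c x + c y + d x + d y) =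
          (c x * c x + c x * d x) * d y + c x * (c y * d y) + c x * (d y * d y) := by
        intro y _; ring
      rw [Finset.sum_congr rfl this, Finset.sum_add_distrib, Finset.sum_add_distrib,
        ← Finset.mul_sum, ← Finset.mul_sum, ← Finset.mul_sum, hds]
      ring
    rw [Finset.sum_congr rfl e1]
    simp only [Finset.sum_add_distrib, ← Finset.sum_mul, hcs, ← Finset.mul_sum]
    ring
  rw [hfin, ← Finset.sum_add_distrib, Finset.mul_sum]
  -- The cross overlap is absorbed through `2cd ≤ c² + d²`; this is the source of the factor `2` in
  -- `2 * C ^ 2`.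
  exact Finset.sum_le_sum fun x _ => by nlinarith [sq_nonneg (c x - d x)]

end pair


/-! ### Moment bounds -/

section moments

variable {M : ℕ} {𝕜 : Type*} [RCLike 𝕜]

lemma bddMeasurable_walkExp {S : Set (ℤ × ℤ)} (i τ : ℤ) (s : ℕ) {f : Env M → ℤ → 𝕜}
    (hS : {z : ℤ × ℤ | τ - s < z.2} ⊆ S) (hf : ∀ x, BddMeasurable S (fun ω => f ω x)) :
    BddMeasurable S (fun ω : Env M => walkExp ω i τ s (f ω)) := by
  simp only [walkExp, RCLike.real_smul_eq_coe_mul]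
  exact BddMeasurable.sum _ fun x _ => ((bddMeasurable_mass _ _ _ _ hS).ofReal).mul (hf x)

lemma bddMeasurable_walkExp_univ (i τ : ℤ) (s : ℕ) (f : ℤ → 𝕜) :
    BddMeasurable univ (fun ω : Env M => walkExp ω i τ s f) :=
  bddMeasurable_walkExp i τ s (f := fun _ => f) (subset_univ _) fun _ => BddMeasurable.const _

lemma walkExp_mul_left (ω : Env M) (i τ : ℤ) (s : ℕ) (a : 𝕜) (f : ℤ → 𝕜) :
    walkExp ω i τ s (fun x => a * f x) = a * walkExp ω i τ s f := by
  simp only [walkExp, Finset.mul_sum, mul_smul_comm]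

lemma walkExp_mono (ω : Env M) (i τ : ℤ) (s : ℕ) {f g : ℤ → ℝ} (h : ∀ x, f x ≤ g x) :
    walkExp ω i τ s f ≤ walkExp ω i τ s g :=
  Finset.sum_le_sum fun x _ => mul_le_mul_of_nonneg_left (h x) (mass_nonneg _ _ _ _ _)

lemma norm_walkExp_le (ω : Env M) (i τ : ℤ) (s : ℕ) {f : ℤ → 𝕜} {C : ℝ} (h : ∀ x, ‖f x‖ ≤ C) :
    ‖walkExp ω i τ s f‖ ≤ C := by
  calc ‖walkExp ω i τ s f‖ ≤ walkExp ω i τ s fun _ => C := by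
        refine (norm_sum_le _ _).trans (Finset.sum_le_sum fun x _ => ?_)
        rw [norm_smul, Real.norm_of_nonneg (mass_nonneg _ _ _ _ _)]
        exact mul_le_mul_of_nonneg_left (h x) (mass_nonneg _ _ _ _ _)
    _ = C := walkExp_const _ _ _ _ _

variable {P : Measure (Env M)}

/-- The walk from the higher level first makes `d` steps alone to reach the level of the other; from
then on both read the same levels. -/
lemma sum_pairExp_eq (ω : Env M) (i τ : ℤ) (d : ℕ) (i' : ℤ) (m : ℕ) :
    pairExp ω i (τ + d) (d + m) i' τ m (fun x y => potKer M (avgProb P) (x - y)) =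
      pairExp ω i (τ + d) d i' τ 0 (fun x y => potKer M (avgProb P) (x - y)) +
      beta P * ∑ s ∈ Finset.range m, overlap ω i (τ + d) (d + s) i' τ s +
      ∑ s ∈ Finset.range m, pairIncr P ω i (τ + d) (d + s) i' τ s := by
  induction m with
  | zero => simp
  | succ m ih =>
    rw [Finset.sum_range_succ, Finset.sum_range_succ, ← add_assoc,
      pairExp_succ_eq ω i (τ + d) (d + m) i' τ m (by push_cast; ring), ih]
    ring

/-- The characteristic function of the position of the walk under the quenched law. -/
def walkChar (ω : Env M) (i τ : ℤ) (s : ℕ) (t : ℝ) : ℂ :=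
  walkExp ω i τ s fun x => Complex.exp (Complex.I * t * x)

/-- The characteristic function of a jump vector. -/
def jumpChar (t : ℝ) (v : JumpVector M) : ℂ :=
  ∑ j ∈ Finset.Icc (-(M : ℤ)) M, (jumpWeight v j : ℂ) * Complex.exp (Complex.I * t * j)

/-- On average a step multiplies by the averaged characteristic function; the remainder is a sum of
centred variables of the current level with coefficients from the higher levels. -/
lemma walkChar_succ (ω : Env M) (i τ : ℤ) (s : ℕ) (t : ℝ) :
    walkChar ω i τ (s + 1) t = avgCharFun P t * walkChar ω i τ s t +
      ∑ x ∈ window M i s, ((mass ω i τ s x : ℂ) * Complex.exp (Complex.I * t * x)) *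
        (jumpChar t (ω (x, τ - s)) - avgCharFun P t) := by
  rw [walkChar, walkExp_succ, walkChar, ← walkExp_mul_left]
  simp only [walkExp]
  rw [← Finset.sum_add_distrib]
  refine Finset.sum_congr rfl fun x _ => ?_
  have : ∑ j ∈ Finset.Icc (-(M : ℤ)) M,
      weight ω x (τ - s) j • Complex.exp (Complex.I * t * (x + j : ℤ)) =
      Complex.exp (Complex.I * t * x) * jumpChar t (ω (x, τ - s)) := by
    rw [jumpChar, Finset.mul_sum]
    refine Finset.sum_congr rfl fun j _ => ?_
    push_cast
    rw [mul_add, Complex.exp_add, Complex.real_smul, weight_eq_jumpWeight]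
    ring
  rw [this, Complex.real_smul, Complex.real_smul]
  ring

variable [IsProbabilityMeasure P]

/-- Every step reads a fresh level, so under the averaged law the walk has independent increments
with law `avgProb P`. -/
lemma integral_walkExp_succ (hiid : IsIID P) (i τ : ℤ) (s : ℕ) (f : ℤ → 𝕜) :
    ∫ ω, walkExp ω i τ (s + 1) f ∂P = ∫ ω, walkExp ω i τ s (fun x =>
      ∑ j ∈ Finset.Icc (-(M : ℤ)) M, avgProb P j • f (x + j)) ∂P := by
  set S : Set (ℤ × ℤ) := {z : ℤ × ℤ | τ - s < z.2} with hS
  have hm : ∀ x, BddMeasurable S (fun ω : Env M => mass ω i τ s x) := fun x =>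
    bddMeasurable_mass _ _ _ _ le_rfl
  have hw : ∀ x j, BddMeasurable {(x, τ - s)} (fun ω : Env M => weight ω x (τ - s) j) :=
    fun x j => bddMeasurable_weight (mem_singleton _) j
  simp only [walkExp_succ]
  simp only [walkExp, Finset.smul_sum, smul_smul]
  have hi : ∀ x j, Integrable (fun ω : Env M => (mass ω i τ s x * weight ω x (τ - s) j) •
      f (x + j)) P := fun x j => ((((hm x).mono (subset_univ _)).mul
        ((hw x j).mono (subset_univ _))).integrable P).smul_const _
  have hi' : ∀ x j, Integrable (fun ω : Env M => (mass ω i τ s x * avgProb P j) •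
      f (x + j)) P := fun x j => (((hm x).mul (BddMeasurable.const _)).integrable P).smul_const _
  rw [integral_finsetSum _ fun x _ => integrable_finsetSum _ fun j _ => hi x j,
    integral_finsetSum _ fun x _ => integrable_finsetSum _ fun j _ => hi' x j]
  refine Finset.sum_congr rfl fun x _ => ?_
  rw [integral_finsetSum _ fun j _ => hi x j, integral_finsetSum _ fun j _ => hi' x j]
  refine Finset.sum_congr rfl fun j _ => ?_
  rw [integral_smul_const, integral_smul_const, (hm x).integral_mul hiid (by simp [hS]) (hw x j),
    hiid.integral_weight, integral_mul_const]

lemma meanDrift_eq : meanDrift P = ∑ j ∈ Finset.Icc (-(M : ℤ)) M, (j : ℝ) * avgProb P j := by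
  simp only [meanDrift, drift, avgProb]
  rw [integral_finsetSum _ fun j _ => ((BddMeasurable.const _).mul
    (bddMeasurable_weight (S := univ) (mem_univ _) j)).integrable P]
  simp only [integral_const_mul]

lemma sum_avgProb_mul_sq (hspan : SpanOne P) (a : ℝ) :
    ∑ j ∈ Finset.Icc (-(M : ℤ)) M, avgProb P j * (a + (j - meanDrift P)) ^ 2 =
      a ^ 2 + sigmaASq P := by
  have hp := isSpanOneLaw_avgProb hspan
  have h1 : ∀ j ∈ Finset.Icc (-(M : ℤ)) M, avgProb P j * (a + (j - meanDrift P)) ^ 2 =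
      a ^ 2 * avgProb P j + 2 * a * (j * avgProb P j) - 2 * a * meanDrift P * avgProb P j +
        (j - meanDrift P) ^ 2 * avgProb P j := fun j _ => by ring
  rw [Finset.sum_congr rfl h1, Finset.sum_add_distrib, Finset.sum_sub_distrib,
    Finset.sum_add_distrib, ← Finset.mul_sum, ← Finset.mul_sum, ← Finset.mul_sum, hp.sum_eq,
    ← meanDrift_eq, sigmaASq]
  ring

lemma integral_walkExp_sq (hiid : IsIID P) (hspan : SpanOne P) (i τ : ℤ) (s : ℕ) :
    ∫ ω, walkExp ω i τ s (fun x => ((x : ℝ) - i - s * meanDrift P) ^ 2) ∂P = s * sigmaASq P := by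
  induction s with
  | zero => simp [walkExp_zero]
  | succ s ih =>
    rw [integral_walkExp_succ hiid]
    have : (fun x : ℤ => ∑ j ∈ Finset.Icc (-(M : ℤ)) M, avgProb P j •
        (((x + j : ℤ) : ℝ) - i - (s + 1 : ℕ) * meanDrift P) ^ 2) =
        fun x : ℤ => ((x : ℝ) - i - s * meanDrift P) ^ 2 + sigmaASq P := by
      funext x
      rw [← sum_avgProb_mul_sq hspan]
      refine Finset.sum_congr rfl fun j _ => ?_
      rw [smul_eq_mul]
      push_cast
      ring
    rw [this]
    simp only [walkExp_add, walkExp_const]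
    rw [integral_add ((bddMeasurable_walkExp_univ i τ s _).integrable P) (integrable_const _), ih]
    simp only [integral_const, probReal_univ, one_smul]
    push_cast
    ring

lemma sigmaASq_nonneg (hspan : SpanOne P) : 0 ≤ sigmaASq P :=
  Finset.sum_nonneg fun _ _ => mul_nonneg (sq_nonneg _) ((isSpanOneLaw_avgProb hspan).nonneg _)

/-- At `t = 0` the Fejér kernel is a square, so this is the second moment of the difference of two
independent averaged jumps. It yields both `σ_a² > 0` and the constant in the scaling limit. -/
lemma ratioFun_zero (hspan : SpanOne P) : ratioFun M (avgProb P) 0 = 2 * sigmaASq P := by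
  have hp := isSpanOneLaw_avgProb hspan
  simp only [ratioFun, fejer_zero_right]
  have h1 : ∀ i ∈ Finset.Icc (-(M : ℤ)) M, ∑ j ∈ Finset.Icc (-(M : ℤ)) M,
      avgProb P i * avgProb P j * ((i - j : ℤ) : ℝ) ^ 2 =
      ((i - meanDrift P) ^ 2 + sigmaASq P) * avgProb P i := by
    intro i _
    have := sum_avgProb_mul_sq hspan (meanDrift P - i)
    rw [← neg_sub, neg_sq, neg_sub] at this
    rw [show ((i : ℝ) - meanDrift P) ^ 2 = (meanDrift P - i) ^ 2 by ring,
      ← sum_avgProb_mul_sq hspan (meanDrift P - i), Finset.sum_mul]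
    refine Finset.sum_congr rfl fun j _ => ?_
    push_cast
    ring
  rw [Finset.sum_congr rfl h1]
  simp only [add_mul, Finset.sum_add_distrib, ← Finset.mul_sum, hp.sum_eq]
  rw [sigmaASq]
  ring

lemma sigmaASq_pos (hspan : SpanOne P) : 0 < sigmaASq P := by
  have h := ratioFun_pos (isSpanOneLaw_avgProb hspan) (t := 0)
    ⟨by linarith [Real.pi_pos], by linarith [Real.pi_pos]⟩
  rw [ratioFun_zero hspan] at h
  linarith

lemma integral_walkExp_abs_le (hiid : IsIID P) (hspan : SpanOne P) (i τ : ℤ) (s : ℕ) :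
    ∫ ω, walkExp ω i τ s (fun x => |(x : ℝ) - i - s * meanDrift P|) ∂P ≤
      (sigmaASq P + 1) / 2 * √s := by
  rcases Nat.eq_zero_or_pos s with rfl | hs
  · simp [walkExp_zero]
  have hs' : (0 : ℝ) < √s := Real.sqrt_pos.2 (by exact_mod_cast hs)
  -- The arithmetic-geometric inequality with weight `√s`, chosen so that both terms are of order
  -- `√s` after averaging.
  have h1 : ∀ u : ℝ, |u| ≤ (2 * √s)⁻¹ * u ^ 2 + √s / 2 := by
    intro u
    rw [← sq_abs u]
    have : (2 * √s)⁻¹ * |u| ^ 2 + √s / 2 - |u| = (2 * √s)⁻¹ * (|u| - √s) ^ 2 := by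
      field_simp; ring
    have h2 : 0 ≤ (2 * √s)⁻¹ * (|u| - √s) ^ 2 := by positivity
    linarith
  calc ∫ ω, walkExp ω i τ s (fun x => |(x : ℝ) - i - s * meanDrift P|) ∂P
      ≤ ∫ ω, ((2 * √s)⁻¹ * walkExp ω i τ s (fun x => ((x : ℝ) - i - s * meanDrift P) ^ 2)
        + √s / 2) ∂P := by
        refine integral_mono ((bddMeasurable_walkExp_univ i τ s _).integrable P)
          (((bddMeasurable_walkExp_univ i τ s _).integrable P).const_mul _ |>.add
            (integrable_const _)) fun ω => ?_
        dsimp only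
        rw [← walkExp_mul_left, ← walkExp_const ω i τ s (√s / 2), ← walkExp_add]
        exact walkExp_mono _ _ _ _ fun x => by
          simpa only [walkExp_const] using h1 _
    _ = (sigmaASq P + 1) / 2 * √s := by
        rw [integral_add (((bddMeasurable_walkExp_univ i τ s _).integrable P).const_mul _)
          (integrable_const _),
          integral_const_mul, integral_walkExp_sq hiid hspan, integral_const, probReal_univ,
          one_smul]
        have : (s : ℝ) = √s * √s := (Real.mul_self_sqrt (Nat.cast_nonneg s)).symm
        conv_lhs => enter [1, 2, 1]; rw [this]
        field_simp

lemma pairExp_le_sum (ω : Env M) (i τ : ℤ) (s : ℕ) (i' τ' : ℤ) (s' : ℕ) {F : ℤ → ℤ → ℝ}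
    {f g : ℤ → ℝ} (h : ∀ x y, F x y ≤ f x + g y) :
    pairExp ω i τ s i' τ' s' F ≤ walkExp ω i τ s f + walkExp ω i' τ' s' g := by
  refine (pairExp_mono _ _ _ _ _ _ _ h).trans (le_of_eq ?_)
  simp only [pairExp, walkExp_add, walkExp_const]

/-- In the mean of the Doob decomposition the martingale disappears: `β` times the summed overlap is
the mean potential kernel of the difference at time `m`, at most linear in the distance between the
walks, which is of order `√m`. -/
lemma exists_sum_overlap_le (hiid : IsIID P) (hell : Elliptic P) (hspan : SpanOne P) :
    ∃ C : ℝ, 0 ≤ C ∧ ∀ (i τ : ℤ) (m : ℕ),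
      ∑ s ∈ Finset.range m, ∫ ω, overlap ω i τ s i τ s ∂P ≤ C * √m := by
  have hp := isSpanOneLaw_avgProb hspan
  obtain ⟨C, hC, hpot⟩ := exists_potKer_le hp
  have hβ := beta_pos hell hspan
  have hσ := sigmaASq_nonneg hspan
  refine ⟨C * (sigmaASq P + 1) / beta P, by positivity, fun i τ m => ?_⟩
  have hov : ∀ s, BddMeasurable univ (fun ω : Env M => overlap ω i τ s i τ s) := fun s =>
    bddMeasurable_overlap _ _ _ _ _ _ (subset_univ _) (subset_univ _)
  have hinc : ∀ s, BddMeasurable univ (fun ω : Env M => pairIncr P ω i τ s i τ s) := fun s =>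
    bddMeasurable_pairIncr _ _ _ _ _ _ rfl (subset_univ _)
  have h0 : ∀ s, ∫ ω, pairIncr P ω i τ s i τ s ∂P = 0 := fun s => by
    simpa using integral_mul_pairIncr hiid hspan i τ s i τ s rfl (BddMeasurable.const (1 : ℝ))
  have heq : ∀ ω : Env M, beta P * ∑ s ∈ Finset.range m, overlap ω i τ s i τ s =
      pairExp ω i τ m i τ m (fun x y => potKer M (avgProb P) (x - y)) -
      ∑ s ∈ Finset.range m, pairIncr P ω i τ s i τ s := by
    intro ω
    have := sum_pairExp_eq (P := P) ω i τ 0 i m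
    simp only [Nat.cast_zero, add_zero, zero_add] at this
    rw [this]
    simp [pairExp, walkExp_zero, potKer_zero]
  have hpe : BddMeasurable univ (fun ω : Env M => pairExp ω i τ m i τ m
      (fun x y => potKer M (avgProb P) (x - y))) :=
    bddMeasurable_pairExp _ _ _ _ _ _ (subset_univ _) (subset_univ _)
      fun _ _ => BddMeasurable.const _
  have hint : beta P * ∑ s ∈ Finset.range m, ∫ ω, overlap ω i τ s i τ s ∂P =
      ∫ ω, pairExp ω i τ m i τ m (fun x y => potKer M (avgProb P) (x - y)) ∂P := by
    rw [← integral_finsetSum _ fun s _ => (hov s).integrable P, ← integral_const_mul]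
    simp only [heq]
    rw [integral_sub (hpe.integrable P) (integrable_finsetSum _ fun s _ => (hinc s).integrable P),
      integral_finsetSum _ fun s _ => (hinc s).integrable P, Finset.sum_eq_zero fun s _ => h0 s,
      sub_zero]
  have hwb : BddMeasurable univ (fun ω : Env M => walkExp ω i τ m
      (fun x => |(x : ℝ) - i - m * meanDrift P|)) :=
    bddMeasurable_walkExp_univ i τ m _
  have hb : ∫ ω, pairExp ω i τ m i τ m (fun x y => potKer M (avgProb P) (x - y)) ∂P ≤
      C * ((sigmaASq P + 1) * √m) := by
    calc _ ≤ ∫ ω, 2 * C * walkExp ω i τ m (fun x => |(x : ℝ) - i - m * meanDrift P|) ∂P := by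
          refine integral_mono (hpe.integrable P)
            (((BddMeasurable.const _).mul hwb).integrable P) fun ω => ?_
          refine (pairExp_le_sum ω i τ m i τ m
            (f := fun x => C * |(x : ℝ) - i - m * meanDrift P|)
            (g := fun x => C * |(x : ℝ) - i - m * meanDrift P|) fun x y => ?_).trans
            (le_of_eq ?_)
          · rw [← mul_add]
            refine (hpot _).trans (mul_le_mul_of_nonneg_left ?_ hC)
            push_cast
            have : (x : ℝ) - y = (x - i - m * meanDrift P) - (y - i - m * meanDrift P) := by ring
            rw [this]
            exact abs_sub _ _
          · rw [walkExp_mul_left]; ring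
      _ ≤ _ := by
          rw [integral_const_mul]
          have := mul_le_mul_of_nonneg_left (integral_walkExp_abs_le hiid hspan i τ m)
            (by positivity : 0 ≤ 2 * C)
          refine this.trans (le_of_eq ?_)
          ring
  rw [← hint] at hb
  rw [div_mul_eq_mul_div, le_div_iff₀ hβ]
  linarith

/-- The increments are orthogonal, each having second moment bounded by overlaps, which sum to order
`√(d + m)`. The martingale is therefore of order `n^{1/4}`. -/
lemma exists_integral_sum_pairIncr_sq_le (hiid : IsIID P) (hell : Elliptic P)
    (hspan : SpanOne P) :
    ∃ C : ℝ, 0 ≤ C ∧ ∀ (i τ : ℤ) (d : ℕ) (i' : ℤ) (m : ℕ),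
      ∫ ω, (∑ s ∈ Finset.range m, pairIncr P ω i (τ + d) (d + s) i' τ s) ^ 2 ∂P ≤
        C * √(d + m : ℕ) := by
  obtain ⟨C₁, hC₁, h₁⟩ := exists_integral_pairIncr_sq_le hiid hell hspan
  obtain ⟨C₂, hC₂, h₂⟩ := exists_sum_overlap_le hiid hell hspan
  refine ⟨C₁ * (2 * C₂), by positivity, fun i τ d i' m => ?_⟩
  have hlev : ∀ s : ℕ, τ + d - ((d + s : ℕ) : ℤ) = τ - s := fun s => by push_cast; ring
  have hinc : ∀ s, BddMeasurable univ (fun ω : Env M => pairIncr P ω i (τ + d) (d + s) i' τ s) :=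
    fun s => bddMeasurable_pairIncr _ _ _ _ _ _ (hlev s) (subset_univ _)
  have hov : ∀ i τ s, Integrable (fun ω : Env M => overlap ω i τ s i τ s) P := fun i τ s =>
    (bddMeasurable_overlap (S := univ) _ _ _ _ _ _ (subset_univ _) (subset_univ _)).integrable P
  have hsq : ∀ n, ∫ ω, (∑ s ∈ Finset.range n, pairIncr P ω i (τ + d) (d + s) i' τ s) ^ 2 ∂P =
      ∑ s ∈ Finset.range n, ∫ ω, pairIncr P ω i (τ + d) (d + s) i' τ s ^ 2 ∂P := by
    intro n
    induction n with
    | zero => simp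
    | succ n ih =>
      simp only [Finset.sum_range_succ, add_sq]
      have hpast : BddMeasurable {z : ℤ × ℤ | τ - n < z.2} (fun ω : Env M =>
          2 * ∑ s ∈ Finset.range n, pairIncr P ω i (τ + d) (d + s) i' τ s) := by
        refine (BddMeasurable.const 2).mul (BddMeasurable.sum _ fun s hs =>
          bddMeasurable_pairIncr _ _ _ _ _ _ (hlev s) ?_)
        intro z hz
        rw [Finset.mem_range] at hs
        simp only [mem_ofPred_eq] at hz ⊢
        omega
      have hsum : BddMeasurable univ (fun ω : Env M =>
          ∑ s ∈ Finset.range n, pairIncr P ω i (τ + d) (d + s) i' τ s) :=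
        BddMeasurable.sum _ fun s _ => hinc s
      rw [integral_add (((hsum.pow 2).add ((hpast.mono (subset_univ _)).mul (hinc n))).integrable P)
        (((hinc n).pow 2).integrable P), integral_add ((hsum.pow 2).integrable P)
        (((hpast.mono (subset_univ _)).mul (hinc n)).integrable P), ih,
        integral_mul_pairIncr hiid hspan _ _ _ _ _ _ (hlev n) hpast, add_zero]
  rw [hsq]
  calc _ ≤ ∑ s ∈ Finset.range m, C₁ * ((∫ ω, overlap ω i (τ + d) (d + s) i (τ + d) (d + s) ∂P) +
        ∫ ω, overlap ω i' τ s i' τ s ∂P) := by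
        refine Finset.sum_le_sum fun s _ => (h₁ _ _ _ _ _ _ (hlev s)).trans (le_of_eq ?_)
        rw [integral_add (hov _ _ _) (hov _ _ _)]
    _ ≤ C₁ * (2 * C₂) * √(d + m : ℕ) := by
        rw [← Finset.mul_sum, Finset.sum_add_distrib, mul_assoc]
        refine mul_le_mul_of_nonneg_left ?_ hC₁
        -- The overlaps at steps `d, …, d + m - 1` are bounded by those at all steps below `d + m`.
        have e1 : ∑ s ∈ Finset.range m,
            ∫ ω, overlap ω i (τ + d) (d + s) i (τ + d) (d + s) ∂P ≤ C₂ * √(d + m : ℕ) := by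
          refine le_trans ?_ (h₂ i (τ + d) (d + m))
          rw [Finset.sum_range_add]
          exact le_add_of_nonneg_left (Finset.sum_nonneg fun s _ =>
            integral_nonneg fun ω => overlap_nonneg _ _ _ _ _ _ _)
        have e2 : ∑ s ∈ Finset.range m, ∫ ω, overlap ω i' τ s i' τ s ∂P ≤
            C₂ * √(d + m : ℕ) := by
          refine (h₂ i' τ m).trans (mul_le_mul_of_nonneg_left (Real.sqrt_le_sqrt ?_) hC₂)
          push_cast
          linarith [(Nat.cast_nonneg d : (0 : ℝ) ≤ d)]
        linarith

/-! ### Quenched characteristic functions -/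

lemma norm_exp_I_mul (t : ℝ) (x : ℤ) : ‖Complex.exp (Complex.I * t * x)‖ = 1 := by
  rw [mul_assoc, ← Complex.ofReal_intCast, ← Complex.ofReal_mul, Complex.norm_exp_I_mul_ofReal]

lemma norm_walkChar_le (ω : Env M) (i τ : ℤ) (s : ℕ) (t : ℝ) : ‖walkChar ω i τ s t‖ ≤ 1 :=
  norm_walkExp_le _ _ _ _ fun x => (norm_exp_I_mul t x).le

lemma bddMeasurable_walkChar {S : Set (ℤ × ℤ)} (i τ : ℤ) (s : ℕ) (t : ℝ)
    (hS : {z : ℤ × ℤ | τ - s < z.2} ⊆ S) :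
    BddMeasurable S (fun ω : Env M => walkChar ω i τ s t) :=
  bddMeasurable_walkExp _ _ _ hS fun _ => BddMeasurable.const _

lemma norm_sum_mul_exp_sub_one_le {p : ℤ → ℝ} (hp : ∀ j, 0 ≤ p j)
    (hp1 : ∑ j ∈ Finset.Icc (-(M : ℤ)) M, p j = 1) (t : ℝ) :
    ‖∑ j ∈ Finset.Icc (-(M : ℤ)) M, (p j : ℂ) * Complex.exp (Complex.I * t * j) - 1‖ ≤
      M * |t| := by
  have h1 : (1 : ℂ) = ∑ j ∈ Finset.Icc (-(M : ℤ)) M, (p j : ℂ) := by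
    rw [← Complex.ofReal_sum, hp1, Complex.ofReal_one]
  calc _ = ‖∑ j ∈ Finset.Icc (-(M : ℤ)) M,
        (p j : ℂ) * (Complex.exp (Complex.I * t * j) - 1)‖ := by
        simp only [mul_sub, mul_one, Finset.sum_sub_distrib, ← h1]
    _ ≤ ∑ j ∈ Finset.Icc (-(M : ℤ)) M, p j * (M * |t|) := by
        refine (norm_sum_le _ _).trans (Finset.sum_le_sum fun j hj => ?_)
        rw [norm_mul, Complex.norm_real, Real.norm_of_nonneg (hp j)]
        refine mul_le_mul_of_nonneg_left ?_ (hp j)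
        rw [mul_assoc, ← Complex.ofReal_intCast, ← Complex.ofReal_mul]
        refine (Real.norm_exp_I_mul_ofReal_sub_one_le).trans ?_
        rw [Real.norm_eq_abs, abs_mul, mul_comm]
        refine mul_le_mul_of_nonneg_right ?_ (abs_nonneg _)
        rw [Finset.mem_Icc] at hj
        have : |j| ≤ (M : ℤ) := abs_le.2 hj
        exact_mod_cast this
    _ = M * |t| := by rw [← Finset.sum_mul, hp1, one_mul]

lemma norm_avgCharFun_le (hspan : SpanOne P) (t : ℝ) : ‖avgCharFun P t‖ ≤ 1 := by
  have hp := isSpanOneLaw_avgProb hspan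
  calc ‖avgCharFun P t‖ ≤ ∑ j ∈ Finset.Icc (-(M : ℤ)) M, avgProb P j := by
        refine (norm_sum_le _ _).trans (Finset.sum_le_sum fun j _ => ?_)
        rw [norm_mul, norm_exp_I_mul, mul_one, Complex.norm_real,
          Real.norm_of_nonneg (hp.nonneg j)]
    _ = 1 := hp.sum_eq

lemma jumpWeight_nonneg (v : JumpVector M) (j : ℤ) : 0 ≤ jumpWeight v j :=
  weight_nonneg (fun _ => v) 0 0 j

lemma jumpWeight_sum (v : JumpVector M) : ∑ j ∈ Finset.Icc (-(M : ℤ)) M, jumpWeight v j = 1 :=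
  weight_sum (fun _ => v) 0 0

lemma measurable_jumpChar (t : ℝ) : Measurable (jumpChar (M := M) t) := by
  unfold jumpChar
  fun_prop

lemma norm_jumpChar_sub_le (hspan : SpanOne P) (t : ℝ) (v : JumpVector M) :
    ‖jumpChar t v - avgCharFun P t‖ ≤ 2 * (M * |t|) := by
  have hp := isSpanOneLaw_avgProb hspan
  have h1 := norm_sum_mul_exp_sub_one_le (jumpWeight_nonneg v) (jumpWeight_sum v) t
  have h2 := norm_sum_mul_exp_sub_one_le hp.nonneg hp.sum_eq t
  have : jumpChar t v - avgCharFun P t = (jumpChar t v - 1) - (avgCharFun P t - 1) := by ring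
  rw [this]
  refine (norm_sub_le _ _).trans ?_
  rw [two_mul]
  exact add_le_add h1 h2

lemma integral_jumpChar_sub (t : ℝ) :
    ∫ ω : Env M, (jumpChar t (ω (0, 0)) - avgCharFun P t) ∂P = 0 := by
  have hw : ∀ j, BddMeasurable univ (fun ω : Env M =>
      ((jumpWeight (ω (0, 0)) j : ℝ) : ℂ) * Complex.exp (Complex.I * t * j)) := fun j =>
    ((bddMeasurable_weight (mem_univ ((0, 0) : ℤ × ℤ)) j).ofReal).mul (BddMeasurable.const _)
  simp only [jumpChar]
  rw [integral_sub ((BddMeasurable.sum _ fun j _ => hw j).integrable P) (integrable_const _),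
    integral_finsetSum _ fun j _ => (hw j).integrable P, integral_const, probReal_univ, one_smul,
    avgCharFun, sub_eq_zero]
  refine Finset.sum_congr rfl fun j _ => ?_
  rw [integral_mul_const, integral_complex_ofReal]
  rfl

/-- At each step the error is multiplied by a factor of modulus at most one and receives an
orthogonal centred term of variance at most `(2M|t|)²` times the mean overlap. At frequency `θ / √n`
over order `n` steps the total is of order `n^{-1/2}`. -/
lemma integral_norm_walkChar_sub_sq_le (hiid : IsIID P) (hspan : SpanOne P) (i τ : ℤ) (s : ℕ)
    (t : ℝ) :
    ∫ ω, ‖walkChar ω i τ s t - Complex.exp (Complex.I * t * i) * avgCharFun P t ^ s‖ ^ 2 ∂P ≤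
      (2 * (M * |t|)) ^ 2 * ∑ r ∈ Finset.range s, ∫ ω, overlap ω i τ r i τ r ∂P := by
  induction s with
  | zero => simp [walkChar, walkExp_zero]
  | succ s ih =>
    set S : Set (ℤ × ℤ) := {z : ℤ × ℤ | τ - s < z.2} with hS
    set Z : JumpVector M → ℂ := fun v => jumpChar t v - avgCharFun P t with hZ
    have hZm : Measurable Z := (measurable_jumpChar t).sub_const _
    have hZb : ∀ v, ‖Z v‖ ≤ 2 * (M * |t|) := norm_jumpChar_sub_le hspan t
    have hZ0 : ∫ ω : Env M, Z (ω (0, 0)) ∂P = 0 := integral_jumpChar_sub t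
    set c : ℤ → Env M → ℂ := fun x ω => (mass ω i τ s x : ℂ) * Complex.exp (Complex.I * t * x)
    have hc : ∀ x, BddMeasurable S (c x) := fun x =>
      ((bddMeasurable_mass i τ s x le_rfl).ofReal).mul (BddMeasurable.const _)
    have hSl : ∀ x, (x, τ - (s : ℤ)) ∉ S := fun x => by simp [hS]
    set A : Env M → ℂ := fun ω => avgCharFun P t *
      (walkChar ω i τ s t - Complex.exp (Complex.I * t * i) * avgCharFun P t ^ s) with hA
    set η : Env M → ℂ := fun ω => ∑ x ∈ window M i s, c x ω * Z (ω (x, τ - s)) with hη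
    have hAb : BddMeasurable S A := (BddMeasurable.const _).mul
      ((bddMeasurable_walkChar _ _ _ _ le_rfl).sub (BddMeasurable.const _))
    have hηb : BddMeasurable univ η := BddMeasurable.sum _ fun x _ =>
      ((hc x).mono (subset_univ _)).mul
        ⟨hZm.comp (measurable_apply_sig (mem_univ _)), _, fun ω => hZb _⟩
    have heq : ∀ ω, walkChar ω i τ (s + 1) t -
        Complex.exp (Complex.I * t * i) * avgCharFun P t ^ (s + 1) = A ω + η ω := by
      intro ω
      rw [walkChar_succ (P := P)]
      simp only [hA, hη, c, Z]
      ring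
    have hsq : ∀ ω, ‖A ω + η ω‖ ^ 2 =
        ‖A ω‖ ^ 2 + 2 * ((starRingEnd ℂ) (A ω) * η ω).re + ‖η ω‖ ^ 2 := by
      intro ω
      rw [← Complex.normSq_eq_norm_sq, ← Complex.normSq_eq_norm_sq, ← Complex.normSq_eq_norm_sq,
        Complex.normSq_add]
      have : ((starRingEnd ℂ) (A ω) * η ω).re = (A ω * (starRingEnd ℂ) (η ω)).re := by
        rw [← Complex.conj_re, map_mul, Complex.conj_conj]
      rw [this]; ring
    simp only [heq, hsq]
    have hAu := hAb.mono (subset_univ S)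
    have i1 := (hAu.norm.pow 2).integrable P
    have i2 : Integrable (fun ω => (starRingEnd ℂ) (A ω) * η ω) P :=
      (hAu.conj.mul hηb).integrable P
    have i3 := (hηb.norm.pow 2).integrable P
    have i4 : Integrable (fun ω => 2 * ((starRingEnd ℂ) (A ω) * η ω).re) P := i2.re.const_mul 2
    have i5 : Integrable (fun ω => ‖A ω‖ ^ 2 + 2 * ((starRingEnd ℂ) (A ω) * η ω).re) P := i1.add i4
    rw [integral_add i5 i3, integral_add i1 i4,
      integral_const_mul]
    have h0 : ∫ ω, ((starRingEnd ℂ) (A ω) * η ω).re ∂P = 0 := by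
      have h1 := integral_mul_siteSum hiid hSl (W := window M i s) hc hZm ⟨_, hZb⟩ hZ0 hAb.conj
      have h2 := integral_re i2
      simp only [RCLike.re_to_complex] at h2
      rw [h2]
      simp only [hη]
      rw [h1, Complex.zero_re]
    have hη2 : ∫ ω, ‖η ω‖ ^ 2 ∂P ≤ (2 * (M * |t|)) ^ 2 * ∫ ω, overlap ω i τ s i τ s ∂P := by
      have h1 := integral_mul_siteSum_sq hiid hSl (W := window M i s) hc hZm ⟨_, hZb⟩ hZ0
        (BddMeasurable.const (1 : ℂ))
      simp only [one_mul, Complex.coe_algebraMap] at h1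
      have h2 : ∫ ω, ‖η ω‖ ^ 2 ∂P =
          (∫ ω, ∑ x ∈ window M i s, ‖c x ω‖ ^ 2 ∂P) * ∫ ω, ‖Z (ω (0, 0))‖ ^ 2 ∂P := by
        have : ((∫ ω, ‖η ω‖ ^ 2 ∂P : ℝ) : ℂ) = (((∫ ω, ∑ x ∈ window M i s, ‖c x ω‖ ^ 2 ∂P) *
            ∫ ω, ‖Z (ω (0, 0))‖ ^ 2 ∂P : ℝ) : ℂ) := by
          push_cast
          rw [← integral_complex_ofReal, ← integral_complex_ofReal, ← integral_complex_ofReal]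
          rw [← integral_complex_ofReal] at h1
          exact h1
        exact_mod_cast this
      have h3 : ∀ ω, ∑ x ∈ window M i s, ‖c x ω‖ ^ 2 = overlap ω i τ s i τ s := by
        intro ω
        rw [overlap_eq_sum ω i τ s i τ s subset_rfl subset_rfl]
        refine Finset.sum_congr rfl fun x _ => ?_
        simp only [c, norm_mul, norm_exp_I_mul, mul_one, Complex.norm_real, Real.norm_eq_abs,
          sq, abs_mul_abs_self]
      rw [h2]
      simp only [h3]
      rw [mul_comm]
      refine mul_le_mul_of_nonneg_right ?_ (integral_nonneg fun ω => overlap_nonneg _ _ _ _ _ _ _)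
      calc ∫ ω : Env M, ‖Z (ω (0, 0))‖ ^ 2 ∂P ≤ ∫ _ : Env M, (2 * (M * |t|)) ^ 2 ∂P := by
            refine integral_mono_of_nonneg (ae_of_all _ fun ω => by positivity)
              (integrable_const _) (ae_of_all _ fun ω => ?_)
            exact pow_le_pow_left₀ (norm_nonneg _) (hZb _) 2
        _ = _ := by simp
    have hA2 : ∫ ω, ‖A ω‖ ^ 2 ∂P ≤
        (2 * (M * |t|)) ^ 2 * ∑ r ∈ Finset.range s, ∫ ω, overlap ω i τ r i τ r ∂P := by
      refine le_trans ?_ ih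
      refine integral_mono_of_nonneg (ae_of_all _ fun ω => by positivity)
        ((((bddMeasurable_walkChar (S := univ) i τ s t (subset_univ _)).sub
          (BddMeasurable.const _)).norm.pow 2).integrable P) (ae_of_all _ fun ω => ?_)
      refine pow_le_pow_left₀ (norm_nonneg _) ?_ 2
      simp only [hA, norm_mul]
      exact mul_le_of_le_one_left (norm_nonneg _) (norm_avgCharFun_le hspan t)
    rw [h0, mul_zero, add_zero, Finset.sum_range_succ, mul_add]
    exact add_le_add hA2 hη2

lemma one_sub_norm_avgCharFun_sq (hspan : SpanOne P) (t : ℝ) :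
    1 - ‖avgCharFun P t‖ ^ 2 = (1 - Real.cos t) * ratioFun M (avgProb P) t := by
  have hp := isSpanOneLaw_avgProb hspan
  rw [one_sub_cos_mul_ratioFun, ← one_sub_re_mul_conj hp.sum_eq hp.sum_eq]
  congr 1
  rw [Complex.mul_conj, Complex.ofReal_re, Complex.normSq_eq_norm_sq]
  rfl

lemma one_sub_re_walkChar (ω : Env M) (i τ : ℤ) (s : ℕ) (i' τ' : ℤ) (s' : ℕ) (t : ℝ) :
    1 - (walkChar ω i τ s t * (starRingEnd ℂ) (walkChar ω i' τ' s' t)).re =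
      pairExp ω i τ s i' τ' s' fun x y => 1 - Real.cos ((x - y : ℤ) * t) := by
  rw [pairExp_eq_sum _ _ _ _ _ _ _ _ subset_rfl subset_rfl,
    ← one_sub_re_mul_conj (mass_sum ω i τ s) (mass_sum ω i' τ' s')]
  simp only [walkChar, walkExp, Complex.real_smul]

/-- The quenched mean of the potential kernel depends on the environment only through two
characteristic functions, and these concentrate. -/
lemma pairExp_potKer_eq (hspan : SpanOne P) (ω : Env M) (i τ : ℤ) (s : ℕ) (i' τ' : ℤ) (s' : ℕ) :
    pairExp ω i τ s i' τ' s' (fun x y => potKer M (avgProb P) (x - y)) =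
      1 / (2 * Real.pi) * ∫ t in (-Real.pi)..Real.pi,
        (1 - (walkChar ω i τ s t * (starRingEnd ℂ) (walkChar ω i' τ' s' t)).re) /
          (1 - ‖avgCharFun P t‖ ^ 2) := by
  have hp := isSpanOneLaw_avgProb hspan
  rw [pairExp_eq_sum _ _ _ _ _ _ _ _ subset_rfl subset_rfl, sum_sum_mul_potKer hp
    (fun x y => mass ω i τ s x * mass ω i' τ' s' y) (fun x y => x - y)]
  congr 1
  refine intervalIntegral.integral_congr_ae ?_
  filter_upwards [ae_cos_ne_one] with t hc ht
  rw [one_sub_norm_avgCharFun_sq hspan, one_sub_re_walkChar,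
    pairExp_eq_sum _ _ _ _ _ _ _ _ subset_rfl subset_rfl]
  simp only [← one_sub_cos_mul_fejer]
  rw [← mul_div_mul_left _ _ (hc ht), Finset.mul_sum]
  congr 1
  refine Finset.sum_congr rfl fun x _ => ?_
  rw [Finset.mul_sum]
  exact Finset.sum_congr rfl fun y _ => by ring

end moments


/-! ### Scaling limits -/

section scaling

lemma norm_pow_sub_pow_le_mul {a b : ℂ} (ha : ‖a‖ ≤ 1) (hb : ‖b‖ ≤ 1) (m : ℕ) :
    ‖a ^ m - b ^ m‖ ≤ m * ‖a - b‖ := by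
  induction m with
  | zero => simp
  | succ m ih =>
    have h : a ^ (m + 1) - b ^ (m + 1) = (a ^ m - b ^ m) * a + b ^ m * (a - b) := by ring
    rw [h]
    refine (norm_add_le _ _).trans ?_
    rw [norm_mul, norm_mul, norm_pow]
    have h1 : ‖a ^ m - b ^ m‖ * ‖a‖ ≤ m * ‖a - b‖ :=
      (mul_le_of_le_one_right (norm_nonneg _) ha).trans ih
    have h2 : ‖b‖ ^ m * ‖a - b‖ ≤ ‖a - b‖ :=
      mul_le_of_le_one_left (norm_nonneg _) (pow_le_one₀ (norm_nonneg _) hb)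
    push_cast
    linarith

lemma norm_mul_conj_sub_le {a b c d : ℂ} (hb : ‖b‖ ≤ 1) (hc : ‖c‖ ≤ 1) :
    ‖a * (starRingEnd ℂ) b - c * (starRingEnd ℂ) d‖ ≤ ‖a - c‖ + ‖b - d‖ := by
  have h : a * (starRingEnd ℂ) b - c * (starRingEnd ℂ) d =
      (a - c) * (starRingEnd ℂ) b + c * (starRingEnd ℂ) (b - d) := by
    rw [map_sub]; ring
  rw [h]
  refine (norm_add_le _ _).trans ?_
  rw [norm_mul, norm_mul, Complex.norm_conj, Complex.norm_conj]
  exact add_le_add (mul_le_of_le_one_right (norm_nonneg _) hb)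
    (mul_le_of_le_one_left (norm_nonneg _) hc)

lemma sq_integral_le {Ω : Type*} [MeasurableSpace Ω] {P : Measure Ω} [IsProbabilityMeasure P]
    {f : Ω → ℝ} (hf : Integrable f P) (hf2 : Integrable (fun ω => f ω ^ 2) P) :
    (∫ ω, f ω ∂P) ^ 2 ≤ ∫ ω, f ω ^ 2 ∂P := by
  set a := ∫ ω, f ω ∂P with ha
  have h : 0 ≤ ∫ ω, (f ω - a) ^ 2 ∂P := integral_nonneg fun ω => sq_nonneg _
  have h2 : ∀ ω, (f ω - a) ^ 2 = f ω ^ 2 - 2 * a * f ω + a ^ 2 := fun ω => by ring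
  simp only [h2] at h
  have i1 : Integrable (fun ω => f ω ^ 2 - 2 * a * f ω) P := hf2.sub (hf.const_mul _)
  rw [integral_add i1 (integrable_const _), integral_sub hf2 (hf.const_mul _),
    integral_const_mul, integral_const, probReal_univ, one_smul, ← ha] at h
  nlinarith

variable {M : ℕ} {P : Measure (Env M)} [IsProbabilityMeasure P]

/-- The characteristic function of the centred averaged jump. -/
def centredChar (P : Measure (Env M)) (s : ℝ) : ℂ :=
  Complex.exp (-(Complex.I * s * meanDrift P)) * avgCharFun P s

lemma norm_centredChar_le (hspan : SpanOne P) (s : ℝ) : ‖centredChar P s‖ ≤ 1 := by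
  have h : ‖Complex.exp (-(Complex.I * s * meanDrift P))‖ = 1 := by
    have : -(Complex.I * s * meanDrift P) = ((-(s * meanDrift P) : ℝ) : ℂ) * Complex.I := by
      push_cast; ring
    rw [this, Complex.norm_exp_ofReal_mul_I]
  rw [centredChar, norm_mul, h, one_mul]
  exact norm_avgCharFun_le hspan s

lemma exists_norm_centredChar_sub_le (hspan : SpanOne P) :
    ∃ C : ℝ, 0 ≤ C ∧ ∀ s : ℝ, |s| ≤ 1 →
      ‖centredChar P s - Complex.exp (-(sigmaASq P * s ^ 2 / 2 : ℝ))‖ ≤ C * |s| ^ 3 := by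
  have hp := isSpanOneLaw_avgProb hspan
  have hσ := sigmaASq_nonneg hspan
  set V := meanDrift P with hV
  set K : ℝ := M + |V| with hK
  have hK0 : 0 ≤ K := by positivity
  -- `K` bounds the centred jumps. The first term is the third order remainder of the complex
  -- exponential of the jump, the second is the second order remainder of `exp (-σ_a² s² / 2)`,
  -- where `|s|⁴ ≤ |s|³`.
  refine ⟨K ^ 3 * Real.exp K + (sigmaASq P / 2) ^ 2 * Real.exp (sigmaASq P / 2), by positivity,
    fun s hs => ?_⟩
  have e1 : centredChar P s = ∑ j ∈ Finset.Icc (-(M : ℤ)) M,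
      (avgProb P j : ℂ) * Complex.exp (Complex.I * (s * (j - V) : ℝ)) := by
    rw [centredChar, avgCharFun, Finset.mul_sum]
    refine Finset.sum_congr rfl fun j _ => ?_
    rw [mul_left_comm, ← Complex.exp_add]
    congr 2
    push_cast
    ring
  have e2 : (1 - sigmaASq P * s ^ 2 / 2 : ℝ) = ∑ j ∈ Finset.Icc (-(M : ℤ)) M,
      avgProb P j * (1 - (s * (j - V)) ^ 2 / 2) := by
    have : ∀ j ∈ Finset.Icc (-(M : ℤ)) M, avgProb P j * (1 - (s * ((j : ℝ) - V)) ^ 2 / 2) =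
        avgProb P j - s ^ 2 / 2 * (((j : ℝ) - V) ^ 2 * avgProb P j) := fun j _ => by ring
    rw [Finset.sum_congr rfl this, Finset.sum_sub_distrib, hp.sum_eq, ← Finset.mul_sum, sigmaASq]
    ring
  have e3 : ∑ j ∈ Finset.Icc (-(M : ℤ)) M, avgProb P j * (s * (j - V)) = 0 := by
    have : ∀ j ∈ Finset.Icc (-(M : ℤ)) M, avgProb P j * (s * ((j : ℝ) - V)) =
        s * (j * avgProb P j) - s * V * avgProb P j := fun j _ => by ring
    rw [Finset.sum_congr rfl this, Finset.sum_sub_distrib, ← Finset.mul_sum, ← Finset.mul_sum,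
      hp.sum_eq, ← meanDrift_eq]
    ring
  have h1 : ‖centredChar P s - ((1 - sigmaASq P * s ^ 2 / 2 : ℝ) : ℂ)‖ ≤
      K ^ 3 * Real.exp K * |s| ^ 3 := by
    have e4 : centredChar P s - ((1 - sigmaASq P * s ^ 2 / 2 : ℝ) : ℂ) =
        ∑ j ∈ Finset.Icc (-(M : ℤ)) M, (avgProb P j : ℂ) *
          (Complex.exp (Complex.I * (s * (j - V) : ℝ)) -
            ∑ m ∈ Finset.range 3, (Complex.I * (s * (j - V) : ℝ)) ^ m / m.factorial) := by
      have : ∀ j : ℤ, (avgProb P j : ℂ) * (Complex.exp (Complex.I * (s * (j - V) : ℝ)) -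
            ∑ m ∈ Finset.range 3, (Complex.I * (s * (j - V) : ℝ)) ^ m / m.factorial) =
          (avgProb P j : ℂ) * Complex.exp (Complex.I * (s * (j - V) : ℝ)) -
          ((avgProb P j * (1 - (s * (j - V)) ^ 2 / 2) : ℝ) : ℂ) -
          Complex.I * ((avgProb P j * (s * (j - V)) : ℝ) : ℂ) := by
        intro j
        simp only [Finset.sum_range_succ, Finset.sum_range_zero, Nat.factorial, mul_pow,
          Complex.I_sq]
        push_cast
        ring
      rw [Finset.sum_congr rfl fun j _ => this j, Finset.sum_sub_distrib, Finset.sum_sub_distrib,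
        ← Finset.mul_sum, ← Complex.ofReal_sum, ← Complex.ofReal_sum, e3, ← e2, ← e1]
      simp
    rw [e4]
    calc _ ≤ ∑ j ∈ Finset.Icc (-(M : ℤ)) M, avgProb P j * (K ^ 3 * Real.exp K * |s| ^ 3) := by
          refine (norm_sum_le _ _).trans (Finset.sum_le_sum fun j hj => ?_)
          rw [norm_mul, Complex.norm_real, Real.norm_of_nonneg (hp.nonneg j)]
          refine mul_le_mul_of_nonneg_left ?_ (hp.nonneg j)
          refine (Complex.norm_exp_sub_sum_le_norm_mul_exp _ 3).trans ?_
          have hn : ‖Complex.I * ((s * (j - V) : ℝ) : ℂ)‖ ≤ K * |s| := by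
            rw [norm_mul, Complex.norm_I, one_mul, Complex.norm_real, Real.norm_eq_abs, abs_mul,
              mul_comm]
            refine mul_le_mul_of_nonneg_right ?_ (abs_nonneg _)
            refine (abs_sub _ _).trans (add_le_add_left ?_ _)
            rw [Finset.mem_Icc] at hj
            have : |j| ≤ (M : ℤ) := abs_le.2 hj
            exact_mod_cast this
          have hn2 : K * |s| ≤ K := mul_le_of_le_one_right hK0 hs
          calc _ ≤ (K * |s|) ^ 3 * Real.exp K :=
                mul_le_mul (pow_le_pow_left₀ (norm_nonneg _) hn 3)
                  (Real.exp_le_exp.2 (hn.trans hn2)) (Real.exp_pos _).le (by positivity)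
            _ = _ := by ring
      _ = _ := by rw [← Finset.sum_mul, hp.sum_eq, one_mul]
  have h2 : ‖((1 - sigmaASq P * s ^ 2 / 2 : ℝ) : ℂ) -
      Complex.exp (-(sigmaASq P * s ^ 2 / 2 : ℝ))‖ ≤
      (sigmaASq P / 2) ^ 2 * Real.exp (sigmaASq P / 2) * |s| ^ 3 := by
    rw [norm_sub_rev]
    have h3 := Complex.norm_exp_sub_sum_le_norm_mul_exp (-(sigmaASq P * s ^ 2 / 2 : ℝ) : ℂ) 2
    have e5 : ∑ m ∈ Finset.range 2, (-(sigmaASq P * s ^ 2 / 2 : ℝ) : ℂ) ^ m / m.factorial =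
        ((1 - sigmaASq P * s ^ 2 / 2 : ℝ) : ℂ) := by
      simp only [Finset.sum_range_succ, Finset.sum_range_zero, Nat.factorial]
      push_cast
      ring
    rw [e5] at h3
    refine h3.trans ?_
    have hs2 : s ^ 2 ≤ 1 := by rw [← sq_abs]; exact pow_le_one₀ (abs_nonneg _) hs
    have hs4 : |s| ^ 4 ≤ |s| ^ 3 := pow_le_pow_of_le_one (abs_nonneg _) hs (by norm_num)
    have hn : ‖(-(sigmaASq P * s ^ 2 / 2 : ℝ) : ℂ)‖ = sigmaASq P / 2 * s ^ 2 := by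
      rw [norm_neg, Complex.norm_real, Real.norm_of_nonneg (by positivity)]
      ring
    rw [hn]
    calc _ ≤ ((sigmaASq P / 2) ^ 2 * |s| ^ 3) * Real.exp (sigmaASq P / 2) := by
          refine mul_le_mul ?_ (Real.exp_le_exp.2 ?_) (Real.exp_pos _).le (by positivity)
          · rw [mul_pow]
            refine mul_le_mul_of_nonneg_left ?_ (by positivity)
            rw [← pow_mul, ← Even.pow_abs (by decide : Even (2 * 2))]
            exact hs4
          · exact mul_le_of_le_one_right (by positivity) hs2
      _ = _ := by ring
  calc _ ≤ _ := norm_sub_le_norm_sub_add_norm_sub _ ((1 - sigmaASq P * s ^ 2 / 2 : ℝ) : ℂ) _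
    _ ≤ _ := by rw [add_mul]; exact add_le_add h1 h2

lemma tendsto_div_sqrt_atTop (θ : ℝ) : Tendsto (fun n : ℕ => θ / √n) atTop (𝓝 0) :=
  Tendsto.div_atTop tendsto_const_nhds (Real.tendsto_sqrt_atTop.comp tendsto_natCast_atTop_atTop)

/-- The classical central limit theorem for the averaged walk: replacing the base by the Gaussian
one costs at most `m n` times a cube of order `n^{-3/2}`. -/
lemma tendsto_centredChar_pow (hspan : SpanOne P) {m : ℕ → ℕ} {t : ℝ}
    (hm : Tendsto (fun n : ℕ => (m n : ℝ) / n) atTop (𝓝 t)) (θ : ℝ) :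
    Tendsto (fun n : ℕ => centredChar P (θ / √n) ^ m n) atTop
      (𝓝 (Complex.exp (-(sigmaASq P * t * θ ^ 2 / 2 : ℝ)))) := by
  obtain ⟨C, hC, h⟩ := exists_norm_centredChar_sub_le hspan
  have hσ := sigmaASq_nonneg hspan
  have h1 : Tendsto (fun n : ℕ => Complex.exp (-(sigmaASq P * (θ / √n) ^ 2 / 2 : ℝ)) ^ m n) atTop
      (𝓝 (Complex.exp (-(sigmaASq P * t * θ ^ 2 / 2 : ℝ)))) := by
    have h2 : Tendsto (fun n : ℕ => (-(sigmaASq P * ((m n : ℝ) / n) * θ ^ 2 / 2 : ℝ) : ℂ)) atTop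
        (𝓝 (-(sigmaASq P * t * θ ^ 2 / 2 : ℝ) : ℂ)) := by
      refine Tendsto.neg (Complex.continuous_ofReal.continuousAt.tendsto.comp ?_)
      exact ((hm.const_mul _).mul_const _).div_const _
    refine ((Complex.continuous_exp.tendsto _).comp h2).congr fun n => ?_
    simp only [Function.comp]
    rw [← Complex.exp_nat_mul]
    congr 1
    rw [div_pow, Real.sq_sqrt (Nat.cast_nonneg n)]
    push_cast
    ring
  have h3 : Tendsto (fun n : ℕ => (m n : ℝ) / n * (C * |θ| ^ 2) * |θ / √n|) atTop (𝓝 0) := by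
    have := (hm.mul_const (C * |θ| ^ 2)).mul (tendsto_div_sqrt_atTop θ).abs
    simpa using this
  have h4 : Tendsto (fun n : ℕ => centredChar P (θ / √n) ^ m n -
      Complex.exp (-(sigmaASq P * (θ / √n) ^ 2 / 2 : ℝ)) ^ m n) atTop (𝓝 0) := by
    refine squeeze_zero_norm' ?_ h3
    have hs : ∀ᶠ n : ℕ in atTop, |θ / √n| ≤ 1 := by
      have := (tendsto_div_sqrt_atTop θ).abs
      rw [abs_zero] at this
      exact this.eventually_le_const one_pos
    filter_upwards [hs, eventually_gt_atTop 0] with n hn hn0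
    refine (norm_pow_sub_pow_le_mul (norm_centredChar_le hspan _) ?_ _).trans ?_
    · rw [← Complex.ofReal_neg, ← Complex.ofReal_exp, Complex.norm_real,
        Real.norm_of_nonneg (Real.exp_pos _).le, Real.exp_le_one_iff]
      have : 0 ≤ sigmaASq P * (θ / √n) ^ 2 / 2 := by positivity
      linarith
    · refine (mul_le_mul_of_nonneg_left (h _ hn) (Nat.cast_nonneg _)).trans (le_of_eq ?_)
      have hn0' : (0 : ℝ) < n := by exact_mod_cast hn0
      have : |θ / √n| ^ 2 = |θ| ^ 2 / n := by
        rw [abs_div, div_pow, sq_abs (√n), Real.sq_sqrt hn0'.le]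
      rw [pow_succ, this]
      ring
  simpa using h4.add h1

/-- Concentration in `L¹`: the variance bound is of order `(θ² / n) √n`. -/
lemma tendsto_integral_walkChar (hiid : IsIID P) (hell : Elliptic P) (hspan : SpanOne P)
    {m : ℕ → ℕ} {t : ℝ} (hm : Tendsto (fun n : ℕ => (m n : ℝ) / n) atTop (𝓝 t))
    (i τ : ℕ → ℤ) (θ : ℝ) :
    Tendsto (fun n : ℕ => ∫ ω, ‖walkChar ω (i n) (τ n) (m n) (θ / √n) -
      Complex.exp (Complex.I * (θ / √n : ℝ) * i n) * avgCharFun P (θ / √n) ^ m n‖ ∂P) atTop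
      (𝓝 0) := by
  obtain ⟨C, hC, hov⟩ := exists_sum_overlap_le hiid hell hspan
  set f : ℕ → Env M → ℝ := fun n ω => ‖walkChar ω (i n) (τ n) (m n) (θ / √n) -
      Complex.exp (Complex.I * (θ / √n : ℝ) * i n) * avgCharFun P (θ / √n) ^ m n‖ with hf
  have hfb : ∀ n, BddMeasurable univ (f n) := fun n =>
    ((bddMeasurable_walkChar _ _ _ _ (subset_univ _)).sub (BddMeasurable.const _)).norm
  have h1 : ∀ n, (∫ ω, f n ω ∂P) ^ 2 ≤ (2 * (M * |θ / √n|)) ^ 2 * (C * √(m n)) := fun n =>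
    (sq_integral_le ((hfb n).integrable P) (((hfb n).pow 2).integrable P)).trans
      ((integral_norm_walkChar_sub_sq_le hiid hspan _ _ _ _).trans
        (mul_le_mul_of_nonneg_left (hov _ _ _) (sq_nonneg _)))
  have h2 : Tendsto (fun n : ℕ => (2 * (M * |θ / √n|)) ^ 2 * (C * √(m n))) atTop (𝓝 0) := by
    have h3 : Tendsto (fun n : ℕ => (2 * M * |θ|) ^ 2 * C * (√((m n : ℝ) / n) * (1 / √n))) atTop
        (𝓝 ((2 * M * |θ|) ^ 2 * C * (√t * 0))) :=
      (((Real.continuous_sqrt.tendsto t).comp hm).mul (tendsto_div_sqrt_atTop 1)).const_mul _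
    rw [mul_zero, mul_zero] at h3
    refine h3.congr' ?_
    filter_upwards [eventually_gt_atTop 0] with n hn
    have hn' : (0 : ℝ) < √n := Real.sqrt_pos.2 (by exact_mod_cast hn)
    rw [Real.sqrt_div' _ (Nat.cast_nonneg n), abs_div, abs_of_pos hn']
    field_simp
  have h4 : Tendsto (fun n => (∫ ω, f n ω ∂P) ^ 2) atTop (𝓝 0) :=
    squeeze_zero (fun n => sq_nonneg _) h1 h2
  have h5 := (Real.continuous_sqrt.tendsto 0).comp h4
  rw [Real.sqrt_zero] at h5
  refine h5.congr fun n => ?_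
  exact Real.sqrt_sq (integral_nonneg fun ω => norm_nonneg _)

/-- Given the environment, the rescaled difference of the two walks behaves like a normal variable
with mean `q` and variance `σ_a² (t + t')`; the randomness of the environment is no longer visible
at this order. -/
lemma tendsto_integral_walkChar_mul (hiid : IsIID P) (hell : Elliptic P) (hspan : SpanOne P)
    {m m' : ℕ → ℕ} {t t' q : ℝ} (hm : Tendsto (fun n : ℕ => (m n : ℝ) / n) atTop (𝓝 t))
    (hm' : Tendsto (fun n : ℕ => (m' n : ℝ) / n) atTop (𝓝 t')) {i i' : ℕ → ℤ} (τ τ' : ℕ → ℤ)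
    (hq : Tendsto (fun n : ℕ => ((i n + m n * meanDrift P) - (i' n + m' n * meanDrift P)) / √n)
      atTop (𝓝 q)) (θ : ℝ) :
    Tendsto (fun n : ℕ => ∫ ω, ‖walkChar ω (i n) (τ n) (m n) (θ / √n) *
      (starRingEnd ℂ) (walkChar ω (i' n) (τ' n) (m' n) (θ / √n)) -
      Complex.exp (Complex.I * (θ * q : ℝ)) *
        Complex.exp (-(sigmaASq P * (t + t') * θ ^ 2 / 2 : ℝ))‖ ∂P) atTop (𝓝 0) := by
  set w : ℕ → ℂ := fun n => Complex.exp (Complex.I * (θ / √n : ℝ) * i n) *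
    avgCharFun P (θ / √n) ^ m n with hw
  set w' : ℕ → ℂ := fun n => Complex.exp (Complex.I * (θ / √n : ℝ) * i' n) *
    avgCharFun P (θ / √n) ^ m' n with hw'
  set L : ℂ := Complex.exp (Complex.I * (θ * q : ℝ)) *
        Complex.exp (-(sigmaASq P * (t + t') * θ ^ 2 / 2 : ℝ)) with hL
  have h1 : Tendsto (fun n => w n * (starRingEnd ℂ) (w' n)) atTop (𝓝 L) := by
    have h2 : Tendsto (fun n : ℕ => Complex.exp (Complex.I * (θ *
        (((i n + m n * meanDrift P) - (i' n + m' n * meanDrift P)) / √n) : ℝ))) atTop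
        (𝓝 (Complex.exp (Complex.I * (θ * q : ℝ)))) := by
      refine (Complex.continuous_exp.tendsto _).comp (Tendsto.const_mul _
        ((Complex.continuous_ofReal.tendsto _).comp (hq.const_mul θ)))
    have h3 := (tendsto_centredChar_pow hspan hm θ).mul
      ((Complex.continuous_conj.tendsto _).comp (tendsto_centredChar_pow hspan hm' θ))
    have h4 := h2.mul h3
    have e1 : Complex.exp (-(sigmaASq P * t * θ ^ 2 / 2 : ℝ)) * (starRingEnd ℂ)
        (Complex.exp (-(sigmaASq P * t' * θ ^ 2 / 2 : ℝ))) =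
        Complex.exp (-(sigmaASq P * (t + t') * θ ^ 2 / 2 : ℝ)) := by
      rw [← Complex.exp_conj, map_neg, Complex.conj_ofReal, ← Complex.exp_add]
      congr 1
      push_cast
      ring
    rw [e1] at h4
    refine h4.congr fun n => ?_
    simp only [Function.comp, hw, hw', centredChar, map_mul, map_pow, ← Complex.exp_conj, mul_pow,
      ← Complex.exp_nat_mul, map_neg, Complex.conj_I, Complex.conj_ofReal, map_intCast, map_natCast]
    have e2 : Complex.exp (Complex.I * (θ *
        (((i n + m n * meanDrift P) - (i' n + m' n * meanDrift P)) / √n) : ℝ)) *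
        (Complex.exp (m n * -(Complex.I * (θ / √n : ℝ) * meanDrift P)) *
        Complex.exp (m' n * -(-Complex.I * (θ / √n : ℝ) * meanDrift P))) =
        Complex.exp (Complex.I * (θ / √n : ℝ) * i n) *
          Complex.exp (-Complex.I * (θ / √n : ℝ) * i' n) := by
      rw [← Complex.exp_add, ← Complex.exp_add, ← Complex.exp_add]
      congr 1
      push_cast
      ring
    linear_combination (avgCharFun P (θ / √n) ^ m n *
      (starRingEnd ℂ) (avgCharFun P (θ / √n)) ^ m' n) * e2
  have hnw : ∀ n, ‖w n‖ ≤ 1 := by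
    intro n
    rw [hw]
    simp only
    rw [norm_mul, norm_exp_I_mul, one_mul, norm_pow]
    exact pow_le_one₀ (norm_nonneg _) (norm_avgCharFun_le hspan _)
  have h5 := ((tendsto_integral_walkChar hiid hell hspan hm i τ θ).add
    (tendsto_integral_walkChar hiid hell hspan hm' i' τ' θ)).add (tendsto_iff_norm_sub_tendsto_zero.1 h1)
  simp only [add_zero] at h5
  refine squeeze_zero (fun n => integral_nonneg fun ω => norm_nonneg _) (fun n => ?_) h5
  have b1 : BddMeasurable univ (fun ω : Env M => walkChar ω (i n) (τ n) (m n) (θ / √n)) :=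
    bddMeasurable_walkChar _ _ _ _ (subset_univ _)
  have b2 : BddMeasurable univ (fun ω : Env M => walkChar ω (i' n) (τ' n) (m' n) (θ / √n)) :=
    bddMeasurable_walkChar _ _ _ _ (subset_univ _)
  have i1 : Integrable (fun ω => ‖walkChar ω (i n) (τ n) (m n) (θ / √n) - w n‖) P :=
    (b1.sub (BddMeasurable.const _)).norm.integrable P
  have i2 : Integrable (fun ω => ‖walkChar ω (i' n) (τ' n) (m' n) (θ / √n) - w' n‖) P :=
    (b2.sub (BddMeasurable.const _)).norm.integrable P
  have i3 : Integrable (fun ω => ‖walkChar ω (i n) (τ n) (m n) (θ / √n) - w n‖ +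
      ‖walkChar ω (i' n) (τ' n) (m' n) (θ / √n) - w' n‖) P := i1.add i2
  calc _ ≤ ∫ ω, (‖walkChar ω (i n) (τ n) (m n) (θ / √n) - w n‖ +
        ‖walkChar ω (i' n) (τ' n) (m' n) (θ / √n) - w' n‖ +
        ‖w n * (starRingEnd ℂ) (w' n) - L‖) ∂P := by
        refine integral_mono ((((b1.mul b2.conj).sub (BddMeasurable.const _)).norm).integrable P)
          (i3.add (integrable_const _)) fun ω => ?_
        refine (norm_sub_le_norm_sub_add_norm_sub _ (w n * (starRingEnd ℂ) (w' n)) _).trans ?_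
        exact add_le_add_left (norm_mul_conj_sub_le (norm_walkChar_le _ _ _ _ _) (hnw n)) _
    _ = _ := by
        rw [integral_add i3 (integrable_const _), integral_add i1 i2, integral_const,
          probReal_univ, one_smul]

end scaling


/-! ### The quenched mean of the potential kernel on the diffusive scale. -/

section overlapLimit

lemma continuous_avgCharFun {M : ℕ} (P : Measure (Env M)) : Continuous (avgCharFun P) := by
  unfold avgCharFun
  fun_prop

variable {M : ℕ} {P : Measure (Env M)} [IsProbabilityMeasure P]

/-- The limit of the rescaled quenched mean of the potential kernel of the difference of two
walks. -/
def potLimit (σ2 t q : ℝ) : ℝ :=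
  1 / (2 * Real.pi) *
    ∫ θ : ℝ, (1 - Real.cos (θ * q) * Real.exp (-(σ2 * t * θ ^ 2 / 2))) / (σ2 * θ ^ 2)

/-- Supplies the domination of the rescaled denominator on the whole range `|θ| ≤ π√n`. -/
lemma exists_le_one_sub_norm_avgCharFun_sq (hspan : SpanOne P) :
    ∃ c : ℝ, 0 < c ∧ ∀ t : ℝ, |t| ≤ Real.pi → c * t ^ 2 ≤ 1 - ‖avgCharFun P t‖ ^ 2 := by
  obtain ⟨c, C, hc, hC, hb⟩ := exists_ratioFun_bounds (isSpanOneLaw_avgProb hspan)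
  have hπ := Real.pi_pos
  refine ⟨2 / Real.pi ^ 2 * c, by positivity, fun t ht => ?_⟩
  rw [one_sub_norm_avgCharFun_sq hspan]
  have h1 := Real.cos_le_one_sub_mul_cos_sq ht
  have h2 := (hb t (abs_le.1 ht)).1
  have h3 : 2 / Real.pi ^ 2 * t ^ 2 ≤ 1 - Real.cos t := by linarith
  calc 2 / Real.pi ^ 2 * c * t ^ 2 = (2 / Real.pi ^ 2 * t ^ 2) * c := by ring
    _ ≤ _ := mul_le_mul h3 h2 hc.le (by linarith [Real.cos_le_one t])

lemma tendsto_one_sub_cos_div_sq :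
    Tendsto (fun s : ℝ => (1 - Real.cos s) / s ^ 2) (𝓝[≠] 0) (𝓝 (1 / 2)) := by
  have h1 : ∀ᶠ s : ℝ in 𝓝[≠] 0, |(1 - Real.cos s) / s ^ 2 - 1 / 2| ≤ s ^ 2 * (5 / 96) := by
    have : ∀ᶠ s : ℝ in 𝓝[≠] 0, |s| ≤ 1 := by
      refine nhdsWithin_le_nhds ?_
      have := (continuous_abs.tendsto (0 : ℝ))
      rw [abs_zero] at this
      exact this.eventually_le_const one_pos
    filter_upwards [this, self_mem_nhdsWithin] with s hs hs0
    have hs0' : s ≠ 0 := hs0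
    have hb := Real.cos_bound hs
    have e : (1 - Real.cos s) / s ^ 2 - 1 / 2 = -(Real.cos s - (1 - s ^ 2 / 2)) / s ^ 2 := by
      field_simp; ring
    rw [e, abs_div, abs_neg, abs_of_nonneg (sq_nonneg s), div_le_iff₀ (by positivity)]
    refine hb.trans (le_of_eq ?_)
    rw [show |s| ^ 4 = (|s| ^ 2) ^ 2 by ring, sq_abs]
    ring
  have h2 : Tendsto (fun s : ℝ => s ^ 2 * (5 / 96)) (𝓝[≠] 0) (𝓝 0) := by
    have : Tendsto (fun s : ℝ => s ^ 2 * (5 / 96)) (𝓝 0) (𝓝 (0 ^ 2 * (5 / 96))) :=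
      (by fun_prop : Continuous fun s : ℝ => s ^ 2 * (5 / 96)).tendsto 0
    rw [zero_pow two_ne_zero, zero_mul] at this
    exact this.mono_left nhdsWithin_le_nhds
  have h3 := squeeze_zero_norm' (f := fun s : ℝ => (1 - Real.cos s) / s ^ 2 - 1 / 2) (h1.mono fun s hs => by simpa [Real.norm_eq_abs] using hs) h2
  have h4 := h3.add_const (1 / 2)
  simpa using h4

lemma tendsto_scaled_one_sub_norm_sq (hspan : SpanOne P) {θ : ℝ} (hθ : θ ≠ 0) :
    Tendsto (fun n : ℕ => n * (1 - ‖avgCharFun P (θ / √n)‖ ^ 2)) atTop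
      (𝓝 (sigmaASq P * θ ^ 2)) := by
  have h1 : Tendsto (fun n : ℕ => θ / √n) atTop (𝓝[≠] 0) := by
    rw [tendsto_nhdsWithin_iff]
    refine ⟨tendsto_div_sqrt_atTop θ, ?_⟩
    filter_upwards [eventually_gt_atTop 0] with n hn
    have hn' : (0 : ℝ) < √n := Real.sqrt_pos.2 (by exact_mod_cast hn)
    exact div_ne_zero hθ hn'.ne'
  have h2 := (tendsto_one_sub_cos_div_sq.comp h1).mul
    (((continuous_ratioFun M (avgProb P)).tendsto 0).comp (tendsto_div_sqrt_atTop θ))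
  have h3 := h2.const_mul (θ ^ 2)
  rw [ratioFun_zero hspan] at h3
  have e : θ ^ 2 * (1 / 2 * (2 * sigmaASq P)) = sigmaASq P * θ ^ 2 := by ring
  rw [e] at h3
  refine h3.congr' ?_
  filter_upwards [eventually_gt_atTop 0] with n hn
  have hn' : (0 : ℝ) < n := by exact_mod_cast hn
  simp only [Function.comp]
  rw [one_sub_norm_avgCharFun_sq hspan, div_pow, Real.sq_sqrt hn'.le]
  field_simp

lemma bddMeasurable_pairExp_univ (i τ : ℤ) (s : ℕ) (i' τ' : ℤ) (s' : ℕ) (F : ℤ → ℤ → ℝ) :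
    BddMeasurable univ (fun ω : Env M => pairExp ω i τ s i' τ' s' F) :=
  bddMeasurable_pairExp (S := univ) (F := fun _ => F) _ _ _ _ _ _ (subset_univ _) (subset_univ _)
    fun _ _ => BddMeasurable.const _

lemma integral_pairExp_sq_le (hiid : IsIID P) (hspan : SpanOne P) (i τ : ℤ) (s : ℕ) (i' τ' : ℤ)
    (s' : ℕ) :
    ∫ ω, pairExp ω i τ s i' τ' s' (fun x y => ((x - y : ℤ) : ℝ) ^ 2) ∂P ≤
      3 * ((s + s') * sigmaASq P +
        ((i + s * meanDrift P) - (i' + s' * meanDrift P)) ^ 2) := by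
  set δ := (i + s * meanDrift P) - (i' + s' * meanDrift P) with hδ
  set f : ℤ → ℝ := fun x => ((x : ℝ) - i - s * meanDrift P) ^ 2
  set g : ℤ → ℝ := fun x => ((x : ℝ) - i' - s' * meanDrift P) ^ 2
  have b1 := bddMeasurable_walkExp_univ (M := M) i τ s f
  have b2 := bddMeasurable_walkExp_univ (M := M) i' τ' s' g
  have i1 : Integrable (fun ω => 3 * walkExp ω i τ s f) P := (b1.integrable P).const_mul 3
  have i2 : Integrable (fun ω => 3 * walkExp ω i' τ' s' g + 3 * δ ^ 2) P :=
    ((b2.integrable P).const_mul 3).add (integrable_const _)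
  calc _ ≤ ∫ ω, (3 * walkExp ω i τ s f + (3 * walkExp ω i' τ' s' g + 3 * δ ^ 2)) ∂P := by
        refine integral_mono ((bddMeasurable_pairExp_univ i τ s i' τ' s' fun x y =>
          ((x - y : ℤ) : ℝ) ^ 2).integrable P) (i1.add i2) fun ω => ?_
        refine (pairExp_le_sum ω i τ s i' τ' s' (f := fun x => 3 * f x)
          (g := fun y => 3 * g y + 3 * δ ^ 2) fun x y => ?_).trans (le_of_eq ?_)
        · simp only [f, g]
          push_cast
          set u := (x : ℝ) - i - s * meanDrift P with hu
          set v := (y : ℝ) - i' - s' * meanDrift P with hv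
          have : (x : ℝ) - y = u - v + δ := by rw [hu, hv, hδ]; ring
          rw [this]
          nlinarith [sq_nonneg (u + v), sq_nonneg (u - δ), sq_nonneg (v + δ)]
        · rw [walkExp_mul_left, walkExp_add, walkExp_mul_left, walkExp_const]
    _ = _ := by
        rw [integral_add i1 i2, integral_add ((b2.integrable P).const_mul 3) (integrable_const _),
          integral_const_mul, integral_const_mul, integral_walkExp_sq hiid hspan,
          integral_walkExp_sq hiid hspan, integral_const, probReal_univ, one_smul]
        ring

/-- After rescaling this makes the mean numerator `O(θ²)` uniformly in `n`, which offsets the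
singularity `θ⁻²` at the origin. -/
lemma integral_one_sub_re_walkChar_le (hiid : IsIID P) (hspan : SpanOne P) (i τ : ℤ) (s : ℕ)
    (i' τ' : ℤ) (s' : ℕ) (t : ℝ) :
    ∫ ω, (1 - (walkChar ω i τ s t * (starRingEnd ℂ) (walkChar ω i' τ' s' t)).re) ∂P ≤
      t ^ 2 / 2 * (3 * ((s + s') * sigmaASq P +
        ((i + s * meanDrift P) - (i' + s' * meanDrift P)) ^ 2)) := by
  refine le_trans ?_ (mul_le_mul_of_nonneg_left (integral_pairExp_sq_le hiid hspan i τ s i' τ' s')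
    (by positivity))
  rw [← integral_const_mul]
  simp only [one_sub_re_walkChar]
  refine integral_mono ((bddMeasurable_pairExp_univ i τ s i' τ' s' fun x y =>
      1 - Real.cos (((x - y : ℤ) : ℝ) * t)).integrable P)
    (((bddMeasurable_pairExp_univ i τ s i' τ' s' fun x y =>
      ((x - y : ℤ) : ℝ) ^ 2).integrable P).const_mul _) fun ω => ?_
  dsimp only
  rw [← pairExp_const_mul]
  refine pairExp_mono _ _ _ _ _ _ _ fun x y => ?_
  have := Real.one_sub_sq_div_two_le_cos (x := ((x - y : ℤ) : ℝ) * t)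
  nlinarith

lemma norm_one_sub_re_le {z : ℂ} (hz : ‖z‖ ≤ 1) : 0 ≤ 1 - z.re ∧ 1 - z.re ≤ 2 := by
  have := abs_le.1 ((Complex.abs_re_le_norm z).trans hz)
  constructor <;> linarith [this.1, this.2]

lemma norm_walkChar_mul_conj_le (ω : Env M) (i τ : ℤ) (s : ℕ) (i' τ' : ℤ) (s' : ℕ) (t : ℝ) :
    ‖walkChar ω i τ s t * (starRingEnd ℂ) (walkChar ω i' τ' s' t)‖ ≤ 1 := by
  rw [norm_mul, Complex.norm_conj]
  exact mul_le_one₀ (norm_walkChar_le _ _ _ _ _) (norm_nonneg _) (norm_walkChar_le _ _ _ _ _)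

lemma measurable_walkChar_uncurry (i τ : ℤ) (s : ℕ) :
    Measurable (fun z : Env M × ℝ => walkChar z.1 i τ s z.2) := by
  simp only [walkChar, walkExp, Complex.real_smul]
  refine Finset.measurable_sum _ fun x _ => Measurable.mul (Complex.measurable_ofReal.comp
    ((measurable_mass i τ s x).comp measurable_fst)) ?_
  exact (by fun_prop : Continuous fun t : ℝ => Complex.exp (Complex.I * t * x)).measurable.comp
    measurable_snd

/-- Merges the bound useful near `0` and the bound useful at infinity into one integrable majorant.
-/
lemma min_le_two_mul_inv_one_add_sq {θ : ℝ} (hθ : θ ≠ 0) {A B u : ℝ}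
    (h1 : u ≤ A * θ ^ 2) (h2 : u ≤ B) : u / θ ^ 2 ≤ (A + B) * (1 + θ ^ 2)⁻¹ := by
  have hθ2 : 0 < θ ^ 2 := by positivity
  rw [div_le_iff₀ hθ2, mul_assoc, mul_comm _ (θ ^ 2), ← div_eq_mul_inv, ← mul_div_assoc,
    le_div_iff₀ (by positivity)]
  nlinarith

/-- The substitution `t = θ / √n` turns the Fourier integral, divided by `√n`, into an integral over
`|θ| ≤ π√n`. For fixed `θ ≠ 0` the integrand converges in `L¹(P)`, and its `L¹(P)` distance from the
limit is at most a constant times `(1 + θ²)⁻¹`. Dominated convergence is applied in `θ` to these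
`L¹` norms, and Tonelli brings the conclusion back to the expectation. -/
lemma tendsto_pairExp_potKer (hiid : IsIID P) (hell : Elliptic P) (hspan : SpanOne P)
    {m m' : ℕ → ℕ} {t t' q : ℝ} (hm : Tendsto (fun n : ℕ => (m n : ℝ) / n) atTop (𝓝 t))
    (hm' : Tendsto (fun n : ℕ => (m' n : ℝ) / n) atTop (𝓝 t')) {i i' : ℕ → ℤ} (τ τ' : ℕ → ℤ)
    (hq : Tendsto (fun n : ℕ => ((i n + m n * meanDrift P) - (i' n + m' n * meanDrift P)) / √n)
      atTop (𝓝 q)) :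
    Tendsto (fun n : ℕ => ∫ ω, |pairExp ω (i n) (τ n) (m n) (i' n) (τ' n) (m' n)
      (fun x y => potKer M (avgProb P) (x - y)) / √n - potLimit (sigmaASq P) (t + t') q| ∂P) atTop
      (𝓝 0) := by
  have hσ := sigmaASq_pos hspan
  have hπ := Real.pi_pos
  obtain ⟨c, hc, hclow⟩ := exists_le_one_sub_norm_avgCharFun_sq hspan
  have ht0 : 0 ≤ t := ge_of_tendsto' hm fun n => by positivity
  have ht0' : 0 ≤ t' := ge_of_tendsto' hm' fun n => by positivity
  set Q : ℕ → Env M → ℝ → ℂ := fun n ω θ => walkChar ω (i n) (τ n) (m n) (θ / √n) *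
      (starRingEnd ℂ) (walkChar ω (i' n) (τ' n) (m' n) (θ / √n)) with hQ
  set ψ : ℝ → ℂ := fun θ => Complex.exp (Complex.I * (θ * q : ℝ)) *
        Complex.exp (-(sigmaASq P * (t + t') * θ ^ 2 / 2 : ℝ)) with hψ
  have hψre : ∀ θ, (ψ θ).re =
      Real.cos (θ * q) * Real.exp (-(sigmaASq P * (t + t') * θ ^ 2 / 2)) := by
    intro θ
    simp only [hψ]
    rw [mul_comm Complex.I, ← Complex.ofReal_neg, ← Complex.ofReal_exp, Complex.re_mul_ofReal,
      Complex.exp_ofReal_mul_I_re]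
  have hψ1 : ∀ θ, ‖ψ θ‖ ≤ 1 := by
    intro θ
    simp only [hψ]
    rw [norm_mul, mul_comm Complex.I, Complex.norm_exp_ofReal_mul_I, one_mul, ← Complex.ofReal_neg,
      ← Complex.ofReal_exp, Complex.norm_real, Real.norm_of_nonneg (Real.exp_pos _).le,
      Real.exp_le_one_iff]
    have : 0 ≤ sigmaASq P * (t + t') * θ ^ 2 / 2 := by positivity
    linarith
  have hQ1 : ∀ n ω θ, ‖Q n ω θ‖ ≤ 1 := fun n ω θ => norm_walkChar_mul_conj_le _ _ _ _ _ _ _ _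
  -- The rescaled weight, extended by `0` beyond the image of `[-π, π]`, so that all integrals run
  -- over the line.
  set g : ℕ → ℝ → ℝ := fun n θ => if |θ| ≤ Real.pi * √n then
    (n * (1 - ‖avgCharFun P (θ / √n)‖ ^ 2))⁻¹ else 0 with hg
  set g' : ℝ → ℝ := fun θ => (sigmaASq P * θ ^ 2)⁻¹ with hg'
  set F : ℕ → Env M → ℝ → ℝ := fun n ω θ => (1 - (Q n ω θ).re) * g n θ - (1 - (ψ θ).re) * g' θ
    with hF
  have hg'0 : ∀ θ, 0 ≤ g' θ := fun θ => by simp only [hg']; positivity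
  have hden : ∀ {n : ℕ}, 0 < n → ∀ {θ : ℝ}, |θ| ≤ Real.pi * √n →
      c * θ ^ 2 ≤ n * (1 - ‖avgCharFun P (θ / √n)‖ ^ 2) := by
    intro n hn θ hθ
    have hn' : (0 : ℝ) < n := by exact_mod_cast hn
    have hs : (0 : ℝ) < √n := Real.sqrt_pos.2 hn'
    have h1 := hclow (θ / √n) (by rw [abs_div, abs_of_pos hs, div_le_iff₀ hs]; exact hθ)
    rw [div_pow, Real.sq_sqrt hn'.le] at h1
    have h2 := mul_le_mul_of_nonneg_left h1 hn'.le
    refine le_trans (le_of_eq ?_) h2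
    field_simp
  have hgle : ∀ {n : ℕ}, 0 < n → ∀ {θ : ℝ}, θ ≠ 0 → 0 ≤ g n θ ∧ g n θ ≤ (c * θ ^ 2)⁻¹ := by
    intro n hn θ hθ
    have hpos : 0 < c * θ ^ 2 := by positivity
    simp only [hg]
    split_ifs with h
    · have h1 := hden hn h
      exact ⟨inv_nonneg.2 (hpos.le.trans h1), inv_anti₀ hpos h1⟩
    · exact ⟨le_rfl, inv_nonneg.2 hpos.le⟩
  -- pointwise limit of the weights
  have hglim : ∀ θ : ℝ, θ ≠ 0 → Tendsto (fun n => g n θ) atTop (𝓝 (g' θ)) := by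
    intro θ hθ
    have h1 := (tendsto_scaled_one_sub_norm_sq hspan hθ).inv₀ (by positivity)
    refine h1.congr' ?_
    have h2 : Tendsto (fun n : ℕ => Real.pi * √n) atTop atTop :=
      (Real.tendsto_sqrt_atTop.comp tendsto_natCast_atTop_atTop).const_mul_atTop hπ
    filter_upwards [h2.eventually_ge_atTop |θ|] with n hn
    simp only [hg]
    rw [if_pos hn]
  -- moment bound
  obtain ⟨K, hK0, hK⟩ : ∃ K : ℝ, 0 ≤ K ∧ ∀ᶠ n : ℕ in atTop, ∀ θ,
      ∫ ω, (1 - (Q n ω θ).re) ∂P ≤ K * θ ^ 2 := by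
    have h1 : Tendsto (fun n : ℕ => 1 / 2 * (3 * (((m n : ℝ) / n + (m' n : ℝ) / n) * sigmaASq P +
        (((i n + m n * meanDrift P) - (i' n + m' n * meanDrift P)) / √n) ^ 2))) atTop
        (𝓝 (1 / 2 * (3 * ((t + t') * sigmaASq P + q ^ 2)))) :=
      ((((hm.add hm').mul_const _).add (hq.pow 2)).const_mul 3).const_mul _
    refine ⟨1 / 2 * (3 * ((t + t') * sigmaASq P + q ^ 2)) + 1, by positivity, ?_⟩
    filter_upwards [h1.eventually_le_const (lt_add_one _), eventually_gt_atTop 0] with n hn hn0 θ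
    have hn' : (0 : ℝ) < n := by exact_mod_cast hn0
    refine (integral_one_sub_re_walkChar_le hiid hspan _ _ _ _ _ _ _).trans ?_
    refine le_trans (le_of_eq ?_) (mul_le_mul_of_nonneg_right hn (sq_nonneg θ))
    rw [div_pow, div_pow, Real.sq_sqrt hn'.le]
    field_simp
  -- The limit inherits the quadratic bound from the approximants, with the same constant `K`.
  have hψK : ∀ θ, 1 - (ψ θ).re ≤ K * θ ^ 2 := by
    intro θ
    have hlim := tendsto_integral_walkChar_mul hiid hell hspan hm hm' τ τ' hq θ
    have h1 : Tendsto (fun n => K * θ ^ 2 + ∫ ω, ‖Q n ω θ - ψ θ‖ ∂P) atTop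
        (𝓝 (K * θ ^ 2 + 0)) := hlim.const_add _
    rw [add_zero] at h1
    refine ge_of_tendsto h1 ?_
    filter_upwards [hK] with n hn
    refine le_trans ?_ (add_le_add_left (hn θ) _)
    have bQ : BddMeasurable univ (fun ω => Q n ω θ) :=
      (bddMeasurable_walkChar _ _ _ _ (subset_univ _)).mul
        (bddMeasurable_walkChar _ _ _ _ (subset_univ _)).conj
    have i1 : Integrable (fun ω => (1 - (Q n ω θ).re)) P :=
      (integrable_const _).sub (bQ.integrable P).re
    have i2 : Integrable (fun ω => ‖Q n ω θ - ψ θ‖) P :=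
      (bQ.sub (BddMeasurable.const _)).norm.integrable P
    rw [← integral_add i1 i2]
    have : 1 - (ψ θ).re = ∫ _, (1 - (ψ θ).re) ∂P := by simp
    rw [this]
    refine integral_mono (integrable_const _) (i1.add i2) fun ω => ?_
    have h2 := (abs_le.1 (Complex.abs_re_le_norm (Q n ω θ - ψ θ))).2
    rw [Complex.sub_re] at h2
    simp only
    linarith
  -- measurability
  have hQmeas : ∀ n, Measurable (fun z : Env M × ℝ => Q n z.1 z.2) := by
    intro n
    have h1 : Measurable (fun z : Env M × ℝ => (z.1, z.2 / √n)) :=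
      measurable_fst.prodMk (measurable_snd.div_const _)
    exact ((measurable_walkChar_uncurry _ _ _).comp h1).mul
      (Complex.continuous_conj.measurable.comp ((measurable_walkChar_uncurry _ _ _).comp h1))
  have hgmeas : ∀ n, Measurable (g n) := by
    intro n
    refine Measurable.ite (measurableSet_le (by fun_prop) (by fun_prop)) ?_ measurable_const
    have h1 : Measurable (fun θ : ℝ => avgCharFun P (θ / √n)) :=
      (continuous_avgCharFun P).measurable.comp (by fun_prop)
    exact ((measurable_const.sub (h1.norm.pow_const 2)).const_mul _).inv
  have hψmeas : Measurable ψ := by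
    simp only [hψ]; fun_prop
  have hFmeas : ∀ n, Measurable (fun z : Env M × ℝ => F n z.1 z.2) := by
    intro n
    refine Measurable.sub (Measurable.mul (measurable_const.sub
      (Complex.measurable_re.comp (hQmeas n))) ((hgmeas n).comp measurable_snd)) ?_
    exact (Measurable.mul (measurable_const.sub (Complex.measurable_re.comp hψmeas))
      (by simp only [hg']; fun_prop)).comp measurable_snd
  -- the dominating function
  set D : ℝ := (K + 2) / c + (K + 2) / sigmaASq P with hD
  have hdom : ∀ᶠ n : ℕ in atTop, ∀ θ, θ ≠ 0 → ∫⁻ ω, ‖F n ω θ‖ₑ ∂P ≤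
      ENNReal.ofReal (D * (1 + θ ^ 2)⁻¹) := by
    filter_upwards [hK, eventually_gt_atTop 0] with n hn hn0 θ hθ
    have bQ : BddMeasurable univ (fun ω => Q n ω θ) :=
      (bddMeasurable_walkChar _ _ _ _ (subset_univ _)).mul
        (bddMeasurable_walkChar _ _ _ _ (subset_univ _)).conj
    have i1 : Integrable (fun ω => (1 - (Q n ω θ).re)) P :=
      (integrable_const _).sub (bQ.integrable P).re
    have i2 : Integrable (fun ω => F n ω θ) P := (i1.mul_const _).sub (integrable_const _)
    rw [← ofReal_integral_norm_eq_lintegral_enorm i2]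
    refine ENNReal.ofReal_le_ofReal ?_
    obtain ⟨hg0, hg1⟩ := hgle hn0 hθ
    have hψ0 := norm_one_sub_re_le (hψ1 θ)
    calc ∫ ω, ‖F n ω θ‖ ∂P ≤ ∫ ω, ((1 - (Q n ω θ).re) * g n θ + (1 - (ψ θ).re) * g' θ) ∂P := by
          refine integral_mono i2.norm ((i1.mul_const _).add (integrable_const _)) fun ω => ?_
          simp only [hF, Real.norm_eq_abs]
          refine (abs_sub _ _).trans (le_of_eq ?_)
          rw [abs_of_nonneg (mul_nonneg (norm_one_sub_re_le (hQ1 n ω θ)).1 hg0),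
            abs_of_nonneg (mul_nonneg hψ0.1 (hg'0 θ))]
      _ = (∫ ω, (1 - (Q n ω θ).re) ∂P) * g n θ + (1 - (ψ θ).re) * g' θ := by
          rw [integral_add (i1.mul_const _) (integrable_const _), integral_mul_const,
            integral_const, probReal_univ, one_smul]
      _ ≤ D * (1 + θ ^ 2)⁻¹ := by
          rw [hD, add_mul]
          have hI0 : 0 ≤ ∫ ω, (1 - (Q n ω θ).re) ∂P :=
            integral_nonneg fun ω => (norm_one_sub_re_le (hQ1 n ω θ)).1
          have hI2 : ∫ ω, (1 - (Q n ω θ).re) ∂P ≤ 2 := by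
            have : (2 : ℝ) = ∫ _, 2 ∂P := by simp
            rw [this]
            exact integral_mono i1 (integrable_const _)
              fun ω => (norm_one_sub_re_le (hQ1 n ω θ)).2
          refine add_le_add ?_ ?_
          · calc _ ≤ (∫ ω, (1 - (Q n ω θ).re) ∂P) * (c * θ ^ 2)⁻¹ :=
                  mul_le_mul_of_nonneg_left hg1 hI0
              _ = 1 / c * ((∫ ω, (1 - (Q n ω θ).re) ∂P) / θ ^ 2) := by
                  rw [mul_inv]; ring
              _ ≤ 1 / c * ((K + 2) * (1 + θ ^ 2)⁻¹) := mul_le_mul_of_nonneg_left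
                  (min_le_two_mul_inv_one_add_sq hθ (hn θ) hI2) (by positivity)
              _ = _ := by ring
          · calc (1 - (ψ θ).re) * g' θ = 1 / sigmaASq P * ((1 - (ψ θ).re) / θ ^ 2) := by
                  simp only [hg']; rw [mul_inv]; ring
              _ ≤ 1 / sigmaASq P * ((K + 2) * (1 + θ ^ 2)⁻¹) := mul_le_mul_of_nonneg_left
                  (min_le_two_mul_inv_one_add_sq hθ (hψK θ) hψ0.2) (by positivity)
              _ = _ := by ring
  have hne : ∀ᵐ θ ∂(volume : Measure ℝ), θ ≠ 0 := by
    rw [ae_iff]; simp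
  -- pointwise convergence of the inner integral
  have hptw : ∀ θ, θ ≠ 0 → Tendsto (fun n => ∫⁻ ω, ‖F n ω θ‖ₑ ∂P) atTop (𝓝 0) := by
    intro θ hθ
    have hlim := tendsto_integral_walkChar_mul hiid hell hspan hm hm' τ τ' hq θ
    have h1 : Tendsto (fun n => (∫ ω, ‖Q n ω θ - ψ θ‖ ∂P) * (c * θ ^ 2)⁻¹ +
        2 * |g n θ - g' θ|) atTop (𝓝 (0 * (c * θ ^ 2)⁻¹ + 2 * |g' θ - g' θ|)) :=
      (hlim.mul_const _).add (((hglim θ hθ).sub_const _).abs.const_mul 2)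
    rw [zero_mul, sub_self, abs_zero, mul_zero, add_zero] at h1
    have h2 := ENNReal.tendsto_ofReal h1
    rw [ENNReal.ofReal_zero] at h2
    refine tendsto_of_tendsto_of_tendsto_of_le_of_le' tendsto_const_nhds h2
      (Eventually.of_forall fun n => zero_le) ?_
    filter_upwards [eventually_gt_atTop 0] with n hn0
    have bQ : BddMeasurable univ (fun ω => Q n ω θ) :=
      (bddMeasurable_walkChar _ _ _ _ (subset_univ _)).mul
        (bddMeasurable_walkChar _ _ _ _ (subset_univ _)).conj
    have i1 : Integrable (fun ω => (1 - (Q n ω θ).re)) P :=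
      (integrable_const _).sub (bQ.integrable P).re
    have i2 : Integrable (fun ω => F n ω θ) P := (i1.mul_const _).sub (integrable_const _)
    have i3 : Integrable (fun ω => ‖Q n ω θ - ψ θ‖) P :=
      (bQ.sub (BddMeasurable.const _)).norm.integrable P
    rw [← ofReal_integral_norm_eq_lintegral_enorm i2]
    refine ENNReal.ofReal_le_ofReal ?_
    obtain ⟨hg0, hg1⟩ := hgle hn0 hθ
    calc _ ≤ ∫ ω, (‖Q n ω θ - ψ θ‖ * (c * θ ^ 2)⁻¹ + 2 * |g n θ - g' θ|) ∂P := by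
          refine integral_mono i2.norm ((i3.mul_const _).add (integrable_const _)) fun ω => ?_
          have e : F n ω θ = (ψ θ - Q n ω θ).re * g n θ + (1 - (ψ θ).re) * (g n θ - g' θ) := by
            simp only [hF, Complex.sub_re]; ring
          simp only
          rw [e, Real.norm_eq_abs]
          refine (abs_add_le _ _).trans (add_le_add ?_ ?_)
          · rw [abs_mul, abs_of_nonneg hg0]
            refine mul_le_mul ?_ hg1 hg0 (norm_nonneg _)
            rw [norm_sub_rev]
            exact Complex.abs_re_le_norm _
          · rw [abs_mul]
            refine mul_le_mul_of_nonneg_right ?_ (abs_nonneg _)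
            have := norm_one_sub_re_le (hψ1 θ)
            rw [abs_of_nonneg this.1]
            exact this.2
      _ = _ := by
          rw [integral_add (i3.mul_const _) (integrable_const _), integral_mul_const,
            integral_const, probReal_univ, one_smul]
  have hDCT : Tendsto (fun n => ∫⁻ θ : ℝ, ∫⁻ ω, ‖F n ω θ‖ₑ ∂P) atTop
      (𝓝 (∫⁻ _ : ℝ, 0)) := by
    refine tendsto_lintegral_filter_of_dominated_convergence
      (fun θ => ENNReal.ofReal (D * (1 + θ ^ 2)⁻¹)) ?_ ?_ ?_ ?_
    · exact Eventually.of_forall fun n =>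
        Measurable.lintegral_prod_left' (f := fun z : Env M × ℝ => ‖F n z.1 z.2‖ₑ) (hFmeas n).enorm
    · filter_upwards [hdom] with n hn
      filter_upwards [hne] with θ hθ using hn θ hθ
    · have : Integrable (fun θ : ℝ => D * (1 + θ ^ 2)⁻¹) := integrable_inv_one_add_sq.const_mul D
      exact this.lintegral_lt_top.ne
    · filter_upwards [hne] with θ hθ using hptw θ hθ
  rw [lintegral_zero] at hDCT
  -- the representation
  have hrep : ∀ᶠ n : ℕ in atTop, ∀ ω : Env M,
      pairExp ω (i n) (τ n) (m n) (i' n) (τ' n) (m' n)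
      (fun x y => potKer M (avgProb P) (x - y)) / √n =
      1 / (2 * Real.pi) * ∫ θ : ℝ, (1 - (Q n ω θ).re) * g n θ := by
    filter_upwards [eventually_gt_atTop 0] with n hn ω
    have hn' : (0 : ℝ) < n := by exact_mod_cast hn
    have hs : (0 : ℝ) < √n := Real.sqrt_pos.2 hn'
    rw [pairExp_potKer_eq hspan, mul_div_assoc]
    congr 1
    have e1 : ∀ θ, (1 - (Q n ω θ).re) * g n θ = (Icc (-(Real.pi * √n)) (Real.pi * √n)).indicator
        (fun θ => (n : ℝ)⁻¹ * ((fun t => (1 - (walkChar ω (i n) (τ n) (m n) t *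
          (starRingEnd ℂ) (walkChar ω (i' n) (τ' n) (m' n) t)).re) /
          (1 - ‖avgCharFun P t‖ ^ 2)) (θ / √n))) θ := by
      intro θ
      simp only [hg, Set.indicator_apply, mem_Icc, ← abs_le, hQ]
      split_ifs with h
      · rw [mul_inv, div_eq_mul_inv]; ring
      · rw [mul_zero]
    simp only [e1]
    have e2 := intervalIntegral.integral_comp_div (a := -(Real.pi * √n)) (b := Real.pi * √n)
      (fun t => (1 - (walkChar ω (i n) (τ n) (m n) t *
          (starRingEnd ℂ) (walkChar ω (i' n) (τ' n) (m' n) t)).re) /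
          (1 - ‖avgCharFun P t‖ ^ 2)) hs.ne'
    rw [neg_div, mul_div_cancel_right₀ _ hs.ne', smul_eq_mul] at e2
    rw [integral_indicator measurableSet_Icc, integral_Icc_eq_integral_Ioc,
      ← intervalIntegral.integral_of_le (by nlinarith), intervalIntegral.integral_const_mul,
      e2, ← mul_assoc, mul_comm, div_eq_mul_inv]
    congr 1
    have e3 : (n : ℝ) = √n * √n := (Real.mul_self_sqrt hn'.le).symm
    rw [e3, Real.sqrt_mul_self hs.le, mul_inv, mul_assoc, inv_mul_cancel₀ hs.ne', mul_one]
  have hψint : Integrable (fun θ => (1 - (ψ θ).re) * g' θ) := by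
    refine Integrable.mono' (integrable_inv_one_add_sq.const_mul ((K + 2) / sigmaASq P)) ?_ ?_
    · exact (Measurable.mul (measurable_const.sub (Complex.measurable_re.comp hψmeas))
        (by simp only [hg']; fun_prop)).aestronglyMeasurable
    · filter_upwards [hne] with θ hθ
      have hψ0 := norm_one_sub_re_le (hψ1 θ)
      rw [Real.norm_of_nonneg (mul_nonneg hψ0.1 (hg'0 θ))]
      calc (1 - (ψ θ).re) * g' θ = 1 / sigmaASq P * ((1 - (ψ θ).re) / θ ^ 2) := by
            simp only [hg']; rw [mul_inv]; ring
        _ ≤ 1 / sigmaASq P * ((K + 2) * (1 + θ ^ 2)⁻¹) := mul_le_mul_of_nonneg_left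
            (min_le_two_mul_inv_one_add_sq hθ (hψK θ) hψ0.2) (by positivity)
        _ = _ := by ring
  have hlimrep : potLimit (sigmaASq P) (t + t') q =
      1 / (2 * Real.pi) * ∫ θ : ℝ, (1 - (ψ θ).re) * g' θ := by
    unfold potLimit
    congr 1
    refine integral_congr_ae (ae_of_all _ fun θ => ?_)
    simp only [hψre, hg', div_eq_mul_inv]
  -- conclusion
  have hfin : ∀ᶠ n : ℕ in atTop, ∫ ω, |pairExp ω (i n) (τ n) (m n) (i' n) (τ' n) (m' n)
      (fun x y => potKer M (avgProb P) (x - y)) / √n - potLimit (sigmaASq P) (t + t') q| ∂P ≤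
      1 / (2 * Real.pi) * (∫⁻ θ : ℝ, ∫⁻ ω, ‖F n ω θ‖ₑ ∂P).toReal := by
    have hfinite : ∀ᶠ n : ℕ in atTop, ∫⁻ θ : ℝ, ∫⁻ ω, ‖F n ω θ‖ₑ ∂P < ∞ :=
      hDCT.eventually_lt_const ENNReal.zero_lt_top
    filter_upwards [hrep, hfinite, hdom] with n hn hnf hnd
    have hFint : Integrable (fun z : Env M × ℝ => F n z.1 z.2) (P.prod volume) := by
      refine ⟨(hFmeas n).aestronglyMeasurable, ?_⟩
      rw [hasFiniteIntegral_iff_enorm, lintegral_prod_symm _ (hFmeas n).enorm.aemeasurable]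
      exact hnf
    have h1 : ∀ᵐ ω ∂P, |pairExp ω (i n) (τ n) (m n) (i' n) (τ' n) (m' n)
      (fun x y => potKer M (avgProb P) (x - y)) / √n - potLimit (sigmaASq P) (t + t') q| ≤
        1 / (2 * Real.pi) * ∫ θ : ℝ, ‖F n ω θ‖ := by
      filter_upwards [hFint.prod_right_ae] with ω hω
      have h2 : Integrable (fun θ => (1 - (Q n ω θ).re) * g n θ) := by
        have := hω.add hψint
        refine this.congr (ae_of_all _ fun θ => ?_)
        simp only [hF, Pi.add_apply, sub_add_cancel]
      rw [hn, hlimrep, ← mul_sub, ← integral_sub h2 hψint, abs_mul,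
        abs_of_pos (by positivity : 0 < 1 / (2 * Real.pi))]
      exact mul_le_mul_of_nonneg_left
        (norm_integral_le_integral_norm (fun θ => (1 - (Q n ω θ).re) * g n θ - (1 - (ψ θ).re) * g' θ))
        (by positivity)
    refine (integral_mono_of_nonneg (ae_of_all _ fun ω => abs_nonneg _)
      (hFint.norm.integral_prod_left.const_mul _) h1).trans (le_of_eq ?_)
    rw [integral_const_mul]
    congr 1
    rw [← integral_prod (fun z : Env M × ℝ => ‖F n z.1 z.2‖) hFint.norm,
      integral_norm_eq_lintegral_enorm hFint.aestronglyMeasurable,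
      lintegral_prod_symm _ (hFmeas n).enorm.aemeasurable]
  have h0 : Tendsto (fun n => 1 / (2 * Real.pi) *
      (∫⁻ θ : ℝ, ∫⁻ ω, ‖F n ω θ‖ₑ ∂P).toReal) atTop (𝓝 0) := by
    have := ((ENNReal.tendsto_toReal ENNReal.zero_ne_top).comp hDCT).const_mul (1 / (2 * Real.pi))
    simpa using this
  exact squeeze_zero' (Eventually.of_forall fun n => integral_nonneg fun ω => abs_nonneg _) hfin h0

end overlapLimit


/-! ### Evaluation of the limiting integral through Gaussian densities. -/

section potLimitEval

lemma one_sub_cos_mul_exp_bounds {x y : ℝ} (hy : 0 ≤ y) :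
    0 ≤ 1 - Real.cos x * Real.exp (-y) ∧ 1 - Real.cos x * Real.exp (-y) ≤ x ^ 2 / 2 + y ∧
      1 - Real.cos x * Real.exp (-y) ≤ 2 := by
  have he : Real.exp (-y) ≤ 1 := Real.exp_le_one_iff.2 (by linarith)
  have he0 := Real.exp_pos (-y)
  have he1 := Real.one_sub_le_exp_neg y
  have hc := Real.one_sub_sq_div_two_le_cos (x := x)
  have hc1 := Real.cos_le_one x
  have hc2 := Real.neg_one_le_cos x
  refine ⟨by nlinarith, ?_, by nlinarith⟩
  nlinarith [mul_nonneg (sub_nonneg.2 he) (sub_nonneg.2 hc1)]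

lemma integrable_potLimit_integrand {σ2 t : ℝ} (hσ : 0 < σ2) (ht : 0 ≤ t) (q : ℝ) :
    Integrable fun θ : ℝ =>
      (1 - Real.cos (θ * q) * Real.exp (-(σ2 * t * θ ^ 2 / 2))) / (σ2 * θ ^ 2) := by
  have hne : ∀ᵐ θ ∂(volume : Measure ℝ), θ ≠ 0 := by
    rw [ae_iff]; simp
  refine Integrable.mono' (integrable_inv_one_add_sq.const_mul
    ((q ^ 2 / 2 + σ2 * t / 2 + 2) / σ2)) (Measurable.aestronglyMeasurable (by fun_prop)) ?_
  filter_upwards [hne] with θ hθ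
  have hb := one_sub_cos_mul_exp_bounds (x := θ * q) (y := σ2 * t * θ ^ 2 / 2) (by positivity)
  rw [Real.norm_of_nonneg (div_nonneg hb.1 (by positivity))]
  have h1 := min_le_two_mul_inv_one_add_sq hθ (A := q ^ 2 / 2 + σ2 * t / 2) (B := 2)
    (hb.2.1.trans (le_of_eq (by ring))) hb.2.2
  calc _ = 1 / σ2 * ((1 - Real.cos (θ * q) * Real.exp (-(σ2 * t * θ ^ 2 / 2))) / θ ^ 2) := by
        field_simp
    _ ≤ 1 / σ2 * ((q ^ 2 / 2 + σ2 * t / 2 + 2) * (1 + θ ^ 2)⁻¹) :=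
        mul_le_mul_of_nonneg_left h1 (by positivity)
    _ = _ := by ring

lemma integral_cos_mul_exp {v : ℝ} (hv : 0 < v) (q : ℝ) :
    ∫ θ : ℝ, Real.cos (θ * q) * Real.exp (-(v * θ ^ 2 / 2)) =
      2 * Real.pi * (1 / √(2 * Real.pi * v) * Real.exp (-(1 / (2 * v)) * q ^ 2)) := by
  have hπ := Real.pi_pos
  have h := fourierIntegral_gaussian (b := ((v / 2 : ℝ) : ℂ)) (by simpa using hv) (q : ℂ)
  have e1 : ∀ θ : ℝ, Complex.exp (Complex.I * q * θ) * Complex.exp (-((v / 2 : ℝ) : ℂ) * θ ^ 2) =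
      Complex.exp ((θ * q : ℝ) * Complex.I) * (Real.exp (-(v * θ ^ 2 / 2)) : ℝ) := by
    intro θ
    push_cast
    congr 2 <;> ring
  have e2 : ((Real.pi : ℂ) / ((v / 2 : ℝ) : ℂ)) ^ (1 / 2 : ℂ) *
      Complex.exp (-(q : ℂ) ^ 2 / (4 * ((v / 2 : ℝ) : ℂ))) =
      ((√(Real.pi / (v / 2)) * Real.exp (-q ^ 2 / (4 * (v / 2))) : ℝ) : ℂ) := by
    rw [Real.sqrt_eq_rpow, Complex.ofReal_mul, Complex.ofReal_cpow (by positivity)]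
    push_cast
    rfl
  have hint : Integrable fun θ : ℝ => Complex.exp ((θ * q : ℝ) * Complex.I) *
      (Real.exp (-(v * θ ^ 2 / 2)) : ℝ) := by
    have h1 : Integrable fun θ : ℝ => Real.exp (-(v / 2) * θ ^ 2) :=
      integrable_exp_neg_mul_sq (by positivity)
    refine h1.mono' (Continuous.aestronglyMeasurable (by fun_prop)) (ae_of_all _ fun θ => ?_)
    rw [norm_mul, Complex.norm_exp_ofReal_mul_I, one_mul, Complex.norm_real,
      Real.norm_of_nonneg (Real.exp_pos _).le]
    exact le_of_eq (by ring_nf)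
  simp only [e1] at h
  rw [e2] at h
  have h2 := congrArg Complex.re h
  have h3 := integral_re hint
  simp only [RCLike.re_to_complex] at h3
  rw [← h3, Complex.ofReal_re] at h2
  simp only [Complex.re_mul_ofReal, Complex.exp_ofReal_mul_I_re] at h2
  rw [h2, ← mul_assoc]
  congr 1
  · rw [show Real.pi / (v / 2) = (2 * Real.pi) ^ 2 / (2 * Real.pi * v) by field_simp,
      Real.sqrt_div (by positivity), Real.sqrt_sq (by positivity)]
    ring
  · congr 1; field_simp; ring

lemma integral_exp_neg_mul_half (u θ a b : ℝ) (hθ : θ ≠ 0) :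
    ∫ v in a..b, u * Real.exp (-(v * θ ^ 2 / 2)) =
      2 * u * (Real.exp (-(a * θ ^ 2 / 2)) - Real.exp (-(b * θ ^ 2 / 2))) / θ ^ 2 := by
  have h : ∀ v ∈ uIcc a b, HasDerivAt (fun v => -(2 * u / θ ^ 2) * Real.exp (-(v * θ ^ 2 / 2)))
      (u * Real.exp (-(v * θ ^ 2 / 2))) v := by
    intro v _
    have h1 : HasDerivAt (fun v : ℝ => -(v * θ ^ 2 / 2)) (-(1 * θ ^ 2 / 2)) v :=
      (((hasDerivAt_id v).mul_const _).div_const _).neg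
    refine (h1.exp.const_mul (-(2 * u / θ ^ 2))).congr_deriv ?_
    field_simp
  rw [intervalIntegral.integral_eq_sub_of_hasDerivAt h
    (Continuous.intervalIntegrable (by fun_prop) _ _)]
  ring

lemma intervalIntegrable_inv_sqrt (a b : ℝ) :
    IntervalIntegrable (fun v : ℝ => 1 / √(2 * Real.pi * v)) volume a b := by
  have h := (intervalIntegral.intervalIntegrable_rpow' (r := -(1 / 2)) (by norm_num)
    (a := a) (b := b)).norm.const_mul (1 / √(2 * Real.pi))
  refine h.mono_fun (Measurable.aestronglyMeasurable (by fun_prop)) (ae_of_all _ fun v => ?_)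
  dsimp only
  -- For `v ≤ 0` the square root is `0` and its reciprocal is `0` by convention.
  rcases le_total v 0 with hv | hv
  · rw [Real.sqrt_eq_zero_of_nonpos (mul_nonpos_of_nonneg_of_nonpos (by positivity) hv), div_zero,
      norm_zero]
    exact norm_nonneg _
  · rw [Real.sqrt_mul (by positivity) v, one_div, mul_inv, Real.sqrt_eq_rpow v,
      ← Real.rpow_neg hv, norm_mul, norm_mul, norm_norm, one_div (√(2 * Real.pi))]

/-- The difference of the exponentials over `θ²` is half the integral over `v` of `exp (-vθ²/2)`.
This removes the singularity at `θ = 0`; after Fubini the inner integral in `θ` is the Fourier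
transform of a Gaussian, that is, the normal density of variance `v`. -/
lemma potLimit_sub_potLimit {σ2 s t : ℝ} (hσ : 0 < σ2) (hs : 0 ≤ s) (hst : s ≤ t) (q : ℝ) :
    potLimit σ2 t q - potLimit σ2 s q =
      1 / (2 * σ2) * ∫ v in (σ2 * s)..(σ2 * t),
        1 / √(2 * Real.pi * v) * Real.exp (-(1 / (2 * v)) * q ^ 2) := by
  have hπ := Real.pi_pos
  have hab : σ2 * s ≤ σ2 * t := mul_le_mul_of_nonneg_left hst hσ.le
  have ha : 0 ≤ σ2 * s := by positivity
  have hne : ∀ᵐ θ ∂(volume : Measure ℝ), θ ≠ 0 := by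
    rw [ae_iff]; simp
  set G : ℝ → ℝ → ℝ := fun v θ => Real.cos (θ * q) * Real.exp (-(v * θ ^ 2 / 2)) with hG
  have hGint : Integrable (Function.uncurry G) ((volume.restrict (Ioc (σ2 * s) (σ2 * t))).prod
      volume) := by
    have hmeas : AEStronglyMeasurable (Function.uncurry G)
        ((volume.restrict (Ioc (σ2 * s) (σ2 * t))).prod volume) :=
      Continuous.aestronglyMeasurable (by simp only [hG, Function.uncurry_def]; fun_prop)
    have hdom : ∀ {v : ℝ}, 0 < v → Integrable fun θ : ℝ => Real.exp (-(v * θ ^ 2 / 2)) := by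
      intro v hv
      have := integrable_exp_neg_mul_sq (b := v / 2) (by positivity)
      exact this.congr (ae_of_all _ fun θ => by simp only; ring_nf)
    have hle : ∀ v θ : ℝ, ‖G v θ‖ ≤ Real.exp (-(v * θ ^ 2 / 2)) := by
      intro v θ
      simp only [hG]
      rw [norm_mul, Real.norm_of_nonneg (Real.exp_pos _).le, Real.norm_eq_abs]
      exact mul_le_of_le_one_left (Real.exp_pos _).le (Real.abs_cos_le_one _)
    rw [integrable_prod_iff hmeas]
    constructor
    · refine (ae_restrict_iff' measurableSet_Ioc).2 (ae_of_all _ fun v hv => ?_)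
      exact (hdom (ha.trans_lt hv.1)).mono'
        (Continuous.aestronglyMeasurable (by simp only [hG, Function.uncurry_def]; fun_prop))
        (ae_of_all _ fun θ => hle v θ)
    · have h1 := (intervalIntegrable_inv_sqrt (σ2 * s) (σ2 * t)).const_mul (2 * Real.pi)
      rw [intervalIntegrable_iff_integrableOn_Ioc_of_le hab] at h1
      refine Integrable.mono' h1 hmeas.norm.integral_prod_right' ?_
      refine (ae_restrict_iff' measurableSet_Ioc).2 (ae_of_all _ fun v hv => ?_)
      have hv0 : 0 < v := ha.trans_lt hv.1
      rw [Real.norm_of_nonneg (integral_nonneg fun _ => norm_nonneg _)]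
      -- At `q = 0` this gives the total mass in `θ`, of order `v^{-1/2}`. It is integrable down to
      -- `v = 0`, so `s = 0` is allowed.
      have h2 := integral_cos_mul_exp hv0 0
      simp only [mul_zero, Real.cos_zero, one_mul, ne_eq, OfNat.ofNat_ne_zero, not_false_eq_true,
        zero_pow, Real.exp_zero, mul_one] at h2
      rw [← h2]
      exact integral_mono_of_nonneg (ae_of_all _ fun _ => norm_nonneg _) (hdom hv0)
        (ae_of_all _ fun θ => hle v θ)
  have hswap := integral_integral_swap hGint
  have e1 : ∀ᵐ θ : ℝ, (1 - Real.cos (θ * q) * Real.exp (-(σ2 * t * θ ^ 2 / 2))) / (σ2 * θ ^ 2) -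
      (1 - Real.cos (θ * q) * Real.exp (-(σ2 * s * θ ^ 2 / 2))) / (σ2 * θ ^ 2) =
      1 / (2 * σ2) * ∫ v in Ioc (σ2 * s) (σ2 * t), G v θ := by
    filter_upwards [hne] with θ hθ
    rw [← intervalIntegral.integral_of_le hab]
    simp only [hG]
    rw [integral_exp_neg_mul_half _ _ _ _ hθ]
    field_simp
    ring
  rw [potLimit, potLimit, ← mul_sub, ← integral_sub (integrable_potLimit_integrand hσ
    (hs.trans hst) q) (integrable_potLimit_integrand hσ hs q), integral_congr_ae e1,
    integral_const_mul, ← hswap, intervalIntegral.integral_of_le hab]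
  have e2 : ∫ v in Ioc (σ2 * s) (σ2 * t), ∫ θ : ℝ, G v θ =
      ∫ v in Ioc (σ2 * s) (σ2 * t),
        2 * Real.pi * (1 / √(2 * Real.pi * v) * Real.exp (-(1 / (2 * v)) * q ^ 2)) :=
    setIntegral_congr_fun measurableSet_Ioc fun v hv => integral_cos_mul_exp (ha.trans_lt hv.1) q
  rw [e2, integral_const_mul]
  field_simp

end potLimitEval

/-! ### The limit of the rescaled overlap. -/

section overlapSum

variable {M : ℕ} {P : Measure (Env M)}

/-- The starting site of the walk in the definition of `yProc`. -/
def startSite (P : Measure (Env M)) (n : ℕ) (a : ℝ≥0 × ℝ) : ℤ :=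
  ⌊(n : ℝ) * a.1 * (-meanDrift P)⌋ + ⌊a.2 * √n⌋

/-- The starting level of the walk in the definition of `yProc`. -/
def startTime (n : ℕ) (a : ℝ≥0 × ℝ) : ℕ := ⌊(n : ℝ) * a.1⌋₊

lemma abs_floor_sub_le (x : ℝ) : |(⌊x⌋ : ℝ) - x| ≤ 1 := by
  rw [abs_le]
  constructor <;> linarith [Int.floor_le x, Int.lt_floor_add_one x]

lemma abs_startTime_sub_le (n : ℕ) (a : ℝ≥0 × ℝ) : |(startTime n a : ℝ) - n * a.1| ≤ 1 := by
  have h : (0 : ℝ) ≤ n * a.1 := by positivity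
  rw [abs_le, startTime]
  constructor <;> linarith [Nat.floor_le h, Nat.lt_floor_add_one ((n : ℝ) * a.1)]

/-- The start is shifted against the mean drift so that the averaged walk ends near `r√n`; the two
integer parts cost `1` and `|V|`. -/
lemma abs_startSite_sub_floor_le (n : ℕ) (a : ℝ≥0 × ℝ) :
    |(startSite P n a + startTime n a * meanDrift P) - ⌊a.2 * √n⌋| ≤ 1 + |meanDrift P| := by
  have h1 := abs_floor_sub_le ((n : ℝ) * a.1 * (-meanDrift P))
  have h2 := abs_startTime_sub_le n a
  have e : (startSite P n a + startTime n a * meanDrift P) - ⌊a.2 * √n⌋ =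
      ((⌊(n : ℝ) * a.1 * (-meanDrift P)⌋ : ℝ) - (n : ℝ) * a.1 * (-meanDrift P)) +
        ((startTime n a : ℝ) - n * a.1) * meanDrift P := by
    rw [startSite]; push_cast; ring
  rw [e]
  refine (abs_add_le _ _).trans (add_le_add h1 ?_)
  rw [abs_mul]
  exact mul_le_of_le_one_left (abs_nonneg _) h2

lemma tendsto_const_div_sqrt_of_bounded {u : ℕ → ℝ} {C : ℝ} (h : ∀ n, |u n| ≤ C) :
    Tendsto (fun n : ℕ => u n / √n) atTop (𝓝 0) := by
  refine squeeze_zero_norm (fun n => ?_) (tendsto_div_sqrt_atTop C)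
  rw [norm_div, Real.norm_eq_abs, Real.norm_of_nonneg (Real.sqrt_nonneg _)]
  exact div_le_div_of_nonneg_right (h n) (Real.sqrt_nonneg _)

lemma tendsto_startTime_div (a : ℝ≥0 × ℝ) :
    Tendsto (fun n : ℕ => (startTime n a : ℝ) / n) atTop (𝓝 a.1) := by
  have h := tendsto_nat_floor_mul_div_atTop (R := ℝ) (a := a.1) a.1.2
  refine (h.comp tendsto_natCast_atTop_atTop).congr fun n => ?_
  simp only [Function.comp, startTime, mul_comm]

lemma tendsto_startSite_div_sqrt (a : ℝ≥0 × ℝ) :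
    Tendsto (fun n : ℕ => (startSite P n a + startTime n a * meanDrift P) / √n) atTop
      (𝓝 a.2) := by
  have h1 := tendsto_const_div_sqrt_of_bounded (u := fun n =>
    (startSite P n a + startTime n a * meanDrift P) - a.2 * √n) (C := 2 + |meanDrift P|)
    fun n => by
      have h1 := abs_startSite_sub_floor_le (P := P) n a
      have h2 := abs_floor_sub_le (a.2 * √n)
      rw [abs_le] at *
      constructor <;> linarith [h1.1, h1.2, h2.1, h2.2]
  have h2 := h1.add_const a.2
  rw [zero_add] at h2
  refine h2.congr' ?_
  filter_upwards [eventually_gt_atTop 0] with n hn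
  have hs : (0 : ℝ) < √n := Real.sqrt_pos.2 (by exact_mod_cast hn)
  field_simp
  ring

lemma startTime_mono (n : ℕ) {a b : ℝ≥0 × ℝ} (h : b.1 ≤ a.1) : startTime n b ≤ startTime n a := by
  have h' : (b.1 : ℝ) ≤ a.1 := h
  exact Nat.floor_mono (mul_le_mul_of_nonneg_left h' (Nat.cast_nonneg _))

variable [IsProbabilityMeasure P]

/-- The factor `1 / (2σ_a²)` of `potLimit_sub_potLimit` and the constant `σ_D² / β` combine to `κ /
2`. -/
lemma GammaQ_eq_potLimit (hell : Elliptic P) (hspan : SpanOne P) {a b : ℝ≥0 × ℝ}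
    (h : b.1 ≤ a.1) :
    GammaQ P a b = sigmaDSq P / beta P * (potLimit (sigmaASq P) (a.1 + b.1) (a.2 - b.2) -
      potLimit (sigmaASq P) (a.1 - b.1) (a.2 - b.2)) := by
  have hσ := sigmaASq_pos hspan
  have hβ := beta_pos hell hspan
  have h' : (b.1 : ℝ) ≤ a.1 := h
  have hb : (0 : ℝ) ≤ b.1 := b.1.2
  rw [potLimit_sub_potLimit hσ (by linarith) (by linarith), GammaQ, kappa,
    abs_of_nonpos (by linarith : (b.1 : ℝ) - a.1 ≤ 0), neg_sub, add_comm (b.1 : ℝ), ← mul_assoc]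
  congr 1
  field_simp

/-- By `sum_pairExp_eq`, `β` times the overlap is the quenched mean of the potential kernel at the
end, minus its value when the walks reach a common level, minus a martingale. Divided by `√n`, the
first two have limits with variance parameters `t + s` and `t - s`, and the martingale is of order
`n^{-1/4}` in `L²`. -/
lemma tendsto_sum_overlap (hiid : IsIID P) (hell : Elliptic P) (hspan : SpanOne P)
    {a b : ℝ≥0 × ℝ} (h : b.1 ≤ a.1) :
    Tendsto (fun n : ℕ => ∫ ω, |sigmaDSq P * (∑ s ∈ Finset.range (startTime n b),
      overlap ω (startSite P n a) (startTime n a) (startTime n a - startTime n b + s)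
        (startSite P n b) (startTime n b) s) / √n - GammaQ P a b| ∂P) atTop (𝓝 0) := by
  have hβ := beta_pos hell hspan
  obtain ⟨C, hC, hincr⟩ := exists_integral_sum_pairIncr_sq_le hiid hell hspan
  set d : ℕ → ℕ := fun n => startTime n a - startTime n b with hd
  have hdm : ∀ n, startTime n b + d n = startTime n a := fun n =>
    Nat.add_sub_cancel' (startTime_mono n h)
  have hdmR : ∀ n, (d n : ℝ) = startTime n a - startTime n b := fun n => by
    rw [← hdm n]; push_cast; ring
  have hta := tendsto_startTime_div a
  have htb := tendsto_startTime_div b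
  have hxa := tendsto_startSite_div_sqrt (P := P) a
  have hxb := tendsto_startSite_div_sqrt (P := P) b
  have htd : Tendsto (fun n : ℕ => (d n : ℝ) / n) atTop (𝓝 (a.1 - b.1)) :=
    (hta.sub htb).congr fun n => by rw [hdmR, sub_div]
  have ht0 : Tendsto (fun n : ℕ => ((0 : ℕ) : ℝ) / n) atTop (𝓝 0) := by simp
  have hend := tendsto_pairExp_potKer hiid hell hspan hta htb (i := fun n => startSite P n a)
    (i' := fun n => startSite P n b) (fun n => startTime n a) (fun n => startTime n b)
    (q := a.2 - b.2) ((hxa.sub hxb).congr fun n => by rw [sub_div])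
  -- At the common level the later walk has made `d n` steps and the earlier one none, hence `m' =
  -- 0`.
  have hstart := tendsto_pairExp_potKer hiid hell hspan (m := d) (m' := fun _ => 0) htd ht0
    (i := fun n => startSite P n a)
    (i' := fun n => startSite P n b) (fun n => startTime n a) (fun n => startTime n b)
    (q := a.2 - b.2) ((hxa.sub hxb).congr fun n => by rw [hdmR, ← sub_div]; push_cast; ring)
  rw [add_zero] at hstart
  have hbI : ∀ n, BddMeasurable univ (fun ω : Env M => ∑ s ∈ Finset.range (startTime n b),
      pairIncr P ω (startSite P n a) ((startTime n b : ℤ) + (d n : ℤ)) (d n + s)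
        (startSite P n b) (startTime n b) s) := fun n => BddMeasurable.sum _ fun s _ =>
      bddMeasurable_pairIncr _ _ _ _ _ _ (by push_cast; ring) (subset_univ _)
  have hrem : Tendsto (fun n : ℕ => ∫ ω, |∑ s ∈ Finset.range (startTime n b),
      pairIncr P ω (startSite P n a) ((startTime n b : ℤ) + (d n : ℤ)) (d n + s)
        (startSite P n b) (startTime n b) s| / √n ∂P) atTop (𝓝 0) := by
    have h1 : Tendsto (fun n : ℕ => √(C * √((startTime n a : ℝ) / n) * (1 / √n))) atTop
        (𝓝 (√(C * √(a.1 : ℝ) * 0))) :=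
      ((hta.sqrt.const_mul C).mul (tendsto_div_sqrt_atTop 1)).sqrt
    rw [mul_zero, Real.sqrt_zero] at h1
    refine squeeze_zero' (Eventually.of_forall fun n => integral_nonneg fun ω => by positivity) ?_ h1
    filter_upwards [eventually_gt_atTop 0] with n hn
    have hn' : (0 : ℝ) < n := by exact_mod_cast hn
    have hs : (0 : ℝ) < √n := Real.sqrt_pos.2 hn'
    refine Real.le_sqrt_of_sq_le ?_
    have hb := (hbI n).norm
    simp only [Real.norm_eq_abs] at hb
    rw [integral_div, div_pow, Real.sq_sqrt hn'.le, div_le_iff₀ hn']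
    refine (sq_integral_le (hb.integrable P) ((hb.pow 2).integrable P)).trans ?_
    simp only [sq_abs]
    refine (hincr _ _ _ _ _).trans (le_of_eq ?_)
    rw [add_comm (d n), hdm, Real.sqrt_div (by positivity)]
    field_simp
    rw [Real.sq_sqrt hn'.le]
  have hsum := ((hend.add hstart).add hrem).const_mul (|sigmaDSq P / beta P|)
  rw [add_zero, add_zero, mul_zero] at hsum
  refine squeeze_zero (fun n => integral_nonneg fun ω => abs_nonneg _) (fun n => ?_) hsum
  set B₁ : Env M → ℝ := fun ω => pairExp ω (startSite P n a) (startTime n a) (startTime n a)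
    (startSite P n b) (startTime n b) (startTime n b)
    (fun x y => potKer M (avgProb P) (x - y)) / √n -
      potLimit (sigmaASq P) (a.1 + b.1) (a.2 - b.2) with hB₁
  set B₂ : Env M → ℝ := fun ω => pairExp ω (startSite P n a) (startTime n a) (d n)
    (startSite P n b) (startTime n b) 0
    (fun x y => potKer M (avgProb P) (x - y)) / √n -
      potLimit (sigmaASq P) (a.1 - b.1) (a.2 - b.2) with hB₂
  set R : Env M → ℝ := fun ω => ∑ s ∈ Finset.range (startTime n b),
      pairIncr P ω (startSite P n a) ((startTime n b : ℤ) + (d n : ℤ)) (d n + s)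
        (startSite P n b) (startTime n b) s with hR
  have i1 : Integrable (fun ω => |B₁ ω|) P :=
    ((((bddMeasurable_pairExp_univ (startSite P n a) (startTime n a) (startTime n a)
      (startSite P n b) (startTime n b) (startTime n b)
      (fun x y => potKer M (avgProb P) (x - y))).integrable P).div_const _).sub
      (integrable_const _)).abs
  have i2 : Integrable (fun ω => |B₂ ω|) P :=
    ((((bddMeasurable_pairExp_univ (startSite P n a) (startTime n a) (d n)
      (startSite P n b) (startTime n b) 0
      (fun x y => potKer M (avgProb P) (x - y))).integrable P).div_const _).sub
      (integrable_const _)).abs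
  have i3 : Integrable (fun ω => |R ω| / √n) P := (((hbI n).integrable P).abs).div_const _
  have i12 : Integrable (fun ω => |B₁ ω| + |B₂ ω|) P := i1.add i2
  rw [← integral_add i1 i2, ← integral_add i12 i3, ← integral_const_mul]
  refine integral_mono_of_nonneg (ae_of_all _ fun ω => abs_nonneg _)
    ((i12.add i3).const_mul _) (ae_of_all _ fun ω => ?_)
  have hid := sum_pairExp_eq (P := P) ω (startSite P n a) (startTime n b) (d n) (startSite P n b)
    (startTime n b)
  have hcast : (startTime n b : ℤ) + (d n : ℤ) = startTime n a := by exact_mod_cast hdm n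
  have hcast' : d n + startTime n b = startTime n a := by rw [add_comm]; exact hdm n
  rw [hcast, hcast'] at hid
  have e : sigmaDSq P * (∑ s ∈ Finset.range (startTime n b),
      overlap ω (startSite P n a) (startTime n a) (d n + s)
        (startSite P n b) (startTime n b) s) / √n - GammaQ P a b =
      sigmaDSq P / beta P * (B₁ ω - B₂ ω - R ω / √n) := by
    rw [GammaQ_eq_potLimit hell hspan h]
    simp only [hB₁, hB₂, hR]
    rw [hcast, hid]
    field_simp
    ring
  simp only
  rw [e, abs_mul]
  refine mul_le_mul_of_nonneg_left ?_ (abs_nonneg _)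
  have e3 : |R ω| / √n = |R ω / √n| := by rw [abs_div, abs_of_nonneg (Real.sqrt_nonneg (n : ℝ))]
  rw [e3]
  exact (abs_sub _ _).trans (add_le_add_left (abs_sub _ _) _)

end overlapSum


/-! ### A central limit theorem for martingale arrays. -/

section martingaleArray

variable {M : ℕ} {P : Measure (Env M)}

lemma BddMeasurable.cexp_mul_I {S : Set (ℤ × ℤ)} {f : Env M → ℝ} (hf : BddMeasurable S f) :
    BddMeasurable S (fun ω => Complex.exp ((f ω : ℝ) * Complex.I)) :=
  ⟨(Complex.measurable_exp.comp ((Complex.measurable_ofReal.comp hf.1).mul_const _)), 1,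
    fun _ => (Complex.norm_exp_ofReal_mul_I _).le⟩

lemma BddMeasurable.rexp {S : Set (ℤ × ℤ)} {f : Env M → ℝ} (hf : BddMeasurable S f) :
    BddMeasurable S (fun ω => Real.exp (f ω)) := by
  obtain ⟨C, hC⟩ := hf.2
  refine ⟨Real.measurable_exp.comp hf.1, Real.exp C, fun ω => ?_⟩
  rw [Real.norm_of_nonneg (Real.exp_pos _).le]
  exact Real.exp_le_exp.2 ((le_abs_self _).trans (hC ω))

lemma BddMeasurable.ite_le {S : Set (ℤ × ℤ)} {f : Env M → ℝ} (hf : BddMeasurable S f) (C : ℝ) :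
    BddMeasurable S (fun ω => if f ω ≤ C then (1 : ℝ) else 0) := by
  refine ⟨Measurable.ite (hf.1 measurableSet_Iic) measurable_const measurable_const, 1, fun ω => ?_⟩
  split_ifs <;> simp

lemma norm_cexp_mul_I_sub_le {x : ℝ} (hx : |x| ≤ 1) :
    ‖Complex.exp (x * Complex.I) - 1 - x * Complex.I + (x : ℂ) ^ 2 / 2‖ ≤ |x| ^ 3 := by
  have hn : ‖(x : ℂ) * Complex.I‖ = |x| := by simp
  have h := Complex.exp_bound (x := x * Complex.I) (by rw [hn]; exact hx) (n := 3) (by norm_num)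
  rw [hn] at h
  have e : Complex.exp (x * Complex.I) - ∑ m ∈ Finset.range 3, ((x : ℂ) * Complex.I) ^ m /
      (m.factorial : ℂ) = Complex.exp (x * Complex.I) - 1 - x * Complex.I + (x : ℂ) ^ 2 / 2 := by
    simp only [Finset.sum_range_succ, Finset.sum_range_zero, mul_pow, Complex.I_sq]
    norm_num [Nat.factorial]
    ring
  rw [e] at h
  refine h.trans ?_
  have : (0 : ℝ) ≤ |x| ^ 3 := by positivity
  norm_num [Nat.factorial]
  nlinarith

/-- A quantitative central limit theorem for bounded martingale differences with respect to an
increasing family of sets of sites. -/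
lemma norm_integral_cexp_sum_sub_le [IsProbabilityMeasure P] {S : ℕ → Set (ℤ × ℤ)}
    (hS : Monotone S) {ξ v : ℕ → Env M → ℝ} {T : ℕ} {δ η s2 : ℝ}
    (hξ : ∀ k, BddMeasurable (S (k + 1)) (ξ k)) (hv : ∀ k, BddMeasurable (S k) (v k))
    (hv0 : ∀ k ω, 0 ≤ v k ω) (hξδ : ∀ k ω, |ξ k ω| ≤ δ) (hvη : ∀ k ω, v k ω ≤ η)
    (hδ : δ ≤ 1) (hη : η ≤ 1) (hs2 : 0 ≤ s2)
    (h1 : ∀ k < T, ∀ Ψ : Env M → ℂ, BddMeasurable (S k) Ψ → ∫ ω, Ψ ω * (ξ k ω : ℂ) ∂P = 0)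
    (h2 : ∀ k < T, ∀ Ψ : Env M → ℂ, BddMeasurable (S k) Ψ →
      ∫ ω, Ψ ω * ((ξ k ω ^ 2 : ℝ) : ℂ) ∂P = ∫ ω, Ψ ω * (v k ω : ℂ) ∂P) :
    ‖∫ ω, Complex.exp ((∑ k ∈ Finset.range T, ξ k ω : ℝ) * Complex.I) ∂P -
        (Real.exp (-(s2 / 2)) : ℂ)‖ ≤
      Real.exp ((s2 + 1) / 2) * (δ + η) * (s2 + 1) +
        (1 + Real.exp ((s2 + 1) / 2)) *
          ∫ ω, |∑ k ∈ Finset.range T, v k ω - s2| ∂P := by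
  set C : ℝ := s2 + 1 with hC
  set V : ℕ → Env M → ℝ := fun k ω => ∑ j ∈ Finset.range k, v j ω with hV
  have hVb : ∀ k, BddMeasurable (S k) (V (k + 1)) := fun k => BddMeasurable.sum _ fun j hj =>
    (hv j).mono (hS (Nat.lt_succ_iff.1 (Finset.mem_range.1 hj)))
  have hVmono : ∀ ω, Monotone fun k => V k ω := fun ω => monotone_nat_of_le_succ fun k => by
    simp only [hV, Finset.sum_range_succ]
    linarith [hv0 k ω]
  -- Truncation once the accumulated variance exceeds `s2 + 1`. The index is `k + 1`, not `k`: `v k`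
  -- is already known from `S k`, so `χ k` is too, the martingale identities survive, and the
  -- truncated variances never sum to more than `C`.
  set χ : ℕ → Env M → ℝ := fun k ω => if V (k + 1) ω ≤ C then 1 else 0 with hχ
  have hχb : ∀ k, BddMeasurable (S k) (χ k) := fun k => (hVb k).ite_le C
  have hχ01 : ∀ k ω, 0 ≤ χ k ω ∧ χ k ω ≤ 1 ∧ χ k ω ^ 2 = χ k ω := fun k ω => by
    simp only [hχ]; split_ifs <;> norm_num
  set ξ' : ℕ → Env M → ℝ := fun k ω => χ k ω * ξ k ω with hξ'
  set v' : ℕ → Env M → ℝ := fun k ω => χ k ω * v k ω with hv'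
  have hξ'b : ∀ k, BddMeasurable (S (k + 1)) (ξ' k) := fun k =>
    ((hχb k).mono (hS (Nat.le_succ k))).mul (hξ k)
  have hv'b : ∀ k, BddMeasurable (S k) (v' k) := fun k => (hχb k).mul (hv k)
  have hv'0 : ∀ k ω, 0 ≤ v' k ω := fun k ω => mul_nonneg (hχ01 k ω).1 (hv0 k ω)
  have hv'v : ∀ k ω, v' k ω ≤ v k ω := fun k ω =>
    mul_le_of_le_one_left (hv0 k ω) (hχ01 k ω).2.1
  have hξ'δ : ∀ k ω, |ξ' k ω| ≤ δ := fun k ω => by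
    simp only [hξ']
    rw [abs_mul, abs_of_nonneg (hχ01 k ω).1]
    exact (mul_le_of_le_one_left (abs_nonneg _) (hχ01 k ω).2.1).trans (hξδ k ω)
  have hC0 : 0 ≤ C := by positivity
  have hsumC : ∀ k ω, ∑ j ∈ Finset.range k, v' j ω ≤ C := by
    intro k ω
    induction k with
    | zero => simpa using hC0
    | succ k ih =>
      by_cases h : V (k + 1) ω ≤ C
      · exact (Finset.sum_le_sum fun j _ => hv'v j ω).trans h
      · rw [Finset.sum_range_succ]
        have : v' k ω = 0 := by simp only [hv', hχ, if_neg h, zero_mul]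
        rw [this, add_zero]
        exact ih
  -- the exponential martingale, up to an error
  set A : ℕ → Env M → ℂ := fun k ω =>
    Complex.exp ((∑ j ∈ Finset.range k, ξ' j ω : ℝ) * Complex.I) *
      ((Real.exp ((∑ j ∈ Finset.range k, v' j ω) / 2) : ℝ) : ℂ) with hA
  -- The part of `A (k + 1)` known from `S k`. The exponent already includes the `k`-th variance, so
  -- that `A (k + 1)` is `Ψ k` times the factor of `ξ' k`, and `A k` is `Ψ k * exp (-v' k / 2)`.
  set Ψ : ℕ → Env M → ℂ := fun k ω =>
    Complex.exp ((∑ j ∈ Finset.range k, ξ' j ω : ℝ) * Complex.I) *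
      ((Real.exp ((∑ j ∈ Finset.range (k + 1), v' j ω) / 2) : ℝ) : ℂ) with hΨ
  have hbξ : ∀ k, BddMeasurable (S k) (fun ω => ∑ j ∈ Finset.range k, ξ' j ω) := fun k =>
    BddMeasurable.sum _ fun j hj => (hξ'b j).mono (hS (Finset.mem_range.1 hj))
  have hbv : ∀ k, BddMeasurable (S k) (fun ω => (∑ j ∈ Finset.range (k + 1), v' j ω) / 2) :=
    fun k => by
      simp only [div_eq_mul_inv]
      exact (BddMeasurable.sum _ fun j hj =>
        (hv'b j).mono (hS (Nat.lt_succ_iff.1 (Finset.mem_range.1 hj)))).mul (BddMeasurable.const _)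
  have hΨb : ∀ k, BddMeasurable (S k) (Ψ k) := fun k =>
    (hbξ k).cexp_mul_I.mul (hbv k).rexp.ofReal
  have hΨn : ∀ k ω, ‖Ψ k ω‖ ≤ Real.exp (C / 2) := fun k ω => by
    simp only [hΨ]
    rw [norm_mul, Complex.norm_exp_ofReal_mul_I, one_mul, Complex.norm_real,
      Real.norm_of_nonneg (Real.exp_pos _).le]
    exact Real.exp_le_exp.2 (by linarith [hsumC (k + 1) ω])
  have hAn : ∀ k ω, ‖A k ω‖ ≤ Real.exp (C / 2) := fun k ω => by
    simp only [hA]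
    rw [norm_mul, Complex.norm_exp_ofReal_mul_I, one_mul, Complex.norm_real,
      Real.norm_of_nonneg (Real.exp_pos _).le]
    exact Real.exp_le_exp.2 (by linarith [hsumC k ω])
  have hAsucc : ∀ k ω, A (k + 1) ω = Ψ k ω * Complex.exp ((ξ' k ω : ℝ) * Complex.I) := by
    intro k ω
    simp only [hA, hΨ]
    rw [Finset.sum_range_succ (fun j => ξ' j ω), Complex.ofReal_add, add_mul, Complex.exp_add]
    ring
  have hAΨ : ∀ k ω, A k ω = Ψ k ω * ((Real.exp (-(v' k ω / 2)) : ℝ) : ℂ) := by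
    intro k ω
    simp only [hA, hΨ]
    have : (∑ j ∈ Finset.range k, v' j ω) / 2 =
        (∑ j ∈ Finset.range (k + 1), v' j ω) / 2 + -(v' k ω / 2) := by
      rw [Finset.sum_range_succ]; ring
    rw [mul_assoc, ← Complex.ofReal_mul, ← Real.exp_add, ← this]
  have hAb : ∀ k, BddMeasurable univ (A k) := fun k => by
    have h3 : BddMeasurable (S k) (fun ω => v' k ω / 2) := by
      simp only [div_eq_mul_inv]
      exact (hv'b k).mul (BddMeasurable.const _)
    have h4 : BddMeasurable (S k) (fun ω => Real.exp (-(v' k ω / 2))) := by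
      have : BddMeasurable (S k) (fun ω => -(v' k ω / 2)) := by
        simpa only [zero_sub] using (BddMeasurable.const (0 : ℝ)).sub h3
      exact this.rexp
    have : A k = fun ω => Ψ k ω * ((Real.exp (-(v' k ω / 2)) : ℝ) : ℂ) := funext (hAΨ k)
    rw [this]
    exact ((hΨb k).mul h4.ofReal).mono (subset_univ _)
  have iξ2 : ∀ k, Integrable (fun ω => ξ' k ω ^ 2) P := fun k => ((hξ'b k).pow 2).integrable P
  have iv : ∀ k, Integrable (fun ω => v' k ω) P := fun k => (hv'b k).integrable P
  have hsq : ∀ k < T, ∀ Φ : Env M → ℂ, BddMeasurable (S k) Φ →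
      ∫ ω, Φ ω * ((ξ' k ω ^ 2 : ℝ) : ℂ) ∂P = ∫ ω, Φ ω * (v' k ω : ℂ) ∂P := by
    intro k hk Φ hΦ
    have h3 := h2 k hk (fun ω => Φ ω * (χ k ω : ℂ)) (hΦ.mul (hχb k).ofReal)
    refine Eq.trans (integral_congr_ae (ae_of_all _ fun ω => ?_)) (h3.trans
      (integral_congr_ae (ae_of_all _ fun ω => ?_)))
    · simp only [hξ']
      rw [mul_pow, (hχ01 k ω).2.2, Complex.ofReal_mul, mul_assoc]
    · simp only [hv']
      rw [Complex.ofReal_mul, mul_assoc]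
  have hlin : ∀ k < T, ∫ ω, Ψ k ω * (ξ' k ω : ℂ) ∂P = 0 := by
    intro k hk
    have h3 := h1 k hk (fun ω => Ψ k ω * (χ k ω : ℂ)) ((hΨb k).mul (hχb k).ofReal)
    rw [← h3]
    refine integral_congr_ae (ae_of_all _ fun ω => ?_)
    simp only [hξ']
    rw [Complex.ofReal_mul]
    ring
  have hvar : ∀ k < T, ∫ ω, ξ' k ω ^ 2 ∂P = ∫ ω, v' k ω ∂P := by
    intro k hk
    have h3 := hsq k hk (fun _ => 1) (BddMeasurable.const 1)
    simp only [one_mul] at h3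
    rw [integral_complex_ofReal, integral_complex_ofReal] at h3
    exact_mod_cast h3
  have hstep : ∀ k < T, ‖∫ ω, A (k + 1) ω ∂P - ∫ ω, A k ω ∂P‖ ≤
      Real.exp (C / 2) * (δ + η) * ∫ ω, v' k ω ∂P := by
    intro k hk
    have iΨ1 : Integrable (fun ω => Ψ k ω * (ξ' k ω : ℂ)) P :=
      (((hΨb k).mono (subset_univ _)).mul ((hξ'b k).mono (subset_univ _)).ofReal).integrable P
    have iΨ2 : Integrable (fun ω => Ψ k ω * ((ξ' k ω ^ 2 : ℝ) : ℂ)) P :=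
      (((hΨb k).mono (subset_univ _)).mul
        (((hξ'b k).pow 2).mono (subset_univ _)).ofReal).integrable P
    have iΨ3 : Integrable (fun ω => Ψ k ω * (v' k ω : ℂ)) P :=
      (((hΨb k).mono (subset_univ _)).mul ((hv'b k).mono (subset_univ _)).ofReal).integrable P
    have i0 : Integrable (fun ω => A (k + 1) ω - A k ω) P :=
      ((hAb (k + 1)).integrable P).sub ((hAb k).integrable P)
    have i1 : Integrable (fun ω => Complex.I * (Ψ k ω * (ξ' k ω : ℂ))) P := iΨ1.const_mul _
    have i2 : Integrable (fun ω => 1 / 2 * (Ψ k ω * ((ξ' k ω ^ 2 : ℝ) : ℂ))) P := iΨ2.const_mul _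
    have i3 : Integrable (fun ω => 1 / 2 * (Ψ k ω * (v' k ω : ℂ))) P := iΨ3.const_mul _
    -- The added linear term has mean zero and the two quadratic terms have equal means, so the
    -- integral is unchanged while the integrand becomes a Taylor remainder.
    have e : ∫ ω, A (k + 1) ω ∂P - ∫ ω, A k ω ∂P =
        ∫ ω, (A (k + 1) ω - A k ω - Complex.I * (Ψ k ω * (ξ' k ω : ℂ)) +
          1 / 2 * (Ψ k ω * ((ξ' k ω ^ 2 : ℝ) : ℂ)) - 1 / 2 * (Ψ k ω * (v' k ω : ℂ))) ∂P := by
      have i01 : Integrable (fun ω => A (k + 1) ω - A k ω - Complex.I * (Ψ k ω * (ξ' k ω : ℂ))) P :=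
        i0.sub i1
      have i02 : Integrable (fun ω => A (k + 1) ω - A k ω - Complex.I * (Ψ k ω * (ξ' k ω : ℂ)) +
          1 / 2 * (Ψ k ω * ((ξ' k ω ^ 2 : ℝ) : ℂ))) P := i01.add i2
      rw [integral_sub i02 i3, integral_add i01 i2, integral_sub i0 i1,
        integral_sub ((hAb (k + 1)).integrable P) ((hAb k).integrable P),
        integral_const_mul, integral_const_mul, integral_const_mul, hlin k hk,
        hsq k hk _ (hΨb k)]
      ring
    rw [e]
    have hbound : ∀ ω, ‖A (k + 1) ω - A k ω - Complex.I * (Ψ k ω * (ξ' k ω : ℂ)) +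
          1 / 2 * (Ψ k ω * ((ξ' k ω ^ 2 : ℝ) : ℂ)) - 1 / 2 * (Ψ k ω * (v' k ω : ℂ))‖ ≤
        Real.exp (C / 2) * (δ * ξ' k ω ^ 2 + η * v' k ω) := by
      intro ω
      have hv1 : v' k ω ≤ η := (hv'v k ω).trans (hvη k ω)
      have e2 : A (k + 1) ω - A k ω - Complex.I * (Ψ k ω * (ξ' k ω : ℂ)) +
          1 / 2 * (Ψ k ω * ((ξ' k ω ^ 2 : ℝ) : ℂ)) - 1 / 2 * (Ψ k ω * (v' k ω : ℂ)) =
          Ψ k ω * ((Complex.exp ((ξ' k ω : ℝ) * Complex.I) - 1 - ξ' k ω * Complex.I +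
            (ξ' k ω : ℂ) ^ 2 / 2) -
            ((Real.exp (-(v' k ω / 2)) - 1 - (-(v' k ω / 2)) : ℝ) : ℂ)) := by
        rw [hAsucc, hAΨ]
        push_cast
        ring
      rw [e2, norm_mul]
      refine mul_le_mul (hΨn k ω) ?_ (norm_nonneg _) (Real.exp_pos _).le
      refine (norm_sub_le _ _).trans (add_le_add ?_ ?_)
      · refine (norm_cexp_mul_I_sub_le ((hξ'δ k ω).trans hδ)).trans ?_
        rw [pow_succ', sq_abs]
        exact mul_le_mul_of_nonneg_right (hξ'δ k ω) (sq_nonneg _)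
      · rw [Complex.norm_real, Real.norm_eq_abs]
        have h5 : |-(v' k ω / 2)| ≤ 1 := by
          rw [abs_neg, abs_of_nonneg (by linarith [hv'0 k ω])]
          linarith
        refine (Real.abs_exp_sub_one_sub_id_le h5).trans ?_
        nlinarith [hv'0 k ω, mul_le_mul_of_nonneg_right hv1 (hv'0 k ω), sq_nonneg (v' k ω)]
    have i4 : Integrable (fun ω => Real.exp (C / 2) * (δ * ξ' k ω ^ 2 + η * v' k ω)) P :=
      (((iξ2 k).const_mul _).add ((iv k).const_mul _)).const_mul _
    refine (norm_integral_le_of_norm_le i4 (ae_of_all _ hbound)).trans (le_of_eq ?_)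
    rw [integral_const_mul, integral_add ((iξ2 k).const_mul _) ((iv k).const_mul _),
      integral_const_mul, integral_const_mul, hvar k hk]
    ring
  have hmain : ‖∫ ω, A T ω ∂P - 1‖ ≤ Real.exp (C / 2) * (δ + η) * C := by
    have hδη : 0 ≤ δ + η := by
      -- The signs of `δ` and `η` are read off at one environment, which exists because `P` has mass
      -- one.
      have hne : Nonempty (Env M) := by
        by_contra hE
        rw [not_nonempty_iff] at hE
        have := measure_univ (μ := P)
        rw [Set.univ_eq_empty_iff.2 hE, measure_empty] at this
        exact zero_ne_one this
      obtain ⟨ω⟩ := hne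
      exact add_nonneg ((abs_nonneg _).trans (hξδ 0 ω)) ((hv0 0 ω).trans (hvη 0 ω))
    have h3 : ∀ k ≤ T, ‖∫ ω, A k ω ∂P - 1‖ ≤
        Real.exp (C / 2) * (δ + η) * ∑ j ∈ Finset.range k, ∫ ω, v' j ω ∂P := by
      intro k hk
      induction k with
      | zero => simp [hA]
      | succ k ih =>
        rw [Finset.sum_range_succ, mul_add]
        have e : ∫ ω, A (k + 1) ω ∂P - 1 =
            (∫ ω, A k ω ∂P - 1) + (∫ ω, A (k + 1) ω ∂P - ∫ ω, A k ω ∂P) := by ring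
        rw [e]
        exact (norm_add_le _ _).trans (add_le_add (ih (by omega)) (hstep k (by omega)))
    refine (h3 T le_rfl).trans (mul_le_mul_of_nonneg_left ?_
      (mul_nonneg (Real.exp_pos _).le hδη))
    rw [← integral_finsetSum _ fun j _ => iv j]
    calc ∫ ω, ∑ j ∈ Finset.range T, v' j ω ∂P ≤ ∫ _, C ∂P :=
          integral_mono (integrable_finsetSum _ fun j _ => iv j) (integrable_const _)
            fun ω => hsumC T ω
      _ = C := by simp
  -- Where the variance stays below `C`, nothing was truncated and the exponentials are compared
  -- directly. Elsewhere `|V T - s2| > 1`, since `C = s2 + 1`, and this pays for the trivial bound.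
  have hcmp : ∀ ω, ‖Complex.exp ((∑ k ∈ Finset.range T, ξ k ω : ℝ) * Complex.I) -
      (Real.exp (-(s2 / 2)) : ℂ) * A T ω‖ ≤ (1 + Real.exp (C / 2)) * |V T ω - s2| := by
    intro ω
    have hexp0 : Real.exp (-(s2 / 2)) ≤ 1 := Real.exp_le_one_iff.2 (by linarith)
    by_cases h : V T ω ≤ C
    · have hχ1 : ∀ j ∈ Finset.range T, χ j ω = 1 := fun j hj => by
        simp only [hχ]
        rw [if_pos ((hVmono ω (Finset.mem_range.1 hj)).trans h)]
      have e1 : ∑ j ∈ Finset.range T, ξ' j ω = ∑ j ∈ Finset.range T, ξ j ω :=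
        Finset.sum_congr rfl fun j hj => by simp only [hξ']; rw [hχ1 j hj, one_mul]
      have e2 : ∑ j ∈ Finset.range T, v' j ω = V T ω :=
        Finset.sum_congr rfl fun j hj => by simp only [hv']; rw [hχ1 j hj, one_mul]
      simp only [hA]
      rw [e1, e2]
      set z := Complex.exp ((∑ k ∈ Finset.range T, ξ k ω : ℝ) * Complex.I) with hz
      have hz1 : ‖z‖ = 1 := Complex.norm_exp_ofReal_mul_I _
      have e3 : z - (Real.exp (-(s2 / 2)) : ℂ) * (z * ((Real.exp (V T ω / 2) : ℝ) : ℂ)) =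
          z * ((1 - Real.exp ((V T ω - s2) / 2) : ℝ) : ℂ) := by
        have : Real.exp ((V T ω - s2) / 2) = Real.exp (-(s2 / 2)) * Real.exp (V T ω / 2) := by
          rw [← Real.exp_add]; congr 1; ring
        rw [this]
        push_cast
        ring
      rw [e3, norm_mul, hz1, one_mul, Complex.norm_real, Real.norm_eq_abs]
      have hx : (V T ω - s2) / 2 ≤ C / 2 := by linarith
      set x := (V T ω - s2) / 2 with hxdef
      have hxa : |V T ω - s2| = 2 * |x| := by
        rw [hxdef, abs_div, abs_of_pos (two_pos : (0 : ℝ) < 2)]; ring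
      rw [hxa]
      have hex := Real.add_one_le_exp x
      have hE : 1 ≤ Real.exp (C / 2) := Real.one_le_exp (by linarith)
      rcases le_total 0 x with h0 | h0
      · have h6 := Real.add_one_le_exp (-x)
        have h7 : Real.exp x - 1 ≤ x * Real.exp x := by
          have : Real.exp x * Real.exp (-x) = 1 := by rw [← Real.exp_add]; simp
          nlinarith [Real.exp_pos x]
        have h8 : Real.exp x ≤ Real.exp (C / 2) := Real.exp_le_exp.2 hx
        rw [abs_of_nonneg h0, abs_of_nonpos (by linarith)]
        nlinarith
      · have : Real.exp x ≤ 1 := Real.exp_le_one_iff.2 h0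
        rw [abs_of_nonpos h0, abs_of_nonneg (by linarith)]
        nlinarith
    · have h6 : 1 ≤ |V T ω - s2| := by
        rw [not_le] at h
        exact le_trans (by linarith) (le_abs_self _)
      refine (norm_sub_le _ _).trans ?_
      rw [Complex.norm_exp_ofReal_mul_I, norm_mul, Complex.norm_real,
        Real.norm_of_nonneg (Real.exp_pos _).le]
      have h7 : Real.exp (-(s2 / 2)) * ‖A T ω‖ ≤ Real.exp (C / 2) :=
        (mul_le_of_le_one_left (norm_nonneg _) hexp0).trans (hAn T ω)
      have h8 := Real.exp_pos (C / 2)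
      nlinarith
  have hEb : BddMeasurable univ
      (fun ω => Complex.exp ((∑ k ∈ Finset.range T, ξ k ω : ℝ) * Complex.I)) :=
    (BddMeasurable.sum _ fun k _ => (hξ k).mono (subset_univ _)).cexp_mul_I
  have iA : Integrable (fun ω => (Real.exp (-(s2 / 2)) : ℂ) * A T ω) P :=
    ((hAb T).integrable P).const_mul _
  have hVT : Integrable (fun ω => (1 + Real.exp (C / 2)) * |V T ω - s2|) P :=
    (((BddMeasurable.sum (S := univ) _ fun k _ => (hv k).mono (subset_univ _)).integrable P).sub
      (integrable_const _)).abs.const_mul _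
  have e : ∫ ω, Complex.exp ((∑ k ∈ Finset.range T, ξ k ω : ℝ) * Complex.I) ∂P -
        (Real.exp (-(s2 / 2)) : ℂ) = (Real.exp (-(s2 / 2)) : ℂ) * (∫ ω, A T ω ∂P - 1) +
      ∫ ω, (Complex.exp ((∑ k ∈ Finset.range T, ξ k ω : ℝ) * Complex.I) -
      (Real.exp (-(s2 / 2)) : ℂ) * A T ω) ∂P := by
    rw [integral_sub (hEb.integrable P) iA, integral_const_mul]
    ring
  rw [e]
  refine (norm_add_le _ _).trans (add_le_add ?_ ?_)
  · rw [norm_mul, Complex.norm_real, Real.norm_of_nonneg (Real.exp_pos _).le]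
    exact (mul_le_of_le_one_left (norm_nonneg _)
      (Real.exp_le_one_iff.2 (by linarith))).trans hmain
  · refine (norm_integral_le_of_norm_le hVT (ae_of_all _ hcmp)).trans (le_of_eq ?_)
    rw [integral_const_mul]

end martingaleArray


/-! ### All walks on a common clock running down from one level. -/

section levels

variable {M : ℕ} {P : Measure (Env M)}

/-- The quenched law of the walk started at the site and level of `yProc P n a`, seen at the level
`T - u`; it vanishes if the walk starts below that level. -/
def levelMass (P : Measure (Env M)) (n : ℕ) (a : ℝ≥0 × ℝ) (T u : ℕ) (x : ℤ) (ω : Env M) : ℝ :=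
  if T ≤ u + startTime n a then
    mass ω (startSite P n a) (startTime n a) (u + startTime n a - T) x else 0

/-- A finite set carrying `levelMass P n a T u`. -/
def levelWindow (P : Measure (Env M)) (n : ℕ) (a : ℝ≥0 × ℝ) (T u : ℕ) : Finset ℤ :=
  window M (startSite P n a) (u + startTime n a - T)

lemma levelMass_nonneg (n : ℕ) (a : ℝ≥0 × ℝ) (T u : ℕ) (x : ℤ) (ω : Env M) :
    0 ≤ levelMass P n a T u x ω := by
  unfold levelMass
  split_ifs
  · exact mass_nonneg _ _ _ _ _
  · exact le_rfl

lemma bddMeasurable_levelMass (n : ℕ) (a : ℝ≥0 × ℝ) (T u : ℕ) (x : ℤ) :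
    BddMeasurable {z : ℤ × ℤ | (T : ℤ) - u < z.2} (levelMass P n a T u x) := by
  unfold levelMass
  by_cases h : T ≤ u + startTime n a
  · simp only [if_pos h]
    refine bddMeasurable_mass _ _ _ _ fun z hz => ?_
    simp only [mem_ofPred_eq] at hz ⊢
    omega
  · simp only [if_neg h]
    exact BddMeasurable.const _

lemma sum_levelMass_mul (n : ℕ) (a : ℝ≥0 × ℝ) (T u : ℕ) (ω : Env M) {W : Finset ℤ}
    (hW : levelWindow P n a T u ⊆ W) (f : ℤ → ℝ) :
    ∑ x ∈ W, levelMass P n a T u x ω * f x = if T ≤ u + startTime n a then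
      walkExp ω (startSite P n a) (startTime n a) (u + startTime n a - T) f else 0 := by
  unfold levelMass
  split_ifs with h
  · rw [walkExp_eq_sum_of_subset _ _ _ _ _ hW]
    rfl
  · simp

lemma sum_levelMass_le_one (n : ℕ) (a : ℝ≥0 × ℝ) (T u : ℕ) (ω : Env M) {W : Finset ℤ}
    (hW : levelWindow P n a T u ⊆ W) : ∑ x ∈ W, levelMass P n a T u x ω ≤ 1 := by
  have h := sum_levelMass_mul n a T u ω hW fun _ => 1
  simp only [mul_one, walkExp_const] at h
  rw [h]
  split_ifs <;> norm_num

/-- On the common clock a walk with `m` steps is idle during the first `T - m` ticks. -/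
lemma sum_range_ite_shift {m T : ℕ} (h : m ≤ T) (f : ℕ → ℝ) :
    ∑ u ∈ Finset.range T, (if T ≤ u + m then f (u + m - T) else 0) =
      ∑ s ∈ Finset.range m, f s := by
  obtain ⟨d, rfl⟩ := Nat.exists_eq_add_of_le' h
  rw [Finset.sum_range_add, Finset.sum_eq_zero, zero_add]
  · refine Finset.sum_congr rfl fun x _ => ?_
    rw [if_pos (by omega)]
    congr 1
    omega
  · intro x hx
    rw [if_neg (by rw [Finset.mem_range] at hx; omega)]

/-- Regroups the drift decomposition by level, so that walks started at different levels add up to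
one martingale array. -/
lemma sum_sum_levelMass_mul_drift (n : ℕ) (a : ℝ≥0 × ℝ) {T : ℕ} (hT : startTime n a ≤ T)
    (ω : Env M) {W : ℕ → Finset ℤ} (hW : ∀ u, levelWindow P n a T u ⊆ W u) (V : ℝ) :
    ∑ u ∈ Finset.range T, ∑ x ∈ W u,
        levelMass P n a T u x ω * (driftAt ω x ((T : ℤ) - u) - V) =
      quenchedMean ω (startSite P n a) (startTime n a) (startTime n a) -
        (startSite P n a + startTime n a * V) := by
  rw [quenchedMean_eq_sum_drift ω _ _ _ V, add_sub_cancel_left, ← sum_range_ite_shift hT]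
  refine Finset.sum_congr rfl fun u _ => ?_
  rw [sum_levelMass_mul n a T u ω (hW u)]
  split_ifs with h
  · have : (T : ℤ) - u = startTime n a - ((u + startTime n a - T : ℕ) : ℤ) := by omega
    rw [this]
  · rfl

/-- The conditional covariance of two walks collected along the clock is their overlap; it starts
when the walk `b`, whose starting level is the lower one, is born. -/
lemma sum_sum_levelMass_mul_levelMass (n : ℕ) {a b : ℝ≥0 × ℝ} (hab : b.1 ≤ a.1) {T : ℕ}
    (hT : startTime n a ≤ T) (ω : Env M) {W : ℕ → Finset ℤ}
    (hWa : ∀ u, levelWindow P n a T u ⊆ W u) (hWb : ∀ u, levelWindow P n b T u ⊆ W u) :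
    ∑ u ∈ Finset.range T, ∑ x ∈ W u, levelMass P n a T u x ω * levelMass P n b T u x ω =
      ∑ s ∈ Finset.range (startTime n b),
      overlap ω (startSite P n a) (startTime n a) (startTime n a - startTime n b + s)
        (startSite P n b) (startTime n b) s := by
  have h := startTime_mono n hab
  rw [← sum_range_ite_shift (h.trans hT)]
  refine Finset.sum_congr rfl fun u _ => ?_
  unfold levelMass
  split_ifs with h1 h2 h3
  · rw [overlap_eq_sum _ _ _ _ _ _ _ (W := W u) ?_ (hWb u)]
    · rw [show startTime n a - startTime n b + (u + startTime n b - T) = u + startTime n a - T by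
        omega]
    · rw [show startTime n a - startTime n b + (u + startTime n b - T) = u + startTime n a - T by
        omega]
      exact hWa u
  · simp
  · omega
  · simp

end levels

/-! ### Convergence of the characteristic functions of the rescaled quenched means. -/

section clt

variable {M : ℕ} {P : Measure (Env M)}

lemma GammaQ_comm (a b : ℝ≥0 × ℝ) : GammaQ P a b = GammaQ P b a := by
  have h (v : ℝ) : -(1 / (2 * v)) * (a.2 - b.2) ^ 2 = -(1 / (2 * v)) * (b.2 - a.2) ^ 2 := by ring
  simp only [GammaQ, h]
  rw [abs_sub_comm, add_comm]

lemma rpow_neg_quarter_sq (n : ℕ) : ((n : ℝ) ^ (-(1 / 4) : ℝ)) ^ 2 = 1 / √n := by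
  rw [← Real.rpow_mul_natCast (Nat.cast_nonneg n), Real.sqrt_eq_rpow,
    one_div ((n : ℝ) ^ (1 / 2 : ℝ)), ← Real.rpow_neg (Nat.cast_nonneg n)]
  norm_num

lemma tendsto_rpow_neg_quarter :
    Tendsto (fun n : ℕ => (n : ℝ) ^ (-(1 / 4) : ℝ)) atTop (𝓝 0) :=
  (tendsto_rpow_neg_atTop (by norm_num)).comp tendsto_natCast_atTop_atTop

lemma abs_sum_theta_levelMass_le {ι : Type*} [Fintype ι] (θ : ι → ℝ) (a : ι → ℝ≥0 × ℝ)
    (n T u : ℕ) (ω : Env M) {W : Finset ℤ} (hW : ∀ j, levelWindow P n (a j) T u ⊆ W) :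
    ∑ x ∈ W, |∑ j, θ j * levelMass P n (a j) T u x ω| ≤ ∑ j, |θ j| := by
  calc ∑ x ∈ W, |∑ j, θ j * levelMass P n (a j) T u x ω|
      ≤ ∑ x ∈ W, ∑ j, |θ j| * levelMass P n (a j) T u x ω := by
        refine Finset.sum_le_sum fun x _ => (Finset.abs_sum_le_sum_abs _ _).trans
          (le_of_eq (Finset.sum_congr rfl fun j _ => ?_))
        rw [abs_mul, abs_of_nonneg (levelMass_nonneg _ _ _ _ _ _)]
    _ = ∑ j, |θ j| * ∑ x ∈ W, levelMass P n (a j) T u x ω := by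
        rw [Finset.sum_comm]
        simp only [Finset.mul_sum]
    _ ≤ ∑ j, |θ j| := Finset.sum_le_sum fun j _ =>
        mul_le_of_le_one_right (abs_nonneg _) (sum_levelMass_le_one n (a j) T u ω (hW j))

lemma sigmaDSq_eq : sigmaDSq P = ∫ ω, ‖(((∑ j ∈ Finset.Icc (-(M : ℤ)) M,
      (j : ℝ) * jumpWeight (ω (0, 0)) j) - meanDrift P : ℝ) : ℂ)‖ ^ 2 ∂P := by
  unfold sigmaDSq
  refine integral_congr_ae (ae_of_all _ fun ω => ?_)
  simp only [Complex.norm_real, Real.norm_eq_abs, sq_abs]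
  rfl

variable [IsProbabilityMeasure P]

lemma tendsto_sum_sum_levelMass (hiid : IsIID P) (hell : Elliptic P) (hspan : SpanOne P)
    (a b : ℝ≥0 × ℝ) {T : ℕ → ℕ} (hTa : ∀ n, startTime n a ≤ T n)
    (hTb : ∀ n, startTime n b ≤ T n) {W : ℕ → ℕ → Finset ℤ}
    (hWa : ∀ n u, levelWindow P n a (T n) u ⊆ W n u)
    (hWb : ∀ n u, levelWindow P n b (T n) u ⊆ W n u) :
    Tendsto (fun n : ℕ => ∫ ω, |sigmaDSq P * (∑ u ∈ Finset.range (T n), ∑ x ∈ W n u,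
      levelMass P n a (T n) u x ω * levelMass P n b (T n) u x ω) / √n - GammaQ P a b| ∂P)
      atTop (𝓝 0) := by
  rcases le_total b.1 a.1 with h | h
  · simp only [sum_sum_levelMass_mul_levelMass _ h (hTa _) _ (hWa _) (hWb _)]
    exact tendsto_sum_overlap hiid hell hspan h
  · simp only [mul_comm (levelMass P _ a _ _ _ _),
      sum_sum_levelMass_mul_levelMass _ h (hTb _) _ (hWb _) (hWa _), GammaQ_comm a b]
    exact tendsto_sum_overlap hiid hell hspan h

lemma driftAt_sub_eq (ω : Env M) (x l : ℤ) (V : ℝ) :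
    driftAt ω x l - V =
      (∑ j ∈ Finset.Icc (-(M : ℤ)) M, (j : ℝ) * jumpWeight (ω (x, l)) j) - V := by
  simp only [driftAt, weight_eq_jumpWeight]


lemma exists_abs_driftAt_sub_le (M : ℕ) (V : ℝ) :
    ∃ K : ℝ, 0 ≤ K ∧ ∀ v : JumpVector M,
      |(∑ j ∈ Finset.Icc (-(M : ℤ)) M, (j : ℝ) * jumpWeight v j) - V| ≤ K := by
  refine ⟨∑ j ∈ Finset.Icc (-(M : ℤ)) M, |(j : ℝ)| + |V|, by positivity, fun v => ?_⟩
  refine (abs_sub _ _).trans (add_le_add_left ((Finset.abs_sum_le_sum_abs _ _).trans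
    (Finset.sum_le_sum fun j hj => ?_)) _)
  rw [abs_mul, abs_of_nonneg (jumpWeight_nonneg v j)]
  refine mul_le_of_le_one_right (abs_nonneg _) ?_
  rw [← jumpWeight_sum v]
  exact Finset.single_le_sum (fun i _ => jumpWeight_nonneg v i) hj

lemma sum_sum_linComb_mul {ι : Type*} [Fintype ι] (ε : ℝ) (θ : ι → ℝ) (R : Finset ℕ)
    (W : ℕ → Finset ℤ) (m : ι → ℕ → ℤ → ℝ) (d : ℕ → ℤ → ℝ) :
    ∑ u ∈ R, ∑ x ∈ W u, (ε * ∑ j, θ j * m j u x) * d u x =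
      ∑ j, θ j * (ε * ∑ u ∈ R, ∑ x ∈ W u, m j u x * d u x) := by
  simp only [Finset.mul_sum]
  rw [Finset.sum_comm]
  refine Finset.sum_congr rfl fun u _ => ?_
  rw [Finset.sum_comm]
  refine Finset.sum_congr rfl fun x _ => ?_
  rw [Finset.sum_mul]
  exact Finset.sum_congr rfl fun j _ => by ring

lemma sum_sum_linComb_sq {ι : Type*} [Fintype ι] (ε : ℝ) (θ : ι → ℝ) (R : Finset ℕ)
    (W : ℕ → Finset ℤ) (m : ι → ℕ → ℤ → ℝ) :
    ∑ u ∈ R, ∑ x ∈ W u, (ε * ∑ j, θ j * m j u x) ^ 2 =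
      ∑ i, ∑ j, θ i * θ j * (ε ^ 2 * ∑ u ∈ R, ∑ x ∈ W u, m i u x * m j u x) := by
  simp only [sq (ε * _)]
  rw [sum_sum_linComb_mul ε θ R W m fun u x => ε * ∑ j, θ j * m j u x]
  refine Finset.sum_congr rfl fun i _ => ?_
  have h := sum_sum_linComb_mul ε θ R W m (m i)
  simp only [mul_comm (m i _ _)]
  rw [h, Finset.mul_sum, Finset.mul_sum]
  exact Finset.sum_congr rfl fun j _ => by ring

lemma integral_drift_sub (P : Measure (Env M)) [IsProbabilityMeasure P] :
    ∫ ω, (((∑ j ∈ Finset.Icc (-(M : ℤ)) M,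
      (j : ℝ) * jumpWeight (ω (0, 0)) j) - meanDrift P : ℝ) : ℂ) ∂P = 0 := by
  have hb : BddMeasurable univ (fun ω : Env M =>
      ∑ j ∈ Finset.Icc (-(M : ℤ)) M, (j : ℝ) * weight ω 0 0 j) := BddMeasurable.sum _ fun j _ =>
    (BddMeasurable.const _).mul (bddMeasurable_weight (mem_univ _) j)
  have h : ∫ ω : Env M, ((∑ j ∈ Finset.Icc (-(M : ℤ)) M,
      (j : ℝ) * weight ω 0 0 j) - meanDrift P) ∂P = 0 := by
    rw [integral_sub (hb.integrable P) (integrable_const _), integral_const, probReal_univ,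
      one_smul]
    exact sub_self _
  rw [integral_complex_ofReal]
  exact_mod_cast h

/-- Up to `O(n^{-1/4})` the linear combination is the martingale array `ξ n`, whose increments are
of order `n^{-1/4}` because each position law has mass at most one. Its conditional variance is a
quadratic form in rescaled overlaps and converges in `L¹` to the constant `Γ`. -/
lemma tendsto_integral_cexp_sum_yProc (hiid : IsIID P) (hell : Elliptic P) (hspan : SpanOne P)
    {ι : Type*} [Fintype ι] (θ : ι → ℝ) (a : ι → ℝ≥0 × ℝ) :
    Tendsto (fun n : ℕ => ∫ ω, Complex.exp ((∑ j, θ j * yProc P n (a j) ω : ℝ) * Complex.I) ∂P)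
      atTop (𝓝 (Real.exp (-((∑ i, ∑ j, θ i * θ j * GammaQ P (a i) (a j)) / 2)) : ℂ)) := by
  classical
  set V := meanDrift P with hVdef
  set Γ := ∑ i, ∑ j, θ i * θ j * GammaQ P (a i) (a j) with hΓ
  set Θ := ∑ j, |θ j| with hΘ
  have hΘ0 : 0 ≤ Θ := Finset.sum_nonneg fun _ _ => abs_nonneg _
  have hσD : 0 ≤ sigmaDSq P := integral_nonneg fun _ => sq_nonneg _
  obtain ⟨K, hK0, hK⟩ := exists_abs_driftAt_sub_le M V
  set ε : ℕ → ℝ := fun n => (n : ℝ) ^ (-(1 / 4) : ℝ) with hε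
  have hε0 : ∀ n, 0 ≤ ε n := fun n => by positivity
  -- The highest starting level, where the clock begins.
  set T : ℕ → ℕ := fun n => Finset.univ.sup fun j => startTime n (a j) with hT
  have hTle : ∀ j n, startTime n (a j) ≤ T n := fun j n =>
    Finset.le_sup (f := fun j => startTime n (a j)) (Finset.mem_univ j)
  set W : ℕ → ℕ → Finset ℤ := fun n u =>
    Finset.univ.biUnion fun j => levelWindow P n (a j) (T n) u with hW
  have hWs : ∀ j n u, levelWindow P n (a j) (T n) u ⊆ W n u := fun j n u =>
    Finset.subset_biUnion_of_mem (fun j => levelWindow P n (a j) (T n) u) (Finset.mem_univ j)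
  set c : ℕ → ℕ → ℤ → Env M → ℝ := fun n u x ω =>
    ε n * ∑ j, θ j * levelMass P n (a j) (T n) u x ω with hc
  -- At tick `u` the sites strictly above level `T - u` are known; the drifts on that level enter `ξ
  -- n u` and become known at `u + 1`.
  set S : ℕ → ℕ → Set (ℤ × ℤ) := fun n u => {z : ℤ × ℤ | (T n : ℤ) - u < z.2} with hS
  have hSmono : ∀ n, Monotone (S n) := fun n u u' huu z hz => by
    simp only [hS, mem_ofPred_eq] at hz ⊢
    omega
  have hcb : ∀ n u x, BddMeasurable (S n u) (c n u x) := fun n u x =>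
    (BddMeasurable.const _).mul (BddMeasurable.sum _ fun j _ =>
      (BddMeasurable.const _).mul (bddMeasurable_levelMass _ _ _ _ _))
  set Z : JumpVector M → ℝ := fun v =>
    (∑ j ∈ Finset.Icc (-(M : ℤ)) M, (j : ℝ) * jumpWeight v j) - V with hZ
  have hZm : Measurable Z := by simp only [hZ]; fun_prop
  set ξ : ℕ → ℕ → Env M → ℝ := fun n u ω =>
    ∑ x ∈ W n u, c n u x ω * Z (ω (x, (T n : ℤ) - u)) with hξ
  set v : ℕ → ℕ → Env M → ℝ := fun n u ω => sigmaDSq P * ∑ x ∈ W n u, c n u x ω ^ 2 with hv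
  have hZb : ∀ n u x, BddMeasurable (S n (u + 1)) (fun ω : Env M => Z (ω (x, (T n : ℤ) - u))) :=
    fun n u x => ⟨hZm.comp (measurable_apply_sig (by simp only [hS, mem_ofPred_eq]; omega)), K,
      fun ω => hK _⟩
  have hξb : ∀ n u, BddMeasurable (S n (u + 1)) (ξ n u) := fun n u =>
    BddMeasurable.sum _ fun x _ => ((hcb n u x).mono (hSmono n (Nat.le_succ u))).mul (hZb n u x)
  have hvb : ∀ n u, BddMeasurable (S n u) (v n u) := fun n u =>
    (BddMeasurable.const _).mul (BddMeasurable.sum _ fun x _ => (hcb n u x).pow 2)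
  have hv0 : ∀ n u ω, 0 ≤ v n u ω := fun n u ω =>
    mul_nonneg hσD (Finset.sum_nonneg fun _ _ => sq_nonneg _)
  have hcsum : ∀ n u ω, ∑ x ∈ W n u, |c n u x ω| ≤ ε n * Θ := fun n u ω => by
    simp only [hc, abs_mul, abs_of_nonneg (hε0 n), ← Finset.mul_sum]
    exact mul_le_mul_of_nonneg_left (abs_sum_theta_levelMass_le θ a n (T n) u ω
      fun j => hWs j n u) (hε0 n)
  have hξδ : ∀ n u ω, |ξ n u ω| ≤ ε n * Θ * K := fun n u ω => by
    refine (Finset.abs_sum_le_sum_abs _ _).trans ?_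
    refine le_trans (Finset.sum_le_sum fun x _ => ?_) ((Finset.sum_mul _ _ _).symm.le.trans
      (mul_le_mul_of_nonneg_right (hcsum n u ω) hK0))
    rw [abs_mul]
    exact mul_le_mul_of_nonneg_left (hK _) (abs_nonneg _)
  have hvη : ∀ n u ω, v n u ω ≤ sigmaDSq P * (ε n * Θ) ^ 2 := fun n u ω => by
    refine mul_le_mul_of_nonneg_left ?_ hσD
    calc ∑ x ∈ W n u, c n u x ω ^ 2 = ∑ x ∈ W n u, |c n u x ω| ^ 2 := by simp only [sq_abs]
      _ ≤ (∑ x ∈ W n u, |c n u x ω|) ^ 2 :=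
          Finset.sum_sq_le_sq_sum_of_nonneg fun _ _ => abs_nonneg _
      _ ≤ _ := pow_le_pow_left₀ (Finset.sum_nonneg fun _ _ => abs_nonneg _) (hcsum n u ω) 2
  have hnot : ∀ n u x, (x, (T n : ℤ) - u) ∉ S n u := fun n u x => by simp [hS]
  have h1 : ∀ n u, ∀ Ψ : Env M → ℂ, BddMeasurable (S n u) Ψ →
      ∫ ω, Ψ ω * (ξ n u ω : ℂ) ∂P = 0 := fun n u Ψ hΨ => by
    have h := integral_mul_siteSum hiid (hnot n u) (W := W n u)
      (c := fun x ω => (c n u x ω : ℂ)) (Z := fun v => (Z v : ℂ)) (fun x => (hcb n u x).ofReal)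
      (Complex.measurable_ofReal.comp hZm) ⟨K, fun v => by rw [Complex.norm_real]; exact hK v⟩
      (integral_drift_sub P) hΨ
    rw [← h]
    refine integral_congr_ae (ae_of_all _ fun ω => ?_)
    simp only [hξ]
    push_cast
    rfl
  have h2 : ∀ n u, ∀ Ψ : Env M → ℂ, BddMeasurable (S n u) Ψ →
      ∫ ω, Ψ ω * ((ξ n u ω ^ 2 : ℝ) : ℂ) ∂P = ∫ ω, Ψ ω * (v n u ω : ℂ) ∂P := fun n u Ψ hΨ => by
    have h := integral_mul_siteSum_sq hiid (hnot n u) (W := W n u)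
      (c := fun x ω => (c n u x ω : ℂ)) (Z := fun v => (Z v : ℂ)) (fun x => (hcb n u x).ofReal)
      (Complex.measurable_ofReal.comp hZm) ⟨K, fun v => by rw [Complex.norm_real]; exact hK v⟩
      (integral_drift_sub P) hΨ
    refine Eq.trans (integral_congr_ae (ae_of_all _ fun ω => ?_)) (h.trans ?_)
    · simp only [hξ]
      rw [← sq_abs, ← Real.norm_eq_abs, ← Complex.norm_real]
      push_cast
      rfl
    · rw [← sigmaDSq_eq, ← integral_mul_const]
      refine integral_congr_ae (ae_of_all _ fun ω => ?_)
      simp only [hv, Complex.norm_real, Real.norm_eq_abs, sq_abs]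
      rw [mul_assoc, mul_comm (sigmaDSq P), Complex.ofReal_mul]
      rfl
  -- the bracket converges
  have hbr : Tendsto (fun n => ∫ ω, |∑ u ∈ Finset.range (T n), v n u ω - Γ| ∂P) atTop (𝓝 0) := by
    have hij := fun i j => (tendsto_sum_sum_levelMass hiid hell hspan (a i) (a j) (hTle i) (hTle j)
      (hWs i) (hWs j)).const_mul |θ i * θ j|
    have hsum := tendsto_finsetSum Finset.univ fun i _ =>
      tendsto_finsetSum Finset.univ fun j _ => hij i j
    simp only [mul_zero, Finset.sum_const_zero] at hsum
    refine squeeze_zero (fun n => integral_nonneg fun ω => abs_nonneg _) (fun n => ?_) hsum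
    have hint : ∀ i j, Integrable (fun ω => |θ i * θ j| * |sigmaDSq P *
        (∑ u ∈ Finset.range (T n), ∑ x ∈ W n u, levelMass P n (a i) (T n) u x ω *
          levelMass P n (a j) (T n) u x ω) / √n - GammaQ P (a i) (a j)|) P := fun i j => by
      have hb : BddMeasurable univ (fun ω : Env M => ∑ u ∈ Finset.range (T n), ∑ x ∈ W n u,
          levelMass P n (a i) (T n) u x ω * levelMass P n (a j) (T n) u x ω) :=
        BddMeasurable.sum _ fun u _ => BddMeasurable.sum _ fun x _ =>
          ((bddMeasurable_levelMass _ _ _ _ _).mono (subset_univ _)).mul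
            ((bddMeasurable_levelMass _ _ _ _ _).mono (subset_univ _))
      exact ((((hb.integrable P).const_mul _).div_const _).sub (integrable_const _)).abs.const_mul _
    simp only [← integral_const_mul]
    simp only [← integral_finsetSum _ fun j _ => hint _ j]
    rw [← integral_finsetSum _ fun i _ => integrable_finsetSum _ fun j _ => hint i j]
    refine integral_mono_of_nonneg (ae_of_all _ fun ω => abs_nonneg _)
      (integrable_finsetSum _ fun i _ => integrable_finsetSum _ fun j _ => hint i j)
      (ae_of_all _ fun ω => ?_)
    have e : ∑ u ∈ Finset.range (T n), v n u ω - Γ = ∑ i, ∑ j, θ i * θ j * (sigmaDSq P *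
        (∑ u ∈ Finset.range (T n), ∑ x ∈ W n u, levelMass P n (a i) (T n) u x ω *
          levelMass P n (a j) (T n) u x ω) / √n - GammaQ P (a i) (a j)) := by
      simp only [hv, hc, hΓ]
      rw [← Finset.mul_sum, sum_sum_linComb_sq (ε n) θ (Finset.range (T n)) (W n)
        (fun j u x => levelMass P n (a j) (T n) u x ω), rpow_neg_quarter_sq]
      simp only [Finset.mul_sum, mul_sub, Finset.sum_sub_distrib]
      congr 1
      refine Finset.sum_congr rfl fun i _ => Finset.sum_congr rfl fun j _ => ?_
      simp only [← Finset.mul_sum]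
      ring
    simp only
    rw [e]
    refine (Finset.abs_sum_le_sum_abs _ _).trans (Finset.sum_le_sum fun i _ =>
      (Finset.abs_sum_le_sum_abs _ _).trans (Finset.sum_le_sum fun j _ => ?_))
    rw [abs_mul]
  -- Nonnegativity of the limiting variance is inherited from the conditional variances.
  have hΓ0 : 0 ≤ Γ := by
    have h : Tendsto (fun n => Γ + ∫ ω, |∑ u ∈ Finset.range (T n), v n u ω - Γ| ∂P) atTop
        (𝓝 (Γ + 0)) := hbr.const_add _
    rw [add_zero] at h
    refine ge_of_tendsto' h fun n => ?_
    have : -Γ ≤ ∫ ω, |∑ u ∈ Finset.range (T n), v n u ω - Γ| ∂P := by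
      have hI : Integrable (fun ω => |∑ u ∈ Finset.range (T n), v n u ω - Γ|) P :=
        (((BddMeasurable.sum (S := univ) _ fun u _ =>
          (hvb n u).mono (subset_univ _)).integrable P).sub (integrable_const _)).abs
      calc -Γ = ∫ _, -Γ ∂P := by simp
        _ ≤ _ := integral_mono (integrable_const _) hI fun ω => by
            have := Finset.sum_nonneg fun u (_ : u ∈ Finset.range (T n)) => hv0 n u ω
            exact le_trans (by linarith) (le_abs_self _)
    linarith
  have hεlim : Tendsto ε atTop (𝓝 0) := tendsto_rpow_neg_quarter
  have hδlim : Tendsto (fun n => ε n * Θ * K) atTop (𝓝 0) := by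
    simpa using (hεlim.mul_const Θ).mul_const K
  have hηlim : Tendsto (fun n => sigmaDSq P * (ε n * Θ) ^ 2) atTop (𝓝 0) := by
    simpa using ((hεlim.mul_const Θ).pow 2).const_mul (sigmaDSq P)
  -- convergence of the martingale part
  have hmart : Tendsto (fun n => ∫ ω, Complex.exp
      ((∑ u ∈ Finset.range (T n), ξ n u ω : ℝ) * Complex.I) ∂P) atTop
      (𝓝 (Real.exp (-(Γ / 2)) : ℂ)) := by
    rw [tendsto_iff_norm_sub_tendsto_zero]
    have hbound : Tendsto (fun n => Real.exp ((Γ + 1) / 2) *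
        (ε n * Θ * K + sigmaDSq P * (ε n * Θ) ^ 2) * (Γ + 1) + (1 + Real.exp ((Γ + 1) / 2)) *
          ∫ ω, |∑ u ∈ Finset.range (T n), v n u ω - Γ| ∂P) atTop (𝓝 0) := by
      simpa using (((hδlim.add hηlim).const_mul (Real.exp ((Γ + 1) / 2))).mul_const (Γ + 1)).add
        (hbr.const_mul (1 + Real.exp ((Γ + 1) / 2)))
    refine squeeze_zero' (Eventually.of_forall fun n => norm_nonneg _) ?_ hbound
    filter_upwards [hδlim.eventually_le_const one_pos, hηlim.eventually_le_const one_pos]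
      with n hn1 hn2
    exact norm_integral_cexp_sum_sub_le (hSmono n) (hξb n) (hvb n) (hv0 n) (hξδ n) (hvη n) hn1 hn2
      hΓ0 (fun u _ => h1 n u) (fun u _ => h2 n u)
  -- comparison with the process
  have hdiff : ∀ n ω, |∑ j, θ j * yProc P n (a j) ω - ∑ u ∈ Finset.range (T n), ξ n u ω| ≤
      ε n * (Θ * (1 + |V|)) := by
    intro n ω
    have e1 : ∑ u ∈ Finset.range (T n), ξ n u ω = ∑ j, θ j * (ε n * (quenchedMean ω
        (startSite P n (a j)) (startTime n (a j)) (startTime n (a j)) -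
        (startSite P n (a j) + startTime n (a j) * V))) := by
      simp only [hξ, hc]
      rw [sum_sum_linComb_mul (ε n) θ (Finset.range (T n)) (W n)
        (fun j u x => levelMass P n (a j) (T n) u x ω)]
      refine Finset.sum_congr rfl fun j _ => ?_
      rw [← sum_sum_levelMass_mul_drift n (a j) (hTle j n) ω (hWs j n) V]
      simp only [driftAt_sub_eq, hZ]
    have e2 : ∑ j, θ j * yProc P n (a j) ω - ∑ u ∈ Finset.range (T n), ξ n u ω =
        ∑ j, θ j * (ε n * ((startSite P n (a j) + startTime n (a j) * V) -
          ⌊(a j).2 * √n⌋)) := by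
      rw [e1, ← Finset.sum_sub_distrib]
      refine Finset.sum_congr rfl fun j _ => ?_
      rw [show yProc P n (a j) ω = ε n * (quenchedMean ω
        (startSite P n (a j)) (startTime n (a j)) (startTime n (a j)) - ⌊(a j).2 * √n⌋) from rfl]
      ring
    rw [e2]
    refine (Finset.abs_sum_le_sum_abs _ _).trans ?_
    rw [hΘ, Finset.sum_mul, Finset.mul_sum]
    refine Finset.sum_le_sum fun j _ => ?_
    rw [abs_mul, abs_mul, abs_of_nonneg (hε0 n)]
    have := mul_le_mul_of_nonneg_left (mul_le_mul_of_nonneg_left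
      (abs_startSite_sub_floor_le (P := P) n (a j)) (hε0 n)) (abs_nonneg (θ j))
    refine this.trans (le_of_eq ?_)
    ring
  have hybm : ∀ n, BddMeasurable univ (fun ω => ∑ j, θ j * yProc P n (a j) ω) := fun n =>
    BddMeasurable.sum _ fun j _ => (BddMeasurable.const _).mul ((BddMeasurable.const _).mul
      (BddMeasurable.sub (by
        simp only [quenchedMean_eq_walkExp]
        exact bddMeasurable_walkExp_univ _ _ _ _) (BddMeasurable.const _)))
  have hξsb : ∀ n, BddMeasurable univ (fun ω => ∑ u ∈ Finset.range (T n), ξ n u ω) := fun n =>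
    BddMeasurable.sum _ fun u _ => (hξb n u).mono (subset_univ _)
  have hd0 : Tendsto (fun n => ∫ ω, Complex.exp ((∑ j, θ j * yProc P n (a j) ω : ℝ) * Complex.I)
      ∂P - ∫ ω, Complex.exp ((∑ u ∈ Finset.range (T n), ξ n u ω : ℝ) * Complex.I) ∂P) atTop
      (𝓝 0) := by
    have hlim : Tendsto (fun n => ε n * (Θ * (1 + |V|))) atTop (𝓝 0) := by
      simpa using hεlim.mul_const (Θ * (1 + |V|))
    refine squeeze_zero_norm (fun n => ?_) hlim
    rw [← integral_sub ((hybm n).cexp_mul_I.integrable P) ((hξsb n).cexp_mul_I.integrable P)]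
    refine (norm_integral_le_of_norm_le_const (C := ε n * (Θ * (1 + |V|)))
      (ae_of_all _ fun ω => ?_)).trans (by simp)
    set p := ∑ j, θ j * yProc P n (a j) ω with hp
    set q := ∑ u ∈ Finset.range (T n), ξ n u ω with hq
    have e : Complex.exp ((p : ℝ) * Complex.I) - Complex.exp ((q : ℝ) * Complex.I) =
        Complex.exp ((q : ℝ) * Complex.I) * (Complex.exp (Complex.I * ((p - q : ℝ) : ℂ)) - 1) := by
      rw [mul_sub, ← Complex.exp_add, mul_one]
      congr 2
      push_cast
      ring
    rw [e, norm_mul, Complex.norm_exp_ofReal_mul_I, one_mul]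
    exact Real.norm_exp_I_mul_ofReal_sub_one_le.trans (hdiff n ω)
  have := hd0.add hmart
  simpa using this

lemma measurable_yProc (P : Measure (Env M)) (n : ℕ) (a : ℝ≥0 × ℝ) : Measurable (yProc P n a) := by
  unfold yProc
  simp only [quenchedMean_eq_walkExp]
  exact ((bddMeasurable_walkExp_univ _ _ _ _).measurable.sub_const _).const_mul _

end clt


/-! ### Convergence of the finite dimensional distributions. -/

section weakConvergence

lemma IsCenteredGaussian.integral_cexp_sum {T Ω : Type*} [MeasurableSpace Ω] {X : T → Ω → ℝ}
    {Γ : T → T → ℝ} {Q : Measure Ω} (hX : IsCenteredGaussian X Γ Q) {ι : Type*} [Fintype ι]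
    (θ : ι → ℝ) (a : ι → T) :
    ∫ ω, Complex.exp ((∑ j, θ j * X (a j) ω : ℝ) * Complex.I) ∂Q =
      (Real.exp (-((∑ i, ∑ j, θ i * θ j * Γ (a i) (a j)) / 2)) : ℂ) := by
  have hQ := hX.gaussian.isProbabilityMeasure
  have h2 : ∀ i, MemLp (X i) 2 Q := fun i => (hX.gaussian.hasGaussianLaw_eval i).memLp_two
  have hS : HasGaussianLaw (fun ω => ∑ j, θ j * X (a j) ω) Q :=
    ((hX.gaussian.comp_right a).smul θ).hasGaussianLaw_fun_sum (I := Finset.univ)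
  have hmean : ∫ ω, ∑ j, θ j * X (a j) ω ∂Q = 0 := by
    rw [integral_finsetSum _ fun j _ => ((h2 (a j)).integrable one_le_two).const_mul (θ j)]
    simp [integral_const_mul, hX.mean_zero]
  have hvar : Var[fun ω => ∑ j, θ j * X (a j) ω; Q] = ∑ i, ∑ j, θ i * θ j * Γ (a i) (a j) := by
    rw [variance_of_integral_eq_zero hS.aemeasurable hmean]
    have e : ∀ ω, (∑ j, θ j * X (a j) ω) ^ 2 =
        ∑ i, ∑ j, θ i * θ j * (X (a i) ω * X (a j) ω) := fun ω => by
      rw [sq, Finset.sum_mul_sum]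
      exact Finset.sum_congr rfl fun i _ => Finset.sum_congr rfl fun j _ => by ring
    simp only [e]
    have hij : ∀ i j, Integrable (fun ω => θ i * θ j * (X (a i) ω * X (a j) ω)) Q := fun i j =>
      ((h2 (a i)).integrable_mul (h2 (a j))).const_mul _
    rw [integral_finsetSum _ fun i _ => integrable_finsetSum _ fun j _ => hij i j]
    refine Finset.sum_congr rfl fun i _ => ?_
    rw [integral_finsetSum _ fun j _ => hij i j]
    exact Finset.sum_congr rfl fun j _ => by rw [integral_const_mul, hX.covariance]
  have hmap := hS.map_eq_gaussianReal
  rw [hmean, hvar] at hmap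
  have hΓ : 0 ≤ ∑ i, ∑ j, θ i * θ j * Γ (a i) (a j) := hvar ▸ variance_nonneg _ _
  have h := charFun_gaussianReal (μ := 0)
    (v := (∑ i, ∑ j, θ i * θ j * Γ (a i) (a j)).toNNReal) 1
  rw [← hmap, charFun_apply_real,
    integral_map hS.aemeasurable (Continuous.aestronglyMeasurable (by fun_prop))] at h
  simp only [Complex.ofReal_one, one_mul, Complex.ofReal_zero, zero_mul, mul_one, zero_sub, one_pow,
    Real.coe_toNNReal _ hΓ] at h
  rw [h]
  push_cast
  rfl

lemma charFun_map_toLp {Ω : Type*} [MeasurableSpace Ω] {Q : Measure Ω} {k : ℕ}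
    {X : Ω → Fin k → ℝ} (hX : AEMeasurable X Q) (t : EuclideanSpace ℝ (Fin k)) :
    charFun (Q.map fun ω => WithLp.toLp 2 (X ω)) t =
      ∫ ω, Complex.exp ((∑ j, t j * X ω j : ℝ) * Complex.I) ∂Q := by
  rw [charFun_apply, integral_map (φ := fun ω => WithLp.toLp 2 (X ω))
    ((PiLp.continuous_toLp 2 _).measurable.comp_aemeasurable hX)
    (Continuous.aestronglyMeasurable (by fun_prop))]
  simp [PiLp.inner_apply]

variable {M : ℕ} {P : Measure (Env M)} [IsProbabilityMeasure P]

/-- Lévy's continuity theorem is applied in Euclidean space, where characteristic functions are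
taken with respect to the inner product, and the result is carried back by the continuous
identification with `Fin k → ℝ`. -/
lemma tendstoInDistribution_yProc (hiid : IsIID P) (hell : Elliptic P) (hspan : SpanOne P)
    {Ω' : Type*} [MeasurableSpace Ω'] (Q : Measure Ω') [IsProbabilityMeasure Q]
    (y : ℝ≥0 × ℝ → Ω' → ℝ) (hy : IsCenteredGaussian y (GammaQ P) Q) (k : ℕ)
    (a : Fin k → ℝ≥0 × ℝ) :
    TendstoInDistribution
      (fun (n : ℕ) (ω : Env M) (j : Fin k) => yProc P n (a j) ω)
      atTop (fun (ω : Ω') (j : Fin k) => y (a j) ω) (fun _ => P) Q := by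
  have hXm : ∀ n, AEMeasurable (fun (ω : Env M) (j : Fin k) => yProc P n (a j) ω) P := fun n =>
    (measurable_pi_lambda _ fun j => measurable_yProc P n (a j)).aemeasurable
  have hYm : AEMeasurable (fun (ω : Ω') (j : Fin k) => y (a j) ω) Q :=
    aemeasurable_pi_lambda _ fun j => hy.gaussian.aemeasurable (a j)
  have hc : Continuous (WithLp.toLp 2 : (Fin k → ℝ) → EuclideanSpace ℝ (Fin k)) :=
    PiLp.continuous_toLp 2 _
  have h : TendstoInDistribution
      (fun (n : ℕ) (ω : Env M) => WithLp.toLp 2 (fun j : Fin k => yProc P n (a j) ω))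
      atTop (fun (ω : Ω') => WithLp.toLp 2 (fun j : Fin k => y (a j) ω)) (fun _ => P) Q := by
    refine ⟨fun n => hc.measurable.comp_aemeasurable (hXm n),
      hc.measurable.comp_aemeasurable hYm, ?_⟩
    refine ProbabilityMeasure.tendsto_iff_tendsto_charFun.2 fun t => ?_
    simp only [ProbabilityMeasure.coe_mk]
    rw [charFun_map_toLp hYm, hy.integral_cexp_sum]
    simp only [charFun_map_toLp (hXm _)]
    exact tendsto_integral_cexp_sum_yProc hiid hell hspan (fun j => t j) a
  exact h.continuous_comp (g := WithLp.ofLp) (PiLp.continuous_ofLp 2 _)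

end weakConvergence


/-! ### Random series of independent normal variables. -/

section gaussianSeries

lemma integral_sq_of_hasLaw_gaussianReal {Ω : Type*} [MeasurableSpace Ω] {Q : Measure Ω}
    {X : Ω → ℝ} {v : ℝ≥0} (hX : HasLaw X (gaussianReal 0 v) Q) :
    MemLp X 2 Q ∧ ∫ ω, X ω ∂Q = 0 ∧ ∫ ω, X ω ^ 2 ∂Q = v := by
  have hG : HasGaussianLaw X Q := hX.hasGaussianLaw
  have h0 : ∫ ω, X ω ∂Q = 0 := by
    rw [hX.integral_eq, integral_id_gaussianReal]
  refine ⟨hG.memLp_two, h0, ?_⟩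
  have := hX.variance_eq
  rw [variance_id_gaussianReal, variance_of_integral_eq_zero hX.aemeasurable h0] at this
  exact this

/-- The law of a sequence of independent standard normal variables. -/
def stdNormalSeq : Measure (ℕ → ℝ) := Measure.infinitePi fun _ => gaussianReal 0 1

instance : IsProbabilityMeasure stdNormalSeq := by
  unfold stdNormalSeq; infer_instance

/-- The value of the series `∑ cₙ ξₙ`, whenever it converges. -/
def seriesValue (c ξ : ℕ → ℝ) : ℝ := limsup (fun N => ∑ n ∈ Finset.range N, c n * ξ n) atTop

/-- An upper limit, unlike an almost sure limit, is defined everywhere and jointly measurable in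
coefficients and noise. The joint measurability of the random field in space-time and chance comes
from here. -/
lemma measurable_seriesValue :
    Measurable (fun p : (ℕ → ℝ) × (ℕ → ℝ) => seriesValue p.1 p.2) := by
  unfold seriesValue
  exact Measurable.limsup fun N => by fun_prop

lemma hasLaw_sum_stdNormalSeq (c : ℕ → ℝ) (N : ℕ) :
    HasLaw (fun ξ : ℕ → ℝ => ∑ n ∈ Finset.range N, c n * ξ n)
      (gaussianReal 0 (∑ n ∈ Finset.range N, c n ^ 2).toNNReal) stdNormalSeq := by
  refine ⟨(by fun_prop : Measurable _).aemeasurable, ?_⟩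
  have hlaw : ∀ n, stdNormalSeq.map (fun ξ : ℕ → ℝ => c n * ξ n) =
      gaussianReal 0 (c n ^ 2).toNNReal := fun n => by
    have h1 : stdNormalSeq.map (fun ξ : ℕ → ℝ => ξ n) = gaussianReal 0 1 :=
      Measure.infinitePi_map_eval (fun _ => gaussianReal 0 1) n
    have h2 : (fun ξ : ℕ → ℝ => c n * ξ n) = (c n * ·) ∘ fun ξ : ℕ → ℝ => ξ n := rfl
    rw [h2, ← Measure.map_map (by fun_prop) (by fun_prop), h1, gaussianReal_map_const_mul, mul_zero,
      mul_one]
    congr 1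
    ext
    simp [sq_nonneg]
  have hind : iIndepFun (fun n (ξ : ℕ → ℝ) => c n * ξ n) stdNormalSeq :=
    iIndepFun_infinitePi (X := fun n x => c n * x) fun n => by fun_prop
  refine Measure.ext_of_charFun ?_
  rw [(hind.restrict _).charFun_map_fun_finsetSum_eq_prod (fun _ _ => (by fun_prop : Measurable _).aemeasurable)]
  ext t
  rw [Finset.prod_apply]
  simp only [hlaw, charFun_gaussianReal]
  rw [← Complex.exp_sum]
  congr 1
  simp only [Complex.ofReal_zero, mul_zero, zero_mul, zero_sub, Finset.sum_neg_distrib]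
  rw [Real.coe_toNNReal _ (Finset.sum_nonneg fun _ _ => sq_nonneg _)]
  simp only [Real.coe_toNNReal _ (sq_nonneg _)]
  push_cast
  rw [Finset.sum_mul, Finset.sum_div]

/-- The partial sums form a martingale bounded in `L²`, hence in `L¹`, so Doob's convergence theorem
applies. -/
lemma ae_tendsto_sum_stdNormalSeq {c : ℕ → ℝ} (hc : Summable fun n => c n ^ 2) :
    ∀ᵐ ξ ∂stdNormalSeq,
      Tendsto (fun N => ∑ n ∈ Finset.range N, c n * ξ n) atTop (𝓝 (seriesValue c ξ)) := by
  have hm : ∀ n, StronglyMeasurable (fun ξ : ℕ → ℝ => ξ n) := fun n =>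
    (measurable_pi_apply n).stronglyMeasurable
  have hind : iIndepFun (fun n (ξ : ℕ → ℝ) => ξ n) stdNormalSeq :=
    iIndepFun_infinitePi (X := fun n x => x) fun n => by fun_prop
  have hlaw : ∀ n, HasLaw (fun ξ : ℕ → ℝ => ξ n) (gaussianReal 0 1) stdNormalSeq := fun n =>
    ⟨(measurable_pi_apply n).aemeasurable, Measure.infinitePi_map_eval (fun _ => gaussianReal 0 1) n⟩
  set ℱ := Filtration.natural (fun n (ξ : ℕ → ℝ) => ξ n) hm with hℱ
  have hint : ∀ n, Integrable (fun ξ : ℕ → ℝ => ξ n) stdNormalSeq := fun n =>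
    (integral_sq_of_hasLaw_gaussianReal (hlaw n)).1.integrable one_le_two
  have hadp : StronglyAdapted ℱ (fun N (ξ : ℕ → ℝ) => ∑ n ∈ Finset.range (N + 1), c n * ξ n) := by
    intro N
    refine Finset.stronglyMeasurable_fun_sum _ fun n hn => ?_
    refine StronglyMeasurable.const_mul ?_ _
    exact ((Filtration.stronglyAdapted_natural hm n).mono
      (ℱ.mono (Nat.lt_succ_iff.1 (Finset.mem_range.1 hn))))
  have hSint : ∀ N, Integrable (fun ξ : ℕ → ℝ => ∑ n ∈ Finset.range N, c n * ξ n)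
      stdNormalSeq := fun N => integrable_finsetSum _ fun n _ => (hint n).const_mul _
  have hmart : Martingale (fun N (ξ : ℕ → ℝ) => ∑ n ∈ Finset.range (N + 1), c n * ξ n) ℱ
      stdNormalSeq := by
    refine martingale_nat hadp (fun N => hSint (N + 1)) fun N => ?_
    have e : (fun ξ : ℕ → ℝ => ∑ n ∈ Finset.range (N + 1 + 1), c n * ξ n) =
        (fun ξ : ℕ → ℝ => ∑ n ∈ Finset.range (N + 1), c n * ξ n) +
          c (N + 1) • fun ξ : ℕ → ℝ => ξ (N + 1) := by
      ext ξ
      simp [Finset.sum_range_succ]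
    rw [e]
    have h1 := condExp_add (hSint (N + 1)) ((hint (N + 1)).smul (c (N + 1))) (ℱ N)
    have h2 : stdNormalSeq[fun ξ : ℕ → ℝ => ∑ n ∈ Finset.range (N + 1), c n * ξ n | ℱ N] =
        fun ξ : ℕ → ℝ => ∑ n ∈ Finset.range (N + 1), c n * ξ n :=
      condExp_of_stronglyMeasurable (ℱ.le N) (hadp N) (hSint (N + 1))
    have h3 := condExp_smul (c (N + 1)) (fun ξ : ℕ → ℝ => ξ (N + 1)) (ℱ N) (μ := stdNormalSeq)
    have h4 := hind.condExp_natural_ae_eq_of_lt hm (Nat.lt_succ_self N)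
    filter_upwards [h1, h3, h4] with ξ a1 a3 a4
    rw [a1, Pi.add_apply, a3, h2, Pi.smul_apply, a4,
      (integral_sq_of_hasLaw_gaussianReal (hlaw (N + 1))).2.1, smul_zero, add_zero]
  -- From `|x| ≤ (x² + 1) / 2` and the bound of the partial variances by their total.
  set R : ℝ≥0 := ((∑' n, c n ^ 2 + 1) / 2).toNNReal with hR
  have hbdd : ∀ N, eLpNorm (fun ξ : ℕ → ℝ => ∑ n ∈ Finset.range (N + 1), c n * ξ n) 1
      stdNormalSeq ≤ R := by
    intro N
    have hS := integral_sq_of_hasLaw_gaussianReal (hasLaw_sum_stdNormalSeq c (N + 1))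
    rw [eLpNorm_one_eq_lintegral_enorm, ← ofReal_integral_norm_eq_lintegral_enorm (hSint (N + 1))]
    refine ENNReal.ofReal_le_ofReal ?_
    have i2 := hS.1.integrable_sq
    calc ∫ ξ, ‖∑ n ∈ Finset.range (N + 1), c n * ξ n‖ ∂stdNormalSeq
        ≤ ∫ ξ, ((∑ n ∈ Finset.range (N + 1), c n * ξ n) ^ 2 + 1) / 2 ∂stdNormalSeq := by
          refine integral_mono (hSint (N + 1)).norm ((i2.add (integrable_const 1)).div_const 2)
            fun ξ => ?_
          simp only [Real.norm_eq_abs]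
          set x := ∑ n ∈ Finset.range (N + 1), c n * ξ n
          rw [← sq_abs x]
          nlinarith [sq_nonneg (|x| - 1)]
      _ = (∑ n ∈ Finset.range (N + 1), c n ^ 2 + 1) / 2 := by
          rw [integral_div, integral_add i2 (integrable_const 1), hS.2.2,
            Real.coe_toNNReal _ (Finset.sum_nonneg fun _ _ => sq_nonneg _)]
          simp
      _ ≤ _ := by
          have := hc.sum_le_tsum (Finset.range (N + 1)) fun _ _ => sq_nonneg _
          linarith
  filter_upwards [hmart.submartingale.exists_ae_tendsto_of_bdd hbdd] with ξ hξ
  obtain ⟨l, hl⟩ := hξ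
  have hl' : Tendsto (fun N => ∑ n ∈ Finset.range N, c n * ξ n) atTop (𝓝 l) :=
    (tendsto_add_atTop_iff_nat 1).1 hl
  rw [seriesValue, hl'.limsup_eq]
  exact hl'

lemma tendsto_integral_cexp_mul_I {Ω : Type*} [MeasurableSpace Ω] {Q : Measure Ω}
    [IsProbabilityMeasure Q] {X : ℕ → Ω → ℝ} {Y : Ω → ℝ} (hX : ∀ N, Measurable (X N))
    (h : ∀ᵐ ω ∂Q, Tendsto (fun N => X N ω) atTop (𝓝 (Y ω))) (t : ℝ) :
    Tendsto (fun N => ∫ ω, Complex.exp (t * (X N ω : ℂ) * Complex.I) ∂Q) atTop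
      (𝓝 (∫ ω, Complex.exp (t * (Y ω : ℂ) * Complex.I) ∂Q)) := by
  refine tendsto_integral_of_dominated_convergence (fun _ => (1 : ℝ))
    (fun N => (Complex.measurable_exp.comp (((Complex.measurable_ofReal.comp
      (hX N)).const_mul _).mul_const _)).aestronglyMeasurable) (integrable_const _)
    (fun N => ae_of_all _ fun ω => ?_) ?_
  · rw [← Complex.ofReal_mul, Complex.norm_exp_ofReal_mul_I]
  · filter_upwards [h] with ω hω
    have hcont : Continuous fun x : ℝ => Complex.exp (t * (x : ℂ) * Complex.I) := by fun_prop
    exact (hcont.tendsto _).comp hω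

/-- The characteristic functions of the partial sums pass to the almost sure limit by dominated
convergence. -/
lemma hasLaw_seriesValue {c : ℕ → ℝ} {v : ℝ≥0} (hc : HasSum (fun n => c n ^ 2) v) :
    HasLaw (seriesValue c) (gaussianReal 0 v) stdNormalSeq := by
  have hm : Measurable (seriesValue c) :=
    Measurable.of_uncurry_left (f := seriesValue) measurable_seriesValue
  refine ⟨hm.aemeasurable, Measure.ext_of_charFun (funext fun t => ?_)⟩
  rw [charFun_apply_real, integral_map hm.aemeasurable
    (Continuous.aestronglyMeasurable (by fun_prop)), charFun_gaussianReal]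
  set S : ℕ → (ℕ → ℝ) → ℝ := fun N ξ => ∑ n ∈ Finset.range N, c n * ξ n with hS
  have hSm : ∀ N, Measurable (S N) := fun N => by simp only [hS]; fun_prop
  have hSlim : ∀ᵐ ξ ∂stdNormalSeq, Tendsto (fun N => S N ξ) atTop (𝓝 (seriesValue c ξ)) :=
    ae_tendsto_sum_stdNormalSeq hc.summable
  have h1 := tendsto_integral_cexp_mul_I hSm hSlim t
  have h2 : ∀ N, ∫ ξ : ℕ → ℝ, Complex.exp (t * (S N ξ : ℂ) * Complex.I) ∂stdNormalSeq =
      Complex.exp (t * (0 : ℝ) * Complex.I - (∑ n ∈ Finset.range N, c n ^ 2 : ℝ) * t ^ 2 / 2) :=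
    fun N => by
      have hl : HasLaw (S N) _ _ := hasLaw_sum_stdNormalSeq c N
      have h3 := charFun_gaussianReal (μ := 0) (v := (∑ n ∈ Finset.range N, c n ^ 2).toNNReal) t
      rw [← hl.map_eq, charFun_apply_real, integral_map hl.aemeasurable
        (Continuous.aestronglyMeasurable (by fun_prop))] at h3
      rw [h3, Real.coe_toNNReal _ (Finset.sum_nonneg fun _ _ => sq_nonneg _)]
  simp only [h2] at h1
  refine tendsto_nhds_unique h1 ?_
  have hcont : Continuous fun x : ℝ =>
      Complex.exp (t * (0 : ℝ) * Complex.I - (x : ℂ) * t ^ 2 / 2) := by fun_prop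
  exact (hcont.tendsto _).comp hc.tendsto_sum_nat

lemma seriesValue_add_ae {c d : ℕ → ℝ} (hc : Summable fun n => c n ^ 2)
    (hd : Summable fun n => d n ^ 2) (a b : ℝ) :
    ∀ᵐ ξ ∂stdNormalSeq, seriesValue (fun n => a * c n + b * d n) ξ =
      a * seriesValue c ξ + b * seriesValue d ξ := by
  filter_upwards [ae_tendsto_sum_stdNormalSeq hc, ae_tendsto_sum_stdNormalSeq hd] with ξ h1 h2
  have h := (h1.const_mul a).add (h2.const_mul b)
  have e : ∀ N, a * ∑ n ∈ Finset.range N, c n * ξ n + b * ∑ n ∈ Finset.range N, d n * ξ n =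
      ∑ n ∈ Finset.range N, (a * c n + b * d n) * ξ n := fun N => by
    rw [Finset.mul_sum, Finset.mul_sum, ← Finset.sum_add_distrib]
    exact Finset.sum_congr rfl fun n _ => by ring
  simp only [e] at h
  exact h.limsup_eq

end gaussianSeries

/-! ### Isonormal Gaussian processes. -/

section isonormal

variable {H : Type*} [NormedAddCommGroup H] [InnerProductSpace ℝ H]

/-- A sequence of vectors for which Parseval's identity holds. -/
lemma exists_parseval_seq [CompleteSpace H] [SecondCountableTopology H] :
    ∃ e : ℕ → H, ∀ f g : H, HasSum (fun n => inner ℝ (e n) f * inner ℝ (e n) g) (inner ℝ f g) := by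
  obtain ⟨w, b, hb⟩ := exists_hilbertBasis ℝ H
  have hcount : w.Countable := by
    -- Orthonormal vectors lie at distance `√2 > 1`, so balls of radius `1/2` around them are
    -- disjoint; a second countable space contains only countably many disjoint nonempty open sets.
    have hdisj : w.PairwiseDisjoint fun x => Metric.ball x (1 / 2) := by
      intro x hx y hy hxy
      refine Metric.ball_disjoint_ball ?_
      have hx1 : ‖x‖ = 1 := by have := b.orthonormal.1 ⟨x, hx⟩; rwa [hb] at this
      have hy1 : ‖y‖ = 1 := by have := b.orthonormal.1 ⟨y, hy⟩; rwa [hb] at this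
      have hxy0 : inner ℝ x y = 0 := by
        have := b.orthonormal.2 (i := ⟨x, hx⟩) (j := ⟨y, hy⟩) (fun h => hxy (by simpa using h))
        rwa [hb] at this
      rw [dist_eq_norm]
      have h2 : ‖x - y‖ ^ 2 = 2 := by rw [norm_sub_sq_real, hx1, hy1, hxy0]; norm_num
      nlinarith [norm_nonneg (x - y)]
    exact hdisj.countable_of_isOpen (fun _ _ => Metric.isOpen_ball)
      fun x _ => ⟨x, Metric.mem_ball_self (by norm_num)⟩
  have := hcount.to_subtype
  obtain ⟨ι, hι⟩ := exists_injective_nat w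
  -- The basis is enumerated by an injection into `ℕ`; unused indices carry the zero vector, so
  -- finite and infinite dimension are treated alike.
  refine ⟨Function.extend ι b 0, fun f g => ?_⟩
  have h := b.hasSum_inner_mul_inner f g
  have h' := (hasSum_extend_zero hι).2 h
  have e : (fun n => inner ℝ (Function.extend ι b 0 n) f * inner ℝ (Function.extend ι b 0 n) g) =
      Function.extend ι (fun i => inner ℝ f (b i) * inner ℝ (b i) g) 0 := by
    funext n
    by_cases hn : ∃ x, ι x = n
    · obtain ⟨x, rfl⟩ := hn
      rw [hι.extend_apply, hι.extend_apply, real_inner_comm]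
    · rw [Function.extend_apply' _ _ _ hn, Function.extend_apply' _ _ _ hn]
      simp
  rw [e]
  exact h'

/-- A centred Gaussian family indexed by a real inner product space, given by a map that is
linear up to null sets. -/
structure IsIsonormal {Ω : Type*} [MeasurableSpace Ω] (W : H → Ω → ℝ) (Q : Measure Ω) : Prop where
  hasLaw : ∀ f, HasLaw (W f) (gaussianReal 0 (‖f‖₊ ^ 2)) Q
  linear : ∀ (a b : ℝ) (f g : H), ∀ᵐ ω ∂Q, W (a • f + b • g) ω = a * W f ω + b * W g ω

namespace IsIsonormal

variable {Ω : Type*} [MeasurableSpace Ω] {W : H → Ω → ℝ} {Q : Measure Ω}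

lemma memLp (hW : IsIsonormal W Q) (f : H) : MemLp (W f) 2 Q :=
  (integral_sq_of_hasLaw_gaussianReal (hW.hasLaw f)).1

lemma integral_eq_zero (hW : IsIsonormal W Q) (f : H) : ∫ ω, W f ω ∂Q = 0 :=
  (integral_sq_of_hasLaw_gaussianReal (hW.hasLaw f)).2.1

lemma integral_sq (hW : IsIsonormal W Q) (f : H) : ∫ ω, W f ω ^ 2 ∂Q = ‖f‖ ^ 2 := by
  rw [(integral_sq_of_hasLaw_gaussianReal (hW.hasLaw f)).2.2]
  simp

/-- Polarization: apply the variance formula to `f + g`. -/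
lemma integral_mul (hW : IsIsonormal W Q) (f g : H) :
    ∫ ω, W f ω * W g ω ∂Q = inner ℝ f g := by
  have h1 := hW.integral_sq (f + g)
  have h2 : ∀ᵐ ω ∂Q, W (f + g) ω ^ 2 = W f ω ^ 2 + 2 * (W f ω * W g ω) + W g ω ^ 2 := by
    filter_upwards [hW.linear 1 1 f g] with ω hω
    rw [one_smul, one_smul] at hω
    rw [hω]
    ring
  have i1 := (hW.memLp f).integrable_sq
  have i2 := (hW.memLp g).integrable_sq
  have i3 : Integrable (fun ω => 2 * (W f ω * W g ω)) Q :=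
    ((hW.memLp f).integrable_mul (hW.memLp g)).const_mul 2
  have i4 : Integrable (fun ω => W f ω ^ 2 + 2 * (W f ω * W g ω)) Q := i1.add i3
  rw [integral_congr_ae h2, integral_add i4 i2, integral_add i1 i3, integral_const_mul,
    hW.integral_sq, hW.integral_sq, norm_add_sq_real] at h1
  linarith

lemma sum_ae [IsProbabilityMeasure Q] (hW : IsIsonormal W Q) {ι : Type*} (s : Finset ι) (c : ι → ℝ)
    (f : ι → H) : ∀ᵐ ω ∂Q, W (∑ i ∈ s, c i • f i) ω = ∑ i ∈ s, c i * W (f i) ω := by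
  classical
  induction s using Finset.induction_on with
  | empty =>
    filter_upwards [hW.linear 0 0 0 0] with ω hω
    simpa using hω
  | insert i s hi ih =>
    filter_upwards [hW.linear (c i) 1 (f i) (∑ i ∈ s, c i • f i), ih] with ω h1 h2
    rw [Finset.sum_insert hi, Finset.sum_insert hi, ← h2]
    simpa using h1

/-- A linear functional of finitely many values is almost surely the value of `W` at one vector,
hence normal. -/
lemma isCenteredGaussian [IsProbabilityMeasure Q] (hW : IsIsonormal W Q) {T : Type*}
    (h : T → H) :
    IsCenteredGaussian (fun t => W (h t)) (fun s t => inner ℝ (h s) (h t)) Q where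
  gaussian := ⟨fun I => by
    classical
    refine ⟨⟨fun L => ?_⟩⟩
    have hm : AEMeasurable (fun ω => I.restrict fun t => W (h t) ω) Q :=
      aemeasurable_pi_lambda _ fun i => (hW.hasLaw _).aemeasurable
    have hL : (fun ω => L (I.restrict fun t => W (h t) ω)) =ᵐ[Q]
        W (∑ i : I, L (Pi.single i 1) • h i) := by
      filter_upwards [hW.sum_ae Finset.univ (fun i : I => L (Pi.single i 1)) fun i => h i] with ω hω
      rw [hω]
      have e : (I.restrict fun t => W (h t) ω) =
          ∑ i : I, W (h i) ω • (Pi.single i (1 : ℝ) : I → ℝ) := by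
        ext j
        simp [Finset.sum_apply, Pi.single_apply]
      rw [e, map_sum]
      exact Finset.sum_congr rfl fun i _ => by rw [map_smul, smul_eq_mul, mul_comm]
    have hmap : (Q.map fun ω => I.restrict fun t => W (h t) ω).map L =
        gaussianReal 0 (‖∑ i : I, L (Pi.single i 1) • h i‖₊ ^ 2) := by
      rw [AEMeasurable.map_map_of_aemeasurable L.continuous.measurable.aemeasurable hm,
        ← (hW.hasLaw _).map_eq]
      exact Measure.map_congr hL
    rw [← integral_map (φ := L) L.continuous.measurable.aemeasurable (f := fun x : ℝ => x)
      measurable_id.aestronglyMeasurable,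
      ← variance_id_map L.continuous.measurable.aemeasurable, hmap]
    simp only [integral_id_gaussianReal, variance_id_gaussianReal, Real.toNNReal_coe]⟩
  mean_zero t := hW.integral_eq_zero _
  covariance s t := hW.integral_mul _ _

end IsIsonormal

/-- The isonormal process built from a sequence satisfying Parseval's identity. -/
lemma isIsonormal_seriesValue {e : ℕ → H}
    (he : ∀ f g : H, HasSum (fun n => inner ℝ (e n) f * inner ℝ (e n) g) (inner ℝ f g)) :
    IsIsonormal (fun f ξ => seriesValue (fun n => inner ℝ (e n) f) ξ) stdNormalSeq := by
  have hs : ∀ f : H, HasSum (fun n => inner ℝ (e n) f ^ 2) ((‖f‖₊ ^ 2 : ℝ≥0) : ℝ) := fun f => by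
    have := he f f
    rw [real_inner_self_eq_norm_sq] at this
    simpa only [← sq, NNReal.coe_pow, coe_nnnorm] using this
  refine ⟨fun f => hasLaw_seriesValue (hs f), fun a b f g => ?_⟩
  simp only [inner_add_right, inner_smul_right]
  exact seriesValue_add_ae (hs f).summable (hs g).summable a b

end isonormal

/-! ### The heat kernel as a square integrable function of its source. -/

section heatKernel

/-- The density of the centred normal law of variance `v`. -/
def gaussKer (v x : ℝ) : ℝ := 1 / √(2 * Real.pi * v) * Real.exp (-(1 / (2 * v)) * x ^ 2)

lemma gaussKer_nonneg (v x : ℝ) : 0 ≤ gaussKer v x := by unfold gaussKer; positivity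

@[fun_prop]
lemma measurable_gaussKer_uncurry : Measurable (fun p : ℝ × ℝ => gaussKer p.1 p.2) := by
  unfold gaussKer; fun_prop

lemma integrable_gaussKer {v : ℝ} (hv : 0 < v) : Integrable (gaussKer v) := by
  unfold gaussKer
  exact (integrable_exp_neg_mul_sq (by positivity)).const_mul _

lemma integral_gaussKer {v : ℝ} (hv : 0 < v) : ∫ x, gaussKer v x = 1 := by
  have hπ := Real.pi_pos
  unfold gaussKer
  rw [integral_const_mul, integral_gaussian, one_div, show Real.pi / (1 / (2 * v)) =
    2 * Real.pi * v by field_simp]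
  exact inv_mul_cancel₀ (Real.sqrt_pos.2 (by positivity)).ne'

/-- Completing the square in `x`; integrating the second factor out gives the Chapman–Kolmogorov
identity. -/
lemma gaussKer_mul_gaussKer {u v : ℝ} (hu : 0 < u) (hv : 0 < v) (r q x : ℝ) :
    gaussKer u (r - x) * gaussKer v (q - x) = gaussKer (u + v) (r - q) *
      gaussKer (u * v / (u + v)) (x - (v * r + u * q) / (u + v)) := by
  have hπ := Real.pi_pos
  unfold gaussKer
  have e1 : √(2 * Real.pi * u) * √(2 * Real.pi * v) =
      √(2 * Real.pi * (u + v)) * √(2 * Real.pi * (u * v / (u + v))) := by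
    rw [← Real.sqrt_mul (by positivity), ← Real.sqrt_mul (by positivity)]
    congr 1
    field_simp
  have e2 : -(1 / (2 * u)) * (r - x) ^ 2 + -(1 / (2 * v)) * (q - x) ^ 2 =
      -(1 / (2 * (u + v))) * (r - q) ^ 2 +
        -(1 / (2 * (u * v / (u + v)))) * (x - (v * r + u * q) / (u + v)) ^ 2 := by
    field_simp
    ring
  calc _ = 1 / (√(2 * Real.pi * u) * √(2 * Real.pi * v)) *
        Real.exp (-(1 / (2 * u)) * (r - x) ^ 2 + -(1 / (2 * v)) * (q - x) ^ 2) := by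
        rw [Real.exp_add, one_div, one_div, one_div, mul_inv]; ring
    _ = _ := by
        rw [e1, e2, Real.exp_add, one_div, one_div, one_div, mul_inv]; ring

lemma integral_gaussKer_mul_gaussKer {u v : ℝ} (hu : 0 < u) (hv : 0 < v) (r q : ℝ) :
    ∫ x, gaussKer u (r - x) * gaussKer v (q - x) = gaussKer (u + v) (r - q) := by
  simp only [gaussKer_mul_gaussKer hu hv]
  rw [integral_const_mul, integral_sub_right_eq_self (gaussKer (u * v / (u + v))),
    integral_gaussKer (by positivity), mul_one]

lemma integrable_gaussKer_mul_gaussKer {u v : ℝ} (hu : 0 < u) (hv : 0 < v) (r q : ℝ) :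
    Integrable fun x => gaussKer u (r - x) * gaussKer v (q - x) := by
  simp only [gaussKer_mul_gaussKer hu hv]
  exact ((integrable_gaussKer (by positivity)).comp_sub_right _).const_mul _

lemma halfPlane_eq_prod : halfPlane = (volume.restrict (Ici (0 : ℝ))).prod volume := by
  rw [halfPlane, Measure.volume_eq_prod, ← Measure.prod_restrict, Measure.restrict_univ]

instance : SigmaFinite halfPlane := by
  rw [halfPlane_eq_prod]; infer_instance

/-- The heat kernel of `½ σ2 ∂_rr`, as a function of its source `w`, vanishing for sources later
than the target `z`. -/
def heatKer (σ2 : ℝ) (z w : ℝ × ℝ) : ℝ :=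
  if w.1 < z.1 then gaussKer (σ2 * (z.1 - w.1)) (z.2 - w.2) else 0

lemma measurable_heatKer_uncurry (σ2 : ℝ) :
    Measurable (fun p : (ℝ × ℝ) × (ℝ × ℝ) => heatKer σ2 p.1 p.2) := by
  unfold heatKer
  refine Measurable.ite (measurableSet_lt (by fun_prop) (by fun_prop)) ?_ measurable_const
  exact measurable_gaussKer_uncurry.comp (f := fun p : (ℝ × ℝ) × (ℝ × ℝ) =>
    (σ2 * (p.1.1 - p.2.1), p.1.2 - p.2.2)) (by fun_prop)

lemma measurable_heatKer (σ2 : ℝ) (z : ℝ × ℝ) : Measurable (heatKer σ2 z) :=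
  (measurable_heatKer_uncurry σ2).comp measurable_prodMk_left

lemma integral_heatKer_mul_heatKer_snd {σ2 : ℝ} (hσ : 0 < σ2) (z z' : ℝ × ℝ) (s : ℝ) :
    ∫ x, heatKer σ2 z (s, x) * heatKer σ2 z' (s, x) =
      if s < min z.1 z'.1 then gaussKer (σ2 * (z.1 + z'.1) - 2 * σ2 * s) (z.2 - z'.2) else 0 := by
  simp only [heatKer, lt_min_iff]
  by_cases h : s < z.1
  · by_cases h' : s < z'.1
    · simp only [h, h', if_true, and_self]
      rw [integral_gaussKer_mul_gaussKer (mul_pos hσ (sub_pos.2 h)) (mul_pos hσ (sub_pos.2 h'))]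
      congr 1
      ring
    · simp [h']
  · simp [h]

lemma setIntegral_ite_lt {m : ℝ} (hm : 0 ≤ m) (f : ℝ → ℝ) :
    ∫ s in Ici (0 : ℝ), (if s < m then f s else 0) = ∫ s in (0 : ℝ)..m, f s := by
  have e : (fun s => if s < m then f s else 0) = (Iio m).indicator f := by
    ext s
    simp [Set.indicator_apply]
  rw [e, setIntegral_indicator measurableSet_Iio, Ici_inter_Iio, integral_Ico_eq_integral_Ioo,
    ← integral_Ioc_eq_integral_Ioo, intervalIntegral.integral_of_le hm]

/-- The square integrates in space to the density of variance `2σ2 (z.1 - s)` at `0`, of order `(z.1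
- s)^{-1/2}`, which is integrable in time. This is where one space dimension matters. -/
lemma memLp_heatKer {σ2 : ℝ} (hσ : 0 < σ2) {z : ℝ × ℝ} (hz : 0 ≤ z.1) :
    MemLp (heatKer σ2 z) 2 halfPlane := by
  have hm := measurable_heatKer σ2 z
  rw [memLp_two_iff_integrable_sq hm.aestronglyMeasurable, halfPlane_eq_prod,
    integrable_prod_iff (hm.pow_const 2).aestronglyMeasurable]
  simp only [Real.norm_of_nonneg (sq_nonneg _)]
  constructor
  · refine ae_of_all _ fun s => ?_
    by_cases h : s < z.1
    · simp only [heatKer, h, if_true, sq]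
      exact integrable_gaussKer_mul_gaussKer (mul_pos hσ (sub_pos.2 h))
        (mul_pos hσ (sub_pos.2 h)) _ _
    · simp [heatKer, h]
  · simp only [sq, integral_heatKer_mul_heatKer_snd hσ, min_self, sub_self]
    have h1 := ((intervalIntegrable_inv_sqrt (σ2 * (z.1 + z.1) - 2 * σ2 * 0)
      (σ2 * (z.1 + z.1) - 2 * σ2 * z.1)).comp_sub_left (σ2 * (z.1 + z.1)))
    have h2 := h1.comp_mul_left (c := 2 * σ2)
    simp only [sub_sub_cancel] at h2
    rw [mul_zero, zero_div, mul_div_cancel_left₀ _ (by positivity)] at h2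
    rw [intervalIntegrable_iff_integrableOn_Ico_of_le hz] at h2
    have e : (fun s => if s < z.1 then gaussKer (σ2 * (z.1 + z.1) - 2 * σ2 * s) 0 else 0) =
        (Iio z.1).indicator fun s => gaussKer (σ2 * (z.1 + z.1) - 2 * σ2 * s) 0 := by
      ext s
      simp [Set.indicator_apply]
    rw [e, integrable_indicator_iff measurableSet_Iio, IntegrableOn,
      Measure.restrict_restrict measurableSet_Iio, inter_comm, Ici_inter_Iio]
    refine h2.congr (ae_of_all _ fun s => ?_)
    simp [gaussKer]

/-- Chapman–Kolmogorov in space, then the substitution `v = σ2 (z.1 + z'.1 - 2s)` for `0 ≤ s ≤ min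
z.1 z'.1`. Up to a constant this is the covariance `Γ_q`. -/
lemma integral_heatKer_mul_heatKer {σ2 : ℝ} (hσ : 0 < σ2) {z z' : ℝ × ℝ} (hz : 0 ≤ z.1)
    (hz' : 0 ≤ z'.1) :
    ∫ w, heatKer σ2 z w * heatKer σ2 z' w ∂halfPlane =
      1 / (2 * σ2) * ∫ v in (σ2 * |z'.1 - z.1|)..(σ2 * (z'.1 + z.1)),
        gaussKer v (z.2 - z'.2) := by
  have hint := (memLp_heatKer hσ hz).integrable_mul (memLp_heatKer hσ hz')
  rw [halfPlane_eq_prod] at hint ⊢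
  have h := integral_prod _ hint
  simp only [Pi.mul_apply] at h
  rw [h]
  simp only [integral_heatKer_mul_heatKer_snd hσ]
  rw [setIntegral_ite_lt (le_min hz hz') fun s =>
    gaussKer (σ2 * (z.1 + z'.1) - 2 * σ2 * s) (z.2 - z'.2),
    intervalIntegral.integral_comp_sub_mul (fun v => gaussKer v (z.2 - z'.2)) (by positivity),
    smul_eq_mul, one_div]
  congr 2
  · rcases le_total z.1 z'.1 with h | h
    · rw [min_eq_left h, abs_of_nonneg (by linarith)]; ring
    · rw [min_eq_right h, abs_of_nonpos (by linarith)]; ring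
  · ring

lemma integral_heatKer_sq_le {σ2 : ℝ} (hσ : 0 < σ2) {z : ℝ × ℝ} {R : ℝ} (hz : 0 ≤ z.1)
    (hR : z.1 ≤ R) :
    ∫ w, heatKer σ2 z w ^ 2 ∂halfPlane ≤
      1 / (2 * σ2) * ∫ v in (0 : ℝ)..(σ2 * (R + R)), 1 / √(2 * Real.pi * v) := by
  simp only [sq, integral_heatKer_mul_heatKer hσ hz hz, sub_self, abs_zero, mul_zero]
  refine mul_le_mul_of_nonneg_left ?_ (by positivity)
  have e : ∀ v, gaussKer v 0 = 1 / √(2 * Real.pi * v) := fun v => by simp [gaussKer]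
  simp only [e]
  refine intervalIntegral.integral_mono_interval le_rfl (by positivity)
    (mul_le_mul_of_nonneg_left (by linarith) hσ.le) (ae_of_all _ fun v => by positivity)
    (intervalIntegrable_inv_sqrt _ _)

end heatKernel


/-! ### The heat kernel as a fundamental solution. -/

section heatEquation

lemma continuous_gaussKer (v : ℝ) : Continuous (gaussKer v) := by unfold gaussKer; fun_prop

lemma hasDerivAt_gaussKer_one (u : ℝ) : HasDerivAt (gaussKer 1) (-(u * gaussKer 1 u)) u := by
  unfold gaussKer
  have h := ((((hasDerivAt_id u).pow 2).const_mul (-(1 / (2 * 1) : ℝ))).exp).const_mul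
    (1 / √(2 * Real.pi * 1))
  refine (h.congr_deriv ?_)
  simp
  ring

lemma integrable_mul_gaussKer_one : Integrable fun u => u * gaussKer 1 u := by
  have h := (integrable_mul_exp_neg_mul_sq (b := 1 / (2 * 1)) (by norm_num)).const_mul
    (1 / √(2 * Real.pi * 1))
  refine h.congr (ae_of_all _ fun u => ?_)
  simp only [gaussKer]
  ring

lemma integral_mul_gaussKer {v : ℝ} (hv : 0 < v) (f : ℝ → ℝ) (x : ℝ) :
    ∫ r, f r * gaussKer v (r - x) = ∫ u, f (x + √v * u) * gaussKer 1 u := by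
  have hs : 0 < √v := Real.sqrt_pos.2 hv
  have e : ∀ u, gaussKer 1 u = √v * gaussKer v (√v * u) := fun u => by
    unfold gaussKer
    rw [mul_pow, Real.sq_sqrt hv.le, Real.sqrt_mul (by positivity) v, mul_one,
      show -(1 / (2 * v)) * (v * u ^ 2) = -(1 / (2 * 1)) * u ^ 2 by field_simp]
    field_simp
  have h := Measure.integral_comp_mul_left (fun y => f (x + y) * gaussKer v y) (√v)
  rw [← integral_sub_right_eq_self (fun y => f (x + y) * gaussKer v y) x, smul_eq_mul,
    abs_of_pos (inv_pos.2 hs)] at h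
  simp only [add_sub_cancel] at h
  simp only [e, mul_left_comm _ (√v), integral_const_mul]
  rw [h, mul_inv_cancel_left₀ hs.ne']

/-- A bounded continuous function against a Gaussian kernel. -/
lemma integrable_bdd_mul {f g : ℝ → ℝ} {C : ℝ} (hf : Continuous f) (hC : ∀ u, ‖f u‖ ≤ C)
    (hg : Integrable g) : Integrable fun u => f u * g u :=
  hg.bdd_mul hf.aestronglyMeasurable (ae_of_all _ hC)

/-- Gaussian integration by parts, from `γ'(u) = -u γ(u)` for the standard normal density. -/
lemma integral_mul_id_mul_gaussKer {f f' : ℝ → ℝ} {C C' : ℝ} (hf : ∀ u, HasDerivAt f (f' u) u)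
    (hf' : Continuous f') (hC : ∀ u, ‖f u‖ ≤ C) (hC' : ∀ u, ‖f' u‖ ≤ C') :
    ∫ u, f u * (u * gaussKer 1 u) = ∫ u, f' u * gaussKer 1 u := by
  have hfc : Continuous f := continuous_iff_continuousAt.2 fun u => (hf u).continuousAt
  have h := integral_mul_deriv_eq_deriv_mul_of_integrable (u := f) (u' := f') (v := gaussKer 1)
    (v' := fun u => -(u * gaussKer 1 u)) (fun u _ => hf u) (fun u _ => hasDerivAt_gaussKer_one u)
    (integrable_bdd_mul hfc hC integrable_mul_gaussKer_one.neg)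
    (integrable_bdd_mul hf' hC' (integrable_gaussKer one_pos))
    (integrable_bdd_mul hfc hC (integrable_gaussKer one_pos))
  simp only [mul_neg, integral_neg, neg_inj] at h
  exact h

/-- The time derivative of a function on space-time. -/
def timeDeriv (φ : ℝ × ℝ → ℝ) (z : ℝ × ℝ) : ℝ := fderiv ℝ φ z (1, 0)

/-- The space derivative of a function on space-time. -/
def spaceDeriv (φ : ℝ × ℝ → ℝ) (z : ℝ × ℝ) : ℝ := fderiv ℝ φ z (0, 1)

variable {φ : ℝ × ℝ → ℝ}

lemma contDiff_timeDeriv (hφ : ContDiff ℝ ((⊤ : ℕ∞) : WithTop ℕ∞) φ) :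
    ContDiff ℝ ((⊤ : ℕ∞) : WithTop ℕ∞) (timeDeriv φ) :=
  (hφ.fderiv_right (m := ((⊤ : ℕ∞) : WithTop ℕ∞)) (by simp)).clm_apply contDiff_const

lemma contDiff_spaceDeriv (hφ : ContDiff ℝ ((⊤ : ℕ∞) : WithTop ℕ∞) φ) :
    ContDiff ℝ ((⊤ : ℕ∞) : WithTop ℕ∞) (spaceDeriv φ) :=
  (hφ.fderiv_right (m := ((⊤ : ℕ∞) : WithTop ℕ∞)) (by simp)).clm_apply contDiff_const

lemma hasCompactSupport_timeDeriv (hc : HasCompactSupport φ) :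
    HasCompactSupport (timeDeriv φ) := hc.fderiv_apply ℝ _

lemma hasCompactSupport_spaceDeriv (hc : HasCompactSupport φ) :
    HasCompactSupport (spaceDeriv φ) := hc.fderiv_apply ℝ _

lemma hasDerivAt_comp_prodMk (hφ : ContDiff ℝ ((⊤ : ℕ∞) : WithTop ℕ∞) φ) {a b : ℝ → ℝ}
    {a' b' τ : ℝ} (ha : HasDerivAt a a' τ) (hb : HasDerivAt b b' τ) :
    HasDerivAt (fun τ => φ (a τ, b τ))
      (timeDeriv φ (a τ, b τ) * a' + spaceDeriv φ (a τ, b τ) * b') τ := by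
  have h1 := (hφ.differentiable (by simp) (a τ, b τ)).hasFDerivAt
  have h2 := h1.comp_hasDerivAt τ (ha.prodMk hb)
  refine h2.congr_deriv ?_
  have e : (a', b') = a' • ((1 : ℝ), (0 : ℝ)) + b' • ((0 : ℝ), (1 : ℝ)) := by simp
  rw [e, map_add, map_smul, map_smul]
  simp only [timeDeriv, spaceDeriv, smul_eq_mul]
  ring

lemma deriv_fst_eq_timeDeriv (hφ : ContDiff ℝ ((⊤ : ℕ∞) : WithTop ℕ∞) φ) (z : ℝ × ℝ) :
    deriv (fun s => φ (s, z.2)) z.1 = timeDeriv φ z := by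
  have h := hasDerivAt_comp_prodMk hφ (hasDerivAt_id z.1) (hasDerivAt_const z.1 z.2)
  simpa using h.deriv

lemma deriv_snd_eq_spaceDeriv (hφ : ContDiff ℝ ((⊤ : ℕ∞) : WithTop ℕ∞) φ) (t x : ℝ) :
    deriv (fun x => φ (t, x)) x = spaceDeriv φ (t, x) := by
  have h := hasDerivAt_comp_prodMk hφ (hasDerivAt_const x t) (hasDerivAt_id x)
  simpa using h.deriv

lemma iteratedDeriv_two_eq_spaceDeriv (hφ : ContDiff ℝ ((⊤ : ℕ∞) : WithTop ℕ∞) φ) (z : ℝ × ℝ) :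
    iteratedDeriv 2 (fun x => φ (z.1, x)) z.2 = spaceDeriv (spaceDeriv φ) z := by
  rw [iteratedDeriv_succ, iteratedDeriv_one]
  have e : deriv (fun x => φ (z.1, x)) = fun x => spaceDeriv φ (z.1, x) :=
    funext fun x => deriv_snd_eq_spaceDeriv hφ z.1 x
  rw [e, deriv_snd_eq_spaceDeriv (contDiff_spaceDeriv hφ)]

/-- The heat operator `∂_t + ½ σ2 ∂_rr` adjoint to the heat equation. -/
def adjointHeat (σ2 : ℝ) (φ : ℝ × ℝ → ℝ) (z : ℝ × ℝ) : ℝ :=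
  timeDeriv φ z + σ2 / 2 * spaceDeriv (spaceDeriv φ) z

lemma continuous_adjointHeat (σ2 : ℝ) (hφ : ContDiff ℝ ((⊤ : ℕ∞) : WithTop ℕ∞) φ) :
    Continuous (adjointHeat σ2 φ) :=
  (contDiff_timeDeriv hφ).continuous.add
    ((contDiff_spaceDeriv (contDiff_spaceDeriv hφ)).continuous.const_mul _)

lemma hasCompactSupport_adjointHeat (σ2 : ℝ) (hc : HasCompactSupport φ) :
    HasCompactSupport (adjointHeat σ2 φ) :=
  (hasCompactSupport_timeDeriv hc).add
    (hasCompactSupport_spaceDeriv (hasCompactSupport_spaceDeriv hc)).mul_left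

/-- The average of `ψ` at time `s + τ` over the Gaussian law with mean `x` and variance `σ2 τ`. -/
def gaussAvg (σ2 : ℝ) (ψ : ℝ × ℝ → ℝ) (w : ℝ × ℝ) (τ : ℝ) : ℝ :=
  ∫ u, ψ (w.1 + τ, w.2 + √(σ2 * τ) * u) * gaussKer 1 u

lemma continuous_gaussAvg (σ2 : ℝ) {ψ : ℝ × ℝ → ℝ} (hψ : Continuous ψ)
    (hc : HasCompactSupport ψ) (w : ℝ × ℝ) : Continuous (gaussAvg σ2 ψ w) := by
  obtain ⟨C, hC⟩ := hc.exists_bound_of_continuous hψ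
  refine continuous_of_dominated (bound := fun u => C * gaussKer 1 u) (fun τ => ?_)
    (fun τ => ae_of_all _ fun u => ?_) ((integrable_gaussKer one_pos).const_mul C)
    (ae_of_all _ fun u => by fun_prop)
  · exact Continuous.aestronglyMeasurable (by have := continuous_gaussKer 1; fun_prop)
  · rw [norm_mul, Real.norm_of_nonneg (gaussKer_nonneg 1 u)]
    exact mul_le_mul_of_nonneg_right (hC _) (gaussKer_nonneg 1 u)

/-- Differentiating `√(σ2 τ) u` in `τ` produces `φ_r` times `σ2 u / (2 √(σ2 τ))`. Integration by
parts trades the factor `u` for `√(σ2 τ)` and one more space derivative, leaving `½ σ2 φ_rr`. -/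
lemma hasDerivAt_gaussAvg {σ2 : ℝ} (hσ : 0 < σ2) (hφ : ContDiff ℝ ((⊤ : ℕ∞) : WithTop ℕ∞) φ)
    (hc : HasCompactSupport φ) (w : ℝ × ℝ) {τ : ℝ} (hτ : 0 < τ) :
    HasDerivAt (gaussAvg σ2 φ w) (gaussAvg σ2 (adjointHeat σ2 φ) w τ) τ := by
  have c0 := hφ.continuous
  have c1 := (contDiff_timeDeriv hφ).continuous
  have c2 := (contDiff_spaceDeriv hφ).continuous
  have c3 := (contDiff_spaceDeriv (contDiff_spaceDeriv hφ)).continuous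
  obtain ⟨C0, hC0⟩ := hc.exists_bound_of_continuous c0
  obtain ⟨C1, hC1⟩ := (hasCompactSupport_timeDeriv hc).exists_bound_of_continuous c1
  obtain ⟨C2, hC2⟩ := (hasCompactSupport_spaceDeriv hc).exists_bound_of_continuous c2
  obtain ⟨C3, hC3⟩ := (hasCompactSupport_spaceDeriv
    (hasCompactSupport_spaceDeriv hc)).exists_bound_of_continuous c3
  have hγ := continuous_gaussKer 1
  set p : ℝ → ℝ → ℝ × ℝ := fun τ u => (w.1 + τ, w.2 + √(σ2 * τ) * u) with hp
  set c : ℝ → ℝ := fun τ => σ2 / (2 * √(σ2 * τ)) with hcdef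
  have hsq : ∀ τ, 0 < τ → HasDerivAt (fun τ => √(σ2 * τ)) (c τ) τ := fun τ hτ => by
    have := ((hasDerivAt_id τ).const_mul σ2).sqrt (by simpa using (mul_pos hσ hτ).ne')
    simpa using this
  have hder : ∀ u τ, 0 < τ → HasDerivAt (fun τ => φ (p τ u) * gaussKer 1 u)
      ((timeDeriv φ (p τ u) * 1 + spaceDeriv φ (p τ u) * (c τ * u)) * gaussKer 1 u) τ :=
    fun u τ hτ => (hasDerivAt_comp_prodMk hφ ((hasDerivAt_id τ).const_add w.1)
      (((hsq τ hτ).mul_const u).const_add w.2)).mul_const _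
  -- The coefficient blows up at `0` but decreases in `τ`, so its value at `τ / 2` dominates on a
  -- neighbourhood of `τ`.
  have hcle : ∀ τ' ∈ Ioi (τ / 2), c τ' ≤ c (τ / 2) := fun τ' h' => by
    have h0 : 0 < √(σ2 * (τ / 2)) := Real.sqrt_pos.2 (by positivity)
    simp only [hcdef]
    gcongr
    exact (mem_Ioi.1 h').le
  have hcnn : ∀ τ, 0 ≤ c τ := fun τ => by simp only [hcdef]; positivity
  have hγn := gaussKer_nonneg 1
  have main := hasDerivAt_integral_of_dominated_loc_of_deriv_le (μ := volume) (x₀ := τ)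
    (F := fun τ u => φ (p τ u) * gaussKer 1 u)
    (F' := fun τ u =>
      (timeDeriv φ (p τ u) * 1 + spaceDeriv φ (p τ u) * (c τ * u)) * gaussKer 1 u)
    (bound := fun u => C1 * gaussKer 1 u + C2 * c (τ / 2) * ‖u * gaussKer 1 u‖)
    (Ioi_mem_nhds (half_lt_self hτ))
    (Eventually.of_forall fun τ' => Continuous.aestronglyMeasurable (by fun_prop))
    (integrable_bdd_mul (by fun_prop) (fun u => hC0 _) (integrable_gaussKer one_pos))
    (Continuous.aestronglyMeasurable (by fun_prop))
    (ae_of_all _ fun u τ' h' => by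
      rw [add_mul]
      refine (norm_add_le _ _).trans (add_le_add ?_ ?_)
      · rw [mul_one, norm_mul, Real.norm_of_nonneg (hγn u)]
        exact mul_le_mul_of_nonneg_right (hC1 _) (hγn u)
      · rw [mul_assoc, mul_assoc (c τ'), norm_mul, norm_mul, Real.norm_of_nonneg (hcnn τ'),
          mul_assoc C2]
        refine mul_le_mul (hC2 _) ?_ (by positivity) ((norm_nonneg _).trans (hC2 (p 0 0)))
        exact mul_le_mul_of_nonneg_right (hcle τ' h') (norm_nonneg _))
    (((integrable_gaussKer one_pos).const_mul C1).add
      (integrable_mul_gaussKer_one.norm.const_mul _))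
    (ae_of_all _ fun u τ' h' => hder u τ' ((half_pos hτ).trans h'))
  refine main.2.congr_deriv ?_
  have hs0 : 0 < √(σ2 * τ) := Real.sqrt_pos.2 (by positivity)
  have ibp := integral_mul_id_mul_gaussKer (f := fun u => spaceDeriv φ (p τ u))
    (f' := fun u => spaceDeriv (spaceDeriv φ) (p τ u) * √(σ2 * τ)) (C := C2)
    (C' := C3 * √(σ2 * τ))
    (fun u => by
      have := hasDerivAt_comp_prodMk (contDiff_spaceDeriv hφ) (hasDerivAt_const u (w.1 + τ))
        (((hasDerivAt_id u).const_mul (√(σ2 * τ))).const_add w.2)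
      simpa using this)
    (by fun_prop) (fun u => hC2 _)
    (fun u => by
      rw [norm_mul, Real.norm_of_nonneg hs0.le]
      exact mul_le_mul_of_nonneg_right (hC3 _) hs0.le)
  have i1 : Integrable fun u => timeDeriv φ (p τ u) * gaussKer 1 u :=
    integrable_bdd_mul (by fun_prop) (fun u => hC1 _) (integrable_gaussKer one_pos)
  have i2 : Integrable fun u => spaceDeriv φ (p τ u) * (u * gaussKer 1 u) :=
    integrable_bdd_mul (by fun_prop) (fun u => hC2 _) integrable_mul_gaussKer_one
  have i3 : Integrable fun u => spaceDeriv (spaceDeriv φ) (p τ u) * gaussKer 1 u :=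
    integrable_bdd_mul (by fun_prop) (fun u => hC3 _) (integrable_gaussKer one_pos)
  have e1 : ∀ u, (timeDeriv φ (p τ u) * 1 + spaceDeriv φ (p τ u) * (c τ * u)) * gaussKer 1 u =
      timeDeriv φ (p τ u) * gaussKer 1 u +
        c τ * (spaceDeriv φ (p τ u) * (u * gaussKer 1 u)) := fun u => by ring
  have e2 : ∀ u, adjointHeat σ2 φ (p τ u) * gaussKer 1 u = timeDeriv φ (p τ u) * gaussKer 1 u +
      σ2 / 2 * (spaceDeriv (spaceDeriv φ) (p τ u) * gaussKer 1 u) := fun u => by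
    unfold adjointHeat; ring
  have e3 : ∀ u, spaceDeriv (spaceDeriv φ) (p τ u) * √(σ2 * τ) * gaussKer 1 u =
      √(σ2 * τ) * (spaceDeriv (spaceDeriv φ) (p τ u) * gaussKer 1 u) := fun u => by ring
  simp only [e3, integral_const_mul] at ibp
  unfold gaussAvg
  change _ = ∫ u, adjointHeat σ2 φ (p τ u) * gaussKer 1 u
  simp only [e1, e2]
  rw [integral_add i1 (i2.const_mul _), integral_add i1 (i3.const_mul _), integral_const_mul,
    integral_const_mul, ibp]
  simp only [hcdef]
  field_simp

lemma exists_fst_bound {ψ : ℝ × ℝ → ℝ} (hc : HasCompactSupport ψ) :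
    ∃ R, 0 ≤ R ∧ ∀ z : ℝ × ℝ, R < z.1 → ψ z = 0 := by
  obtain ⟨R, hR⟩ := hc.isBounded.exists_norm_le
  refine ⟨max R 0, le_max_right _ _, fun z hz => ?_⟩
  by_contra h
  have h1 := hR z (subset_tsupport _ h)
  have h2 : |z.1| ≤ ‖z‖ := norm_fst_le z
  have := le_abs_self z.1
  have := le_max_left R 0
  linarith

/-- The fundamental theorem of calculus: the Gaussian average starts at `φ w` and has vanished at
time `T`. Only continuity is needed at `τ = 0`, where the derivative formula is not available. -/
lemma integral_gaussAvg_adjointHeat {σ2 : ℝ} (hσ : 0 < σ2)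
    (hφ : ContDiff ℝ ((⊤ : ℕ∞) : WithTop ℕ∞) φ) (hc : HasCompactSupport φ) (w : ℝ × ℝ) {T : ℝ}
    (hT : 0 ≤ T) (h0 : ∀ z : ℝ × ℝ, w.1 + T ≤ z.1 → φ z = 0) :
    ∫ τ in (0 : ℝ)..T, gaussAvg σ2 (adjointHeat σ2 φ) w τ = -φ w := by
  rw [intervalIntegral.integral_eq_sub_of_hasDerivAt_of_le hT
    (continuous_gaussAvg σ2 hφ.continuous hc w).continuousOn
    (fun τ hτ => hasDerivAt_gaussAvg hσ hφ hc w hτ.1)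
    ((continuous_gaussAvg σ2 (continuous_adjointHeat σ2 hφ)
      (hasCompactSupport_adjointHeat σ2 hc) w).intervalIntegrable _ _)]
  have e1 : gaussAvg σ2 φ w T = 0 := by
    unfold gaussAvg
    simp [h0 (w.1 + T, _) le_rfl]
  have e2 : gaussAvg σ2 φ w 0 = φ w := by
    unfold gaussAvg
    simp [integral_const_mul, integral_gaussKer one_pos]
  rw [e1, e2, zero_sub]

lemma integrable_mul_heatKer {σ2 : ℝ} (hσ : 0 < σ2) {ψ : ℝ × ℝ → ℝ} (hψ : Continuous ψ)
    (hc : HasCompactSupport ψ) (w : ℝ × ℝ) :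
    Integrable (fun z => ψ z * heatKer σ2 z w) halfPlane := by
  obtain ⟨C, hC⟩ := hc.exists_bound_of_continuous hψ
  obtain ⟨R, hR0, hR⟩ := exists_fst_bound hc
  have hm : Measurable fun z => ψ z * heatKer σ2 z w :=
    hψ.measurable.mul ((measurable_heatKer_uncurry σ2).comp measurable_prodMk_right)
  have hC0 : 0 ≤ C := (norm_nonneg _).trans (hC 0)
  have hk : ∀ t, w.1 < t → Integrable fun r => gaussKer (σ2 * (t - w.1)) (r - w.2) := fun t ht =>
    (integrable_gaussKer (mul_pos hσ (sub_pos.2 ht))).comp_sub_right _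
  have hin : ∀ t, Integrable fun r => ψ (t, r) * heatKer σ2 (t, r) w := fun t => by
    by_cases ht : w.1 < t
    · simp only [heatKer, ht, if_true]
      exact integrable_bdd_mul (by fun_prop) (fun r => hC _) (hk t ht)
    · simp [heatKer, ht]
  rw [halfPlane_eq_prod, integrable_prod_iff hm.aestronglyMeasurable]
  refine ⟨ae_of_all _ hin, ?_⟩
  have hb : Integrable ((Icc 0 R).indicator fun _ : ℝ => C) (volume.restrict (Ici 0)) := by
    refine Integrable.restrict ?_
    rw [integrable_indicator_iff measurableSet_Icc]
    exact integrableOn_const (by simp)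
  refine hb.mono' hm.aestronglyMeasurable.norm.integral_prod_right' ?_
  refine (ae_restrict_iff' measurableSet_Ici).2 (ae_of_all _ fun t (ht0 : 0 ≤ t) => ?_)
  rw [Real.norm_of_nonneg (integral_nonneg fun _ => norm_nonneg _)]
  by_cases htR : t ≤ R
  · rw [indicator_of_mem (show t ∈ Icc 0 R from ⟨ht0, htR⟩)]
    by_cases ht : w.1 < t
    · calc ∫ r, ‖ψ (t, r) * heatKer σ2 (t, r) w‖
          ≤ ∫ r, C * gaussKer (σ2 * (t - w.1)) (r - w.2) := by
            refine integral_mono (hin t).norm ((hk t ht).const_mul C) fun r => ?_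
            simp only [heatKer, ht, if_true]
            rw [norm_mul, Real.norm_of_nonneg (gaussKer_nonneg _ _)]
            exact mul_le_mul_of_nonneg_right (hC _) (gaussKer_nonneg _ _)
        _ = C := by
            rw [integral_const_mul, integral_sub_right_eq_self (gaussKer (σ2 * (t - w.1))),
              integral_gaussKer (mul_pos hσ (sub_pos.2 ht)), mul_one]
    · simpa [heatKer, ht] using hC0
  · have : ∀ r, ψ (t, r) = 0 := fun r => hR _ (not_le.1 htR)
    simp [this, htR]

/-- The space integral at time `t` is a Gaussian average started at the source `w`, nonzero only for
`t > w.1`; integrate over the elapsed time `t - w.1`. -/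
lemma integral_adjointHeat_mul_heatKer {σ2 : ℝ} (hσ : 0 < σ2)
    (hφ : ContDiff ℝ ((⊤ : ℕ∞) : WithTop ℕ∞) φ) (hc : HasCompactSupport φ) {w : ℝ × ℝ}
    (hw : 0 ≤ w.1) :
    ∫ z, adjointHeat σ2 φ z * heatKer σ2 z w ∂halfPlane = -φ w := by
  obtain ⟨R, hR0, hR⟩ := exists_fst_bound hc
  obtain ⟨R', hR0', hR'⟩ := exists_fst_bound (hasCompactSupport_adjointHeat σ2 hc)
  -- Beyond the time supports of both `φ` and its image; the `1` makes the inequality strict for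
  -- `hR`.
  set T := R + R' + 1 with hT
  have hint := integrable_mul_heatKer hσ (continuous_adjointHeat σ2 hφ)
    (hasCompactSupport_adjointHeat σ2 hc) w
  rw [halfPlane_eq_prod] at hint ⊢
  rw [integral_prod _ hint]
  have e : ∀ t, ∫ r, adjointHeat σ2 φ (t, r) * heatKer σ2 (t, r) w =
      (Ioc w.1 (w.1 + T)).indicator (fun t => gaussAvg σ2 (adjointHeat σ2 φ) w (t - w.1)) t := by
    intro t
    by_cases ht : w.1 < t
    · by_cases hTt : t ≤ w.1 + T
      · rw [indicator_of_mem (show t ∈ Ioc w.1 (w.1 + T) from ⟨ht, hTt⟩)]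
        simp only [heatKer, ht, if_true]
        rw [integral_mul_gaussKer (mul_pos hσ (sub_pos.2 ht)) fun r => adjointHeat σ2 φ (t, r)]
        simp [gaussAvg]
      · have : ∀ r, adjointHeat σ2 φ (t, r) = 0 := fun r => hR' _ (by simp only; linarith)
        simp [this, hTt]
    · simp [heatKer, ht]
  simp only [e]
  rw [setIntegral_indicator measurableSet_Ioc,
    inter_eq_self_of_subset_right (s := Ici (0 : ℝ)) (fun t ht => hw.trans ht.1.le),
    ← intervalIntegral.integral_of_le (by linarith),
    intervalIntegral.integral_comp_sub_right (gaussAvg σ2 (adjointHeat σ2 φ) w), sub_self,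
    add_sub_cancel_left]
  exact integral_gaussAvg_adjointHeat hσ hφ hc w (by linarith) fun z hz => hR z (by linarith)

end heatEquation

/-! ### Integrals of Gaussian fields over a parameter. -/

section stochasticFubini

lemma integral_norm_mul_le_sqrt {α : Type*} [MeasurableSpace α] {μ : Measure α} {f g : α → ℝ}
    (hf : MemLp f 2 μ) (hg : MemLp g 2 μ) :
    ∫ a, ‖f a * g a‖ ∂μ ≤ √(∫ a, f a ^ 2 ∂μ) * √(∫ a, g a ^ 2 ∂μ) := by
  have h := integral_mul_norm_le_Lp_mul_Lq (μ := μ) (f := f) (g := g) Real.HolderConjugate.two_two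
    (by simpa using hf) (by simpa using hg)
  simpa [Real.sqrt_eq_rpow] using h

namespace IsIsonormal

variable {H : Type*} [NormedAddCommGroup H] [InnerProductSpace ℝ H]
  {Ω : Type*} [MeasurableSpace Ω] {W : H → Ω → ℝ} {Q : Measure Ω}
  {Z : Type*} [MeasurableSpace Z] {μ : Measure Z} {S : Z → Ω → ℝ} {k : Z → H}
  {m : Z → ℝ}

lemma sqrt_integral_sq (hW : IsIsonormal W Q) (f : H) : √(∫ ω, W f ω ^ 2 ∂Q) = ‖f‖ := by
  rw [hW.integral_sq, Real.sqrt_sq (norm_nonneg _)]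

lemma integral_norm_mul_le (hW : IsIsonormal W Q) (f : H) {V : Ω → ℝ} (hV : MemLp V 2 Q) :
    ∫ ω, ‖W f ω * V ω‖ ∂Q ≤ ‖f‖ * √(∫ ω, V ω ^ 2 ∂Q) := by
  rw [← hW.sqrt_integral_sq f]
  exact integral_norm_mul_le_sqrt (hW.memLp f) hV

/-- By Cauchy–Schwarz the mean of `|S z V|` is at most `‖k z‖` times the `L²` norm of `V`, and `m`
dominates `‖k z‖`. -/
lemma integrable_prod_mul [SFinite Q] (hW : IsIsonormal W Q) (hS : Measurable (Function.uncurry S))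
    (hk : ∀ᵐ z ∂μ, S z =ᵐ[Q] W (k z)) (hm : Integrable m μ) (hkm : ∀ᵐ z ∂μ, ‖k z‖ ≤ m z)
    {V : Ω → ℝ} (hV : MemLp V 2 Q) :
    Integrable (fun p : Z × Ω => S p.1 p.2 * V p.2) (μ.prod Q) := by
  have hmeas : AEStronglyMeasurable (fun p : Z × Ω => S p.1 p.2 * V p.2) (μ.prod Q) :=
    hS.aestronglyMeasurable.mul hV.aestronglyMeasurable.comp_snd
  rw [integrable_prod_iff hmeas]
  constructor
  · filter_upwards [hk] with z hz
    exact ((hW.memLp (k z)).integrable_mul hV).congr (hz.symm.mul EventuallyEq.rfl)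
  · refine (hm.mul_const (√(∫ ω, V ω ^ 2 ∂Q))).mono' hmeas.norm.integral_prod_right' ?_
    filter_upwards [hk, hkm] with z hz hzm
    rw [Real.norm_of_nonneg (integral_nonneg fun _ => norm_nonneg _)]
    have e : ∫ ω, ‖S z ω * V ω‖ ∂Q = ∫ ω, ‖W (k z) ω * V ω‖ ∂Q := by
      refine integral_congr_ae ?_
      filter_upwards [hz] with ω hω
      rw [hω]
    simp only [e]
    exact (hW.integral_norm_mul_le (k z) hV).trans
      (mul_le_mul_of_nonneg_right hzm (Real.sqrt_nonneg _))

lemma integrable_left_ae [IsProbabilityMeasure Q] [SFinite μ] (hW : IsIsonormal W Q) (hS : Measurable (Function.uncurry S))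
    (hk : ∀ᵐ z ∂μ, S z =ᵐ[Q] W (k z)) (hm : Integrable m μ) (hkm : ∀ᵐ z ∂μ, ‖k z‖ ≤ m z) :
    ∀ᵐ ω ∂Q, Integrable (fun z => S z ω) μ := by
  have h := hW.integrable_prod_mul hS hk hm hkm (memLp_const (1 : ℝ))
  simp only [mul_one] at h
  exact h.prod_left_ae

lemma integrable_prod_mul_self [SFinite Q] [SFinite μ] (hW : IsIsonormal W Q) (hS : Measurable (Function.uncurry S))
    (hk : ∀ᵐ z ∂μ, S z =ᵐ[Q] W (k z)) (hm : Integrable m μ) (hkm : ∀ᵐ z ∂μ, ‖k z‖ ≤ m z) :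
    Integrable (fun p : (Z × Z) × Ω => S p.1.1 p.2 * S p.1.2 p.2) ((μ.prod μ).prod Q) := by
  have hmeas : AEStronglyMeasurable (fun p : (Z × Z) × Ω => S p.1.1 p.2 * S p.1.2 p.2)
      ((μ.prod μ).prod Q) :=
    ((hS.comp (f := fun p : (Z × Z) × Ω => (p.1.1, p.2)) (by fun_prop)).mul
      (hS.comp (f := fun p : (Z × Z) × Ω => (p.1.2, p.2)) (by fun_prop))).aestronglyMeasurable
  have hk1 : ∀ᵐ p ∂μ.prod μ, S p.1 =ᵐ[Q] W (k p.1) := Measure.quasiMeasurePreserving_fst.ae hk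
  have hk2 : ∀ᵐ p ∂μ.prod μ, S p.2 =ᵐ[Q] W (k p.2) := Measure.quasiMeasurePreserving_snd.ae hk
  have hm1 : ∀ᵐ p ∂μ.prod μ, ‖k p.1‖ ≤ m p.1 := Measure.quasiMeasurePreserving_fst.ae hkm
  have hm2 : ∀ᵐ p ∂μ.prod μ, ‖k p.2‖ ≤ m p.2 := Measure.quasiMeasurePreserving_snd.ae hkm
  rw [integrable_prod_iff hmeas]
  constructor
  · filter_upwards [hk1, hk2] with p h1 h2
    exact ((hW.memLp (k p.1)).integrable_mul (hW.memLp (k p.2))).congr (h1.symm.mul h2.symm)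
  · refine (hm.mul_prod hm).mono' hmeas.norm.integral_prod_right' ?_
    filter_upwards [hk1, hk2, hm1, hm2] with p h1 h2 h3 h4
    rw [Real.norm_of_nonneg (integral_nonneg fun _ => norm_nonneg _)]
    have e : ∫ ω, ‖S p.1 ω * S p.2 ω‖ ∂Q = ∫ ω, ‖W (k p.1) ω * W (k p.2) ω‖ ∂Q := by
      refine integral_congr_ae ?_
      filter_upwards [h1, h2] with ω e1 e2
      rw [e1, e2]
    simp only [e]
    refine (hW.integral_norm_mul_le (k p.1) (hW.memLp (k p.2))).trans ?_
    rw [hW.sqrt_integral_sq]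
    exact mul_le_mul h3 h4 (norm_nonneg _) ((norm_nonneg _).trans h3)

/-- The stochastic Fubini theorem. `κ` is the weak integral of `k`, so the second moments of `∫ S
dμ` and `W κ` and their mixed moment all equal `‖κ‖²`, and the mean square of the difference is
zero. Only inner products of `k` are integrated, never `k` itself. -/
lemma integral_ae_eq [SFinite Q] [SFinite μ] (hW : IsIsonormal W Q) (hS : Measurable (Function.uncurry S))
    (hk : ∀ᵐ z ∂μ, S z =ᵐ[Q] W (k z)) (hm : Integrable m μ) (hkm : ∀ᵐ z ∂μ, ‖k z‖ ≤ m z)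
    {κ : H} (hκ : ∀ f, ∫ z, inner ℝ (k z) f ∂μ = inner ℝ κ f) :
    ∀ᵐ ω ∂Q, ∫ z, S z ω ∂μ = W κ ω := by
  have hcov : ∀ᵐ p ∂μ.prod μ, ∫ ω, S p.1 ω * S p.2 ω ∂Q = inner ℝ (k p.1) (k p.2) := by
    filter_upwards [Measure.quasiMeasurePreserving_fst.ae hk,
      Measure.quasiMeasurePreserving_snd.ae hk] with p h1 h2
    rw [← hW.integral_mul]
    exact integral_congr_ae (h1.mul h2)
  have hcov' : ∀ᵐ z ∂μ, ∫ ω, S z ω * W κ ω ∂Q = inner ℝ (k z) κ := by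
    filter_upwards [hk] with z hz
    rw [← hW.integral_mul]
    exact integral_congr_ae (hz.mul EventuallyEq.rfl)
  have iUW := hW.integrable_prod_mul hS hk hm hkm (hW.memLp κ)
  have iU2 := hW.integrable_prod_mul_self hS hk hm hkm
  have EUW : ∫ ω, (∫ z, S z ω ∂μ) * W κ ω ∂Q = ‖κ‖ ^ 2 := by
    have h := integral_integral_swap (f := fun z ω => S z ω * W κ ω) iUW
    simp only [integral_mul_const] at h
    rw [← h, integral_congr_ae hcov', hκ, real_inner_self_eq_norm_sq]
  have eU2 : ∀ ω, ∫ p, S p.1 ω * S p.2 ω ∂μ.prod μ = (∫ z, S z ω ∂μ) ^ 2 := fun ω => by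
    rw [integral_prod_mul (fun z => S z ω) (fun z => S z ω), sq]
  have EU2 : ∫ ω, (∫ z, S z ω ∂μ) ^ 2 ∂Q = ‖κ‖ ^ 2 := by
    have h := integral_integral_swap (f := fun (p : Z × Z) ω => S p.1 ω * S p.2 ω) iU2
    simp only [eU2] at h
    have hi := iU2.integral_prod_left
    rw [← h, integral_congr_ae hcov, integral_prod _ (hi.congr hcov)]
    have e : ∀ z, ∫ z', inner ℝ (k z) (k z') ∂μ = inner ℝ (k z) κ := fun z => by
      rw [real_inner_comm, ← hκ]
      exact integral_congr_ae (ae_of_all _ fun z' => real_inner_comm _ _)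
    simp only [e]
    rw [hκ, real_inner_self_eq_norm_sq]
  have jU2 : Integrable (fun ω => (∫ z, S z ω ∂μ) ^ 2) Q := by
    have := iU2.integral_prod_right
    simpa only [eU2] using this
  have jUW : Integrable (fun ω => (∫ z, S z ω ∂μ) * W κ ω) Q := by
    have := iUW.integral_prod_right
    simpa only [integral_mul_const] using this
  have jW2 := (hW.memLp κ).integrable_sq
  have e : ∀ ω, ((∫ z, S z ω ∂μ) - W κ ω) ^ 2 =
      (∫ z, S z ω ∂μ) ^ 2 - 2 * ((∫ z, S z ω ∂μ) * W κ ω) + W κ ω ^ 2 := fun ω => by ring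
  have j1 : Integrable (fun ω => (∫ z, S z ω ∂μ) ^ 2 - 2 * ((∫ z, S z ω ∂μ) * W κ ω)) Q :=
    jU2.sub (jUW.const_mul 2)
  have j2 : Integrable (fun ω => ((∫ z, S z ω ∂μ) - W κ ω) ^ 2) Q := by
    simp only [e]; exact j1.add jW2
  have h0 : ∫ ω, ((∫ z, S z ω ∂μ) - W κ ω) ^ 2 ∂Q = 0 := by
    simp only [e]
    rw [integral_add j1 jW2, integral_sub jU2 (jUW.const_mul 2), integral_const_mul, EU2, EUW,
      hW.integral_sq]
    ring
  filter_upwards [(integral_eq_zero_iff_of_nonneg (fun _ => sq_nonneg _) j2).1 h0] with ω hω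
  have : (∫ z, S z ω ∂μ) - W κ ω = 0 := pow_eq_zero_iff two_ne_zero |>.1 hω
  linarith

end IsIsonormal

end stochasticFubini

/-! ### The stochastic convolution and the stochastic heat equation. -/

section sheField

lemma ae_halfPlane_nonneg : ∀ᵐ z ∂halfPlane, 0 ≤ z.1 := by
  rw [halfPlane, ae_restrict_iff' (measurableSet_Ici.prod MeasurableSet.univ)]
  exact ae_of_all _ fun z hz => hz.1

lemma inner_lp_halfPlane (f g : Lp ℝ 2 halfPlane) :
    inner ℝ f g = ∫ z, f z * g z ∂halfPlane := by
  rw [L2.inner_def]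
  exact integral_congr_ae (ae_of_all _ fun z => by simp [mul_comm])

variable {σ2 : ℝ}

/-- The heat kernel with target `z`, as an element of `L²`. -/
def heatLp (hσ : 0 < σ2) (z : ℝ × ℝ) : Lp ℝ 2 halfPlane :=
  if hz : 0 ≤ z.1 then (memLp_heatKer hσ hz).toLp (heatKer σ2 z) else 0

lemma inner_heatLp (hσ : 0 < σ2) {z : ℝ × ℝ} (hz : 0 ≤ z.1) (f : Lp ℝ 2 halfPlane) :
    inner ℝ (heatLp hσ z) f = ∫ w, heatKer σ2 z w * f w ∂halfPlane := by
  rw [inner_lp_halfPlane, heatLp, dif_pos hz]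
  refine integral_congr_ae ?_
  filter_upwards [(memLp_heatKer hσ hz).coeFn_toLp] with w hw
  rw [hw]

lemma inner_heatLp_heatLp (hσ : 0 < σ2) {z z' : ℝ × ℝ} (hz : 0 ≤ z.1) (hz' : 0 ≤ z'.1) :
    inner ℝ (heatLp hσ z) (heatLp hσ z') = ∫ w, heatKer σ2 z w * heatKer σ2 z' w ∂halfPlane := by
  rw [inner_heatLp hσ hz, heatLp, dif_pos hz']
  refine integral_congr_ae ?_
  filter_upwards [(memLp_heatKer hσ hz').coeFn_toLp] with w hw
  rw [hw]

lemma exists_norm_heatLp_le (hσ : 0 < σ2) (R : ℝ) :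
    ∃ G, 0 ≤ G ∧ ∀ z : ℝ × ℝ, 0 ≤ z.1 → z.1 ≤ R → ‖heatLp hσ z‖ ≤ G := by
  refine ⟨√(1 / (2 * σ2) * ∫ v in (0 : ℝ)..(σ2 * (R + R)), 1 / √(2 * Real.pi * v)),
    Real.sqrt_nonneg _, fun z hz hR => Real.le_sqrt_of_sq_le ?_⟩
  rw [← real_inner_self_eq_norm_sq, inner_heatLp_heatLp hσ hz hz]
  simp only [← sq]
  exact integral_heatKer_sq_le hσ hz hR

lemma integrable_prod_mul_heatKer_mul (hσ : 0 < σ2) {h : ℝ × ℝ → ℝ} {R : ℝ} (hm : Measurable h)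
    (hh : Integrable h halfPlane) (hR : ∀ z : ℝ × ℝ, R < z.1 → h z = 0) (f : Lp ℝ 2 halfPlane) :
    Integrable (fun p : (ℝ × ℝ) × (ℝ × ℝ) => h p.1 * (heatKer σ2 p.1 p.2 * f p.2))
      (halfPlane.prod halfPlane) := by
  obtain ⟨G, hG0, hG⟩ := exists_norm_heatLp_le hσ R
  have hmeas : AEStronglyMeasurable
      (fun p : (ℝ × ℝ) × (ℝ × ℝ) => h p.1 * (heatKer σ2 p.1 p.2 * f p.2))
      (halfPlane.prod halfPlane) :=
    ((hm.comp measurable_fst).mul ((measurable_heatKer_uncurry σ2).mul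
      ((Lp.stronglyMeasurable f).measurable.comp measurable_snd))).aestronglyMeasurable
  rw [integrable_prod_iff hmeas]
  constructor
  · filter_upwards [ae_halfPlane_nonneg] with z hz
    exact ((memLp_heatKer hσ hz).integrable_mul (Lp.memLp f)).const_mul _
  · refine (hh.norm.mul_const (G * √(∫ w, f w ^ 2 ∂halfPlane))).mono'
      hmeas.norm.integral_prod_right' ?_
    filter_upwards [ae_halfPlane_nonneg] with z hz
    rw [Real.norm_of_nonneg (integral_nonneg fun _ => norm_nonneg _)]
    simp only [norm_mul (h z), integral_const_mul]
    by_cases hzR : z.1 ≤ R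
    · refine mul_le_mul_of_nonneg_left ?_ (norm_nonneg _)
      refine (integral_norm_mul_le_sqrt (memLp_heatKer hσ hz) (Lp.memLp f)).trans
        (mul_le_mul_of_nonneg_right ?_ (Real.sqrt_nonneg _))
      have e := inner_heatLp_heatLp hσ hz hz
      rw [real_inner_self_eq_norm_sq] at e
      simp only [sq (heatKer _ _ _)]
      rw [← e, Real.sqrt_sq (norm_nonneg _)]
      exact hG z hz hzR
    · simp [hR z (not_le.1 hzR)]

/-- Identifies the weak integral of the heat kernels against the adjoint heat operator: by Fubini,
the integral in the target reproduces `-φ` at the source. -/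
lemma integral_adjointHeat_mul_inner_heatLp (hσ : 0 < σ2) {φ : ℝ × ℝ → ℝ}
    (hφ : ContDiff ℝ ((⊤ : ℕ∞) : WithTop ℕ∞) φ) (hc : HasCompactSupport φ)
    (f : Lp ℝ 2 halfPlane) :
    ∫ z, adjointHeat σ2 φ z * inner ℝ (heatLp hσ z) f ∂halfPlane =
      -inner ℝ ((memLp_test hφ hc).toLp φ) f := by
  have hcont := continuous_adjointHeat σ2 hφ
  have hcs := hasCompactSupport_adjointHeat σ2 hc
  obtain ⟨R, -, hR⟩ := exists_fst_bound hcs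
  have hi : Integrable (adjointHeat σ2 φ) halfPlane :=
    (hcont.integrable_of_hasCompactSupport (μ := volume) hcs).restrict
  have hsw := integral_integral_swap
    (f := fun z w => adjointHeat σ2 φ z * (heatKer σ2 z w * f w))
    (integrable_prod_mul_heatKer_mul hσ hcont.measurable hi hR f)
  simp only [integral_const_mul] at hsw
  have e1 : ∫ z, adjointHeat σ2 φ z * inner ℝ (heatLp hσ z) f ∂halfPlane =
      ∫ z, adjointHeat σ2 φ z * ∫ w, heatKer σ2 z w * f w ∂halfPlane ∂halfPlane := by
    refine integral_congr_ae ?_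
    filter_upwards [ae_halfPlane_nonneg] with z hz
    rw [inner_heatLp hσ hz]
  rw [e1, hsw, inner_lp_halfPlane, ← integral_neg]
  refine integral_congr_ae ?_
  filter_upwards [ae_halfPlane_nonneg, (memLp_test hφ hc).coeFn_toLp] with w hw hφw
  simp only [← mul_assoc, integral_mul_const]
  rw [integral_adjointHeat_mul_heatKer hσ hφ hc hw, hφw, neg_mul]

/-- The stochastic convolution `z ↦ B ∬ heatKer z dW`, with the white noise `W` expanded along
the sequence `e`. -/
def sheField (σ2 B : ℝ) (e : ℕ → Lp ℝ 2 halfPlane) (z : ℝ × ℝ) (ξ : ℕ → ℝ) : ℝ :=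
  seriesValue (fun n => B * ∫ w, heatKer σ2 z w * e n w ∂halfPlane) ξ

lemma measurable_integral_heatKer_mul (σ2 : ℝ) (f : Lp ℝ 2 halfPlane) :
    Measurable fun z : ℝ × ℝ => ∫ w, heatKer σ2 z w * f w ∂halfPlane := by
  have h1 : Measurable fun p : (ℝ × ℝ) × (ℝ × ℝ) => heatKer σ2 p.1 p.2 * f p.2 :=
    (measurable_heatKer_uncurry σ2).mul ((Lp.stronglyMeasurable f).measurable.comp measurable_snd)
  exact (StronglyMeasurable.integral_prod_right (f := fun z w => heatKer σ2 z w * f w)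
    h1.stronglyMeasurable).measurable

lemma measurable_seriesValue_comp {c : ℝ × ℝ → ℕ → ℝ} (hc : Measurable c) :
    Measurable fun p : (ℝ × ℝ) × (ℕ → ℝ) => seriesValue (c p.1) p.2 :=
  measurable_seriesValue.comp (f := fun p : (ℝ × ℝ) × (ℕ → ℝ) => (c p.1, p.2))
    ((hc.comp measurable_fst).prodMk measurable_snd)

/-- The coefficients are honest integrals of the kernel, measurable in `z`, not values of a chosen
`L²` class. -/
lemma measurable_sheField (σ2 B : ℝ) (e : ℕ → Lp ℝ 2 halfPlane) :
    Measurable (fun p : (ℝ × ℝ) × (ℕ → ℝ) => sheField σ2 B e p.1 p.2) := by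
  have h := measurable_seriesValue_comp (measurable_pi_lambda _ fun n =>
    (measurable_integral_heatKer_mul σ2 (e n)).const_mul B)
  delta sheField
  exact h

/-- At each nonnegative time the field is, as a function of the noise, the isonormal process at the
heat kernel. -/
lemma sheField_eq (hσ : 0 < σ2) (B : ℝ) (e : ℕ → Lp ℝ 2 halfPlane) {z : ℝ × ℝ} (hz : 0 ≤ z.1) :
    sheField σ2 B e z = fun ξ => seriesValue (fun n => inner ℝ (e n) (B • heatLp hσ z)) ξ := by
  funext ξ
  unfold sheField
  congr 1
  funext n
  rw [inner_smul_right, real_inner_comm, inner_heatLp hσ hz]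

lemma sheField_zero_left (σ2 B : ℝ) (e : ℕ → Lp ℝ 2 halfPlane) (r : ℝ) (ξ : ℕ → ℝ) :
    sheField σ2 B e (0, r) ξ = 0 := by
  have h : ∀ n, ∫ w, heatKer σ2 (0, r) w * e n w ∂halfPlane = 0 := fun n => by
    refine integral_eq_zero_of_ae ?_
    filter_upwards [ae_halfPlane_nonneg] with w hw
    simp [heatKer, not_lt.2 hw]
  simp [sheField, h, seriesValue]

section weighted

variable {e : ℕ → Lp ℝ 2 halfPlane} {h : ℝ × ℝ → ℝ}

lemma measurable_uncurry_sheField_mul (σ2 B : ℝ) (e : ℕ → Lp ℝ 2 halfPlane) (hm : Measurable h) :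
    Measurable (Function.uncurry fun z ξ => sheField σ2 B e z ξ * h z) :=
  (measurable_sheField σ2 B e).mul (hm.comp measurable_fst)

lemma sheField_mul_ae_eq (hσ : 0 < σ2) (B : ℝ)
    (he : ∀ f g, HasSum (fun n => inner ℝ (e n) f * inner ℝ (e n) g) (inner ℝ f g)) :
    ∀ᵐ z ∂halfPlane, (fun ξ => sheField σ2 B e z ξ * h z) =ᵐ[stdNormalSeq]
      fun ξ => seriesValue (fun n => inner ℝ (e n) (h z • B • heatLp hσ z)) ξ := by
  filter_upwards [ae_halfPlane_nonneg] with z hz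
  filter_upwards [(isIsonormal_seriesValue he).linear (h z) 0 (B • heatLp hσ z) 0] with ξ hξ
  rw [sheField_eq hσ B e hz, mul_comm]
  simpa using hξ.symm

lemma exists_norm_smul_heatLp_le (hσ : 0 < σ2) (B : ℝ) {R : ℝ} (hh : Integrable h halfPlane)
    (hR : ∀ z : ℝ × ℝ, R < z.1 → h z = 0) :
    ∃ m : ℝ × ℝ → ℝ, Integrable m halfPlane ∧
      ∀ᵐ z ∂halfPlane, ‖h z • B • heatLp hσ z‖ ≤ m z := by
  obtain ⟨G, hG0, hG⟩ := exists_norm_heatLp_le hσ R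
  refine ⟨fun z => ‖h z‖ * (‖B‖ * G), hh.norm.mul_const _, ?_⟩
  filter_upwards [ae_halfPlane_nonneg] with z hz
  rw [norm_smul, norm_smul]
  by_cases hzR : z.1 ≤ R
  · have := hG z hz hzR
    gcongr
  · simp [hR z (not_le.1 hzR)]

lemma integrable_sheField_mul_ae (hσ : 0 < σ2) (B : ℝ)
    (he : ∀ f g, HasSum (fun n => inner ℝ (e n) f * inner ℝ (e n) g) (inner ℝ f g))
    {R : ℝ} (hm : Measurable h) (hh : Integrable h halfPlane)
    (hR : ∀ z : ℝ × ℝ, R < z.1 → h z = 0) :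
    ∀ᵐ ξ ∂stdNormalSeq, Integrable (fun z => sheField σ2 B e z ξ * h z) halfPlane := by
  obtain ⟨m, hmi, hmle⟩ := exists_norm_smul_heatLp_le hσ B hh hR
  exact (isIsonormal_seriesValue he).integrable_left_ae
    (measurable_uncurry_sheField_mul σ2 B e hm) (sheField_mul_ae_eq hσ B he) hmi hmle

/-- The field is integrable against indicators of balls of integer radius; countably many
exceptional null sets cover all compact sets. -/
lemma locallyIntegrable_sheField_ae (hσ : 0 < σ2) (B : ℝ)
    (he : ∀ f g, HasSum (fun n => inner ℝ (e n) f * inner ℝ (e n) g) (inner ℝ f g)) :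
    ∀ᵐ ξ ∂stdNormalSeq, LocallyIntegrable (fun z => sheField σ2 B e z ξ) halfPlane := by
  have h : ∀ n : ℕ, ∀ᵐ ξ ∂stdNormalSeq, Integrable (fun z => sheField σ2 B e z ξ *
      (Metric.closedBall (0 : ℝ × ℝ) n).indicator 1 z) halfPlane := fun n => by
    refine integrable_sheField_mul_ae hσ B he (R := n)
      (measurable_one.indicator Metric.isClosed_closedBall.measurableSet) ?_ fun z hz => ?_
    · refine Integrable.restrict ?_
      rw [integrable_indicator_iff Metric.isClosed_closedBall.measurableSet]
      exact integrableOn_const (isCompact_closedBall _ _).measure_lt_top.ne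
    · refine indicator_of_notMem (fun hmem => ?_) _
      have h1 : ‖z‖ ≤ n := mem_closedBall_zero_iff.1 hmem
      have h2 : |z.1| ≤ ‖z‖ := norm_fst_le z
      linarith [le_abs_self z.1]
  filter_upwards [ae_all_iff.2 h] with ξ hξ
  rw [locallyIntegrable_iff]
  intro K hK
  obtain ⟨r, hr⟩ := hK.isBounded.subset_closedBall 0
  obtain ⟨n, hn⟩ := exists_nat_ge r
  have h1 : IntegrableOn (fun z => sheField σ2 B e z ξ) (Metric.closedBall (0 : ℝ × ℝ) n)
      halfPlane := by
    rw [← integrable_indicator_iff Metric.isClosed_closedBall.measurableSet]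
    refine (hξ n).congr (ae_of_all _ fun z => ?_)
    by_cases hz : z ∈ Metric.closedBall (0 : ℝ × ℝ) n <;> simp [hz]
  exact h1.mono_set (hr.trans (Metric.closedBall_subset_closedBall hn))

end weighted

/-- Stochastic Fubini with `k z` the weighted heat kernel, whose weak integral is `-B φ`; this
already is the equation, with the two derivatives still combined. -/
lemma integral_sheField_mul_adjointHeat_ae (hσ : 0 < σ2) (B : ℝ) {e : ℕ → Lp ℝ 2 halfPlane}
    (he : ∀ f g, HasSum (fun n => inner ℝ (e n) f * inner ℝ (e n) g) (inner ℝ f g))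
    {φ : ℝ × ℝ → ℝ} (hφ : ContDiff ℝ ((⊤ : ℕ∞) : WithTop ℕ∞) φ) (hc : HasCompactSupport φ) :
    ∀ᵐ ξ ∂stdNormalSeq, ∫ z, sheField σ2 B e z ξ * adjointHeat σ2 φ z ∂halfPlane =
      -(B * seriesValue (fun n => inner ℝ (e n) ((memLp_test hφ hc).toLp φ)) ξ) := by
  have hW := isIsonormal_seriesValue he
  have hcont := continuous_adjointHeat σ2 hφ
  have hcs := hasCompactSupport_adjointHeat σ2 hc
  obtain ⟨R, -, hR⟩ := exists_fst_bound hcs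
  have hi : Integrable (adjointHeat σ2 φ) halfPlane :=
    (hcont.integrable_of_hasCompactSupport (μ := volume) hcs).restrict
  obtain ⟨m, hmi, hmle⟩ := exists_norm_smul_heatLp_le hσ B hi hR
  have hκ : ∀ f, ∫ z, inner ℝ (adjointHeat σ2 φ z • B • heatLp hσ z) f ∂halfPlane =
      inner ℝ ((-B) • (memLp_test hφ hc).toLp φ) f := fun f => by
    simp only [real_inner_smul_left]
    rw [neg_mul, ← mul_neg, ← integral_adjointHeat_mul_inner_heatLp hσ hφ hc,
      ← integral_const_mul]
    exact integral_congr_ae (ae_of_all _ fun z => by ring)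
  filter_upwards [hW.integral_ae_eq (measurable_uncurry_sheField_mul σ2 B e hcont.measurable)
    (sheField_mul_ae_eq hσ B he) hmi hmle hκ,
    hW.linear (-B) 0 ((memLp_test hφ hc).toLp φ) 0] with ξ h1 h2
  rw [h1]
  simpa using h2

lemma isCenteredGaussian_sheField (hσ : 0 < σ2) (B : ℝ) {e : ℕ → Lp ℝ 2 halfPlane}
    (he : ∀ f g, HasSum (fun n => inner ℝ (e n) f * inner ℝ (e n) g) (inner ℝ f g)) :
    IsCenteredGaussian (fun (a : ℝ≥0 × ℝ) ξ => sheField σ2 B e ((a.1 : ℝ), a.2) ξ)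
      (fun a b => B ^ 2 / (2 * σ2) * ∫ v in (σ2 * |(b.1 : ℝ) - a.1|)..(σ2 * ((b.1 : ℝ) + a.1)),
        gaussKer v (a.2 - b.2)) stdNormalSeq := by
  have h := (isIsonormal_seriesValue he).isCenteredGaussian
    fun a : ℝ≥0 × ℝ => B • heatLp hσ ((a.1 : ℝ), a.2)
  have e1 : (fun (a : ℝ≥0 × ℝ) ξ => sheField σ2 B e ((a.1 : ℝ), a.2) ξ) = fun a ξ =>
      seriesValue (fun n => inner ℝ (e n) (B • heatLp hσ ((a.1 : ℝ), a.2))) ξ :=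
    funext fun a => sheField_eq hσ B e (by simp)
  rw [e1]
  refine ⟨h.gaussian, h.mean_zero, fun a b => ?_⟩
  rw [h.covariance, real_inner_smul_left, real_inner_smul_right,
    inner_heatLp_heatLp hσ (by simp) (by simp), integral_heatKer_mul_heatKer hσ (by simp) (by simp)]
  ring

lemma isWhiteNoise_seriesValue {e : ℕ → Lp ℝ 2 halfPlane}
    (he : ∀ f g, HasSum (fun n => inner ℝ (e n) f * inner ℝ (e n) g) (inner ℝ f g)) :
    IsWhiteNoise (fun f ξ => seriesValue (fun n => inner ℝ (e n) f) ξ) stdNormalSeq := by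
  have h := (isIsonormal_seriesValue he).isCenteredGaussian (id : Lp ℝ 2 halfPlane → _)
  refine ⟨h.gaussian, h.mean_zero, fun f g => ?_⟩
  rw [← inner_lp_halfPlane]
  exact h.covariance f g

lemma isWeakSolutionSHE_sheField (hσ : 0 < σ2) (B : ℝ) {e : ℕ → Lp ℝ 2 halfPlane}
    (he : ∀ f g, HasSum (fun n => inner ℝ (e n) f * inner ℝ (e n) g) (inner ℝ f g)) :
    IsWeakSolutionSHE (σ2 / 2) B
      (fun (a : ℝ≥0 × ℝ) ξ => sheField σ2 B e ((a.1 : ℝ), a.2) ξ)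
      (fun f ξ => seriesValue (fun n => inner ℝ (e n) f) ξ) stdNormalSeq := by
  -- Times are nonnegative almost everywhere on the half plane, so passing through `ℝ≥0` does not
  -- affect the integrals.
  have hcoe : ∀ ξ, (fun z : ℝ × ℝ => sheField σ2 B e ((z.1.toNNReal : ℝ), z.2) ξ) =ᵐ[halfPlane]
      fun z => sheField σ2 B e z ξ := fun ξ => by
    filter_upwards [ae_halfPlane_nonneg] with z hz
    rw [Real.coe_toNNReal _ hz]
  have hloc := locallyIntegrable_sheField_ae hσ B he
  refine ⟨?_, fun r => ae_of_all _ fun ξ => ?_, ?_, fun φ hφ hc => ?_⟩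
  · exact (measurable_sheField σ2 B e).comp
      (f := fun p : (ℝ≥0 × ℝ) × (ℕ → ℝ) => (((p.1.1 : ℝ), p.1.2), p.2)) (by fun_prop)
  · simpa using sheField_zero_left σ2 B e r ξ
  · filter_upwards [hloc] with ξ hξ
    exact hξ.congr (hcoe ξ).symm
  · have c1 := (contDiff_timeDeriv hφ).continuous
    have c2 := (contDiff_spaceDeriv (contDiff_spaceDeriv hφ)).continuous
    filter_upwards [hloc, integral_sheField_mul_adjointHeat_ae hσ B he hφ hc] with ξ h1 h2
    have i1 : Integrable (fun z => sheField σ2 B e z ξ * timeDeriv φ z) halfPlane := by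
      simpa [mul_comm] using h1.integrable_smul_left_of_hasCompactSupport c1
        (hasCompactSupport_timeDeriv hc)
    have i2 : Integrable (fun z => sheField σ2 B e z ξ * spaceDeriv (spaceDeriv φ) z)
        halfPlane := by
      simpa [mul_comm] using h1.integrable_smul_left_of_hasCompactSupport c2
        (hasCompactSupport_spaceDeriv (hasCompactSupport_spaceDeriv hc))
    simp only [deriv_fst_eq_timeDeriv hφ, iteratedDeriv_two_eq_spaceDeriv hφ]
    have e0 : ∀ ψ : ℝ × ℝ → ℝ, ∫ z, sheField σ2 B e ((z.1.toNNReal : ℝ), z.2) ξ * ψ z ∂halfPlane =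
        ∫ z, sheField σ2 B e z ξ * ψ z ∂halfPlane := fun ψ =>
      integral_congr_ae ((hcoe ξ).mul (EventuallyEq.refl _ ψ))
    rw [e0, e0]
    have e1 : ∀ z, sheField σ2 B e z ξ * adjointHeat σ2 φ z =
        sheField σ2 B e z ξ * timeDeriv φ z +
          σ2 / 2 * (sheField σ2 B e z ξ * spaceDeriv (spaceDeriv φ) z) := fun z => by
      unfold adjointHeat; ring
    simp only [e1] at h2
    rw [integral_add i1 (i2.const_mul _), integral_const_mul] at h2
    linarith

end sheField
end SpaceTimeRWRE

end

/-! ### Assembly of the two statements. -/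

theorem mainTheorem2 {M : ℕ} (P : Measure (SpaceTimeRWRE.Env M)) [IsProbabilityMeasure P]
    (hiid : SpaceTimeRWRE.IsIID P) (hell : SpaceTimeRWRE.Elliptic P)
    (hspan : SpaceTimeRWRE.SpanOne P) :
    (∀ {Ω' : Type*} [MeasurableSpace Ω'] (Q : Measure Ω') [IsProbabilityMeasure Q]
        (y : ℝ≥0 × ℝ → Ω' → ℝ),
        SpaceTimeRWRE.IsCenteredGaussian y (SpaceTimeRWRE.GammaQ P) Q →
        ∀ (k : ℕ) (a : Fin k → ℝ≥0 × ℝ),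
          TendstoInDistribution
            (fun (n : ℕ) (ω : SpaceTimeRWRE.Env M) (j : Fin k) =>
              SpaceTimeRWRE.yProc P n (a j) ω)
            atTop (fun (ω : Ω') (j : Fin k) => y (a j) ω) (fun _ => P) Q) ∧
    ∃ (Ω' : Type) (_ : MeasurableSpace Ω') (Q : Measure Ω') (_ : IsProbabilityMeasure Q)
      (y : ℝ≥0 × ℝ → Ω' → ℝ) (W : Lp ℝ 2 SpaceTimeRWRE.halfPlane → Ω' → ℝ),
      SpaceTimeRWRE.IsCenteredGaussian y (SpaceTimeRWRE.GammaQ P) Q ∧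
      SpaceTimeRWRE.IsWhiteNoise W Q ∧
      SpaceTimeRWRE.IsWeakSolutionSHE (SpaceTimeRWRE.sigmaASq P / 2)
        (Real.sqrt (SpaceTimeRWRE.sigmaASq P) * Real.sqrt (SpaceTimeRWRE.kappa P)) y W Q := by
  have hσ := SpaceTimeRWRE.sigmaASq_pos hspan
  have hκ : 0 ≤ SpaceTimeRWRE.kappa P :=
    div_nonneg (integral_nonneg fun _ => sq_nonneg _)
      (mul_pos (SpaceTimeRWRE.beta_pos hell hspan) hσ).le
  refine ⟨fun Q _ y hy k a => SpaceTimeRWRE.tendstoInDistribution_yProc hiid hell hspan Q y hy k a,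
    ?_⟩
  -- Finiteness of the exponent gives separability of `L²`, hence a sequence with Parseval's
  -- identity.
  have : Fact ((2 : ℝ≥0∞) ≠ ⊤) := ⟨by simp⟩
  obtain ⟨e, he⟩ := SpaceTimeRWRE.exists_parseval_seq (H := Lp ℝ 2 SpaceTimeRWRE.halfPlane)
  refine ⟨ℕ → ℝ, inferInstance, SpaceTimeRWRE.stdNormalSeq, inferInstance, _, _, ?_,
    SpaceTimeRWRE.isWhiteNoise_seriesValue he,
    SpaceTimeRWRE.isWeakSolutionSHE_sheField hσ _ he⟩
  have h := SpaceTimeRWRE.isCenteredGaussian_sheField hσ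
    (Real.sqrt (SpaceTimeRWRE.sigmaASq P) * Real.sqrt (SpaceTimeRWRE.kappa P)) he
  refine ⟨h.gaussian, h.mean_zero, fun a b => ?_⟩
  -- With `B² = σ_a² κ` the prefactor `B² / (2σ_a²)` is the `κ / 2` of `GammaQ`.
  rw [h.covariance, mul_pow, Real.sq_sqrt hσ.le, Real.sq_sqrt hκ]
  unfold SpaceTimeRWRE.GammaQ SpaceTimeRWRE.gaussKer
  congr 1
  field_simp
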